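/- **Setting.** Let $g=\mathrm{diag}(1,-1,-1,-1)$ and let $\Theta^{\mu\nu}$ lie in the Lorentz orbit of $\Theta_0=\lambda_{\rm nc}^2\begin{pmatrix}0&-1_2\\1_2&0\end{pmatrix}$, $\lambda_{\rm nc}>0$. Write $(k\Theta)^\nu=k_\mu\Theta^{\mu\nu}$ and $k\Theta l=k_\mu\Theta^{\mu\nu}l_\nu$. Consider supersymmetric electrodynamics on the noncommutative Minkowski space $[q^\mu,q^\nu]=i\Theta^{\mu\nu}$ in Feynman gauge, with field equations $$\Box A^\mu= ie\,\partial_\nu[A^\nu,A^\mu]+ie[A_\nu,F^{\nu\mu}]+ie\{\partial^\mu\bar c,c\}+e\,\sigma^\mu_{\alpha\dot\alpha}\{\lambda^\alpha,\bar\lambda^{\dot\alpha}\},$$ $$\Box c=ie\,\partial_\mu[A^\mu,c],\qquad \Box\bar c=ie[A^\mu,\partial_\mu\bar c],\qquad i\bar\sigma^\mu\partial_\mu\lambda=-e\bar\sigma^\mu[A_\mu,\lambda]\ \text{ and its conjugate},$$ with $F_{\mu\nu}=\partial_\mu A_\nu-\partial_\nu A_\mu-ie[A_\mu,A_\nu]$,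 quantized perturbatively by the Yang–Feldman series with (graded-)symmetrized operator products. Here $\hat\Delta_R(p)=-(2\pi)^{-2}/(p^2+i\epsilon p_0)$, $\hat\Delta_A(p)=\hat\Delta_R(-p)$, $\hat\Delta_+(k)=(2\pi)^{-1}\theta(k_0)\delta(k^2)$ (massive version: $\delta(k^2-s)$), $\hat\Delta^{(1)}(l)=\hat\Delta_+(l)+\hat\Delta_+(-l)$, and the free two-point functions are $(2\pi)^2\delta(k+p)\hat\Delta_+(k)$ times $-g_{\mu\nu}$ for $\langle A_\mu(k) A_\nu(p)\rangle$, $1$ for $\langle\bar c(k)\,c(p)\rangle$, $-1$ for $\langle c(k)\,\bar c(p)\rangle$, and $\sigma^\mu_{\alpha\dot\alpha} k_\mu$ for both $\langle\lambda_\alpha(k)\bar\lambda_{\dot\alpha}(p)\rangle$ and $\langle\bar\lambda_{\dot\alpha}(k)\lambda_\alpha(p)\rangle$. The self-energy $\Pi_{\mu\nu}(k)$ is the coefficient of $\hat A_0^\nu(k)$ in the once contracted second order source of $A_\mu$. The observables are $\int d^6q\,f^\alpha(X)W_\alpha+\text{h.c.}$, with supersymmetric covariant coordinates $X$, i.e.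 the supersymmetric completion of $\int d^4q\,f^{\mu\nu}(X)F_{\mu\nu}$; they are expanded in kernels $K_{\mu\nu}(k;k_1,\dots,k_n)$ of order $e^{n-1}$, and the test functions $\hat f^{\mu\nu},\hat h^{\lambda\rho}$ are antisymmetric and of Schwartz class. The first order kernels are ($\delta(k-k_1-k_2)$ understood, $w(p)=\sin(\frac{k\Theta p}{2})/\frac{k\Theta p}{2}$) $$K_{\mu\nu}^{\mu_1\mu_2}=(2\pi)^{-2}\Big[-2\delta^{\mu_1}_\mu\delta^{\mu_2}_\nu\sin\tfrac{k_1\Theta k_2}2+(k\Theta)^{\mu_1}k_{2\mu}\delta^{\mu_2}_\nu w(k_1)+(k\Theta)^{\mu_2}k_{1\mu}\delta^{\mu_1}_\nu w(k_2)\Big],$$ $$K_{\mu\nu}^{\dot\alpha\alpha}=-K_{\mu\nu}^{\alpha\dot\alpha}=\tfrac14(2\pi)^{-2}w(k_1)\,(k\Theta)^\lambda\big(\bar\sigma_\lambda\sigma_{\mu\nu}-(\bar\sigma_\lambda\sigma_{\mu\nu})^\dagger\big)^{\dot\alpha\alpha},$$ and the kernel of order zero is $K^{\sigma}_{\mu\nu}(k)=-2ik_\mu\delta^\sigma_\nu$.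 **(1) Cancellation of $\Sigma_2$.** For $l^2=0$ and $(k-l)^2\ne0$ the tadpole, photon loop and ghost loop integrands (with respect to $e^2\hat\Delta^{(1)}(l)\,d^4l$) add up to $2\hat\Delta_R(k-l)\sin^2\frac{k\Theta l}{2}\,\big(\pi^{(1)}_{\mu\nu}+\pi^{(2)}_{\mu\nu}\big)$ with $$\pi^{(1)}_{\mu\nu}=-2(g_{\mu\nu}k^2-k_\mu k_\nu),\qquad \pi^{(2)}_{\mu\nu}=-4\big(g_{\mu\nu}k\cdot l-(k-l)_\mu l_\nu-l_\mu(k-l)_\nu\big).$$ The photino loop integrand is $2\hat\Delta_R(k-l)\sin^2\frac{k\Theta l}2\,\pi^{\rm ino}_{\mu\nu}$ with $$\pi^{\rm ino}_{\mu\nu}=-(k-l)^\lambda l^\rho\{\mathrm{tr}(\bar\sigma_\lambda\sigma_\mu\bar\sigma_\rho\sigma_\nu)+\mathrm{tr}(\bar\sigma_\rho\sigma_\mu\bar\sigma_\lambda\sigma_\nu)\},$$ and $\pi^{\rm ino}_{\mu\nu}=-\pi^{(2)}_{\mu\nu}$ whenever $l^2=0$. So no term proportional to $(k\Theta)_\mu(k\Theta)_\nu$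 is left in the self-energy; see (3). **(2) Cancellation of the contributions with one kernel of first order.** Consider all second order contributions to the two-point function of the observables with smearing functions $f$, $h$ in which one of the two observables enters with a kernel of first order (two photons, or photino and antiphotino) and the other one with the kernel of order zero. They are integrals against $\hat\Delta_+(a)\hat\Delta_+(b)$ with one further propagator $\hat\Delta_R$ on one of the three legs. For each position of that propagator, the integrand (without propagators, $e^2$ taken out) at total momentum $k$ and loop momentum $l$ equals $+N(k,l)$ if the first order kernel is in the first observable and $-N(k,l)$ if it is in the second one, where $$N(k,l)=8(2\pi)^2\hat f^{\mu\nu}(-k)\hat h^{\lambda\rho}(k)\,k_\mu k_\lambda\,\frac{\sin^2\frac{k\Theta l}2}{\frac{k\Theta l}2}\big[(k\Theta)_\nu l_\rho-(k\Theta)_\rho l_\nu\big],$$ so that only $\hat\Delta_R-\hat\Delta_A$ occurs in the sum. If $k$, $l$ and $k-l$ are all lightlike (or zero), then $k\Theta l=0$ and $N(k,l)=0$. Consequently the sum vanishes: if $\hat\Delta_R$ is regularized by $\epsilon>0$ and the energy of the loop momentum is cut off at any $\Lambda>0$ in the terms where the external momentum is on shell, then all the integrals converge absolutely and their sum tends to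 $0$ as $\epsilon\to0^+$. **(3) The remaining effect.** For timelike $k$, regularize $\Pi_{\mu\nu}(k)$ by $\epsilon$ and by the cutoff $|k\cdot l|\le\Lambda\sqrt{k^2}$ on the loop momentum, and add a local counterterm $e^2Z(\Lambda)(g_{\mu\nu}k^2-k_\mu k_\nu)$ with $Z(\Lambda)\in\mathbb R$ independent of $k$. There is a function $Z$, independent of $\Theta$ and $e$, for which the limits $\epsilon\to0^+$, then $\Lambda\to\infty$, exist for all timelike $k$, and for which the result extends continuously from the interior to the points of the light cone with $(k\Theta)^2\neq0$. For every $Z$ there is a scale $\mu>0$, independent of $\Theta$, $e$ and $k$, such that whenever these limits exist, one has, for all timelike $k$, $(k\Theta)^2<0$ and $$\Pi_{\mu\nu}(k)=-(2\pi)^{-2}e^2(g_{\mu\nu}k^2-k_\mu k_\nu)\Big(\ln\big(\mu\sqrt{-(k\Theta)^2}\big)+R(k)\Big),$$ where $|R(k)|\le C\,t\,(1+|\ln t|)$ with $t=-k^2(k\Theta)^2$ if $t\le1$, and $C$ is an absolute constant. The contribution of $\Pi$ to the full two-point function, obtained from the second order contribution $(2\pi)^2\delta(k+p)\,\Pi_{\nu\rho}(k)\,\partial_{m^2}\hat\Delta_+(k)\big|_{m^2=0^+}$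 to $\langle A_\nu(k) A_\rho(p)\rangle$, exists and is the momentum-dependent field strength normalization $$-4e^2\int d^4k\ \hat f^{\mu\nu}(-k)\,\hat h^{\lambda}{}_{\nu}(k)\,k_\mu k_\lambda\,\hat\Delta_+(k)\,\ln\big(\mu\sqrt{-(k\Theta)^2}\big).$$ -/

import Mathlib

open MeasureTheory Filter Topology Matrix
open scoped SchwartzMap

namespace NCSQED

noncomputable section

/-! ## Minkowski space and the noncommutativity tensor -/

/-- Momenta; `k μ` are the contravariant components. -/
abbrev Mom := Fin 4 → ℝ

/-- Spatial momenta, with the Euclidean norm. -/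
abbrev Mom3 := EuclideanSpace ℝ (Fin 3)

/-- Diagonal entries of the metric `g = diag(1,-1,-1,-1)`. -/
def eta (μ : Fin 4) : ℝ := if μ = 0 then 1 else -1

/-- The metric, with both indices down or both indices up. -/
def metric : Matrix (Fin 4) (Fin 4) ℝ := Matrix.diagonal eta

/-- Covariant components `k_μ`. -/
def low (k : Mom) (μ : Fin 4) : ℝ := eta μ * k μ

/-- Minkowski product of momenta. -/
def mdot (k l : Mom) : ℝ := ∑ μ, eta μ * k μ * l μ

/-- The reference tensor `Θ₀` at noncommutativity length `lam` (both indices up). -/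
def theta0 (lam : ℝ) : Matrix (Fin 4) (Fin 4) ℝ :=
  lam ^ 2 • !![0, 0, -1, 0; 0, 0, 0, -1; 1, 0, 0, 0; 0, 1, 0, 0]

/-- The orbit of `Θ₀` under the Lorentz group. -/
def thetaOrbit (lam : ℝ) : Set (Matrix (Fin 4) (Fin 4) ℝ) :=
  {Θ | ∃ L : Matrix (Fin 4) (Fin 4) ℝ, Lᵀ * metric * L = metric ∧ Θ = L * theta0 lam * Lᵀ}

/-- The vector `(kΘ)^ν = k_μ Θ^{μν}`. -/
def kTheta (Θ : Matrix (Fin 4) (Fin 4) ℝ) (k : Mom) : Mom := fun ν => ∑ μ, low k μ * Θ μ ν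

/-- The number `kΘl = k_μ Θ^{μν} l_ν`. -/
def twist (Θ : Matrix (Fin 4) (Fin 4) ℝ) (k l : Mom) : ℝ := mdot (kTheta Θ k) l

/-! ## Propagators -/

/-- The regularized retarded propagator `Δ̂_R(p) = -(2π)⁻² / (p² + iεp₀)`. The advanced one is
`Δ̂_A(p) = Δ̂_R(-p)`. -/
def retProp (ε : ℝ) (p : Mom) : ℂ :=
  -((2 * Real.pi : ℝ) : ℂ) ^ (-2 : ℤ) /
    ((mdot p p : ℝ) + Complex.I * (ε : ℂ) * (p 0 : ℝ))

/-- The point of the forward mass shell `k² = s`, `k₀ ≥ 0` over the spatial momentum `x`. -/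
def onShell (s : ℝ) (x : Mom3) : Mom :=
  ![Real.sqrt (s + ‖x‖ ^ 2), x 0, x 1, x 2]

/-- The positive frequency two-point function of mass squared `s`,
`Δ̂_+(k) = (2π)⁻¹ θ(k₀) δ(k² - s)`, as a measure on momentum space. -/
def deltaPlus (s : ℝ) : Measure Mom :=
  ((volume : Measure Mom3).withDensity fun x =>
    ENNReal.ofReal ((2 * Real.pi)⁻¹ / (2 * Real.sqrt (s + ‖x‖ ^ 2)))).map (onShell s)

/-- `Δ̂⁽¹⁾(k) = Δ̂_+(k) + Δ̂_+(-k)` at mass zero, as a measure. -/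
def deltaOne : Measure Mom := deltaPlus 0 + (deltaPlus 0).map (fun k => -k)

/-! ## Sigma matrices -/

/-- `σ^μ = (1, σ^i)`, with index structure `α α̇`. -/
def sigma : Fin 4 → Matrix (Fin 2) (Fin 2) ℂ :=
  ![1, !![0, 1; 1, 0], !![0, -Complex.I; Complex.I, 0], !![1, 0; 0, -1]]

/-- `σ̄^μ = (1, -σ^i)`, with index structure `α̇ α`. -/
def sigmaBar (μ : Fin 4) : Matrix (Fin 2) (Fin 2) ℂ := (eta μ : ℂ) • sigma μ

/-- The complex vector with the components of a momentum. -/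
def cvec (p : Mom) : Fin 4 → ℂ := fun μ => (p μ : ℂ)

/-- Bilinear Minkowski product of complex vectors. -/
def cdot (a b : Fin 4 → ℂ) : ℂ := ∑ μ, (eta μ : ℂ) * a μ * b μ

/-- `σ^μ a_μ`. -/
def slash (a : Fin 4 → ℂ) : Matrix (Fin 2) (Fin 2) ℂ := ∑ μ, ((eta μ : ℂ) * a μ) • sigma μ

/-- `σ̄^μ a_μ`. -/
def slashBar (a : Fin 4 → ℂ) : Matrix (Fin 2) (Fin 2) ℂ := ∑ μ, ((eta μ : ℂ) * a μ) • sigmaBar μ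

/-- `(σ_{μν})` with lower Lorentz indices. -/
def sigmaLow (μ ν : Fin 4) : Matrix (Fin 2) (Fin 2) ℂ :=
  ((eta μ * eta ν : ℝ) : ℂ) •
    ((1 / 4 : ℂ) • (sigma μ * sigmaBar ν - sigma ν * sigmaBar μ))

/-- Basis vectors. -/
def basisVec (ρ : Fin 4) : Fin 4 → ℂ := Pi.single ρ 1

/-! ## The field equations in momentum space

Fields are written as `φ(q) = (2π)⁻² ∫ d⁴k φ̂(k) e^{-ikq}`, so that `∂_μ` becomes `-i k_μ`, and the
graded commutator of two fields (with respect to the noncommutative product, operators being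
multiplied by the graded-symmetrized product `φ ∘ ψ = (φψ ± ψφ)/2`) has the Fourier transform
`∫ d⁴p comm p (k - p) φ̂(p) ∘ ψ̂(k - p)`.

The equations of motion, in Feynman gauge, are
`□A^μ = ie ∂_ν[A^ν,A^μ] + ie[A_ν, ∂^νA^μ - ∂^μA^ν - ie[A^ν,A^μ]] + ie{∂^μ c̄, c}
  + e σ^μ_{αα̇}{λ^α, λ̄^α̇}`,
`□c = ie ∂_μ[A^μ,c]`, `□c̄ = ie[A^μ, ∂_μ c̄]`, `iσ̄^μ∂_μλ = -eσ̄^μ[A_μ,λ]` and the conjugate of the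
last one. The definitions below are the right-hand sides, without the factors of `e`; an interacting
field of higher order is `(2π)² Δ̂_R(k)` times its source. -/

/-- Fourier kernel `-2i (2π)⁻² sin(pΘq/2)` of the commutator. -/
def comm (Θ : Matrix (Fin 4) (Fin 4) ℝ) (p q : Mom) : ℂ :=
  -2 * Complex.I * ((2 * Real.pi : ℝ) : ℂ) ^ (-2 : ℤ) * (Real.sin (twist Θ p q / 2) : ℂ)

/-- Source of `A^μ` quadratic in the photon field,
`i∂_ν[A^ν,A^μ] + i[A_ν,∂^νA^μ] - i[A_ν,∂^μA^ν]`, evaluated on `a` (momentum `p`) in the first and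
`b` (momentum `q`) in the second slot of the commutator. -/
def photonSource (Θ : Matrix (Fin 4) (Fin 4) ℝ) (p q : Mom) (a b : Fin 4 → ℂ) : Fin 4 → ℂ :=
  fun μ => comm Θ p q * Complex.I *
    (-Complex.I * cdot (cvec (p + q)) a * b μ - Complex.I * cdot (cvec q) a * b μ
      + Complex.I * (q μ : ℂ) * cdot a b)

/-- The quadratic photon source with both assignments of the two fields to the slots. -/
def photonSourceSym (Θ : Matrix (Fin 4) (Fin 4) ℝ) (p q : Mom) (a b : Fin 4 → ℂ) : Fin 4 → ℂ :=
  photonSource Θ p q a b + photonSource Θ q p b a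

/-- Source `[A_ν,[A^ν,A^μ]]` of `A^μ`, cubic in the photon field. -/
def cubicSource (Θ : Matrix (Fin 4) (Fin 4) ℝ) (p q r : Mom) (a b c : Fin 4 → ℂ) : Fin 4 → ℂ :=
  fun μ => comm Θ p (q + r) * comm Θ q r * cdot a b * c μ

/-- Source `i{∂^μ c̄, c}` of `A^μ`, for `c̄` of momentum `p` and `c` of momentum `q`. -/
def ghostCurrent (Θ : Matrix (Fin 4) (Fin 4) ℝ) (p q : Mom) : Fin 4 → ℂ :=
  fun μ => comm Θ p q * Complex.I * (-Complex.I * (p μ : ℂ))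

/-- Source `i∂_μ[A^μ,c]` of `c`, for `A = a` of momentum `p` and `c` of momentum `q`. -/
def ghostSource (Θ : Matrix (Fin 4) (Fin 4) ℝ) (p q : Mom) (a : Fin 4 → ℂ) : ℂ :=
  comm Θ p q * Complex.I * (-Complex.I * cdot (cvec (p + q)) a)

/-- Source `i[A^μ,∂_μ c̄]` of `c̄`, for `A = a` of momentum `p` and `c̄` of momentum `q`. -/
def antighostSource (Θ : Matrix (Fin 4) (Fin 4) ℝ) (p q : Mom) (a : Fin 4 → ℂ) : ℂ :=
  comm Θ p q * Complex.I * (-Complex.I * cdot (cvec q) a)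

/-- Source `σ^μ_{αα̇}{λ^α, λ̄^α̇} = σ̄^{μ α̇α}{λ_α, λ̄_α̇}` of `A^μ`; the matrix `M` stands for the
product `λ_α(p) ∘ λ̄_α̇(q)`. -/
def photinoCurrent (Θ : Matrix (Fin 4) (Fin 4) ℝ) (p q : Mom) (M : Matrix (Fin 2) (Fin 2) ℂ) :
    Fin 4 → ℂ :=
  fun μ => comm Θ p q * Matrix.trace (sigmaBar μ * M)

/-- Source of `λ_α`, for `A = a` of momentum `p` and `λ` of momentum `q`, as a matrix acting on the
column `λ_β`: the retarded propagator `-iσ^ν∂_νΔ_R` applied to `-σ̄^μ[A_μ,λ]`. -/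
def photinoSource (Θ : Matrix (Fin 4) (Fin 4) ℝ) (p q : Mom) (a : Fin 4 → ℂ) :
    Matrix (Fin 2) (Fin 2) ℂ :=
  comm Θ p q • (slash (cvec (p + q)) * slashBar a)

/-- Source of `λ̄_α̇`, conjugate to the previous one, as a matrix acting from the right on the
row `λ̄_β̇`. -/
def antiphotinoSource (Θ : Matrix (Fin 4) (Fin 4) ℝ) (p q : Mom) (a : Fin 4 → ℂ) :
    Matrix (Fin 2) (Fin 2) ℂ :=
  comm Θ p q • (slashBar a * slash (cvec (p + q)))

/-! ## The one-loop self-energy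

`Π_{μν}(k)` is the coefficient of `Â_0^ν(k)` in the source of `A_μ` at second order, after
contraction of two of the three free fields. The free two-point functions are
`⟨A_μ(k)A_ν(p)⟩ = -(2π)² g_{μν} Δ̂_+(k)δ(k+p)`,
`⟨c̄(k)c(p)⟩ = -⟨c(k)c̄(p)⟩ = (2π)² Δ̂_+(k)δ(k+p)`,
`⟨λ_α(k)λ̄_α̇(p)⟩ = ⟨λ̄_α̇(k)λ_α(p)⟩ = (2π)² σ^μ_{αα̇}k_μ Δ̂_+(k)δ(k+p)`,
so that graded-symmetrized products are contracted with `½(2π)² Δ̂⁽¹⁾(l)` times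
`-g_{μν}` for `A_μ(l)∘A_ν(-l)`, `1` for `c̄(l)∘c(-l)`, and `σ^μ l_μ` for `λ(l)∘λ̄(-l)`.
Each contribution is an integral over `l` with respect to `Δ̂⁽¹⁾(l)`; the integrands follow, without
the factor `e²`. Contractions of the two fields of one commutator vanish, as `sin(lΘl/2) = 0`. -/

/-- Tadpole, from the cubic source. -/
def tadpole (Θ : Matrix (Fin 4) (Fin 4) ℝ) (k l : Mom) (μ ν : Fin 4) : ℂ :=
  (eta μ : ℂ) * ((1 / 2 : ℂ) * ((2 * Real.pi : ℝ) : ℂ) ^ 2 * ∑ ρ, -(eta ρ : ℂ) *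
    (cubicSource Θ l (-l) k (basisVec ρ) (basisVec ρ) (basisVec ν) μ
      + cubicSource Θ l k (-l) (basisVec ρ) (basisVec ν) (basisVec ρ) μ
      + cubicSource Θ k l (-l) (basisVec ν) (basisVec ρ) (basisVec ρ) μ))

/-- Photon loop: one field in the quadratic source is itself of first order. -/
def photonLoop (Θ : Matrix (Fin 4) (Fin 4) ℝ) (ε : ℝ) (k l : Mom) (μ ν : Fin 4) : ℂ :=
  (eta μ : ℂ) * ((1 / 2 : ℂ) * ((2 * Real.pi : ℝ) : ℂ) ^ 2 *
    (((2 * Real.pi : ℝ) : ℂ) ^ 2 * retProp ε (k - l)) * ∑ ρ, -(eta ρ : ℂ) *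
      photonSourceSym Θ (k - l) l
        (photonSourceSym Θ k (-l) (basisVec ν) (basisVec ρ)) (basisVec ρ) μ)

/-- Ghost loop: either the antighost or the ghost is of first order. -/
def ghostLoop (Θ : Matrix (Fin 4) (Fin 4) ℝ) (ε : ℝ) (k l : Mom) (μ ν : Fin 4) : ℂ :=
  (eta μ : ℂ) * ((1 / 2 : ℂ) * ((2 * Real.pi : ℝ) : ℂ) ^ 2 *
    (((2 * Real.pi : ℝ) : ℂ) ^ 2 * retProp ε (k - l)) *
      (antighostSource Θ k (-l) (basisVec ν) * ghostCurrent Θ (k - l) l μ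
        + ghostSource Θ k (-l) (basisVec ν) * ghostCurrent Θ l (k - l) μ))

/-- Photino loop: either the photino or the antiphotino is of first order. -/
def photinoLoop (Θ : Matrix (Fin 4) (Fin 4) ℝ) (ε : ℝ) (k l : Mom) (μ ν : Fin 4) : ℂ :=
  (eta μ : ℂ) * ((1 / 2 : ℂ) * ((2 * Real.pi : ℝ) : ℂ) ^ 2 *
    (((2 * Real.pi : ℝ) : ℂ) ^ 2 * retProp ε (k - l)) *
      (photinoCurrent Θ (k - l) l (photinoSource Θ k (-l) (basisVec ν) * slash (cvec (-l))) μ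
        + photinoCurrent Θ l (k - l)
            (slash (cvec l) * antiphotinoSource Θ k (-l) (basisVec ν)) μ))

/-- The transverse tensor `g_{μν}k² - k_μk_ν`. -/
def transverse (k : Mom) (μ ν : Fin 4) : ℝ := metric μ ν * mdot k k - low k μ * low k ν

/-- First term of the loop tensor of the theory without photino,
`-(6-d)(g_{μν}k² - k_μk_ν)` in `d = 4`. -/
def piTot1 (k : Mom) (μ ν : Fin 4) : ℝ := -(6 - 4) * transverse k μ ν

/-- Second term of the loop tensor of the theory without photino,
`-2(d-2)(g_{μν}k·l - (k-l)_μl_ν - l_μ(k-l)_ν)` in `d = 4`. -/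
def piTot2 (k l : Mom) (μ ν : Fin 4) : ℝ :=
  -2 * (4 - 2) * (metric μ ν * mdot k l - low (k - l) μ * low l ν - low l μ * low (k - l) ν)

/-- The photino loop tensor
`-(k-l)^λ l^ρ {tr(σ̄_λσ_μσ̄_ρσ_ν) + tr(σ̄_ρσ_μσ̄_λσ_ν)}`. -/
def piIno (k l : Mom) (μ ν : Fin 4) : ℂ :=
  -(((eta μ * eta ν : ℝ) : ℂ) *
    (Matrix.trace (slashBar (cvec (k - l)) * sigma μ * slashBar (cvec l) * sigma ν)
      + Matrix.trace (slashBar (cvec l) * sigma μ * slashBar (cvec (k - l)) * sigma ν)))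

/-- The self-energy of the supersymmetric model, without the factor `e²`, with regularized retarded
propagator and with the loop energy in the rest frame of `k` cut off at `Λ` (for timelike `k`). -/
def selfEnergyReg (Θ : Matrix (Fin 4) (Fin 4) ℝ) (ε Λ : ℝ) (k : Mom) (μ ν : Fin 4) : ℂ :=
  ∫ l in {l : Mom | |mdot k l| ≤ Λ * Real.sqrt (mdot k k)},
    (tadpole Θ k l μ ν + photonLoop Θ ε k l μ ν + ghostLoop Θ ε k l μ ν
      + photinoLoop Θ ε k l μ ν) ∂deltaOne

/-- `P` is the renormalized self-energy belonging to the field strength counterterm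
`e² Z(Λ) (g_{μν}k² - k_μk_ν)`, where the real number `Z(Λ)` does not depend on the momentum: in the
interior of the light cone it is the limit `ε → 0`, and then `Λ → ∞`, of the regularized self-energy
plus the counterterm, and on the light cone it is the limit from the interior. -/
def IsRenormalizedSelfEnergy (Θ : Matrix (Fin 4) (Fin 4) ℝ) (e : ℝ) (Z : ℝ → ℝ)
    (P : Mom → Fin 4 → Fin 4 → ℂ) : Prop :=
  (∀ k : Mom, 0 < mdot k k → ∀ μ ν : Fin 4, ∃ U : ℝ → ℂ,
    (∀ᶠ Λ in atTop, Tendsto (fun ε : ℝ => (e : ℂ) ^ 2 * selfEnergyReg Θ ε Λ k μ ν)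
      (𝓝[>] 0) (𝓝 (U Λ))) ∧
    Tendsto (fun Λ : ℝ => U Λ + ((e ^ 2 * Z Λ * transverse k μ ν : ℝ) : ℂ))
      atTop (𝓝 (P k μ ν))) ∧
  (∀ k : Mom, mdot k k = 0 → mdot (kTheta Θ k) (kTheta Θ k) ≠ 0 → ∀ μ ν : Fin 4,
    Tendsto (fun k' => P k' μ ν) (𝓝[{k' : Mom | 0 < mdot k' k'}] k) (𝓝 (P k μ ν)))

/-! ## The kernels of the field strength observable

The observable `∫ d⁶q f^α(X) W_α + h.c.`, i.e. the supersymmetric completion of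
`∫ d⁴q f^{μν}(X) F_{μν}`, is expanded as
`∫ d⁴k f̂^{μν}(-k) Σ_n e^{n-1} ∫ K_{μν}(k; k_1,…,k_n) F(k_1)⋯F(k_n)`. The kernels contain
`δ(k - Σ k_i)`, which is not written; Lorentz indices of photons are contracted with `A_{μ_i}`. -/

/-- `P_1(y) = Σ_n yⁿ/(n+1)!`, from the expansion of `e^{ikX}`. -/
def weylP1 (y : ℂ) : ℂ := ∑' n : ℕ, y ^ n / ((n + 1).factorial : ℂ)

/-- `P_1(-ikΘp) e^{(i/2)kΘp}`, for one field of momentum `p` from the covariant coordinate. -/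
def coordFactor (Θ : Matrix (Fin 4) (Fin 4) ℝ) (k p : Mom) : ℂ :=
  weylP1 (-Complex.I * (twist Θ k p : ℝ)) * Complex.exp (Complex.I / 2 * (twist Θ k p : ℝ))

/-- Kernel of order zero, `-2i k_μ δ_ν^σ`. -/
def kernel0 (k : Mom) (μ ν σ : Fin 4) : ℂ :=
  -2 * Complex.I * (low k μ : ℝ) * (if σ = ν then 1 else 0)

/-- First order kernel with two photons: the commutator in `F_{μν}`, and one photon from the
covariant coordinate. -/
def kernel1Photon (Θ : Matrix (Fin 4) (Fin 4) ℝ) (p q : Mom) (μ ν μ₁ μ₂ : Fin 4) : ℂ :=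
  -Complex.I * comm Θ p q * (if μ₁ = μ ∧ μ₂ = ν then 1 else 0)
    + ((2 * Real.pi : ℝ) : ℂ) ^ (-2 : ℤ) *
      ((kTheta Θ (p + q) μ₁ : ℝ) * (low q μ : ℝ) * (if μ₂ = ν then 1 else 0)
          * coordFactor Θ (p + q) p
        + (kTheta Θ (p + q) μ₂ : ℝ) * (low p μ : ℝ) * (if μ₁ = ν then 1 else 0)
          * coordFactor Θ (p + q) q)

/-- First order kernel with `λ̄_α̇` of momentum `p` from the covariant coordinate to the left of `λ_α`
of momentum `q`, with index structure `α̇ α`. By graded symmetrization, the kernel for the opposite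
order of the two operators is its negative. -/
def kernel1Photino (Θ : Matrix (Fin 4) (Fin 4) ℝ) (p q : Mom) (μ ν : Fin 4) :
    Matrix (Fin 2) (Fin 2) ℂ :=
  ((1 / 4 : ℂ) * ((2 * Real.pi : ℝ) : ℂ) ^ (-2 : ℤ) * coordFactor Θ (p + q) p) •
    (slashBar (cvec (kTheta Θ (p + q))) * sigmaLow μ ν
      - (slashBar (cvec (kTheta Θ (p + q))) * sigmaLow μ ν)ᴴ)

/-! ## Elementary three-point functions at first order

In `⟨F(k_1)F(k_2)F(k_3)⟩` one of the three fields is of first order; it carries the retarded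
propagator, and its two constituents are contracted with the two other fields. The definitions
below leave out `e`, `δ(k_1+k_2+k_3)`, the retarded propagator and the two factors `Δ̂_+`. -/

/-- Three photons: the first order field has the (lower) index `μ`, the two other fields have
momenta `p`, `q` and (lower) indices `ν`, `ρ`. -/
def photonLeg (Θ : Matrix (Fin 4) (Fin 4) ℝ) (p q : Mom) (μ ν ρ : Fin 4) : ℂ :=
  ((2 * Real.pi : ℝ) : ℂ) ^ 2 * (eta μ : ℂ) *
    photonSourceSym Θ (-p) (-q) (-((2 * Real.pi : ℝ) : ℂ) ^ 2 • basisVec ν)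
      (-((2 * Real.pi : ℝ) : ℂ) ^ 2 • basisVec ρ) μ

/-- Three photons; `j` is the position of the first order field. -/
def threePhoton (Θ : Matrix (Fin 4) (Fin 4) ℝ) (j : Fin 3) (k₁ k₂ k₃ : Mom)
    (μ₁ μ₂ μ₃ : Fin 4) : ℂ :=
  ![photonLeg Θ k₂ k₃ μ₁ μ₂ μ₃, photonLeg Θ k₁ k₃ μ₂ μ₁ μ₃, photonLeg Θ k₁ k₂ μ₃ μ₁ μ₂] j

/-- Photino of momentum `q`, antiphotino of momentum `q'`, photon of momentum `k` with (lower) index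
`μ`, where `q + q' + k = 0`, with the antiphotino of first order. Here and below, `s = -1` if the
antiphotino stands to the left of the photino, `s = 1` otherwise, and the result has index structure
`α α̇`. -/
def antiphotinoLeg (Θ : Matrix (Fin 4) (Fin 4) ℝ) (s : ℂ) (q k : Mom) (μ : Fin 4) :
    Matrix (Fin 2) (Fin 2) ℂ :=
  ((2 * Real.pi : ℝ) : ℂ) ^ 2 • (((s * ((2 * Real.pi : ℝ) : ℂ) ^ 2) • slash (cvec q)) *
    antiphotinoSource Θ (-k) (-q) (-((2 * Real.pi : ℝ) : ℂ) ^ 2 • basisVec μ))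

/-- The same with the photino of first order. -/
def photinoLeg (Θ : Matrix (Fin 4) (Fin 4) ℝ) (s : ℂ) (q' k : Mom) (μ : Fin 4) :
    Matrix (Fin 2) (Fin 2) ℂ :=
  ((2 * Real.pi : ℝ) : ℂ) ^ 2 •
    (photinoSource Θ (-k) (-q') (-((2 * Real.pi : ℝ) : ℂ) ^ 2 • basisVec μ) *
      ((-s * ((2 * Real.pi : ℝ) : ℂ) ^ 2) • slash (cvec q')))

/-- The same with the photon of first order; the sign of the double contraction is `s`. -/
def photonOfPhotinoLeg (Θ : Matrix (Fin 4) (Fin 4) ℝ) (s : ℂ) (q q' : Mom) (μ : Fin 4) :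
    Matrix (Fin 2) (Fin 2) ℂ :=
  (((2 * Real.pi : ℝ) : ℂ) ^ 2 * s * comm Θ (-q') (-q) * (eta μ : ℂ)) •
    ((((2 * Real.pi : ℝ) : ℂ) ^ 2 • slash (cvec q)) * sigmaBar μ *
      (((2 * Real.pi : ℝ) : ℂ) ^ 2 • slash (cvec q')))

/-! ## Contributions to the full two-point function with one kernel of first order -/

/-- First order kernel contracted with the first two fields of the three-point function; the third
field is the photon with (lower) index `σ`; `j` is the position of the first order field. The
terms are those of the photons, of `λ̄λ` and of `λλ̄`. -/
def loop21 (Θ : Matrix (Fin 4) (Fin 4) ℝ) (j : Fin 3) (k₁ k₂ k₃ : Mom) (μ ν σ : Fin 4) : ℂ :=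
  (∑ μ₁, ∑ μ₂, kernel1Photon Θ k₁ k₂ μ ν μ₁ μ₂ * threePhoton Θ j k₁ k₂ k₃ μ₁ μ₂ σ)
    + Matrix.trace (kernel1Photino Θ k₁ k₂ μ ν *
        ![antiphotinoLeg Θ (-1) k₂ k₃ σ, photinoLeg Θ (-1) k₁ k₃ σ,
          photonOfPhotinoLeg Θ (-1) k₂ k₁ σ] j)
    + Matrix.trace (-kernel1Photino Θ k₂ k₁ μ ν *
        ![photinoLeg Θ 1 k₂ k₃ σ, antiphotinoLeg Θ 1 k₁ k₃ σ,
          photonOfPhotinoLeg Θ 1 k₁ k₂ σ] j)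

/-- First order kernel contracted with the last two fields of the three-point function; the first
field is the photon with (lower) index `σ`. -/
def loop12 (Θ : Matrix (Fin 4) (Fin 4) ℝ) (j : Fin 3) (k₁ k₂ k₃ : Mom) (l r σ : Fin 4) : ℂ :=
  (∑ μ₁, ∑ μ₂, kernel1Photon Θ k₂ k₃ l r μ₁ μ₂ * threePhoton Θ j k₁ k₂ k₃ σ μ₁ μ₂)
    + Matrix.trace (kernel1Photino Θ k₂ k₃ l r *
        ![photonOfPhotinoLeg Θ (-1) k₃ k₂ σ, antiphotinoLeg Θ (-1) k₃ k₁ σ,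
          photinoLeg Θ (-1) k₂ k₁ σ] j)
    + Matrix.trace (-kernel1Photino Θ k₃ k₂ l r *
        ![photonOfPhotinoLeg Θ 1 k₂ k₃ σ, photinoLeg Θ 1 k₃ k₁ σ,
          antiphotinoLeg Θ 1 k₂ k₁ σ] j)

/-- Smeared integrand, first order kernel in the first observable; `f`, `h` are the Fourier
transforms of the smearing functions. -/
def amp21 (Θ : Matrix (Fin 4) (Fin 4) ℝ) (f h : Fin 4 → Fin 4 → Mom → ℂ) (j : Fin 3)
    (k₁ k₂ k₃ : Mom) : ℂ :=
  ∑ μ, ∑ ν, ∑ l, ∑ r, f μ ν (-(k₁ + k₂)) * h l r (-k₃) *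
    ∑ σ, loop21 Θ j k₁ k₂ k₃ μ ν σ * kernel0 k₃ l r σ

/-- Smeared integrand, first order kernel in the second observable. -/
def amp12 (Θ : Matrix (Fin 4) (Fin 4) ℝ) (f h : Fin 4 → Fin 4 → Mom → ℂ) (j : Fin 3)
    (k₁ k₂ k₃ : Mom) : ℂ :=
  ∑ μ, ∑ ν, ∑ l, ∑ r, f μ ν (-k₁) * h l r (-(k₂ + k₃)) *
    ∑ σ, kernel0 k₁ μ ν σ * loop12 Θ j k₁ k₂ k₃ l r σ

/-- The momenta of the three fields, in operator order, when the field at position `j` is of first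
order. The contractions of the two other fields are `Δ̂_+(a)` and `Δ̂_+(b)`, where the field to the
left in each contraction has momentum `a`, respectively `b`. -/
def legMom (j : Fin 3) (a b : Mom) : Fin 3 → Mom :=
  ![![a + b, -a, -b], ![a, b - a, -b], ![a, b, -(a + b)]] j

/-- Integrand, with respect to `Δ̂_+ ⊗ Δ̂_+`, of the contribution with first order kernel in the first
observable and first order field at position `j`. If the external momentum `b` is on shell, the loop
energy `a₀` is cut off at `Λ`. -/
def integrand21 (Θ : Matrix (Fin 4) (Fin 4) ℝ) (f h : Fin 4 → Fin 4 → Mom → ℂ) (ε Λ : ℝ)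
    (j : Fin 3) (z : Mom × Mom) : ℂ :=
  open Classical in
  if j = 2 ∨ z.1 0 ≤ Λ then
    retProp ε (legMom j z.1 z.2 j) *
      amp21 Θ f h j (legMom j z.1 z.2 0) (legMom j z.1 z.2 1) (legMom j z.1 z.2 2)
  else 0

/-- The same with the first order kernel in the second observable. If the external momentum `a` is
on shell, the loop energy `b₀` is cut off at `Λ`. -/
def integrand12 (Θ : Matrix (Fin 4) (Fin 4) ℝ) (f h : Fin 4 → Fin 4 → Mom → ℂ) (ε Λ : ℝ)
    (j : Fin 3) (z : Mom × Mom) : ℂ :=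
  open Classical in
  if j = 0 ∨ z.2 0 ≤ Λ then
    retProp ε (legMom j z.1 z.2 j) *
      amp12 Θ f h j (legMom j z.1 z.2 0) (legMom j z.1 z.2 1) (legMom j z.1 z.2 2)
  else 0

/-- The sum of all contributions (coefficient of `e²`) to the full two-point function that involve
one kernel of first order, one of order zero, and one power of `e` from the interaction. -/
def firstOrderKernelSum (Θ : Matrix (Fin 4) (Fin 4) ℝ) (f h : Fin 4 → Fin 4 → Mom → ℂ)
    (ε Λ : ℝ) : ℂ :=
  (∑ j, ∫ z, integrand21 Θ f h ε Λ j z ∂((deltaPlus 0).prod (deltaPlus 0)))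
    + ∑ j, ∫ z, integrand12 Θ f h ε Λ j z ∂((deltaPlus 0).prod (deltaPlus 0))

/-- The integrand to which the sum of the loop integrals reduces,
`8(2π)² f̂^{μν}(-k) ĥ^{λρ}(k) k_μ k_λ sin²(kΘl/2)/(kΘl/2) [(kΘ)_ν l_ρ - (kΘ)_ρ l_ν]`. -/
def residualIntegrand (Θ : Matrix (Fin 4) (Fin 4) ℝ) (f h : Fin 4 → Fin 4 → Mom → ℂ)
    (k l : Mom) : ℂ :=
  8 * ((2 * Real.pi : ℝ) : ℂ) ^ 2 *
    ((Real.sin (twist Θ k l / 2) ^ 2 / (twist Θ k l / 2) : ℝ) : ℂ) *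
    ∑ μ, ∑ ν, ∑ m, ∑ r, f μ ν (-k) * h m r k *
      ((low k μ * low k m *
        (low (kTheta Θ k) ν * low l r - low (kTheta Θ k) r * low l ν) : ℝ) : ℂ)

/-! ## Contribution of the self-energy to the full two-point function -/

/-- The pairing of the self-energy `P` and of two kernels of order zero with the two-point function
of mass squared `s`. The second order contribution `(2π)² δ(k+p) Π_{νρ}(k) ∂Δ̂_+(k)/∂m²` of the
self-energy to `⟨A_ν(k)A_ρ(p)⟩` contributes to the full two-point function the derivative of this
pairing with respect to `s` at `s = 0`. -/
def selfEnergyPairing (f h : Fin 4 → Fin 4 → Mom → ℂ) (P : Mom → Fin 4 → Fin 4 → ℂ)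
    (s : ℝ) : ℂ :=
  ∫ k, ((2 * Real.pi : ℝ) : ℂ) ^ 2 * ∑ μ, ∑ ν, ∑ l, ∑ r, f μ ν (-k) * h l r k *
    ∑ σ, ∑ τ, kernel0 k μ ν σ * kernel0 (-k) l r τ * P k σ τ ∂(deltaPlus s)

end

end NCSQED

namespace NCSQED

section

/-! ## Bilinear forms -/

/-! Every integrand is a polynomial in the momenta times a trigonometric function of kΘl. The proof
is therefore an algebraic reduction in components, followed by an analysis of the remaining
integrals over the light cone.

Self-energy integrand. For l² = 0 the photon and ghost loops add up to Δ_R(k-l) times the tensors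
π⁽¹⁾ + π⁽²⁾, plus the tadpole multiplied by (2π)²(k-l)²Δ_R(k-l) (`photonLoop_add_ghostLoop`).
Without regularization the last factor is -1 and the tadpole drops out. The symmetrized trace of
four sigma matrices has no ε-tensor part and cancels π⁽²⁾ (`photinoLoop_eq`, `piIno_eq`). There
remains sin²(kΘl/2) Δ_R(k-l) times a multiple of the transverse tensor, up to a term that disappears
with ε (`selfEnergy_integrand`).

Kernels of first order. A three-point function does not depend on which of its fields is of first
order, apart from the propagator (`threePhoton_eq`, `photinoLegs_left`, `photinoLegs_right`).
Contraction with the kernels is thus a single polynomial identity, `contracted_sub`, which holds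
modulo (kΘ)·k = 0 and the transversality of the other vertex, and gives N. Exchange of the
observables changes the sign of N. For lightlike a, b the six propagators at ε = 0 are equal up to
sign, and the six terms cancel in pairs. The limit may be taken under the integral because N is
quadratic in the bivector k∧l: one power comes from the sine, one from the antisymmetric test
functions. The bivector of lightlike a, b is of size √(a·b), so N compensates the denominators ±2a·b
uniformly in ε (`norm_residualIntegrand_le`, `wedgeLE_of_lightlike`, `norm_retProp_mul_le`).

Self-energy. Let k² = m², (kΘ)² = -a². On the ray of the cone in direction n the coordinate ω =
k·l/m makes (k-l)² = m² ∓ 2mω independent of n, so that n enters only through the sine (and through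
ε). The integral over directions is fixed by Lorentz invariance: ∫(k·n)⁻² = 4π/k², expanded at k + t
kΘ, yields all moments (`sphere_moments`), hence the average aω - sin aω (`integral_sphere_rayNum`).
The pole at ω = m/2 is treated by subtraction and a complex logarithm, which produces the imaginary
part. The integral over ω is elementary up to the sine and cosine integrals. It behaves as -ln Λ
with a coefficient independent of k and Θ, so a local counterterm suffices, and the limit is -(ln a
+ const) up to O(τ² ln τ), τ = am/2 (`tendsto_cutoffSelfEnergy`, `norm_selfEnergyRem_le`). Any other
admissible Z differs by a convergent function, which changes only the scale (`renormalized_eq`).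

Two-point function. Transversality produces a factor k² = s in the pairing at mass squared s, so the
derivative at s = 0⁺ is the limit of the remaining integral. Its logarithm is singular at most where
a spacelike vector is orthogonal to k, and is dominated there by an inverse square root, which is
integrable over the cone by Archimedes' theorem (`norm_pairingDensity_le`). -/

lemma mdot_comm (k l : Mom) : mdot k l = mdot l k := by
  simp only [mdot]; exact Finset.sum_congr rfl fun _ _ => by ring

lemma mdot_add_left (a b c : Mom) : mdot (a + b) c = mdot a c + mdot b c := by
  simp only [mdot, Pi.add_apply, ← Finset.sum_add_distrib]
  exact Finset.sum_congr rfl fun _ _ => by ring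

lemma mdot_smul_left (r : ℝ) (a c : Mom) : mdot (r • a) c = r * mdot a c := by
  simp only [mdot, Pi.smul_apply, smul_eq_mul, Finset.mul_sum]
  exact Finset.sum_congr rfl fun _ _ => by ring

lemma mdot_neg_left (a c : Mom) : mdot (-a) c = -mdot a c := by
  simpa using mdot_smul_left (-1) a c

lemma mdot_sub_left (a b c : Mom) : mdot (a - b) c = mdot a c - mdot b c := by
  rw [sub_eq_add_neg, mdot_add_left, mdot_neg_left, sub_eq_add_neg]

lemma mdot_add_right (a b c : Mom) : mdot c (a + b) = mdot c a + mdot c b := by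
  rw [mdot_comm, mdot_add_left, mdot_comm a, mdot_comm b]

lemma mdot_smul_right (r : ℝ) (a c : Mom) : mdot c (r • a) = r * mdot c a := by
  rw [mdot_comm, mdot_smul_left, mdot_comm a]

lemma mdot_neg_right (a c : Mom) : mdot c (-a) = -mdot c a := by
  rw [mdot_comm, mdot_neg_left, mdot_comm a]

lemma mdot_sub_right (a b c : Mom) : mdot c (a - b) = mdot c a - mdot c b := by
  rw [mdot_comm, mdot_sub_left, mdot_comm a, mdot_comm b]

lemma mdot_four (k l : Mom) : mdot k l = k 0 * l 0 - k 1 * l 1 - k 2 * l 2 - k 3 * l 3 := by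
  simp [mdot, Fin.sum_univ_four, eta]; ring

lemma mdot_sub_self (k l : Mom) :
    mdot (k - l) (k - l) = mdot k k - 2 * mdot k l + mdot l l := by
  rw [mdot_sub_left, mdot_sub_right, mdot_sub_right, mdot_comm l k]; ring

lemma mdot_neg_neg (k l : Mom) : mdot (-k) (-l) = mdot k l := by
  rw [mdot_neg_left, mdot_neg_right, neg_neg]

variable {Θ : Matrix (Fin 4) (Fin 4) ℝ}

lemma kTheta_add (k l : Mom) : kTheta Θ (k + l) = kTheta Θ k + kTheta Θ l := by
  ext ν
  simp only [kTheta, low, Pi.add_apply, ← Finset.sum_add_distrib]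
  exact Finset.sum_congr rfl fun _ _ => by ring

lemma kTheta_smul (r : ℝ) (k : Mom) : kTheta Θ (r • k) = r • kTheta Θ k := by
  ext ν
  simp only [kTheta, low, Pi.smul_apply, smul_eq_mul, Finset.mul_sum]
  exact Finset.sum_congr rfl fun _ _ => by ring

lemma kTheta_neg (k : Mom) : kTheta Θ (-k) = -kTheta Θ k := by
  simpa using kTheta_smul (Θ := Θ) (-1) k

lemma twist_add_left (a b c : Mom) : twist Θ (a + b) c = twist Θ a c + twist Θ b c := by
  rw [twist, kTheta_add, mdot_add_left]; rfl

lemma twist_smul_left (r : ℝ) (a c : Mom) : twist Θ (r • a) c = r * twist Θ a c := by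
  rw [twist, kTheta_smul, mdot_smul_left]; rfl

lemma twist_neg_left (a c : Mom) : twist Θ (-a) c = -twist Θ a c := by
  rw [twist, kTheta_neg, mdot_neg_left]; rfl

lemma twist_sub_left (a b c : Mom) : twist Θ (a - b) c = twist Θ a c - twist Θ b c := by
  rw [sub_eq_add_neg, twist_add_left, twist_neg_left, sub_eq_add_neg]

lemma twist_add_right (a b c : Mom) : twist Θ c (a + b) = twist Θ c a + twist Θ c b :=
  mdot_add_right _ _ _

lemma twist_smul_right (r : ℝ) (a c : Mom) : twist Θ c (r • a) = r * twist Θ c a :=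
  mdot_smul_right _ _ _

lemma twist_neg_right (a c : Mom) : twist Θ c (-a) = -twist Θ c a := mdot_neg_right _ _

lemma twist_sub_right (a b c : Mom) : twist Θ c (a - b) = twist Θ c a - twist Θ c b :=
  mdot_sub_right _ _ _

lemma twist_zero_right (c : Mom) : twist Θ c 0 = 0 := by
  simpa using twist_smul_right (Θ := Θ) 0 0 c

/-- Antisymmetry of Θ is all that the algebra and the cancellation of the kernels of first order
need. The block form of Θ₀ matters again only in `exists_spacelike`. -/
lemma thetaOrbit_transpose {lam : ℝ} (hΘ : Θ ∈ thetaOrbit lam) : Θᵀ = -Θ := by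
  obtain ⟨L, -, rfl⟩ := hΘ
  have h0 : (theta0 lam)ᵀ = -theta0 lam := by
    ext i j; fin_cases i <;> fin_cases j <;> simp [theta0]
  rw [Matrix.transpose_mul, Matrix.transpose_mul, Matrix.transpose_transpose, h0]
  simp [Matrix.mul_assoc]

lemma twist_swap (hΘ : Θᵀ = -Θ) (k l : Mom) : twist Θ k l = -twist Θ l k := by
  have h : ∀ i j, Θ i j = -Θ j i := fun i j => by
    have := congrFun (congrFun hΘ j) i
    simpa using this
  simp only [twist, mdot, kTheta, low, Finset.mul_sum, Finset.sum_mul, ← Finset.sum_neg_distrib]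
  rw [Finset.sum_comm]
  refine Finset.sum_congr rfl fun i _ => Finset.sum_congr rfl fun j _ => ?_
  rw [h i j]; ring

lemma twist_self (hΘ : Θᵀ = -Θ) (k : Mom) : twist Θ k k = 0 := by
  have := twist_swap hΘ k k; linarith

/-! ## Sigma matrices in components -/

lemma slash_eq (a : Fin 4 → ℂ) : slash a =
    !![a 0 - a 3, -(a 1 - Complex.I * a 2); -(a 1 + Complex.I * a 2), a 0 + a 3] := by
  ext i j; fin_cases i <;> fin_cases j <;>
    simp [slash, Fin.sum_univ_four, eta, sigma] <;> ring

lemma slashBar_eq (a : Fin 4 → ℂ) : slashBar a =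
    !![a 0 + a 3, a 1 - Complex.I * a 2; a 1 + Complex.I * a 2, a 0 - a 3] := by
  ext i j; fin_cases i <;> fin_cases j <;>
    simp [slashBar, sigmaBar, Fin.sum_univ_four, eta, sigma] <;> ring

lemma comm_swap (hΘ : Θᵀ = -Θ) (p q : Mom) : comm Θ q p = -comm Θ p q := by
  simp only [comm]
  rw [twist_swap hΘ q p, neg_div, Real.sin_neg]; push_cast; ring

lemma I_mul_neg_I (z : ℂ) : Complex.I * (-Complex.I * z) = z := by
  linear_combination (-z) * Complex.I_sq

/-! ## The one-loop integrands -/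

/-- The ε-tensor parts of the two traces cancel, and the Clifford part is the second loop tensor
with k·l replaced by (k-l)·l. The difference is a multiple of g l². -/
lemma piIno_eq (k l : Mom) (hl : mdot l l = 0) (μ ν : Fin 4) :
    piIno k l μ ν = -((piTot2 k l μ ν : ℝ) : ℂ) := by
  have hl' : (l 0 : ℂ) * l 0 - l 1 * l 1 - l 2 * l 2 - l 3 * l 3 = 0 := by
    rw [mdot_four] at hl; exact_mod_cast hl
  simp only [piIno, piTot2, slashBar_eq, mdot_four, metric, low, cvec]
  fin_cases μ <;> fin_cases ν <;>
  · simp [sigma, eta, Matrix.trace_fin_two]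
    ring_nf
    try simp only [Complex.I_sq, Complex.I_pow_four]
    try ring_nf
    -- The condition l² = 0 is needed only in the diagonal components, with the sign of the metric
    -- entry; the others are identities.
    try linear_combination 4 * hl'
    try linear_combination (-4) * hl'

end

section

variable {Θ : Matrix (Fin 4) (Fin 4) ℝ}

lemma comm_eq (p q : Mom) : comm Θ p q = -(2 * Complex.I * ((2 * Real.pi : ℝ) : ℂ) ^ (-2 : ℤ)) *
    ((Real.sin (twist Θ p q / 2) : ℝ) : ℂ) := by
  simp only [comm]; ring

lemma comm_congr {p q p' q' : Mom} (h : twist Θ p q = twist Θ p' q') :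
    comm Θ p q = comm Θ p' q' := by simp only [comm, h]

lemma comm_congr_neg {p q p' q' : Mom} (h : twist Θ p q = -twist Θ p' q') :
    comm Θ p q = -comm Θ p' q' := by
  simp only [comm, h, neg_div, Real.sin_neg]; push_cast; ring

lemma comm_sq (p q : Mom) : comm Θ p q ^ 2 = -(4 * (((2 * Real.pi : ℝ) : ℂ) ^ (-2 : ℤ)) ^ 2 *
    ((Real.sin (twist Θ p q / 2) ^ 2 : ℝ) : ℂ)) := by
  rw [comm_eq]; push_cast
  linear_combination (4 * ((2 * (Real.pi : ℂ)) ^ (-2 : ℤ)) ^ 2 *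
    Complex.sin (twist Θ p q / 2) ^ 2) * Complex.I_sq

lemma two_pi_zpow_mul : ((2 * Real.pi : ℝ) : ℂ) ^ 2 * ((2 * Real.pi : ℝ) : ℂ) ^ (-2 : ℤ) = 1 := by
  have h : ((2 * Real.pi : ℝ) : ℂ) ≠ 0 := by
    exact_mod_cast (by positivity : (2 * Real.pi : ℝ) ≠ 0)
  rw [_root_.zpow_neg]
  exact mul_inv_cancel₀ (pow_ne_zero 2 h)

lemma cdot_four (a b : Fin 4 → ℂ) :
    cdot a b = a 0 * b 0 - a 1 * b 1 - a 2 * b 2 - a 3 * b 3 := by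
  simp [cdot, Fin.sum_univ_four, eta]; ring

lemma basisVec_cdot (a : Fin 4 → ℂ) (ρ : Fin 4) : cdot (basisVec ρ) a = (eta ρ : ℂ) * a ρ := by
  simp [cdot, basisVec, Pi.single_apply]

/-- Exchanging the slots changes the sign of the commutator kernel, so the two assignments combine
to one sine times one polynomial. -/
lemma photonSourceSym_eq (hΘ : Θᵀ = -Θ) (p q : Mom) (a b : Fin 4 → ℂ) (μ : Fin 4) :
    photonSourceSym Θ p q a b μ = comm Θ p q *
      (cdot (cvec (p + q + q)) a * b μ - cdot (cvec (q + p + p)) b * a μ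
        - ((q μ : ℂ) - p μ) * cdot a b) := by
  simp only [photonSourceSym, photonSource, Pi.add_apply, comm_swap hΘ p q, cdot_four, cvec]
  push_cast
  ring_nf
  simp only [Complex.I_sq]
  ring

lemma tadpole_eq (hΘ : Θᵀ = -Θ) (k l : Mom) (μ ν : Fin 4) : tadpole Θ k l μ ν =
    -6 * ((2 * Real.pi : ℝ) : ℂ) ^ (-2 : ℤ) *
      ((Real.sin (twist Θ k l / 2) ^ 2 : ℝ) : ℂ) * ((metric μ ν : ℝ) : ℂ) := by
  have e1 : comm Θ l (-l + k) = -comm Θ k l := comm_congr_neg (by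
    rw [twist_add_right, twist_neg_right, twist_self hΘ, twist_swap hΘ]; ring)
  have e2 : comm Θ (-l) k = comm Θ k l := comm_congr (by
    rw [twist_neg_left, twist_swap hΘ k l])
  have e3 : comm Θ l (k + -l) = -comm Θ k l := by rw [add_comm, e1]
  have e4 : comm Θ k (-l) = -comm Θ k l := comm_congr_neg (by rw [twist_neg_right])
  -- In the third contraction the inner commutator carries zero total momentum, so it vanishes. The
  -- first contributes the trace 4 of the metric and the second -1, which explains 3/2 = (4 - 1)/2
  -- below.
  have e5 : comm Θ k (l + -l) = 0 := by simp [comm, twist_zero_right]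
  simp only [tadpole, cubicSource, e1, e2, e3, e4, e5, basisVec_cdot]
  have h := comm_sq (Θ := Θ) k l
  have h2 := two_pi_zpow_mul
  generalize ((2 * Real.pi : ℝ) : ℂ) ^ (-2 : ℤ) = c at *
  generalize ((2 * Real.pi : ℝ) : ℂ) = d at *
  generalize ((Real.sin (twist Θ k l / 2) ^ 2 : ℝ) : ℂ) = s at *
  generalize comm Θ k l = z at *
  have key : ∀ x : ℂ, d ^ 2 * z ^ 2 * x = -(4 * c * s) * x := fun x => by
    linear_combination (d ^ 2 * x) * h - 4 * c * s * x * h2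
  fin_cases μ <;> fin_cases ν <;> simp [Fin.sum_univ_four, basisVec, eta, metric] <;>
    first
    | linear_combination (key (3 / 2))
    | linear_combination (-(key (3 / 2)))

set_option maxHeartbeats 1000000 in
-- The contracted numerator contains 3(k-l)²g besides the two tensors, and this part is written as
-- the tadpole. In this form no condition on ε or on (k-l)² is needed, so the same identity serves
-- the unregularized cancellation and the regularized integral.
lemma photonLoop_add_ghostLoop (hΘ : Θᵀ = -Θ) (ε : ℝ) (k l : Mom) (hl : mdot l l = 0)
    (μ ν : Fin 4) : photonLoop Θ ε k l μ ν + ghostLoop Θ ε k l μ ν =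
      retProp ε (k - l) * (2 * ((Real.sin (twist Θ k l / 2) ^ 2 : ℝ) : ℂ) *
          ((piTot1 k μ ν + piTot2 k l μ ν : ℝ) : ℂ) +
        ((2 * Real.pi : ℝ) : ℂ) ^ 2 * ((mdot (k - l) (k - l) : ℝ) : ℂ) * tadpole Θ k l μ ν) := by
  have hl' : (l 0 : ℂ) * l 0 - l 1 * l 1 - l 2 * l 2 - l 3 * l 3 = 0 := by
    rw [mdot_four] at hl; exact_mod_cast hl
  have e1 : comm Θ (k - l) l = comm Θ k l := comm_congr (by
    rw [twist_sub_left, twist_self hΘ, sub_zero])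
  have e2 : comm Θ l (k - l) = -comm Θ k l := by rw [comm_swap hΘ, e1]
  have e4 : comm Θ k (-l) = -comm Θ k l := comm_congr_neg (by rw [twist_neg_right])
  rw [tadpole_eq hΘ]
  simp only [photonLoop, ghostLoop, photonSourceSym_eq hΘ, ghostCurrent, ghostSource,
    antighostSource, e1, e2, e4, mul_assoc (comm Θ _ _) Complex.I,
    mul_assoc (-comm Θ _ _) Complex.I, I_mul_neg_I, cdot_four, cvec, Fin.sum_univ_four,
    basisVec]
  have h := comm_sq (Θ := Θ) k l
  have h2 := two_pi_zpow_mul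
  generalize ((2 * Real.pi : ℝ) : ℂ) ^ (-2 : ℤ) = c at *
  generalize ((2 * Real.pi : ℝ) : ℂ) = d at *
  generalize ((Real.sin (twist Θ k l / 2) ^ 2 : ℝ) : ℂ) = s at *
  generalize comm Θ k l = z at *
  generalize retProp ε (k - l) = r at *
  have K1 : d ^ 4 * z ^ 2 = -4 * s := by
    linear_combination (d ^ 4) * h - (4 * c * d ^ 2 * s + 4 * s) * h2
  obtain ⟨P, hP⟩ : ∃ P : ℂ, P = ((piTot1 k μ ν + piTot2 k l μ ν : ℝ) : ℂ) := ⟨_, rfl⟩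
  obtain ⟨D, hD⟩ : ∃ D : ℂ, D = ((mdot (k - l) (k - l) : ℝ) : ℂ) := ⟨_, rfl⟩
  obtain ⟨g, hg⟩ : ∃ g : ℂ, g = ((metric μ ν : ℝ) : ℂ) := ⟨_, rfl⟩
  rw [← hP, ← hD, ← hg]
  simp only [piTot1, piTot2, transverse, mdot_four, metric, low, Pi.sub_apply] at hP hD hg
  push_cast at hP hD hg
  simp only [Pi.add_apply, Pi.sub_apply, Pi.neg_apply]
  push_cast
  fin_cases μ <;> fin_cases ν <;> simp [eta] at hP hg ⊢ <;>
  linear_combination (r / 2 * (-P + 3 * D * g)) * K1 + 6 * r * s * D * g * h2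
    + (r / 2 * d ^ 4 * z ^ 2) * (hP - 3 * g * hD + (-3 *
        (((k 0 : ℂ) - l 0) * (k 0 - l 0) - (k 1 - l 1) * (k 1 - l 1) -
          (k 2 - l 2) * (k 2 - l 2) - (k 3 - l 3) * (k 3 - l 3)) +
        ((l 0 : ℂ) * l 0 - l 1 * l 1 - l 2 * l 2 - l 3 * l 3)) * hg - g * hl')

lemma slashBar_basisVec (ν : Fin 4) : slashBar (basisVec ν) = (eta ν : ℂ) • sigmaBar ν := by
  simp only [slashBar, basisVec, Pi.single_apply, mul_ite, mul_one, mul_zero, ite_smul, zero_smul]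
  simp

lemma slash_neg (a : Fin 4 → ℂ) : slash (-a) = -slash a := by
  simp [slash, ← Finset.sum_neg_distrib]

lemma cvec_neg (p : Mom) : cvec (-p) = -cvec p := by ext; simp [cvec]

/-- Interchanging σ and σ̄ reverses the sign of the ε-tensor in each trace; after symmetrization in
`a` and `b` this part is absent on both sides. -/
lemma sigma_trace_identity (a b : Fin 4 → ℂ) (μ ν : Fin 4) :
    Matrix.trace (sigmaBar μ * (slash a * sigmaBar ν * slash b)) +
      Matrix.trace (sigmaBar μ * (slash b * (sigmaBar ν * slash a))) =
    Matrix.trace (slashBar a * sigma μ * slashBar b * sigma ν)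
      + Matrix.trace (slashBar b * sigma μ * slashBar a * sigma ν) := by
  simp only [slashBar_eq, slash_eq, sigmaBar]
  fin_cases μ <;> fin_cases ν <;>
  · simp [sigma, eta, Matrix.trace_fin_two]
    ring_nf
    try simp only [Complex.I_sq, Complex.I_pow_three, Complex.I_pow_four]
    try ring_nf

lemma photinoLoop_eq (hΘ : Θᵀ = -Θ) (ε : ℝ) (k l : Mom) (μ ν : Fin 4) :
    photinoLoop Θ ε k l μ ν =
      2 * retProp ε (k - l) * ((Real.sin (twist Θ k l / 2) ^ 2 : ℝ) : ℂ) * piIno k l μ ν := by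
  have e1 : comm Θ (k - l) l = comm Θ k l := comm_congr (by
    rw [twist_sub_left, twist_self hΘ, sub_zero])
  have e2 : comm Θ l (k - l) = -comm Θ k l := by rw [comm_swap hΘ, e1]
  have e4 : comm Θ k (-l) = -comm Θ k l := comm_congr_neg (by rw [twist_neg_right])
  have hS := sigma_trace_identity (cvec (k - l)) (cvec l) μ ν
  simp only [photinoLoop, photinoCurrent, photinoSource, antiphotinoSource, e1, e2, e4, piIno,
    ← hS, slashBar_basisVec, cvec_neg, slash_neg, ← sub_eq_add_neg, mul_neg, neg_mul, smul_mul_assoc,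
    mul_smul_comm, Matrix.trace_neg, Matrix.trace_smul, smul_eq_mul, neg_smul]
  have h := comm_sq (Θ := Θ) k l
  have h2 := two_pi_zpow_mul
  generalize ((2 * Real.pi : ℝ) : ℂ) ^ (-2 : ℤ) = c at *
  generalize ((2 * Real.pi : ℝ) : ℂ) = d at *
  generalize ((Real.sin (twist Θ k l / 2) ^ 2 : ℝ) : ℂ) = s at *
  generalize comm Θ k l = z at *
  have K1 : d ^ 4 * z ^ 2 = -4 * s := by
    linear_combination (d ^ 4) * h - (4 * c * d ^ 2 * s + 4 * s) * h2
  push_cast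
  linear_combination (1 / 2 * retProp ε (k - l) * eta μ * eta ν *
    (Matrix.trace (sigmaBar μ * (slash (cvec (k - l)) * sigmaBar ν * slash (cvec l))) +
      Matrix.trace (sigmaBar μ * (slash (cvec l) * (sigmaBar ν * slash (cvec (k - l))))))) * K1

lemma retProp_zero_mul {p : Mom} (hp : mdot p p ≠ 0) :
    ((2 * Real.pi : ℝ) : ℂ) ^ 2 * ((mdot p p : ℝ) : ℂ) * retProp 0 p = -1 := by
  have h : ((mdot p p : ℝ) : ℂ) ≠ 0 := by exact_mod_cast hp
  have h2 := two_pi_zpow_mul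
  simp only [retProp, Complex.ofReal_zero, mul_zero, zero_mul, add_zero]
  field_simp

/-- At ε = 0 the propagator inverts (k-l)², and the extra term of `photonLoop_add_ghostLoop` is
minus the tadpole. -/
lemma tadpole_add_photonLoop_add_ghostLoop (hΘ : Θᵀ = -Θ) (k l : Mom) (hl : mdot l l = 0)
    (hkl : mdot (k - l) (k - l) ≠ 0) (μ ν : Fin 4) :
    tadpole Θ k l μ ν + photonLoop Θ 0 k l μ ν + ghostLoop Θ 0 k l μ ν =
      2 * retProp 0 (k - l) * ((Real.sin (twist Θ k l / 2) ^ 2 : ℝ) : ℂ) *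
        ((piTot1 k μ ν + piTot2 k l μ ν : ℝ) : ℂ) := by
  rw [add_assoc, photonLoop_add_ghostLoop hΘ 0 k l hl]
  linear_combination (tadpole Θ k l μ ν) * retProp_zero_mul hkl

/-- On the light cone the integrand of the self-energy is, up to a term that vanishes with the
regularization, the retarded propagator times the transverse tensor. -/
lemma selfEnergy_integrand (hΘ : Θᵀ = -Θ) (ε : ℝ) (k l : Mom) (hl : mdot l l = 0) (μ ν : Fin 4) :
    tadpole Θ k l μ ν + photonLoop Θ ε k l μ ν + ghostLoop Θ ε k l μ ν + photinoLoop Θ ε k l μ ν =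
      ((Real.sin (twist Θ k l / 2) ^ 2 : ℝ) : ℂ) *
        (-4 * ((transverse k μ ν : ℝ) : ℂ) * retProp ε (k - l)
          - 6 * ((2 * Real.pi : ℝ) : ℂ) ^ (-2 : ℤ) * ((metric μ ν : ℝ) : ℂ) *
            (1 + ((2 * Real.pi : ℝ) : ℂ) ^ 2 * ((mdot (k - l) (k - l) : ℝ) : ℂ) *
              retProp ε (k - l))) := by
  have h1 := photonLoop_add_ghostLoop hΘ ε k l hl μ ν
  have h2 := photinoLoop_eq hΘ ε k l μ ν
  rw [piIno_eq k l hl] at h2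
  have h3 := tadpole_eq hΘ k l μ ν
  rw [h3] at h1 ⊢
  simp only [piTot1] at h1
  push_cast at h1 h2 ⊢
  linear_combination h1 + h2

end

section

variable {Θ : Matrix (Fin 4) (Fin 4) ℝ}

/-! ## Kernels and three-point functions -/

lemma mul_weylP1 (y : ℂ) : y * weylP1 y = Complex.exp y - 1 := by
  have hs : Summable fun n : ℕ => y ^ n / (n.factorial : ℂ) := NormedSpace.expSeries_div_summable y
  have h : Complex.exp y = ∑' n : ℕ, y ^ n / (n.factorial : ℂ) := by
    rw [Complex.exp_eq_exp_ℂ, NormedSpace.exp_eq_tsum_div]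
  rw [h, hs.tsum_eq_zero_add, weylP1, ← tsum_mul_left]
  simp only [pow_zero, Nat.factorial_zero, Nat.cast_one, div_one, add_sub_cancel_left]
  exact tsum_congr fun n => by rw [pow_succ]; ring

lemma weylP1_zero : weylP1 0 = 1 := by
  rw [weylP1, tsum_eq_single 0 (fun n hn => by simp [hn])]; simp

/-- The phase e^{ix/2} symmetrizes (1 - e^{-ix})/(ix). The value is real and even, which is why the
two momenta of a pair receive the same factor. -/
lemma coordFactor_eq (k p : Mom) :
    coordFactor Θ k p = ((Real.sinc (twist Θ k p / 2) : ℝ) : ℂ) := by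
  simp only [coordFactor]
  generalize twist Θ k p = x
  rcases eq_or_ne x 0 with rfl | hx
  · simp [weylP1_zero]
  have h := mul_weylP1 (-Complex.I * (x : ℂ))
  have hx' : (x : ℂ) ≠ 0 := by exact_mod_cast hx
  have e1 : Complex.exp (-Complex.I * x) * Complex.exp (Complex.I / 2 * x) =
      Complex.cos (x / 2) - Complex.sin (x / 2) * Complex.I := by
    rw [← Complex.exp_add,
      show -Complex.I * (x : ℂ) + Complex.I / 2 * x = (-(x / 2 : ℂ)) * Complex.I by ring,
      Complex.exp_mul_I, Complex.sin_neg, Complex.cos_neg]; ring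
  have e2 : Complex.exp (Complex.I / 2 * x) =
      Complex.cos (x / 2) + Complex.sin (x / 2) * Complex.I := by
    rw [show Complex.I / 2 * (x : ℂ) = (x / 2 : ℂ) * Complex.I by ring, Complex.exp_mul_I]
  rw [Real.sinc_of_ne_zero (by simpa using hx)]
  push_cast
  have h3 : (-Complex.I * x) * (weylP1 (-Complex.I * x) * Complex.exp (Complex.I / 2 * x)) =
      (-Complex.I * x) * (Complex.sin (x / 2) / (x / 2)) := by
    rw [← mul_assoc, h, sub_mul, e1, one_mul, e2]
    field_simp
    ring
  exact mul_left_cancel₀ (by simp [hx', Complex.I_ne_zero]) h3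

/-- The cubic vertex, with the coupling removed. -/
noncomputable def vertex (k₁ k₂ k₃ : Mom) (μ₁ μ₂ μ₃ : Fin 4) : ℂ :=
  ((low (k₁ - k₂) μ₃ * metric μ₁ μ₂ + low (k₂ - k₃) μ₁ * metric μ₂ μ₃
    + low (k₃ - k₁) μ₂ * metric μ₁ μ₃ : ℝ) : ℂ)

lemma photonLeg_eq (hΘ : Θᵀ = -Θ) (p q : Mom) (μ ν ρ : Fin 4) : photonLeg Θ p q μ ν ρ =
    -((2 * Real.pi : ℝ) : ℂ) ^ 6 * comm Θ p q * vertex (-(p + q)) p q μ ν ρ := by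
  have e : comm Θ (-p) (-q) = comm Θ p q := comm_congr (by
    rw [twist_neg_left, twist_neg_right, neg_neg])
  simp only [photonLeg, photonSourceSym_eq hΘ, e, cdot, Pi.smul_apply, smul_eq_mul, basisVec,
    Pi.single_apply, vertex, cvec, low, metric, Matrix.diagonal_apply, Pi.add_apply, Pi.sub_apply,
    Pi.neg_apply]
  simp only [mul_ite, mul_one, mul_zero, Finset.sum_ite_eq', Finset.mem_univ, if_true]
  push_cast
  generalize comm Θ p q = z
  -- The excluded simp lemmas would turn the polynomial equations into disjunctions.
  fin_cases μ <;> fin_cases ν <;> fin_cases ρ <;>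
    simp [eta, -mul_eq_mul_left_iff, -mul_eq_mul_right_iff, -neg_inj] <;>
    first | ring1 | (ring_nf; simp)

lemma vertex_symm (k₁ k₂ k₃ : Mom) (μ₁ μ₂ μ₃ : Fin 4) :
    vertex k₂ k₁ k₃ μ₂ μ₁ μ₃ = -vertex k₁ k₂ k₃ μ₁ μ₂ μ₃ := by
  have e : ∀ i j, metric i j = metric j i := fun i j => by
    simp [metric, Matrix.diagonal_apply]; split_ifs <;> simp_all
  simp only [vertex, low, Pi.sub_apply, e μ₂ μ₁]
  push_cast; ring

lemma vertex_cycle (k₁ k₂ k₃ : Mom) (μ₁ μ₂ μ₃ : Fin 4) :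
    vertex k₂ k₃ k₁ μ₂ μ₃ μ₁ = vertex k₁ k₂ k₃ μ₁ μ₂ μ₃ := by
  have e : ∀ i j, metric i j = metric j i := fun i j => by
    simp [metric, Matrix.diagonal_apply]; split_ifs <;> simp_all
  simp only [vertex, low, Pi.sub_apply, e μ₃ μ₁, e μ₂ μ₁]
  push_cast; ring

/-- Momentum conservation makes the sine cyclic in the three momenta. Both the sine and the vertex
are odd under exchange of two legs, so the product does not see the position of the first order
field. -/
lemma threePhoton_eq (hΘ : Θᵀ = -Θ) (j : Fin 3) (p q : Mom) (μ₁ μ₂ μ₃ : Fin 4) :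
    threePhoton Θ j p q (-(p + q)) μ₁ μ₂ μ₃ =
      -((2 * Real.pi : ℝ) : ℂ) ^ 6 * comm Θ p q * vertex p q (-(p + q)) μ₁ μ₂ μ₃ := by
  have e1 : comm Θ q (-(p + q)) = comm Θ p q := comm_congr (by
    rw [twist_neg_right, twist_add_right, twist_self hΘ, twist_swap hΘ p q]; ring)
  have e2 : comm Θ p (-(p + q)) = -comm Θ p q := comm_congr_neg (by
    rw [twist_neg_right, twist_add_right, twist_self hΘ]; ring)
  have e3 : -(q + -(p + q)) = p := by abel
  have e4 : -(p + -(p + q)) = q := by abel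
  fin_cases j
  · change photonLeg Θ q (-(p + q)) μ₁ μ₂ μ₃ = _
    rw [photonLeg_eq hΘ, e1, e3]
  · change photonLeg Θ p (-(p + q)) μ₂ μ₁ μ₃ = _
    rw [photonLeg_eq hΘ, e2, e4, vertex_symm]; ring
  · change photonLeg Θ p q μ₃ μ₁ μ₂ = _
    rw [photonLeg_eq hΘ, ← vertex_cycle (-(p + q))]

/-- The photino-antiphotino-photon function with the photino line first, with the coupling
removed. -/
noncomputable def photinoVertex (q q' : Mom) (σ : Fin 4) : Matrix (Fin 2) (Fin 2) ℂ :=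
  slash (cvec q) * slashBar (basisVec σ) * slash (cvec q')

/-- The same independence of the position for the photino line: the signs of the graded contractions
compensate those of the commutator kernels. -/
lemma photinoLegs_left (hΘ : Θᵀ = -Θ) (j : Fin 3) (p q : Mom) (σ : Fin 4) :
    ![antiphotinoLeg Θ (-1) q (-(p + q)) σ, photinoLeg Θ (-1) p (-(p + q)) σ,
      photonOfPhotinoLeg Θ (-1) q p σ] j =
    (-((2 * Real.pi : ℝ) : ℂ) ^ 6 * comm Θ p q) • photinoVertex q p σ := by
  have e1 : comm Θ (-(-(p + q))) (-q) = -comm Θ p q := comm_congr_neg (by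
    rw [neg_neg, twist_neg_right, twist_add_left, twist_self hΘ]; ring)
  have e2 : comm Θ (-(-(p + q))) (-p) = comm Θ p q := comm_congr (by
    rw [neg_neg, twist_neg_right, twist_add_left, twist_self hΘ, twist_swap hΘ q p]; ring)
  have e3 : -(-(p + q)) + -q = p := by abel
  have e4 : -(-(p + q)) + -p = q := by abel
  have e5 : comm Θ (-p) (-q) = comm Θ p q := comm_congr (by
    rw [twist_neg_left, twist_neg_right, neg_neg])
  have e6 : ∀ (c : ℂ) (a : Fin 4 → ℂ), slashBar (c • a) = c • slashBar a := fun c a => by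
    simp only [slashBar, Pi.smul_apply, smul_eq_mul, Finset.smul_sum, smul_smul]
    exact Finset.sum_congr rfl fun _ _ => by congr 1; ring
  fin_cases j
  · change antiphotinoLeg Θ (-1) q (-(p + q)) σ = _
    rw [antiphotinoLeg, antiphotinoSource, e1, e3, e6, photinoVertex]
    simp only [smul_mul_assoc, mul_smul_comm, smul_smul, ← mul_assoc]
    congr 1; ring
  · change photinoLeg Θ (-1) p (-(p + q)) σ = _
    rw [photinoLeg, photinoSource, e2, e4, e6, photinoVertex]
    simp only [smul_mul_assoc, mul_smul_comm, smul_smul, ← mul_assoc]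
    congr 1; ring
  · change photonOfPhotinoLeg Θ (-1) q p σ = _
    rw [photonOfPhotinoLeg, e5, photinoVertex, slashBar_basisVec]
    simp only [smul_mul_assoc, mul_smul_comm, smul_smul]
    congr 1; ring

lemma photinoLegs_right (hΘ : Θᵀ = -Θ) (j : Fin 3) (p q : Mom) (σ : Fin 4) :
    ![photinoLeg Θ 1 q (-(p + q)) σ, antiphotinoLeg Θ 1 p (-(p + q)) σ,
      photonOfPhotinoLeg Θ 1 p q σ] j =
    (-((2 * Real.pi : ℝ) : ℂ) ^ 6 * comm Θ p q) • photinoVertex p q σ := by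
  have e1 : comm Θ (-(-(p + q))) (-q) = -comm Θ p q := comm_congr_neg (by
    rw [neg_neg, twist_neg_right, twist_add_left, twist_self hΘ]; ring)
  have e2 : comm Θ (-(-(p + q))) (-p) = comm Θ p q := comm_congr (by
    rw [neg_neg, twist_neg_right, twist_add_left, twist_self hΘ, twist_swap hΘ q p]; ring)
  have e3 : -(-(p + q)) + -q = p := by abel
  have e4 : -(-(p + q)) + -p = q := by abel
  have e5 : comm Θ (-q) (-p) = -comm Θ p q := comm_congr_neg (by
    rw [twist_neg_left, twist_neg_right, neg_neg, twist_swap hΘ])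
  have e6 : ∀ (c : ℂ) (a : Fin 4 → ℂ), slashBar (c • a) = c • slashBar a := fun c a => by
    simp only [slashBar, Pi.smul_apply, smul_eq_mul, Finset.smul_sum, smul_smul]
    exact Finset.sum_congr rfl fun _ _ => by congr 1; ring
  fin_cases j
  · change photinoLeg Θ 1 q (-(p + q)) σ = _
    rw [photinoLeg, photinoSource, e1, e3, e6, photinoVertex]
    simp only [smul_mul_assoc, mul_smul_comm, smul_smul, ← mul_assoc]
    congr 1; ring
  · change antiphotinoLeg Θ 1 p (-(p + q)) σ = _
    rw [antiphotinoLeg, antiphotinoSource, e2, e4, e6, photinoVertex]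
    simp only [smul_mul_assoc, mul_smul_comm, smul_smul, ← mul_assoc]
    congr 1; ring
  · change photonOfPhotinoLeg Θ 1 p q σ = _
    rw [photonOfPhotinoLeg, e5, photinoVertex, slashBar_basisVec]
    simp only [smul_mul_assoc, mul_smul_comm, smul_smul]
    congr 1; ring

lemma loop21_eq (hΘ : Θᵀ = -Θ) (j : Fin 3) (p q : Mom) (μ ν σ : Fin 4) :
    loop21 Θ j p q (-(p + q)) μ ν σ = (-((2 * Real.pi : ℝ) : ℂ) ^ 6 * comm Θ p q) *
      ((∑ μ₁, ∑ μ₂, kernel1Photon Θ p q μ ν μ₁ μ₂ * vertex p q (-(p + q)) μ₁ μ₂ σ)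
        + Matrix.trace (kernel1Photino Θ p q μ ν * photinoVertex q p σ)
        - Matrix.trace (kernel1Photino Θ q p μ ν * photinoVertex p q σ)) := by
  rw [loop21, photinoLegs_left hΘ, photinoLegs_right hΘ]
  simp only [threePhoton_eq hΘ, mul_smul_comm, Matrix.trace_smul, neg_mul, Matrix.trace_neg,
    smul_eq_mul, mul_add, mul_sub, Finset.mul_sum, smul_neg]
  rw [sub_eq_add_neg]
  congr 2
  refine Finset.sum_congr rfl fun _ _ => Finset.sum_congr rfl fun _ _ => by ring

/-- A cyclic relabelling of the three fields turns position 0 into 2, 1 into 0 and 2 into 1. Since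
`loop21` does not depend on the position, the new one may be taken to be 2. -/
lemma loop12_eq_loop21 (hΘ : Θᵀ = -Θ) (j : Fin 3) (p q : Mom) (μ ν σ : Fin 4) :
    loop12 Θ j (-(p + q)) p q μ ν σ = loop21 Θ 2 p q (-(p + q)) μ ν σ := by
  have hs : ∀ (a b : Mom) (x y z : Fin 4), photonLeg Θ a b x y z = photonLeg Θ b a x z y := by
    intro a b x y z
    simp only [photonLeg, photonSourceSym, Pi.add_apply]; ring
  obtain ⟨j', hj⟩ : ∃ j' : Fin 3, loop12 Θ j (-(p + q)) p q μ ν σ =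
      loop21 Θ j' p q (-(p + q)) μ ν σ := by
    fin_cases j
    · exact ⟨2, rfl⟩
    · refine ⟨0, ?_⟩
      simp only [loop12, loop21, threePhoton]
      simp [hs (-q + -p) q]
    · refine ⟨1, ?_⟩
      simp only [loop12, loop21, threePhoton]
      simp [hs (-q + -p) p]
  rw [hj, loop21_eq hΘ, loop21_eq hΘ]

end

/-! ### The contraction with the first order kernel -/

section

variable {Θ : Matrix (Fin 4) (Fin 4) ℝ}

lemma sigmaLow_conjTranspose (μ ν : Fin 4) : (sigmaLow μ ν)ᴴ = ((eta μ * eta ν : ℝ) : ℂ) •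
    ((1 / 4 : ℂ) • (sigmaBar ν * sigma μ - sigmaBar μ * sigma ν)) := by
  ext i j
  fin_cases μ <;> fin_cases ν <;> fin_cases i <;> fin_cases j <;>
    simp [sigmaLow, sigmaBar, sigma, eta] <;> ring

lemma slashBar_cvec_conjTranspose (p : Mom) : (slashBar (cvec p))ᴴ = slashBar (cvec p) := by
  rw [slashBar_eq]
  ext i j
  fin_cases i <;> fin_cases j <;> (simp [cvec]; try ring)

/-- Lowering of an index of a complex vector. -/
noncomputable def clow (a : Fin 4 → ℂ) (μ : Fin 4) : ℂ := (eta μ : ℂ) * a μ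

/-- The sum of the photon and the photino terms of a three-point function, contracted with the
first order kernel and with an external vector `H`; `K` stands for `(kΘ)`, and `p`, `q` are the two
loop momenta. -/
noncomputable def contracted (p q K H : Fin 4 → ℂ) (μ ν : Fin 4) : ℂ :=
  let V : Fin 4 → Fin 4 → Fin 4 → ℂ := fun a b c =>
    clow (p - q) c * ((metric a b : ℝ) : ℂ) + clow (q + (p + q)) a * ((metric b c : ℝ) : ℂ)
      + clow (-(p + q) - p) b * ((metric a c : ℝ) : ℂ)
  cdot K p * (∑ σ, V μ ν σ * H σ)
    + clow q μ * (∑ ρ, ∑ σ, K ρ * V ρ ν σ * H σ) + clow p μ * (∑ ρ, ∑ σ, K ρ * V ν ρ σ * H σ)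
    + 1 / 4 * Matrix.trace ((slashBar K * sigmaLow μ ν - (sigmaLow μ ν)ᴴ * slashBar K) *
        (slash q * slashBar H * slash p - slash p * slashBar H * slash q))

set_option maxHeartbeats 4000000 in
-- This identity carries the cancellation of the first order kernels. Only the part antisymmetric in
-- μ, ν is seen by the test functions, and there the photino trace removes every structure of the
-- photon terms except two. Transversality of `K` and `H` suffices; no mass-shell condition enters.
lemma contracted_sub (k l K H : Fin 4 → ℂ) (hK : cdot K k = 0) (hH : cdot H k = 0)
    (μ ν : Fin 4) (h : μ < ν) : contracted l (k - l) K H μ ν - contracted l (k - l) K H ν μ =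
      2 * ((clow k μ * clow K ν - clow k ν * clow K μ) * cdot H l
        - (clow k μ * clow l ν - clow k ν * clow l μ) * cdot H K) := by
  rw [cdot_four] at hK hH
  simp only [contracted, sigmaLow_conjTranspose, slashBar_eq, slash_eq, cdot_four,
    Fin.sum_univ_four, clow, metric, Pi.sub_apply, Pi.add_apply, Pi.neg_apply]
  fin_cases μ <;> fin_cases ν <;> try exact absurd h (by decide)
  all_goals
    simp [sigmaLow, sigmaBar, sigma, eta, Matrix.trace_fin_two]
    ring_nf
    simp only [Complex.I_sq]
  -- Six independent components remain. Each is an identity modulo K·k and H·k; the coefficients are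
  -- components of the bivectors k∧H, l∧H and k∧K.
  · linear_combination (2 * (k 0 * -H 1 - -k 1 * H 0) - (l 0 * -H 1 - -l 1 * H 0)) * hK -
      (k 0 * -K 1 - -k 1 * K 0) * hH
  · linear_combination (2 * (k 0 * -H 2 - -k 2 * H 0) - (l 0 * -H 2 - -l 2 * H 0)) * hK -
      (k 0 * -K 2 - -k 2 * K 0) * hH
  · linear_combination (2 * (k 0 * -H 3 - -k 3 * H 0) - (l 0 * -H 3 - -l 3 * H 0)) * hK -
      (k 0 * -K 3 - -k 3 * K 0) * hH
  · linear_combination (2 * (k 1 * H 2 - k 2 * H 1) - (l 1 * H 2 - l 2 * H 1)) * hK -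
      (k 1 * K 2 - k 2 * K 1) * hH
  · linear_combination (2 * (k 1 * H 3 - k 3 * H 1) - (l 1 * H 3 - l 3 * H 1)) * hK -
      (k 1 * K 3 - k 3 * K 1) * hH
  · linear_combination (2 * (k 2 * H 3 - k 3 * H 2) - (l 2 * H 3 - l 3 * H 2)) * hK -
      (k 2 * K 3 - k 3 * K 2) * hH

end

section

variable {Θ : Matrix (Fin 4) (Fin 4) ℝ}

lemma clow_cvec (p : Mom) (μ : Fin 4) : clow (cvec p) μ = ((low p μ : ℝ) : ℂ) := by
  simp [clow, cvec, low]

lemma cdot_cvec (p q : Mom) : cdot (cvec p) (cvec q) = ((mdot p q : ℝ) : ℂ) := by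
  simp [cdot, cvec, mdot]

lemma slashBar_eq_sum (H : Fin 4 → ℂ) : slashBar H = ∑ σ, H σ • slashBar (basisVec σ) := by
  simp only [slashBar_basisVec, smul_smul]
  exact Finset.sum_congr rfl fun _ _ => by rw [mul_comm]

lemma sin_half_eq (x : ℝ) : Real.sin (x / 2) = Real.sinc (x / 2) * (x / 2) := by
  rcases eq_or_ne x 0 with rfl | hx
  · simp
  · rw [Real.sinc_of_ne_zero (by simpa using hx), div_mul_cancel₀ _ (by simpa using hx)]

lemma sin_sq_div_eq (x : ℝ) :
    Real.sin (x / 2) ^ 2 / (x / 2) = Real.sin (x / 2) * Real.sinc (x / 2) := by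
  rcases eq_or_ne x 0 with rfl | hx
  · simp
  · rw [Real.sinc_of_ne_zero (by simpa using hx)]; ring

lemma twist_right_self (hΘ : Θᵀ = -Θ) (k : Mom) : mdot (kTheta Θ k) k = 0 := twist_self hΘ k

lemma kernel1Photino_trace (k p : Mom) (μ ν : Fin 4) (q : Mom) (hk : p + q = k)
    (M : Matrix (Fin 2) (Fin 2) ℂ) :
    Matrix.trace (kernel1Photino Θ p q μ ν * M) =
      ((2 * Real.pi : ℝ) : ℂ) ^ (-2 : ℤ) * ((Real.sinc (twist Θ k p / 2) : ℝ) : ℂ) * (1 / 4 *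
        Matrix.trace ((slashBar (cvec (kTheta Θ k)) * sigmaLow μ ν -
          (sigmaLow μ ν)ᴴ * slashBar (cvec (kTheta Θ k))) * M)) := by
  rw [kernel1Photino, hk, coordFactor_eq, Matrix.conjTranspose_mul, slashBar_cvec_conjTranspose,
    smul_mul_assoc, Matrix.trace_smul, smul_eq_mul]
  ring

/-- The sinc factor is the same for the momenta l and k - l, as kΘk = 0. It can be taken out of all
terms once the sine in the commutator part of the photon kernel is written as sinc times kΘl/2. -/
lemma loop21_contract (hΘ : Θᵀ = -Θ) (j : Fin 3) (k l : Mom) (H : Fin 4 → ℂ) (μ ν : Fin 4) :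
    ∑ σ, loop21 Θ j l (k - l) (-k) μ ν σ * H σ =
      -2 * Complex.I * ((2 * Real.pi : ℝ) : ℂ) ^ 2 *
        ((Real.sin (twist Θ k l / 2) * Real.sinc (twist Θ k l / 2) : ℝ) : ℂ) *
        contracted (cvec l) (cvec k - cvec l) (cvec (kTheta Θ k)) H μ ν := by
  have hk : l + (k - l) = k := by abel
  have hk' : k - l + l = k := by abel
  have hz : comm Θ l (k - l) = 2 * Complex.I * ((2 * Real.pi : ℝ) : ℂ) ^ (-2 : ℤ) *
      ((Real.sin (twist Θ k l / 2) : ℝ) : ℂ) := by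
    rw [comm_eq, twist_sub_right, twist_self hΘ, sub_zero, twist_swap hΘ, neg_div, Real.sin_neg]
    push_cast; ring
  have hloop := loop21_eq hΘ j l (k - l) μ ν
  simp only [hk] at hloop
  have hV : ∀ a b c, vertex l (k - l) (-k) a b c =
      clow (cvec l - (cvec k - cvec l)) c * ((metric a b : ℝ) : ℂ)
      + clow ((cvec k - cvec l) + (cvec l + (cvec k - cvec l))) a * ((metric b c : ℝ) : ℂ)
      + clow (-(cvec l + (cvec k - cvec l)) - cvec l) b * ((metric a c : ℝ) : ℂ) := by
    intro a b c
    simp only [vertex, clow, low, cvec, Pi.add_apply, Pi.sub_apply, Pi.neg_apply]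
    push_cast; ring
  have hw2 : Real.sinc (twist Θ k (k - l) / 2) = Real.sinc (twist Θ k l / 2) := by
    rw [twist_sub_right, twist_self hΘ, zero_sub, neg_div, Real.sinc_neg]
  have hP : ∀ q q' : Mom, ∑ σ, H σ • photinoVertex q q' σ =
      slash (cvec q) * slashBar H * slash (cvec q') := by
    intro q q'
    rw [slashBar_eq_sum H]
    simp only [photinoVertex, Finset.mul_sum, Finset.sum_mul, mul_smul_comm, smul_mul_assoc]
  have hT : ∀ (M : Matrix (Fin 2) (Fin 2) ℂ) (q q' : Mom),
      ∑ σ, Matrix.trace (M * photinoVertex q q' σ) * H σ =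
        Matrix.trace (M * (slash (cvec q) * slashBar H * slash (cvec q'))) := by
    intro M q q'
    rw [← hP, Finset.mul_sum, Matrix.trace_sum]
    exact Finset.sum_congr rfl fun σ _ => by
      rw [mul_smul_comm, Matrix.trace_smul, smul_eq_mul, mul_comm]
  have hcv : cvec (k - l) = cvec k - cvec l := by ext; simp [cvec]
  have hx : cdot (cvec (kTheta Θ k)) (cvec l) = ((twist Θ k l : ℝ) : ℂ) := cdot_cvec _ _
  have hA : ∑ σ, (∑ μ₁, ∑ μ₂, kernel1Photon Θ l (k - l) μ ν μ₁ μ₂ *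
        vertex l (k - l) (-k) μ₁ μ₂ σ) * H σ =
      ((2 * Real.pi : ℝ) : ℂ) ^ (-2 : ℤ) * ((Real.sinc (twist Θ k l / 2) : ℝ) : ℂ) *
      (((twist Θ k l : ℝ) : ℂ) * (∑ σ, vertex l (k - l) (-k) μ ν σ * H σ)
        + clow (cvec k - cvec l) μ * (∑ ρ, ∑ σ, cvec (kTheta Θ k) ρ *
            vertex l (k - l) (-k) ρ ν σ * H σ)
        + clow (cvec l) μ * (∑ ρ, ∑ σ, cvec (kTheta Θ k) ρ *
            vertex l (k - l) (-k) ν ρ σ * H σ)) := by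
    have hs : ((Real.sin (twist Θ k l / 2) : ℝ) : ℂ) =
        ((Real.sinc (twist Θ k l / 2) : ℝ) : ℂ) * (((twist Θ k l : ℝ) : ℂ) / 2) := by
      rw [sin_half_eq]; push_cast; ring
    have e1 : ∀ σ, ∑ μ₁, ∑ μ₂, kernel1Photon Θ l (k - l) μ ν μ₁ μ₂ *
        vertex l (k - l) (-k) μ₁ μ₂ σ =
      ((2 * Real.pi : ℝ) : ℂ) ^ (-2 : ℤ) * ((Real.sinc (twist Θ k l / 2) : ℝ) : ℂ) *
      (((twist Θ k l : ℝ) : ℂ) * vertex l (k - l) (-k) μ ν σ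
        + clow (cvec k - cvec l) μ * (∑ ρ, cvec (kTheta Θ k) ρ * vertex l (k - l) (-k) ρ ν σ)
        + clow (cvec l) μ * (∑ ρ, cvec (kTheta Θ k) ρ * vertex l (k - l) (-k) ν ρ σ)) := by
      intro σ
      simp only [kernel1Photon, hz, hk, coordFactor_eq, hw2, ← hcv, clow_cvec, add_mul,
        Finset.sum_add_distrib, mul_add]
      have i1 : ∀ (c : ℂ) (F : Fin 4 → Fin 4 → ℂ), ∑ a, ∑ b,
          c * (if a = μ ∧ b = ν then 1 else 0) * F a b = c * F μ ν := by
        intro c F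
        rw [Finset.sum_eq_single μ (fun a _ ha => by simp [ha]) (by simp),
          Finset.sum_eq_single ν (fun a _ ha => by simp [ha]) (by simp)]
        simp
      rw [i1, hs]
      simp only [mul_ite, mul_one, mul_zero, ite_mul, zero_mul, Finset.sum_ite_eq',
        Finset.mem_univ, if_true, Finset.mul_sum]
      rw [add_assoc]
      congr 1
      · linear_combination (-((2 * Real.pi : ℝ) : ℂ) ^ (-2 : ℤ) *
          ((Real.sinc (twist Θ k l / 2) : ℝ) : ℂ) * ((twist Θ k l : ℝ) : ℂ) *
          vertex l (k - l) (-k) μ ν σ) * Complex.I_sq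
      · congr 1
        · exact Finset.sum_congr rfl fun a _ => by simp only [cvec]; ring
        · rw [Finset.sum_comm]
          simp only [Finset.sum_ite_eq', Finset.mem_univ, if_true]
          exact Finset.sum_congr rfl fun a _ => by simp only [cvec]; ring
    simp only [e1]
    simp only [mul_assoc, add_mul, ← Finset.mul_sum, Finset.sum_add_distrib, Finset.sum_mul]
    congr 4
    · rw [Finset.sum_comm]; simp only [Finset.mul_sum]
    · rw [Finset.sum_comm]; simp only [Finset.mul_sum]
  have hc : contracted (cvec l) (cvec k - cvec l) (cvec (kTheta Θ k)) H μ ν =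
      ((twist Θ k l : ℝ) : ℂ) * (∑ σ, vertex l (k - l) (-k) μ ν σ * H σ)
        + clow (cvec k - cvec l) μ * (∑ ρ, ∑ σ, cvec (kTheta Θ k) ρ *
            vertex l (k - l) (-k) ρ ν σ * H σ)
        + clow (cvec l) μ * (∑ ρ, ∑ σ, cvec (kTheta Θ k) ρ *
            vertex l (k - l) (-k) ν ρ σ * H σ)
        + 1 / 4 * Matrix.trace ((slashBar (cvec (kTheta Θ k)) * sigmaLow μ ν -
            (sigmaLow μ ν)ᴴ * slashBar (cvec (kTheta Θ k))) *
          (slash (cvec (k - l)) * slashBar H * slash (cvec l) -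
            slash (cvec l) * slashBar H * slash (cvec (k - l)))) := by
    simp only [contracted, hV, hx, hcv]
  simp only [hloop, mul_assoc, ← Finset.mul_sum]
  have hsum : ∑ σ, ((∑ μ₁, ∑ μ₂, kernel1Photon Θ l (k - l) μ ν μ₁ μ₂ *
        vertex l (k - l) (-k) μ₁ μ₂ σ) +
        Matrix.trace (kernel1Photino Θ l (k - l) μ ν * photinoVertex (k - l) l σ) -
        Matrix.trace (kernel1Photino Θ (k - l) l μ ν * photinoVertex l (k - l) σ)) * H σ =
      ((2 * Real.pi : ℝ) : ℂ) ^ (-2 : ℤ) * ((Real.sinc (twist Θ k l / 2) : ℝ) : ℂ) *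
        contracted (cvec l) (cvec k - cvec l) (cvec (kTheta Θ k)) H μ ν := by
    simp only [sub_mul, add_mul, Finset.sum_add_distrib, Finset.sum_sub_distrib]
    rw [hA, hT, hT, kernel1Photino_trace k l μ ν (k - l) hk,
      kernel1Photino_trace k (k - l) μ ν l hk', hw2, hc, Matrix.mul_sub, Matrix.trace_sub]
    ring
  rw [hsum, hz]
  have h2 := two_pi_zpow_mul
  push_cast at h2 ⊢
  generalize (2 * (Real.pi : ℂ)) ^ (-2 : ℤ) = c at *
  generalize (2 * (Real.pi : ℂ)) = d at *
  -- The powers of d = 2π and c = d⁻² amount to d⁶c² = d²; with x = d²c this is x² - 1 = (x + 1)(x -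
  -- 1).
  linear_combination (-2 * Complex.I * d ^ 2 * Complex.sin (twist Θ k l / 2) *
    ((Real.sinc (twist Θ k l / 2) : ℝ) : ℂ) *
    contracted (cvec l) (cvec k - cvec l) (cvec (kTheta Θ k)) H μ ν) * (d ^ 2 * c + 1) * h2

end

/-! ### The residual integrand N and its vanishing on light cones -/

section

variable {Θ : Matrix (Fin 4) (Fin 4) ℝ}

lemma sum_antisymm_congr (f T U : Fin 4 → Fin 4 → ℂ) (hf : ∀ μ ν, f μ ν = -f ν μ)
    (h : ∀ μ ν, μ < ν → T μ ν - T ν μ = U μ ν - U ν μ) :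
    ∑ μ, ∑ ν, f μ ν * T μ ν = ∑ μ, ∑ ν, f μ ν * U μ ν := by
  have hD : ∀ μ ν, T μ ν - U μ ν = T ν μ - U ν μ := by
    intro μ ν
    rcases lt_trichotomy μ ν with h1 | rfl | h1
    · linear_combination h μ ν h1
    · rfl
    · linear_combination -h ν μ h1
  have h0 : ∑ μ, ∑ ν, f μ ν * (T μ ν - U μ ν) = 0 := by
    have h1 : ∑ μ, ∑ ν, f μ ν * (T μ ν - U μ ν) = -∑ μ, ∑ ν, f μ ν * (T μ ν - U μ ν) := by
      conv_lhs => rw [Finset.sum_comm]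
      simp only [← Finset.sum_neg_distrib]
      exact Finset.sum_congr rfl fun μ _ => Finset.sum_congr rfl fun ν _ => by
        rw [hf ν μ, hD ν μ]; ring
    exact self_eq_neg.mp h1
  simp only [mul_sub, Finset.sum_sub_distrib] at h0
  exact sub_eq_zero.mp h0

/-- The kernel of order zero and `h` form a vector orthogonal to k because `h` is antisymmetric, and
(kΘ)·k = 0 because Θ is. These are the two hypotheses of `contracted_sub`. -/
lemma amp21_eq (hΘ : Θᵀ = -Θ) (f h : Fin 4 → Fin 4 → Mom → ℂ) (j : Fin 3) (k l : Mom)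
    (hf : ∀ μ ν, f μ ν (-k) = -f ν μ (-k)) (hh : ∀ μ ν, h μ ν k = -h ν μ k) :
    amp21 Θ f h j l (k - l) (-k) = residualIntegrand Θ f h k l := by
  -- The second observable carries momentum -k, which turns the factor -2i of the kernel into 2i.
  set H : Fin 4 → ℂ := fun σ => ∑ m, 2 * Complex.I * ((low k m : ℝ) : ℂ) * h m σ k with hH
  have hlow : low (-k) = -low k := by ext; simp [low]
  have hk : l + (k - l) = k := by abel
  have hHp : ∀ p : Mom, cdot H (cvec p) =
      2 * Complex.I * ∑ m, ∑ r, h m r k * (((low k m : ℝ) : ℂ) * ((low p r : ℝ) : ℂ)) := by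
    intro p
    simp only [cdot, hH, cvec, low, Finset.mul_sum, Finset.sum_mul]
    rw [Finset.sum_comm]
    refine Finset.sum_congr rfl fun a _ => Finset.sum_congr rfl fun b _ => ?_
    push_cast; ring
  have hHk : cdot H (cvec k) = 0 := by
    rw [hHp, sum_antisymm_congr (fun m r => h m r k) _ (fun _ _ => 0) hh
      (fun μ ν _ => by ring)]
    simp
  have hKk : cdot (cvec (kTheta Θ k)) (cvec k) = 0 := by
    rw [cdot_cvec, twist_right_self hΘ, Complex.ofReal_zero]
  have e1 : amp21 Θ f h j l (k - l) (-k) =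
      ∑ μ, ∑ ν, f μ ν (-k) * ∑ σ, loop21 Θ j l (k - l) (-k) μ ν σ * H σ := by
    simp only [amp21, hk, neg_neg, kernel0, hlow, Pi.neg_apply, hH]
    refine Finset.sum_congr rfl fun μ _ => Finset.sum_congr rfl fun ν _ => ?_
    simp only [mul_ite, mul_one, mul_zero, Finset.sum_ite_eq',
      Finset.mem_univ, if_true, Finset.mul_sum]
    rw [Finset.sum_comm]
    refine Finset.sum_congr rfl fun μ _ => Finset.sum_congr rfl fun ν _ => ?_
    push_cast; ring
  rw [e1]
  simp only [loop21_contract hΘ]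
  rw [sum_antisymm_congr _ _ (fun μ ν => -2 * Complex.I * ((2 * Real.pi : ℝ) : ℂ) ^ 2 *
        ((Real.sin (twist Θ k l / 2) * Real.sinc (twist Θ k l / 2) : ℝ) : ℂ) *
        (2 * (clow (cvec k) μ * clow (cvec (kTheta Θ k)) ν * cdot H (cvec l) -
          clow (cvec k) μ * clow (cvec l) ν * cdot H (cvec (kTheta Θ k))))) hf
        (fun μ ν hμν => by
          have := contracted_sub (cvec k) (cvec l) (cvec (kTheta Θ k)) H hKk hHk μ ν hμν
          linear_combination (-2 * Complex.I * ((2 * Real.pi : ℝ) : ℂ) ^ 2 *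
            ((Real.sin (twist Θ k l / 2) * Real.sinc (twist Θ k l / 2) : ℝ) : ℂ)) * this)]
  simp only [hHp, clow_cvec, residualIntegrand, sin_sq_div_eq, Finset.mul_sum,
    ← Finset.sum_sub_distrib]
  refine Finset.sum_congr rfl fun μ _ => Finset.sum_congr rfl fun ν _ =>
    Finset.sum_congr rfl fun m _ => Finset.sum_congr rfl fun r _ => ?_
  push_cast
  linear_combination (-8 * (2 * (Real.pi : ℂ)) ^ 2 * (Complex.sin (twist Θ k l / 2) *
    ((Real.sinc (twist Θ k l / 2) : ℝ) : ℂ)) * f μ ν (-k) * h m r k * low k μ * low k m *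
    (low (kTheta Θ k) ν * low l r - low (kTheta Θ k) r * low l ν)) * Complex.I_sq

lemma sum_swap_pairs (F : Fin 4 → Fin 4 → Fin 4 → Fin 4 → ℂ) :
    ∑ a, ∑ b, ∑ c, ∑ d, F a b c d = ∑ a, ∑ b, ∑ c, ∑ d, F c d a b := by
  have h : ∀ G : Fin 4 → Fin 4 → Fin 4 → Fin 4 → ℂ, ∑ a, ∑ b, ∑ c, ∑ d, G a b c d =
      ∑ p : Fin 4 × Fin 4, ∑ q : Fin 4 × Fin 4, G p.1 p.2 q.1 q.2 := fun G => by
    simp only [Fintype.sum_prod_type]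
  rw [h, h, Finset.sum_comm]

/-- Reversal of both momenta leaves all products invariant, while exchange of the test functions
reverses the bracket. This sign is the reason why Δ_R appears only in the combination Δ_R - Δ_A. -/
lemma residualIntegrand_swap (f h : Fin 4 → Fin 4 → Mom → ℂ) (k l : Mom) :
    residualIntegrand Θ h f (-k) (-l) = -residualIntegrand Θ f h k l := by
  have e1 : twist Θ (-k) (-l) = twist Θ k l := by rw [twist_neg_left, twist_neg_right, neg_neg]
  have hlow : ∀ p, low (-p) = -low p := fun p => by ext; simp [low]
  simp only [residualIntegrand, e1, hlow, kTheta_neg, Pi.neg_apply, neg_neg, Finset.mul_sum,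
    ← Finset.sum_neg_distrib]
  rw [sum_swap_pairs]
  refine Finset.sum_congr rfl fun μ _ => Finset.sum_congr rfl fun ν _ =>
    Finset.sum_congr rfl fun m _ => Finset.sum_congr rfl fun r _ => ?_
  push_cast; ring

lemma amp12_eq_amp21 (hΘ : Θᵀ = -Θ) (f h : Fin 4 → Fin 4 → Mom → ℂ) (j : Fin 3) (k l : Mom) :
    amp12 Θ f h j k (-l) (l - k) = amp21 Θ h f 2 (-l) (-k - -l) (- -k) := by
  have hk : -l + (l - k) = -k := by abel
  have hl : -k - -l = l - k := by abel
  have hloop : ∀ μ ν σ, loop12 Θ j k (-l) (l - k) μ ν σ = loop21 Θ 2 (-l) (l - k) k μ ν σ := by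
    intro μ ν σ
    have := loop12_eq_loop21 hΘ j (-l) (l - k) μ ν σ
    rwa [hk, neg_neg] at this
  simp only [amp12, amp21, hk, hl, neg_neg, hloop]
  rw [sum_swap_pairs]
  refine Finset.sum_congr rfl fun μ _ => Finset.sum_congr rfl fun ν _ =>
    Finset.sum_congr rfl fun m _ => Finset.sum_congr rfl fun r _ => ?_
  rw [mul_comm (f _ _ _)]
  congr 1
  exact Finset.sum_congr rfl fun _ _ => mul_comm _ _

lemma amp12_eq (hΘ : Θᵀ = -Θ) (f h : Fin 4 → Fin 4 → Mom → ℂ) (j : Fin 3) (k l : Mom)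
    (hf : ∀ μ ν, f μ ν (-k) = -f ν μ (-k)) (hh : ∀ μ ν, h μ ν k = -h ν μ k) :
    amp12 Θ f h j k (-l) (l - k) = -residualIntegrand Θ f h k l := by
  rw [amp12_eq_amp21 hΘ, amp21_eq hΘ h f 2 (-k) (-l) (by simpa using hh) hf,
    residualIntegrand_swap]

/-- The squares of the components k₀l_i - l₀k_i add up to -k₀²l² - l₀²k² + 2k₀l₀ k·l, which is zero
here. -/
lemma mdot_lightlike_parallel {k l : Mom} (hk : mdot k k = 0) (hl : mdot l l = 0)
    (hkl : mdot k l = 0) (hk0 : k 0 ≠ 0) : l = (l 0 / k 0) • k := by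
  rw [mdot_four] at hk hl hkl
  have h : (k 0 * l 1 - l 0 * k 1) ^ 2 + (k 0 * l 2 - l 0 * k 2) ^ 2
      + (k 0 * l 3 - l 0 * k 3) ^ 2 = 0 := by
    linear_combination -(k 0) ^ 2 * hl - (l 0) ^ 2 * hk + 2 * k 0 * l 0 * hkl
  have h1 : k 0 * l 1 - l 0 * k 1 = 0 := by
    nlinarith [sq_nonneg (k 0 * l 1 - l 0 * k 1), sq_nonneg (k 0 * l 2 - l 0 * k 2),
      sq_nonneg (k 0 * l 3 - l 0 * k 3)]
  have h2 : k 0 * l 2 - l 0 * k 2 = 0 := by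
    nlinarith [sq_nonneg (k 0 * l 1 - l 0 * k 1), sq_nonneg (k 0 * l 2 - l 0 * k 2),
      sq_nonneg (k 0 * l 3 - l 0 * k 3)]
  have h3 : k 0 * l 3 - l 0 * k 3 = 0 := by
    nlinarith [sq_nonneg (k 0 * l 1 - l 0 * k 1), sq_nonneg (k 0 * l 2 - l 0 * k 2),
      sq_nonneg (k 0 * l 3 - l 0 * k 3)]
  ext i
  fin_cases i <;> simp <;> field_simp <;> linarith

lemma eq_zero_of_lightlike {k : Mom} (hk : mdot k k = 0) (h0 : k 0 = 0) : k = 0 := by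
  rw [mdot_four, h0] at hk
  have h1 : k 1 ^ 2 = 0 := by nlinarith [sq_nonneg (k 1), sq_nonneg (k 2), sq_nonneg (k 3)]
  have h2 : k 2 ^ 2 = 0 := by nlinarith [sq_nonneg (k 1), sq_nonneg (k 2), sq_nonneg (k 3)]
  have h3 : k 3 ^ 2 = 0 := by nlinarith [sq_nonneg (k 1), sq_nonneg (k 2), sq_nonneg (k 3)]
  rw [sq_eq_zero_iff] at h1 h2 h3
  ext i
  fin_cases i <;> simp [h0, h1, h2, h3]

lemma twist_eq_zero_of_lightlike (hΘ : Θᵀ = -Θ) {k l : Mom} (hk : mdot k k = 0)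
    (hl : mdot l l = 0) (hkl : mdot k l = 0) : twist Θ k l = 0 := by
  by_cases h0 : k 0 = 0
  · rw [eq_zero_of_lightlike hk h0]
    simpa using twist_smul_left (Θ := Θ) 0 0 l
  · rw [mdot_lightlike_parallel hk hl hkl h0, twist_smul_right, twist_self hΘ, mul_zero]

lemma residualIntegrand_eq_zero (f h : Fin 4 → Fin 4 → Mom → ℂ) {k l : Mom}
    (hx : twist Θ k l = 0) : residualIntegrand Θ f h k l = 0 := by
  simp [residualIntegrand, hx]

end

section

/-! ## Integration over the unit sphere -/

/-- The unit sphere in momentum space. -/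
abbrev Sph := Metric.sphere (0 : Mom3) 1

/-- The surface measure of the unit sphere. -/
noncomputable abbrev sphereMeasure : Measure Sph := (volume : Measure Mom3).toSphere

lemma lintegral_sphere_polar {F : Mom3 → ENNReal} (hF : Measurable F) :
    ∫⁻ x, F x = ∫⁻ n : Sph, ∫⁻ r in Set.Ioi (0 : ℝ), ENNReal.ofReal (r ^ 2) *
      F (r • (n : Mom3)) ∂volume ∂sphereMeasure := by
  have h1 : ∫⁻ x, F x = ∫⁻ x : ({0}ᶜ : Set Mom3), F x ∂(Measure.comap Subtype.val volume) := by
    rw [lintegral_subtype_comap (measurableSet_singleton _).compl, restrict_compl_singleton]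
  have hmp := (volume : Measure Mom3).measurePreserving_homeomorphUnitSphereProd
  have hG : Measurable fun p : Sph × Set.Ioi (0 : ℝ) => F ((p.2 : ℝ) • (p.1 : Mom3)) := by
    apply hF.comp
    fun_prop
  have h2 : ∫⁻ x : ({0}ᶜ : Set Mom3), F x ∂(Measure.comap Subtype.val volume) =
      ∫⁻ p : Sph × Set.Ioi (0 : ℝ), F ((p.2 : ℝ) • (p.1 : Mom3))
        ∂(sphereMeasure.prod (Measure.volumeIoiPow (Module.finrank ℝ Mom3 - 1))) := by
    rw [← hmp.lintegral_comp hG]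
    refine lintegral_congr fun x => ?_
    congr 1
    have hx : ‖(x : Mom3)‖ ≠ 0 := norm_ne_zero_iff.mpr x.2
    simp [homeomorphUnitSphereProd, smul_smul, hx]
  rw [h1, h2, lintegral_prod _ hG.aemeasurable]
  refine lintegral_congr fun n => ?_
  have hfr : Module.finrank ℝ Mom3 - 1 = 2 := by simp
  rw [hfr, Measure.volumeIoiPow, lintegral_withDensity_eq_lintegral_mul _ (by fun_prop)
    (by fun_prop)]
  exact lintegral_subtype_comap (μ := (volume : Measure ℝ)) measurableSet_Ioi
    (fun r => ENNReal.ofReal (r ^ 2) * F (r • (n : Mom3)))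

/-- The surface measure is defined abstractly through polar coordinates. Comparison with cylindrical
coordinates identifies its projection to an axis. -/
lemma lintegral_cylinder {F : ℝ → ℝ → ENNReal} (hF : Measurable (Function.uncurry F)) :
    ∫⁻ x : Mom3, F ‖x‖ (x 0) = ENNReal.ofReal (2 * Real.pi) *
      ∫⁻ z : ℝ, ∫⁻ ρ in Set.Ioi (0 : ℝ), ENNReal.ofReal ρ * F (√(z ^ 2 + ρ ^ 2)) z := by
  have hF' : ∀ {α : Type} [MeasurableSpace α] {f g : α → ℝ}, Measurable f → Measurable g →
      Measurable fun x => F (f x) (g x) := fun hf hg => hF.comp (hf.prodMk hg)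
  have h1 : ∫⁻ x : Mom3, F ‖x‖ (x 0) =
      ∫⁻ y : Fin 3 → ℝ, F (√(y 0 ^ 2 + y 1 ^ 2 + y 2 ^ 2)) (y 0) := by
    rw [← (EuclideanSpace.volume_preserving_symm_measurableEquiv_toLp (Fin 3)).lintegral_comp
      (hF' (by fun_prop) (by fun_prop))]
    refine lintegral_congr fun x => ?_
    simp [EuclideanSpace.norm_eq, Fin.sum_univ_three, sq_abs]
  have h2 : ∫⁻ y : Fin 3 → ℝ, F (√(y 0 ^ 2 + y 1 ^ 2 + y 2 ^ 2)) (y 0) =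
      ∫⁻ p : ℝ × (Fin 2 → ℝ), F (√(p.1 ^ 2 + p.2 0 ^ 2 + p.2 1 ^ 2)) p.1 := by
    rw [← (volume_preserving_piFinSuccAbove (fun _ : Fin 3 => ℝ) 0).lintegral_comp
      (hF' (by fun_prop) (by fun_prop))]
    rfl
  have h3 : ∀ z : ℝ, ∫⁻ w : Fin 2 → ℝ, F (√(z ^ 2 + w 0 ^ 2 + w 1 ^ 2)) z =
      ∫⁻ p : ℝ × ℝ, F (√(z ^ 2 + p.1 ^ 2 + p.2 ^ 2)) z := by
    intro z
    rw [← (volume_preserving_finTwoArrow ℝ).lintegral_comp (hF' (by fun_prop) (by fun_prop))]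
    rfl
  have h4 : ∀ z : ℝ, ∫⁻ p : ℝ × ℝ, F (√(z ^ 2 + p.1 ^ 2 + p.2 ^ 2)) z =
      ENNReal.ofReal (2 * Real.pi) *
        ∫⁻ ρ in Set.Ioi (0 : ℝ), ENNReal.ofReal ρ * F (√(z ^ 2 + ρ ^ 2)) z := by
    intro z
    rw [← lintegral_comp_polarCoord_symm, polarCoord_target, Measure.volume_eq_prod,
      ← Measure.prod_restrict]
    have e : ∀ p : ℝ × ℝ, ENNReal.ofReal p.1 • F (√(z ^ 2 + (polarCoord.symm p).1 ^ 2 +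
        (polarCoord.symm p).2 ^ 2)) z = ENNReal.ofReal p.1 * F (√(z ^ 2 + p.1 ^ 2)) z := by
      intro p
      have e' : z ^ 2 + (p.1 * Real.cos p.2) ^ 2 + (p.1 * Real.sin p.2) ^ 2 = z ^ 2 + p.1 ^ 2 := by
        linear_combination p.1 ^ 2 * Real.sin_sq_add_cos_sq p.2
      simp only [polarCoord_symm_apply, smul_eq_mul, e']
    have hm : Measurable fun p : ℝ × ℝ => ENNReal.ofReal p.1 * F (√(z ^ 2 + p.1 ^ 2)) z :=
      Measurable.mul (by fun_prop) (hF' (by fun_prop) (by fun_prop))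
    simp only [e]
    rw [lintegral_prod _ hm.aemeasurable]
    simp only [lintegral_const, Measure.restrict_apply_univ, Real.volume_Ioo]
    rw [lintegral_mul_const' _ _ ENNReal.ofReal_ne_top, mul_comm]
    congr 2
    ring
  rw [h1, h2, Measure.volume_eq_prod, lintegral_prod _ (hF' (by fun_prop)
    (by fun_prop)).aemeasurable]
  simp only [h3, h4]
  rw [lintegral_const_mul]
  apply Measurable.lintegral_prod_right' (f := fun p : ℝ × ℝ =>
    ENNReal.ofReal p.2 * F (√(p.1 ^ 2 + p.2 ^ 2)) p.1)
  exact Measurable.mul (by fun_prop) (hF' (by fun_prop) (by fun_prop))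

/-- A reflection suffices, since only norms and inner products have to be preserved. -/
lemma exists_rotation (u : Mom3) : ∃ U : Mom3 ≃ₗᵢ[ℝ] Mom3,
    U u = ‖u‖ • EuclideanSpace.single 0 (1 : ℝ) := by
  refine ⟨(ℝ ∙ (u - ‖u‖ • EuclideanSpace.single 0 (1 : ℝ)))ᗮ.reflection, ?_⟩
  apply Submodule.reflection_sub
  simp [norm_smul]

lemma lintegral_norm_inner {F : ℝ → ℝ → ENNReal} (u : Mom3) :
    ∫⁻ x : Mom3, F ‖x‖ (inner ℝ u x) = ∫⁻ x : Mom3, F ‖x‖ (‖u‖ * x 0) := by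
  obtain ⟨U, hU⟩ := exists_rotation u
  rw [← U.measurePreserving.lintegral_comp_emb U.toHomeomorph.measurableEmbedding
    (fun x : Mom3 => F ‖x‖ (‖u‖ * x 0))]
  refine lintegral_congr fun x => ?_
  rw [U.norm_map, ← U.inner_map_map, hU, inner_smul_left, EuclideanSpace.inner_single_left]
  simp

lemma lintegral_halfplane_polar {G : ℝ → ℝ → ENNReal} (hG : Measurable (Function.uncurry G)) :
    ∫⁻ z : ℝ, ∫⁻ ρ in Set.Ioi (0 : ℝ), G z ρ =
      ∫⁻ r in Set.Ioi (0 : ℝ), ∫⁻ θ in Set.Ioo (0 : ℝ) Real.pi,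
        ENNReal.ofReal r * G (r * Real.cos θ) (r * Real.sin θ) := by
  set G' : ℝ × ℝ → ENNReal := Set.indicator {p | 0 < p.2} (Function.uncurry G) with hG'
  have hm : MeasurableSet {p : ℝ × ℝ | 0 < p.2} := measurableSet_lt measurable_const measurable_snd
  have hGm : Measurable G' := hG.indicator hm
  have h1 : ∫⁻ z : ℝ, ∫⁻ ρ in Set.Ioi (0 : ℝ), G z ρ = ∫⁻ p, G' p := by
    rw [Measure.volume_eq_prod, lintegral_prod _ hGm.aemeasurable]
    refine lintegral_congr fun z => ?_
    rw [← lintegral_indicator measurableSet_Ioi]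
    rfl
  have hpm : Measurable (polarCoord.symm : ℝ × ℝ → ℝ × ℝ) := by
    have : (polarCoord.symm : ℝ × ℝ → ℝ × ℝ) =
        fun p => (p.1 * Real.cos p.2, p.1 * Real.sin p.2) := by
      ext p <;> simp [polarCoord_symm_apply]
    rw [this]
    fun_prop
  have hm' : Measurable fun p : ℝ × ℝ => ENNReal.ofReal p.1 • G' (polarCoord.symm p) :=
    Measurable.mul (by fun_prop) (hGm.comp hpm)
  rw [h1, ← lintegral_comp_polarCoord_symm, polarCoord_target, Measure.volume_eq_prod,
      ← Measure.prod_restrict, lintegral_prod _ hm'.aemeasurable]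
  refine setLIntegral_congr_fun measurableSet_Ioi fun r hr => ?_
  have hr : 0 < r := hr
  simp only
  rw [← lintegral_indicator measurableSet_Ioo, ← lintegral_indicator measurableSet_Ioo]
  refine lintegral_congr fun θ => ?_
  simp only [Set.indicator_apply, polarCoord_symm_apply, smul_eq_mul, hG', Set.mem_ofPred_eq,
    Function.uncurry, Set.mem_Ioo]
  by_cases h1 : 0 < θ ∧ θ < Real.pi
  · rw [if_pos ⟨by linarith [Real.pi_pos, h1.1], h1.2⟩, if_pos h1,
      if_pos (mul_pos hr (Real.sin_pos_of_pos_of_lt_pi h1.1 h1.2))]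
  · rw [if_neg h1]
    split_ifs with h2 h3
    · exfalso
      have h4 := (mul_pos_iff_of_pos_left hr).mp h3
      have : θ ≤ 0 := by
        by_contra h5; exact h1 ⟨not_le.mp h5, h2.2⟩
      exact absurd h4 (not_lt.mpr (Real.sin_nonpos_of_nonpos_of_neg_pi_le this h2.1.le))
    · simp
    · rfl

lemma lintegral_sin_cos (φ : ℝ → ENNReal) :
    ∫⁻ θ in Set.Ioo (0 : ℝ) Real.pi, ENNReal.ofReal (Real.sin θ) * φ (Real.cos θ) =
      ∫⁻ z in Set.Ioo (-1 : ℝ) 1, φ z := by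
  have himg : Real.cos '' Set.Ioo 0 Real.pi = Set.Ioo (-1 : ℝ) 1 := by
    ext z
    constructor
    · rintro ⟨θ, hθ, rfl⟩
      refine ⟨?_, ?_⟩
      · have := Real.strictAntiOn_cos ⟨hθ.1.le, hθ.2.le⟩ ⟨Real.pi_pos.le, le_refl _⟩ hθ.2
        simpa using this
      · have := Real.strictAntiOn_cos ⟨le_refl _, Real.pi_pos.le⟩ ⟨hθ.1.le, hθ.2.le⟩ hθ.1
        simpa using this
    · intro hz
      refine ⟨Real.arccos z, ⟨Real.arccos_pos.mpr hz.2, ?_⟩, Real.cos_arccos hz.1.le hz.2.le⟩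
      refine lt_of_le_of_ne (Real.arccos_le_pi z) fun h => ?_
      have := Real.arccos_eq_pi.mp h
      linarith [hz.1]
  rw [← himg, lintegral_image_eq_lintegral_abs_deriv_mul measurableSet_Ioo
    (fun x _ => (Real.hasDerivAt_cos x).hasDerivWithinAt)
    (Real.strictAntiOn_cos.injOn.mono Set.Ioo_subset_Icc_self)]
  refine setLIntegral_congr_fun measurableSet_Ioo fun θ hθ => ?_
  simp only [abs_neg]
  rw [abs_of_nonneg (Real.sin_nonneg_of_mem_Icc ⟨hθ.1.le, hθ.2.le⟩)]

/-- Archimedes' theorem: the projection of the sphere to an axis is uniformly distributed. -/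
lemma lintegral_sphere_inner {φ : ℝ → ENNReal} (hφ : Measurable φ) (u : Mom3) :
    ∫⁻ n : Sph, φ (inner ℝ u (n : Mom3)) ∂sphereMeasure =
      ENNReal.ofReal (2 * Real.pi) * ∫⁻ z in Set.Ioo (-1 : ℝ) 1, φ (‖u‖ * z) := by
  -- A radial test function: the same integral over the unit ball is evaluated in spherical and in
  -- cylindrical coordinates. The common radial factor A = 1/3 is neither 0 nor ∞ and may be
  -- cancelled.
  set g : ℝ → ENNReal := (Set.Ioo (0 : ℝ) 1).indicator 1 with hg
  have hgm : Measurable g := measurable_one.indicator measurableSet_Ioo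
  set A : ENNReal := ∫⁻ r in Set.Ioi (0 : ℝ), ENNReal.ofReal (r ^ 2) * g r with hA
  have hA1 : A = ENNReal.ofReal (1 / 3) := by
    have e : A = ∫⁻ r in Set.Ioo (0 : ℝ) 1, ENNReal.ofReal (r ^ 2) := by
      rw [hA, ← lintegral_indicator measurableSet_Ioi, ← lintegral_indicator measurableSet_Ioo]
      refine lintegral_congr fun r => ?_
      simp only [hg, Set.indicator_apply, Set.mem_Ioi, Set.mem_Ioo, Pi.one_apply]
      by_cases h0 : 0 < r <;> by_cases h1 : r < 1 <;> simp [h0, h1]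
    rw [e, restrict_Ioo_eq_restrict_Ioc, ← ofReal_integral_eq_lintegral_ofReal
      (intervalIntegral.intervalIntegrable_pow 2).1
      (Filter.Eventually.of_forall fun r => sq_nonneg r),
      ← intervalIntegral.integral_of_le zero_le_one, integral_pow]
    norm_num
  have h1 : ∫⁻ x : Mom3, g ‖x‖ * φ (inner ℝ u x / ‖x‖) =
      (∫⁻ n : Sph, φ (inner ℝ u (n : Mom3)) ∂sphereMeasure) * A := by
    rw [lintegral_sphere_polar (by fun_prop)]
    rw [← lintegral_mul_const _ (by fun_prop)]
    refine lintegral_congr fun n => ?_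
    rw [hA, ← lintegral_const_mul _ (by fun_prop)]
    refine setLIntegral_congr_fun measurableSet_Ioi fun r hr => ?_
    have hr : 0 < r := hr
    have hn : ‖(n : Mom3)‖ = 1 := by simp
    simp only [norm_smul, hn, mul_one, Real.norm_eq_abs, abs_of_pos hr, inner_smul_right]
    rw [mul_div_cancel_left₀ _ hr.ne']
    ring
  have h2 : ∫⁻ x : Mom3, g ‖x‖ * φ (inner ℝ u x / ‖x‖) =
      ENNReal.ofReal (2 * Real.pi) * (∫⁻ z in Set.Ioo (-1 : ℝ) 1, φ (‖u‖ * z)) * A := by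
    rw [lintegral_norm_inner (F := fun r w => g r * φ (w / r)) u,
      lintegral_cylinder (F := fun r w => g r * φ (‖u‖ * w / r)) (by fun_prop),
      lintegral_halfplane_polar (by fun_prop), mul_assoc]
    congr 1
    rw [← lintegral_sin_cos (fun z => φ (‖u‖ * z)), mul_comm, hA,
      ← lintegral_mul_const _ (by fun_prop)]
    refine setLIntegral_congr_fun measurableSet_Ioi fun r hr => ?_
    have hr : 0 < r := hr
    rw [← lintegral_const_mul _ (by fun_prop)]
    refine setLIntegral_congr_fun measurableSet_Ioo fun θ hθ => ?_
    have hs : √((r * Real.cos θ) ^ 2 + (r * Real.sin θ) ^ 2) = r := by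
      rw [show (r * Real.cos θ) ^ 2 + (r * Real.sin θ) ^ 2 = r ^ 2 by
        linear_combination r ^ 2 * Real.sin_sq_add_cos_sq θ, Real.sqrt_sq hr.le]
    simp only [hs]
    rw [show ‖u‖ * (r * Real.cos θ) / r = ‖u‖ * Real.cos θ by field_simp,
      ENNReal.ofReal_mul hr.le, pow_two, ENNReal.ofReal_mul hr.le]
    ring
  rw [h1] at h2
  have hA0 : A ≠ 0 := by rw [hA1]; simp
  have hAt : A ≠ ⊤ := by rw [hA1]; simp
  exact (ENNReal.mul_left_inj hA0 hAt).mp h2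

end

/-! ### Integrals over the rays of the light cone -/

section

/-- As an equality of measures this passes to Bochner integrals without any integrability condition.
-/
lemma map_inner_sphere (u : Mom3) :
    Measure.map (fun n : Sph => inner ℝ u (n : Mom3)) sphereMeasure =
      ENNReal.ofReal (2 * Real.pi) •
        Measure.map (fun z => ‖u‖ * z) (volume.restrict (Set.Ioo (-1 : ℝ) 1)) := by
  refine Measure.ext_of_lintegral _ fun φ hφ => ?_
  rw [lintegral_map hφ (by fun_prop), lintegral_smul_measure, lintegral_map hφ (by fun_prop),
    lintegral_sphere_inner hφ, smul_eq_mul]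

lemma integral_sphere_inner {φ : ℝ → ℝ} (hφ : Measurable φ) (u : Mom3) :
    ∫ n : Sph, φ (inner ℝ u (n : Mom3)) ∂sphereMeasure =
      2 * Real.pi * ∫ z in (-1 : ℝ)..1, φ (‖u‖ * z) := by
  have h1 : ∫ n : Sph, φ (inner ℝ u (n : Mom3)) ∂sphereMeasure =
      ∫ z, φ z ∂(Measure.map (fun n : Sph => inner ℝ u (n : Mom3)) sphereMeasure) := by
    rw [integral_map (by fun_prop) hφ.aestronglyMeasurable]
  rw [h1, map_inner_sphere, integral_smul_measure, integral_map (by fun_prop)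
    hφ.aestronglyMeasurable, ENNReal.toReal_ofReal (by positivity), smul_eq_mul,
    intervalIntegral.integral_of_le (by norm_num), integral_Ioc_eq_integral_Ioo]

/-- Spatial part of a momentum. -/
noncomputable def spatial (k : Mom) : Mom3 := !₂[k 1, k 2, k 3]

/-- The lightlike vector of energy one in the direction `n`. -/
noncomputable def ray (n : Mom3) : Mom := ![1, n 0, n 1, n 2]

lemma inner_spatial (k : Mom) (n : Mom3) :
    inner ℝ (spatial k) n = k 1 * n 0 + k 2 * n 1 + k 3 * n 2 := by
  simp [spatial, PiLp.inner_apply, Fin.sum_univ_three]; ring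

lemma mdot_ray (k : Mom) (n : Mom3) : mdot k (ray n) = k 0 - inner ℝ (spatial k) n := by
  rw [inner_spatial, mdot_four]; simp [ray]; ring

lemma norm_sq_mom3 (n : Mom3) : ‖n‖ ^ 2 = n 0 ^ 2 + n 1 ^ 2 + n 2 ^ 2 := by
  simp [EuclideanSpace.norm_sq_eq, Fin.sum_univ_three]

lemma norm_spatial_sq (k : Mom) : ‖spatial k‖ ^ 2 = k 0 ^ 2 - mdot k k := by
  rw [norm_sq_mom3, mdot_four]; simp [spatial]; ring

lemma mdot_ray_self (n : Sph) : mdot (ray (n : Mom3)) (ray (n : Mom3)) = 0 := by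
  have h : ‖(n : Mom3)‖ ^ 2 = 1 := by simp
  rw [norm_sq_mom3] at h
  rw [mdot_four]; simp [ray]; linarith

lemma abs_inner_le (u : Mom3) (n : Sph) : |inner ℝ u (n : Mom3)| ≤ ‖u‖ := by
  simpa using abs_real_inner_le_norm u (n : Mom3)

lemma norm_spatial_lt {k : Mom} (hk : 0 < mdot k k) (h0 : 0 < k 0) : ‖spatial k‖ < k 0 := by
  refine lt_of_pow_lt_pow_left₀ 2 h0.le ?_
  rw [norm_spatial_sq]; linarith

lemma mdot_ray_ge {k : Mom} (n : Sph) : k 0 - ‖spatial k‖ ≤ mdot k (ray n) := by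
  rw [mdot_ray]; linarith [le_of_abs_le (abs_inner_le (spatial k) n)]

lemma mdot_ray_pos {k : Mom} (hk : 0 < mdot k k) (h0 : 0 < k 0) (n : Sph) :
    0 < mdot k (ray n) :=
  lt_of_lt_of_le (sub_pos.mpr (norm_spatial_lt hk h0)) (mdot_ray_ge n)

lemma abs_mdot_ray_le (k : Mom) (n : Sph) : |mdot k (ray n)| ≤ |k 0| + ‖spatial k‖ := by
  rw [mdot_ray]; exact (abs_sub _ _).trans (by linarith [abs_inner_le (spatial k) n])

lemma continuous_mdot_ray (k : Mom) : Continuous fun n : Sph => mdot k (ray n) := by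
  simp only [mdot_ray]; fun_prop

lemma integral_inv_sq {A b : ℝ} (hb : |b| < A) :
    ∫ z in (-1 : ℝ)..1, ((A - b * z) ^ 2)⁻¹ = 2 / (A ^ 2 - b ^ 2) := by
  have hA : 0 < A := lt_of_le_of_lt (abs_nonneg b) hb
  have hb' := abs_lt.mp hb
  have hpos : ∀ z ∈ Set.uIcc (-1 : ℝ) 1, 0 < A - b * z := by
    intro z hz
    rw [Set.uIcc_of_le (by norm_num)] at hz
    have : |b * z| ≤ |b| := by
      rw [abs_mul]; exact mul_le_of_le_one_right (abs_nonneg _) (abs_le.mpr ⟨hz.1, hz.2⟩)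
    linarith [le_of_abs_le this]
  have hd : ∀ z ∈ Set.uIcc (-1 : ℝ) 1,
      -- This primitive, unlike 1/(b(A - bz)), also covers b = 0.
      HasDerivAt (fun z => z / (A - b * z) / A) (((A - b * z) ^ 2)⁻¹) z := by
    intro z hz
    have h := hpos z hz
    have h1 : HasDerivAt (fun z => A - b * z) (-b) z := by
      simpa using ((hasDerivAt_id z).const_mul b).const_sub A
    convert ((hasDerivAt_id z).div h1 h.ne').div_const A using 1
    all_goals first | rfl | (simp only [id]; field_simp; ring)
  rw [intervalIntegral.integral_eq_sub_of_hasDerivAt hd]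
  · have h1 : A - b ≠ 0 := by linarith
    have h2 : A + b ≠ 0 := by linarith
    have h3 : A ^ 2 - b ^ 2 ≠ 0 := by
      rw [show A ^ 2 - b ^ 2 = (A - b) * (A + b) by ring]; exact mul_ne_zero h1 h2
    simp only [mul_one, mul_neg, sub_neg_eq_add]
    field_simp
    ring
  · refine ContinuousOn.intervalIntegrable fun z hz => ContinuousAt.continuousWithinAt ?_
    exact ContinuousAt.inv₀ (by fun_prop) (pow_ne_zero 2 (hpos z hz).ne')

lemma integral_mdot_ray_inv_sq {k : Mom} (hk : 0 < mdot k k) (h0 : 0 < k 0) :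
    ∫ n : Sph, (mdot k (ray n) ^ 2)⁻¹ ∂sphereMeasure = 4 * Real.pi / mdot k k := by
  simp only [mdot_ray]
  rw [integral_sphere_inner (φ := fun z => ((k 0 - z) ^ 2)⁻¹) (by fun_prop), integral_inv_sq
    (by rw [abs_norm]; exact norm_spatial_lt hk h0), norm_spatial_sq, sub_sub_cancel]
  ring

/-- A generating function argument. For small t the vector k + tκ is timelike with square m² - t²a²,
so `integral_mdot_ray_inv_sq` applies to it. Expanding under the integral gives the moments,
expanding 1/(m² - t²a²) into two geometric series gives their values, and the coefficients of a
power series are unique. -/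
lemma sphere_moments {k κ : Mom} {m a : ℝ} (hm : 0 < m) (hk : mdot k k = m ^ 2) (h0 : 0 < k 0)
    (hκ : mdot k κ = 0) (ha : mdot κ κ = -a ^ 2) (j : ℕ) :
    (j + 1) * (-1) ^ j * ∫ n : Sph, mdot κ (ray n) ^ j / mdot k (ray n) ^ (j + 2) ∂sphereMeasure =
      2 * Real.pi / m ^ 2 * ((a / m) ^ j + (-(a / m)) ^ j) := by
  have hkp : 0 < mdot k k := by rw [hk]; positivity
  set q0 := k 0 - ‖spatial k‖ with hq0
  have hq0pos : 0 < q0 := sub_pos.mpr (norm_spatial_lt hkp h0)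
  set C := |κ 0| + ‖spatial κ‖ + 1 with hC
  have hCpos : 0 < C := by positivity
  have hq : ∀ n : Sph, q0 ≤ mdot k (ray n) := fun n => mdot_ray_ge n
  have hc : ∀ n : Sph, |mdot κ (ray n)| ≤ C := fun n =>
    (abs_mdot_ray_le κ n).trans (by simp [hC])
  set M : ℕ → ℝ := fun j => ∫ n : Sph, mdot κ (ray n) ^ j / mdot k (ray n) ^ (j + 2) ∂sphereMeasure
    with hM
  have hcont : ∀ j : ℕ, Continuous fun n : Sph => mdot κ (ray n) ^ j / mdot k (ray n) ^ (j + 2) :=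
    fun j => ((continuous_mdot_ray κ).pow j).div ((continuous_mdot_ray k).pow _)
      fun n => pow_ne_zero _ (mdot_ray_pos hkp h0 n).ne'
  -- The first condition bounds the ratio of the expansion by 1/2 on all rays, the second keeps k +
  -- tκ timelike and the geometric series convergent, the third keeps the vector in the forward
  -- cone.
  have hev : ∀ᶠ t : ℝ in 𝓝 0, |t| * C < q0 / 2 ∧ |t| * |a| < m / 2 ∧ 0 < k 0 + t * κ 0 := by
    have c1 : Continuous fun t : ℝ => |t| * C := by fun_prop
    have c2 : Continuous fun t : ℝ => |t| * |a| := by fun_prop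
    have c3 : Continuous fun t : ℝ => k 0 + t * κ 0 := by fun_prop
    refine (c1.tendsto 0 |>.eventually_lt_const (by simpa using hq0pos)).and
      ((c2.tendsto 0 |>.eventually_lt_const (by simpa using hm)).and
        (c3.tendsto 0 |>.eventually_const_lt (by simpa using h0)))
  have hs1 : ∀ᶠ t : ℝ in 𝓝 0, HasSum (fun j : ℕ => t ^ j • ((j + 1) * (-1) ^ j * M j))
      (4 * Real.pi / (m ^ 2 - t ^ 2 * a ^ 2)) := by
    filter_upwards [hev] with t ht
    have hmd : mdot (k + t • κ) (k + t • κ) = m ^ 2 - t ^ 2 * a ^ 2 := by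
      rw [mdot_add_left, mdot_add_right, mdot_add_right, mdot_smul_left, mdot_smul_left,
        mdot_smul_right, mdot_smul_right, hk, mdot_comm κ k, hκ, ha]; ring
    have hpos : 0 < mdot (k + t • κ) (k + t • κ) := by
      rw [hmd, ← sq_abs t, ← sq_abs a]
      have := ht.2.1
      have h2 : 0 ≤ |t| * |a| := by positivity
      nlinarith
    have hI := integral_mdot_ray_inv_sq hpos (by simpa using ht.2.2)
    rw [hmd] at hI
    rw [← hI]
    have hx : ∀ n : Sph, ‖-(t * mdot κ (ray n) / mdot k (ray n))‖ ≤ 1 / 2 := by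
      intro n
      have hqp := mdot_ray_pos hkp h0 n
      rw [norm_neg, Real.norm_eq_abs, abs_div, abs_mul, abs_of_pos hqp, div_le_iff₀ hqp]
      nlinarith [hq n, hc n, abs_nonneg t, mul_le_mul_of_nonneg_left (hc n) (abs_nonneg t)]
    have hterm : ∀ n : Sph, HasSum (fun j : ℕ => t ^ j • ((j + 1) * (-1) ^ j *
        (mdot κ (ray n) ^ j / mdot k (ray n) ^ (j + 2)))) ((mdot (k + t • κ) (ray n) ^ 2)⁻¹) := by
      intro n
      have hqp := mdot_ray_pos hkp h0 n
      have hlt : ‖-(t * mdot κ (ray n) / mdot k (ray n))‖ < 1 := lt_of_le_of_lt (hx n) (by norm_num)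
      -- This is Σ (j+1) xʲ = (1-x)⁻².
      have := (hasSum_choose_mul_geometric_of_norm_lt_one 1 hlt).mul_left ((mdot k (ray n) ^ 2)⁻¹)
      convert this using 1
      · rfl
      · ext j
        simp only [Nat.choose_one_right, smul_eq_mul]
        push_cast
        rw [← neg_div, div_pow, neg_mul_eq_neg_mul, mul_pow, neg_pow t]
        field_simp
        ring
      · rw [mdot_add_left, mdot_smul_left]
        have h1 := (abs_lt.mp hlt)
        have hne : 1 - -(t * mdot κ (ray n) / mdot k (ray n)) ≠ 0 := by linarith [h1.2]
        have e : mdot k (ray n) + t * mdot κ (ray n) = mdot k (ray n) *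
            (1 - -(t * mdot κ (ray n) / mdot k (ray n))) := by field_simp; ring
        rw [e, mul_pow, mul_inv]
        simp
    have hint : ∀ j : ℕ, Integrable (fun n : Sph => t ^ j • ((j + 1) * (-1) ^ j *
        (mdot κ (ray n) ^ j / mdot k (ray n) ^ (j + 2)))) sphereMeasure := fun j =>
      Continuous.integrable_of_hasCompactSupport (((hcont j).const_mul _).const_smul (t ^ j))
        (HasCompactSupport.of_compactSpace _)
    have hbd : ∀ (j : ℕ) (n : Sph), ‖t ^ j • ((j + 1) * (-1) ^ j *
        (mdot κ (ray n) ^ j / mdot k (ray n) ^ (j + 2)))‖ ≤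
          (q0 ^ 2)⁻¹ * ((j + 1) * (1 / 2) ^ j) := by
      intro j n
      have hqp := mdot_ray_pos hkp h0 n
      have e : t ^ j • (((j : ℝ) + 1) * (-1) ^ j *
          (mdot κ (ray n) ^ j / mdot k (ray n) ^ (j + 2))) = (mdot k (ray n) ^ 2)⁻¹ * ((j + 1) *
            (-(t * mdot κ (ray n) / mdot k (ray n))) ^ j) := by
        rw [← neg_div, div_pow, neg_mul_eq_neg_mul, mul_pow, neg_pow t, smul_eq_mul]
        field_simp
        ring
      rw [e, norm_mul, norm_mul, norm_pow]
      have h1 : ‖(mdot k (ray n) ^ 2)⁻¹‖ ≤ (q0 ^ 2)⁻¹ := by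
        rw [norm_inv, norm_pow, Real.norm_eq_abs, abs_of_pos hqp]
        have := hq n
        gcongr
      have h2 : ‖(j : ℝ) + 1‖ = j + 1 := by rw [Real.norm_eq_abs, abs_of_pos (by positivity)]
      rw [h2]
      have := hx n
      gcongr
    have hsum := hasSum_integral_of_summable_integral_norm hint (by
      refine Summable.of_nonneg_of_le (fun j => integral_nonneg fun n => norm_nonneg _)
        (fun j => ?_) (f := fun j : ℕ => sphereMeasure.real Set.univ *
          ((q0 ^ 2)⁻¹ * ((j + 1) * (1 / 2) ^ j))) ?_
      · calc ∫ n : Sph, ‖t ^ j • (((j : ℝ) + 1) * (-1) ^ j *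
              (mdot κ (ray n) ^ j / mdot k (ray n) ^ (j + 2)))‖ ∂sphereMeasure
            ≤ ∫ n : Sph, (q0 ^ 2)⁻¹ * ((j + 1) * (1 / 2) ^ j) ∂sphereMeasure :=
              integral_mono (hint j).norm (integrable_const _) (hbd j)
          _ = _ := by rw [integral_const, smul_eq_mul]
      · refine Summable.mul_left _ (Summable.mul_left _ ?_)
        have := summable_choose_mul_geometric_of_norm_lt_one (R := ℝ) 1 (r := 1 / 2) (by norm_num)
        simpa using this)
    have e2 : ∫ n : Sph, (mdot (k + t • κ) (ray n) ^ 2)⁻¹ ∂sphereMeasure =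
        ∫ n : Sph, ∑' j : ℕ, t ^ j • (((j : ℝ) + 1) * (-1) ^ j *
          (mdot κ (ray n) ^ j / mdot k (ray n) ^ (j + 2))) ∂sphereMeasure :=
      integral_congr_ae (Eventually.of_forall fun n => ((hterm n).tsum_eq).symm)
    rw [e2]
    convert hsum using 2 with j
    · rfl
    rw [integral_smul, integral_const_mul]
  have hs2 : ∀ᶠ t : ℝ in 𝓝 0, HasSum (fun j : ℕ => t ^ j •
      (2 * Real.pi / m ^ 2 * ((a / m) ^ j + (-(a / m)) ^ j)))
      (4 * Real.pi / (m ^ 2 - t ^ 2 * a ^ 2)) := by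
    filter_upwards [hev] with t ht
    have hx : ‖t * (a / m)‖ < 1 := by
      rw [Real.norm_eq_abs, abs_mul, abs_div, abs_of_pos hm, ← mul_div_assoc, div_lt_one hm]
      linarith [ht.2.1]
    have hx' : ‖-(t * (a / m))‖ < 1 := by rwa [norm_neg]
    have := ((hasSum_geometric_of_norm_lt_one hx).add
      (hasSum_geometric_of_norm_lt_one hx')).mul_left (2 * Real.pi / m ^ 2)
    convert this using 1
    · rfl
    · ext j
      rw [smul_eq_mul, neg_pow (a / m), neg_pow (t * (a / m)), mul_pow]; ring
    · have h1 := abs_lt.mp hx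
      have hn1 : 1 - t * (a / m) ≠ 0 := by linarith [h1.2]
      have hn2 : 1 - -(t * (a / m)) ≠ 0 := by linarith [h1.1]
      have e : m ^ 2 - t ^ 2 * a ^ 2 = m ^ 2 * ((1 - t * (a / m)) * (1 - -(t * (a / m)))) := by
        field_simp; ring
      rw [e]
      generalize t * (a / m) = x at hn1 hn2 ⊢
      field_simp
      ring
  have hp1 : HasFPowerSeriesAt (fun t : ℝ => 4 * Real.pi / (m ^ 2 - t ^ 2 * a ^ 2))
      (FormalMultilinearSeries.ofScalars ℝ fun j : ℕ => ((j : ℝ) + 1) * (-1) ^ j * M j) 0 := by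
    rw [hasFPowerSeriesAt_iff]
    simpa [FormalMultilinearSeries.coeff_ofScalars] using hs1
  have hp2 : HasFPowerSeriesAt (fun t : ℝ => 4 * Real.pi / (m ^ 2 - t ^ 2 * a ^ 2))
      (FormalMultilinearSeries.ofScalars ℝ fun j : ℕ =>
        2 * Real.pi / m ^ 2 * ((a / m) ^ j + (-(a / m)) ^ j)) 0 := by
    rw [hasFPowerSeriesAt_iff]
    simpa [FormalMultilinearSeries.coeff_ofScalars] using hs2
  have := congrArg (fun p => p.coeff j) (hp1.eq_formalMultilinearSeries hp2)
  simpa [FormalMultilinearSeries.coeff_ofScalars] using this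

lemma hasSum_sinc (x : ℝ) :
    HasSum (fun n : ℕ => (-1) ^ n * x ^ (2 * n) / ((2 * n + 1).factorial : ℝ)) (Real.sinc x) := by
  rcases eq_or_ne x 0 with rfl | hx
  · rw [Real.sinc_zero]
    have := hasSum_single (f := fun n : ℕ => (-1) ^ n * (0 : ℝ) ^ (2 * n) /
      ((2 * n + 1).factorial : ℝ)) 0 (fun n hn => by simp [hn])
    simpa using this
  · rw [Real.sinc_of_ne_zero hx]
    convert (Real.hasSum_sin x).div_const x using 1
    · rfl
    · ext n
      field_simp
      ring

/-- In the expansion of the cosine, the moment of order 2n contributes an extra 1/(2n+1), which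
turns (2n)! into (2n+1)! and the cosine into a sinc. -/
lemma integral_cos_ray {k κ : Mom} {m a : ℝ} (hm : 0 < m) (hk : mdot k k = m ^ 2) (h0 : 0 < k 0)
    (hκ : mdot k κ = 0) (ha : mdot κ κ = -a ^ 2) (y : ℝ) :
    ∫ n : Sph, Real.cos (y * mdot κ (ray n) / mdot k (ray n)) / mdot k (ray n) ^ 2
      ∂sphereMeasure = 4 * Real.pi / m ^ 2 * Real.sinc (y * a / m) := by
  have hkp : 0 < mdot k k := by rw [hk]; positivity
  set q0 := k 0 - ‖spatial k‖ with hq0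
  have hq0pos : 0 < q0 := sub_pos.mpr (norm_spatial_lt hkp h0)
  set C := |κ 0| + ‖spatial κ‖ with hC
  set F : ℕ → Sph → ℝ := fun n v => (mdot k (ray v) ^ 2)⁻¹ *
    ((-1) ^ n * (y * mdot κ (ray v) / mdot k (ray v)) ^ (2 * n) / ((2 * n).factorial : ℝ)) with hF
  have hq : Continuous fun n : Sph => (mdot k (ray n))⁻¹ :=
    (continuous_mdot_ray k).inv₀ fun n => (mdot_ray_pos hkp h0 n).ne'
  have hFc : ∀ n, Continuous (F n) := by
    intro n
    have h1 := continuous_mdot_ray κ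
    simp only [hF, ← inv_pow, div_eq_mul_inv]
    fun_prop
  have hint : ∀ n, Integrable (F n) sphereMeasure := fun n =>
    (hFc n).integrable_of_hasCompactSupport (HasCompactSupport.of_compactSpace _)
  have hbd : ∀ n v, ‖F n v‖ ≤ (q0 ^ 2)⁻¹ * ((|y| * C / q0) ^ (2 * n) / ((2 * n).factorial : ℝ)) := by
    intro n v
    have hqp := mdot_ray_pos hkp h0 v
    have h2 : q0 ≤ mdot k (ray v) := mdot_ray_ge v
    have h3 := abs_mdot_ray_le κ v
    simp only [hF, norm_mul, norm_div, norm_pow, norm_inv, norm_neg, norm_one, one_pow, one_mul,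
      Real.norm_eq_abs, Nat.abs_cast, abs_of_pos hqp]
    gcongr
  have hsm : Summable fun n : ℕ => (|y| * C / q0) ^ (2 * n) / ((2 * n).factorial : ℝ) :=
    (Real.hasSum_cosh _).summable
  have hsum := hasSum_integral_of_summable_integral_norm hint (by
    refine Summable.of_nonneg_of_le (fun j => integral_nonneg fun n => norm_nonneg _)
      (fun j => ?_) (((hsm.mul_left (q0 ^ 2)⁻¹)).mul_left (sphereMeasure.real Set.univ))
    calc ∫ v : Sph, ‖F j v‖ ∂sphereMeasure
        ≤ ∫ v : Sph, (q0 ^ 2)⁻¹ * ((|y| * C / q0) ^ (2 * j) / ((2 * j).factorial : ℝ))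
            ∂sphereMeasure := integral_mono (hint j).norm (integrable_const _) (hbd j)
      _ = _ := by rw [integral_const, smul_eq_mul])
  have e1 : ∀ v : Sph, ∑' n, F n v =
      Real.cos (y * mdot κ (ray v) / mdot k (ray v)) / mdot k (ray v) ^ 2 := by
    intro v
    rw [((Real.hasSum_cos _).mul_left _).tsum_eq]
    exact (div_eq_inv_mul _ _).symm
  have e2 : ∀ n : ℕ, ∫ v, F n v ∂sphereMeasure = 4 * Real.pi / m ^ 2 *
      ((-1) ^ n * (y * a / m) ^ (2 * n) / ((2 * n + 1).factorial : ℝ)) := by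
    intro n
    have h := sphere_moments hm hk h0 hκ ha (2 * n)
    rw [neg_pow (a / m), pow_mul (-1 : ℝ) 2 n] at h
    have e : ∀ v, F n v = ((-1) ^ n * y ^ (2 * n) / ((2 * n).factorial : ℝ)) *
        (mdot κ (ray v) ^ (2 * n) / mdot k (ray v) ^ (2 * n + 2)) := by
      intro v
      have hqp := (mdot_ray_pos hkp h0 v).ne'
      simp only [hF, div_pow, mul_pow]
      field_simp
      try ring
    simp only [e, integral_const_mul]
    set I := ∫ v : Sph, mdot κ (ray v) ^ (2 * n) / mdot k (ray v) ^ (2 * n + 2) ∂sphereMeasure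
    have hI : I = 2 * Real.pi / m ^ 2 * (2 * (a / m) ^ (2 * n)) / (2 * n + 1) := by
      rw [eq_div_iff (by positivity)]
      push_cast at h
      simp only [even_two, Even.neg_pow, one_pow, one_mul, mul_one] at h
      linarith
    rw [hI, Nat.factorial_succ]
    push_cast
    simp only [div_pow, mul_pow]
    field_simp
    try ring
  simp only [e1, e2] at hsum
  exact (hsum.unique ((hasSum_sinc _).mul_left _))

end

/-! ### The light cone measure in polar coordinates -/

section

lemma onShell_zero_smul {r : ℝ} (hr : 0 ≤ r) (n : Sph) : onShell 0 (r • (n : Mom3)) = r • ray n := by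
  have h : ‖r • (n : Mom3)‖ = r := by simp [norm_smul, abs_of_nonneg hr]
  ext i
  fin_cases i <;> simp [onShell, ray, Real.sqrt_sq_eq_abs, norm_smul, abs_of_nonneg hr]

lemma continuous_onShell_uncurry : Continuous fun p : ℝ × Mom3 => onShell p.1 p.2 := by
  refine continuous_pi fun i => ?_
  fin_cases i <;> simp [onShell] <;> fun_prop

lemma continuous_onShell (s : ℝ) : Continuous (onShell s) :=
  continuous_onShell_uncurry.comp (by fun_prop : Continuous fun x : Mom3 => (s, x))

lemma continuous_ray : Continuous ray := by
  refine continuous_pi fun i => ?_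
  fin_cases i <;> simp [ray] <;> fun_prop

lemma lintegral_deltaPlus (s : ℝ) {F : Mom → ENNReal} (hF : Measurable F) :
    ∫⁻ k, F k ∂(deltaPlus s) = ∫⁻ x : Mom3,
      ENNReal.ofReal ((2 * Real.pi)⁻¹ / (2 * √(s + ‖x‖ ^ 2))) * F (onShell s x) := by
  rw [deltaPlus, lintegral_map hF (continuous_onShell s).measurable]
  exact lintegral_withDensity_eq_lintegral_mul _ (by fun_prop)
    (hF.comp (continuous_onShell s).measurable)

/-- The radial density r/(4π) is the Jacobian r² times the invariant density 1/(4πr). -/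
lemma lintegral_deltaPlus_zero {F : Mom → ENNReal} (hF : Measurable F) :
    ∫⁻ k, F k ∂(deltaPlus 0) = ∫⁻ n : Sph, ∫⁻ r in Set.Ioi (0 : ℝ),
      ENNReal.ofReal ((4 * Real.pi)⁻¹ * r) * F (r • ray n) ∂volume ∂sphereMeasure := by
  rw [lintegral_deltaPlus 0 hF, lintegral_sphere_polar (by
    exact Measurable.mul (by fun_prop) (hF.comp (continuous_onShell 0).measurable))]
  refine lintegral_congr fun n => setLIntegral_congr_fun measurableSet_Ioi fun r hr => ?_
  have hr' : 0 < r := hr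
  have h : ‖r • (n : Mom3)‖ = r := by simp [norm_smul, abs_of_pos hr']
  rw [onShell_zero_smul hr'.le, h, ← mul_assoc, ← ENNReal.ofReal_mul (by positivity), zero_add,
    Real.sqrt_sq hr'.le]
  congr 2
  field_simp
  ring

lemma lintegral_Ioi_scale {c : ℝ} (hc : 0 < c) (F : ℝ → ENNReal) :
    ∫⁻ r in Set.Ioi (0 : ℝ), F r = ENNReal.ofReal c * ∫⁻ r in Set.Ioi (0 : ℝ), F (r * c) := by
  have himg : (fun r : ℝ => r * c) '' Set.Ioi 0 = Set.Ioi 0 := by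
    ext y
    simp only [Set.mem_image, Set.mem_Ioi]
    exact ⟨fun ⟨x, hx, h⟩ => h ▸ mul_pos hx hc,
      fun hy => ⟨y / c, div_pos hy hc, div_mul_cancel₀ y hc.ne'⟩⟩
  have := lintegral_image_eq_lintegral_abs_deriv_mul (s := Set.Ioi (0 : ℝ)) (f := fun r => r * c)
    (f' := fun _ => c) measurableSet_Ioi (fun x _ => by
      simpa using ((hasDerivAt_id x).mul_const c).hasDerivWithinAt)
    (mul_left_injective₀ hc.ne').injOn F
  rw [himg] at this
  rw [this, lintegral_const_mul' _ _ ENNReal.ofReal_ne_top, abs_of_pos hc]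

lemma measurable_coneMap {w : Sph → ℝ} (hw : Measurable w) :
    Measurable fun p : Sph × ℝ => (p.2 * w p.1) • ray (p.1 : Mom3) := by
  have h1 : Measurable fun p : Sph × ℝ => ray (p.1 : Mom3) :=
    (continuous_ray.comp (continuous_subtype_val.comp continuous_fst)).measurable
  have h2 : Measurable fun p : Sph × ℝ => p.2 * w p.1 := by fun_prop
  exact h2.smul h1

/-- The cone measure in polar coordinates, with the radial coordinate rescaled by `w`. -/
lemma deltaPlus_zero_eq {w : Sph → ℝ} (hw : Measurable w) (hw0 : ∀ n, 0 < w n) :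
    deltaPlus 0 = ((sphereMeasure.prod (volume.restrict (Set.Ioi (0 : ℝ)))).withDensity
      fun p => ENNReal.ofReal ((4 * Real.pi)⁻¹ * w p.1 ^ 2 * p.2)).map
        fun p => (p.2 * w p.1) • ray p.1 := by
  have hΦ := measurable_coneMap hw
  refine Measure.ext_of_lintegral _ fun F hF => ?_
  rw [lintegral_deltaPlus_zero hF, lintegral_map hF hΦ]
  refine Eq.trans ?_ (lintegral_withDensity_eq_lintegral_mul _ (by fun_prop) (hF.comp hΦ)).symm
  rw [lintegral_prod]
  · refine lintegral_congr fun n => ?_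
    rw [lintegral_Ioi_scale (hw0 n), ← lintegral_const_mul' _ _ ENNReal.ofReal_ne_top]
    refine lintegral_congr fun r => ?_
    simp only [Pi.mul_apply, Function.comp_apply]
    rw [← mul_assoc, ← ENNReal.ofReal_mul (hw0 n).le]
    congr 2
    ring
  · have := hF.comp hΦ
    exact (Measurable.mul (by fun_prop) this).aemeasurable

/-- Integration over the part of the cone cut off by a bound on the rescaled radial coordinate. -/
lemma restrict_deltaPlus_zero {w : Sph → ℝ} (hw : Measurable w) (hw0 : ∀ n, 0 < w n) {S : Set Mom}
    (hS : MeasurableSet S) {Λ : ℝ}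
    (hSΛ : ∀ (n : Sph) (r : ℝ), 0 < r → ((r * w n) • ray (n : Mom3) ∈ S ↔ r ≤ Λ)) :
    (deltaPlus 0).restrict S = ((sphereMeasure.prod (volume.restrict (Set.Ioc 0 Λ))).withDensity
      fun p => ENNReal.ofReal ((4 * Real.pi)⁻¹ * w p.1 ^ 2 * p.2)).map
        fun p => (p.2 * w p.1) • ray p.1 := by
  have hΦ := measurable_coneMap hw
  rw [deltaPlus_zero_eq hw hw0, Measure.restrict_map hΦ hS,
    restrict_withDensity (hΦ hS)]
  congr 2
  rw [← Measure.restrict_univ (μ := (sphereMeasure : Measure Sph)), Measure.prod_restrict,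
    Measure.prod_restrict, Measure.restrict_restrict (hΦ hS)]
  congr 1
  ext ⟨n, r⟩
  simp only [Set.mem_inter_iff, Set.mem_preimage, Set.mem_prod, Set.mem_univ, true_and,
    Set.mem_Ioi, Set.mem_Ioc]
  constructor
  · rintro ⟨h1, h2⟩; exact ⟨h2, (hSΛ n r h2).1 h1⟩
  · rintro ⟨h1, h2⟩; exact ⟨(hSΛ n r h1).2 h2, h1⟩

lemma integrable_restrict_deltaPlus_zero {w : Sph → ℝ} (hw : Measurable w) (hw0 : ∀ n, 0 < w n)
    {S : Set Mom} (hS : MeasurableSet S) {Λ : ℝ}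
    (hSΛ : ∀ (n : Sph) (r : ℝ), 0 < r → ((r * w n) • ray (n : Mom3) ∈ S ↔ r ≤ Λ))
    {F : Mom → ℂ} (hF : Measurable F) :
    (Integrable F ((deltaPlus 0).restrict S) ↔ Integrable (fun p : Sph × ℝ =>
      (((4 * Real.pi)⁻¹ * w p.1 ^ 2 * p.2 : ℝ) : ℂ) * F ((p.2 * w p.1) • ray p.1))
      (sphereMeasure.prod (volume.restrict (Set.Ioc 0 Λ)))) ∧
    ∫ l in S, F l ∂(deltaPlus 0) = ∫ p : Sph × ℝ,
      (((4 * Real.pi)⁻¹ * w p.1 ^ 2 * p.2 : ℝ) : ℂ) * F ((p.2 * w p.1) • ray p.1)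
      ∂(sphereMeasure.prod (volume.restrict (Set.Ioc 0 Λ))) := by
  have hΦ := measurable_coneMap hw
  have hpos : ∀ᵐ p : Sph × ℝ ∂(sphereMeasure.prod (volume.restrict (Set.Ioc 0 Λ))),
      (ENNReal.ofReal ((4 * Real.pi)⁻¹ * w p.1 ^ 2 * p.2)).toReal =
        (4 * Real.pi)⁻¹ * w p.1 ^ 2 * p.2 := by
    have h1 : ∀ᵐ p : Sph × ℝ ∂(sphereMeasure.prod (volume.restrict (Set.Ioc 0 Λ))),
        p.2 ∈ Set.Ioc 0 Λ :=
      Measure.quasiMeasurePreserving_snd.ae (ae_restrict_mem measurableSet_Ioc)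
    filter_upwards [h1] with p hp
    have := hp.1
    exact ENNReal.toReal_ofReal (by positivity)
  rw [restrict_deltaPlus_zero hw hw0 hS hSΛ]
  constructor
  · rw [integrable_map_measure hF.aestronglyMeasurable hΦ.aemeasurable,
      integrable_withDensity_iff_integrable_smul' (by fun_prop)
        (Eventually.of_forall fun _ => ENNReal.ofReal_lt_top)]
    refine integrable_congr ?_
    filter_upwards [hpos] with p hp
    rw [hp, Complex.real_smul]; rfl
  · rw [integral_map hΦ.aemeasurable hF.aestronglyMeasurable,
      integral_withDensity_eq_integral_toReal_smul (by fun_prop)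
        (Eventually.of_forall fun _ => ENNReal.ofReal_lt_top)]
    refine integral_congr_ae ?_
    filter_upwards [hpos] with p hp
    rw [hp, Complex.real_smul]

lemma measurable_mdot_self : Measurable fun l : Mom => mdot l l := by
  simp only [mdot_four]; fun_prop

lemma ae_deltaPlus_zero : ∀ᵐ l ∂(deltaPlus 0), mdot l l = 0 := by
  rw [deltaPlus, ae_map_iff (continuous_onShell 0).measurable.aemeasurable
    (measurableSet_eq_fun measurable_mdot_self measurable_const)]
  refine Eventually.of_forall fun x => ?_
  have h : √(0 + ‖x‖ ^ 2) = ‖x‖ := by rw [zero_add, Real.sqrt_sq (norm_nonneg x)]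
  have := norm_sq_mom3 x
  simp [mdot_four, onShell, -zero_add, h]
  linarith

lemma ae_deltaOne : ∀ᵐ l ∂deltaOne, mdot l l = 0 := by
  rw [deltaOne, ae_add_measure_iff]
  refine ⟨ae_deltaPlus_zero, ?_⟩
  rw [ae_map_iff measurable_neg.aemeasurable
    (measurableSet_eq_fun measurable_mdot_self measurable_const)]
  filter_upwards [ae_deltaPlus_zero] with l hl
  rwa [mdot_neg_neg]

lemma integral_restrict_deltaOne {S : Set Mom} (hS : MeasurableSet S) (hneg : ∀ l, -l ∈ S ↔ l ∈ S)
    {F : Mom → ℂ} (h1 : Integrable F ((deltaPlus 0).restrict S))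
    (h2 : Integrable (fun l => F (-l)) ((deltaPlus 0).restrict S)) :
    ∫ l in S, F l ∂deltaOne = ∫ l in S, (F l + F (-l)) ∂(deltaPlus 0) := by
  have hS' : (fun l : Mom => -l) ⁻¹' S = S := by ext l; exact hneg l
  have e := (MeasurableEquiv.neg Mom).measurableEmbedding
  have h3 : ((deltaPlus 0).map (fun l : Mom => -l)).restrict S =
      ((deltaPlus 0).restrict S).map (MeasurableEquiv.neg Mom) := by
    rw [Measure.restrict_map measurable_neg hS, hS']; rfl
  rw [deltaOne, Measure.restrict_add, h3, integral_add_measure h1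
    ((e.integrable_map_iff).2 h2), e.integral_map, integral_add h1 h2]
  rfl

lemma integral_deltaOne_neg (F : Mom → ℂ) {S : Set Mom} (hneg : ∀ l, -l ∈ S ↔ l ∈ S) :
    ∫ l in S, F (-l) ∂deltaOne = ∫ l in S, F l ∂deltaOne := by
  have hS' : (fun l : Mom => -l) ⁻¹' S = S := by ext l; exact hneg l
  have e := (MeasurableEquiv.neg Mom).measurableEmbedding
  have h : deltaOne.map (MeasurableEquiv.neg Mom) = deltaOne := by
    have : ((deltaPlus 0).map fun k => -k).map (fun k : Mom => -k) = deltaPlus 0 := by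
      rw [Measure.map_map measurable_neg measurable_neg]
      convert Measure.map_id
      ext; simp
    change deltaOne.map (fun k : Mom => -k) = _
    rw [deltaOne, Measure.map_add _ _ measurable_neg, this, add_comm]
  conv_rhs => rw [← h, e.setIntegral_map]
  change _ = ∫ x in (fun l : Mom => -l) ⁻¹' S, F (-x) ∂deltaOne
  rw [hS']

end

/-! ### Removing the regularization ε along the rays -/

section

/-- Denominator of the regularized propagator along a ray. -/
noncomputable def rayDen (m E ε w ω : ℝ) : ℂ :=
  ((m ^ 2 - 2 * m * ω : ℝ) : ℂ) + Complex.I * (ε : ℂ) * ((E - w * ω : ℝ) : ℂ)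

/-- The loop factor `ω sin²(ωb/2)`. -/
noncomputable def rayNum (b ω : ℝ) : ℝ := ω * Real.sin (ω * b / 2) ^ 2

lemma rayDen_re (m E ε w ω : ℝ) : (rayDen m E ε w ω).re = m ^ 2 - 2 * m * ω := by
  simp only [rayDen, Complex.add_re, Complex.ofReal_re, Complex.mul_re, Complex.I_re, Complex.I_im,
    Complex.ofReal_im, Complex.mul_im]
  ring

lemma rayDen_im (m E ε w ω : ℝ) : (rayDen m E ε w ω).im = ε * (E - w * ω) := by
  simp only [rayDen, Complex.add_im, Complex.ofReal_re, Complex.mul_re, Complex.I_re, Complex.I_im,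
    Complex.ofReal_im, Complex.mul_im]
  ring

lemma abs_re_le_norm_rayDen (m E ε w ω : ℝ) : |m ^ 2 - 2 * m * ω| ≤ ‖rayDen m E ε w ω‖ := by
  rw [← rayDen_re m E ε w ω]; exact Complex.abs_re_le_norm _

/-- The real part of the denominator vanishes only at ω = m/2, where k - l has positive energy and
the imaginary part is positive. Multiplied by -i, the denominator crosses the real axis on the
positive side, so the principal logarithm is differentiable along the whole ray. -/
lemma rayDen_mem_slitPlane {m E ε w ω : ℝ} (hm : 0 < m) (hE : 0 < E - w * (m / 2)) (hε : 0 < ε) :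
    -Complex.I * rayDen m E ε w ω ∈ Complex.slitPlane := by
  rw [Complex.mem_slitPlane_iff]
  by_cases h : m ^ 2 - 2 * m * ω = 0
  · left
    have hω : ω = m / 2 := by
      have : m * (m - 2 * ω) = 0 := by linarith
      rcases mul_eq_zero.mp this with h' | h'
      · exact absurd h' hm.ne'
      · linarith
    have : 0 < ε * (E - w * ω) := by rw [hω]; positivity
    simpa [rayDen_im] using this
  · right
    simpa [rayDen_re, sub_eq_zero] using fun h' => h (sub_eq_zero.mpr h'.symm)

lemma rayDen_ne_zero {m E ε w ω : ℝ} (hm : 0 < m) (hE : 0 < E - w * (m / 2)) (hε : 0 < ε) :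
    rayDen m E ε w ω ≠ 0 := fun h => by
  have := rayDen_mem_slitPlane (ω := ω) hm hE hε
  rw [h, mul_zero] at this
  exact Complex.zero_notMem_slitPlane this

lemma rayDen_mem_slitPlane' {m E ε w ω : ℝ} (h : m ^ 2 - 2 * m * ω ≠ 0) :
    -Complex.I * rayDen m E ε w ω ∈ Complex.slitPlane := by
  rw [Complex.mem_slitPlane_iff]
  right
  simpa [rayDen_re, sub_eq_zero] using fun h' => h (sub_eq_zero.mpr h'.symm)

/-- The integral of the regularized propagator along a ray. -/
noncomputable def rayLog (m E ε w Λ : ℝ) : ℂ :=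
  -(1 / ((2 * m : ℝ) + Complex.I * (ε : ℂ) * (w : ℂ))) *
    (Complex.log (-Complex.I * rayDen m E ε w Λ) - Complex.log (-Complex.I * rayDen m E ε w 0))

lemma rayLog_slope_ne_zero {m : ℝ} (hm : 0 < m) (ε w : ℝ) :
    ((2 * m : ℝ) : ℂ) + Complex.I * (ε : ℂ) * (w : ℂ) ≠ 0 := fun h => by
  have := congrArg Complex.re h
  simp at this
  exact hm.ne' this

lemma integral_inv_rayDen {m E ε w : ℝ} (hm : 0 < m) (hE : 0 < E - w * (m / 2)) (hε : 0 < ε)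
    (Λ : ℝ) : ∫ ω in (0 : ℝ)..Λ, (rayDen m E ε w ω)⁻¹ = rayLog m E ε w Λ := by
  have hB := rayLog_slope_ne_zero hm ε w
  -- B is minus the slope of the denominator, which is affine in ω.
  set B := ((2 * m : ℝ) : ℂ) + Complex.I * (ε : ℂ) * (w : ℂ) with hBdef
  have hz : ∀ ω, HasDerivAt (fun ω : ℝ => -Complex.I * rayDen m E ε w ω) (Complex.I * B) ω := by
    intro ω
    have h1 : HasDerivAt (fun ω : ℝ => (ω : ℂ)) 1 ω := Complex.ofRealCLM.hasDerivAt
    have e : (fun ω : ℝ => -Complex.I * rayDen m E ε w ω) = fun ω : ℝ =>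
        -Complex.I * ((m : ℂ) ^ 2 + Complex.I * ε * E) + (Complex.I * B) * (ω : ℂ) := by
      ext ω; simp only [rayDen, hBdef]; push_cast; ring
    rw [e]
    simpa using (h1.const_mul (Complex.I * B)).const_add
      (-Complex.I * ((m : ℂ) ^ 2 + Complex.I * ε * E))
  have hd : ∀ ω ∈ Set.uIcc 0 Λ, HasDerivAt
      (fun ω : ℝ => -(1 / B) * Complex.log (-Complex.I * rayDen m E ε w ω))
      ((rayDen m E ε w ω)⁻¹) ω := by
    intro ω _
    have h := (((hz ω).clog_real (rayDen_mem_slitPlane hm hE hε)).const_mul (-(1 / B)))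
    convert h using 1
    · rfl
    have := rayDen_ne_zero (ω := ω) hm hE hε
    field_simp
  rw [intervalIntegral.integral_eq_sub_of_hasDerivAt hd, rayLog, mul_sub]
  refine Continuous.intervalIntegrable (Continuous.inv₀ ?_ fun ω => rayDen_ne_zero hm hE hε) _ _
  unfold rayDen; fun_prop

/-- At ε = 0 the end points lie on the positive and the negative imaginary axis. Their arguments
differ by π, which is the source of the imaginary part of the self-energy. -/
lemma rayLog_zero {m E w Λ : ℝ} (hm : 0 < m) (hΛ : m / 2 < Λ) :
    rayLog m E 0 w Λ = -(1 / (2 * m)) * (Real.log ((2 * Λ - m) / m) + Complex.I * Real.pi) := by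
  have h1 : -Complex.I * rayDen m E 0 w Λ = ((2 * m * Λ - m ^ 2 : ℝ) : ℂ) * Complex.I := by
    simp [rayDen]; ring
  have h2 : -Complex.I * rayDen m E 0 w 0 = ((m ^ 2 : ℝ) : ℂ) * (-Complex.I) := by
    simp [rayDen]; ring
  have p1 : 0 < 2 * m * Λ - m ^ 2 := by nlinarith
  have p2 : 0 < m ^ 2 := by positivity
  rw [rayLog, h1, h2, Complex.log_ofReal_mul p1 Complex.I_ne_zero, Complex.log_ofReal_mul p2
    (neg_ne_zero.mpr Complex.I_ne_zero), Complex.log_I, Complex.log_neg_I]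
  have e : (2 * Λ - m) / m = (2 * m * Λ - m ^ 2) / m ^ 2 := by field_simp
  rw [e, Real.log_div p1.ne' p2.ne']
  push_cast
  simp only [mul_zero, zero_mul, add_zero]
  ring

/-- Only the end points enter the logarithms, and their real parts before the rotation by -i do not
vanish for any ε. The function is therefore continuous through ε = 0, although the integrand is not.
-/
lemma continuous_rayLog {X : Type*} [TopologicalSpace X] {m E Λ : ℝ} (hm : 0 < m) (hΛ : m / 2 < Λ)
    {ε w : X → ℝ} (hε : Continuous ε) (hw : Continuous w) :
    Continuous fun x => rayLog m E (ε x) (w x) Λ := by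
  have h1 : ∀ x, -Complex.I * rayDen m E (ε x) (w x) Λ ∈ Complex.slitPlane := fun x =>
    rayDen_mem_slitPlane' (by nlinarith)
  have h2 : ∀ x, -Complex.I * rayDen m E (ε x) (w x) 0 ∈ Complex.slitPlane := fun x =>
    rayDen_mem_slitPlane' (by simpa using hm.ne')
  have c : ∀ ω, Continuous fun x => -Complex.I * rayDen m E (ε x) (w x) ω := by
    intro ω; unfold rayDen; fun_prop
  unfold rayLog
  refine Continuous.mul (Continuous.neg (Continuous.div continuous_const (by fun_prop)
    fun x => rayLog_slope_ne_zero hm _ _)) ?_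
  exact ((c Λ).clog h1).sub ((c 0).clog h2)

/-- From sin²x - sin²y = sin(x+y) sin(x-y). The Lipschitz bound compensates the pole after the
subtraction at ω = m/2, uniformly in ε and in the direction. -/
lemma abs_rayNum_sub_le (b x y : ℝ) :
    |rayNum b x - rayNum b y| ≤ (1 + |y| * |b|) * |x - y| := by
  have h1 : rayNum b x - rayNum b y = (x - y) * Real.sin (x * b / 2) ^ 2 +
      y * (Real.sin (x * b / 2 + y * b / 2) * Real.sin (x * b / 2 - y * b / 2)) := by
    rw [Real.sin_add, Real.sin_sub, rayNum, rayNum]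
    have h1 := Real.sin_sq_add_cos_sq (x * b / 2)
    have h2 := Real.sin_sq_add_cos_sq (y * b / 2)
    linear_combination (y * Real.sin (y * b / 2) ^ 2) * h1 - (y * Real.sin (x * b / 2) ^ 2) * h2
  have h2 : |Real.sin (x * b / 2 - y * b / 2)| ≤ |b| * |x - y| := by
    refine (Real.abs_sin_le_abs).trans ?_
    rw [show x * b / 2 - y * b / 2 = b * (x - y) / 2 by ring, abs_div, abs_mul, abs_two]
    have : 0 ≤ |b| * |x - y| := by positivity
    linarith
  have h3 : Real.sin (x * b / 2) ^ 2 ≤ 1 := Real.sin_sq_le_one _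
  have h4 : |Real.sin (x * b / 2 + y * b / 2)| ≤ 1 := Real.abs_sin_le_one _
  rw [h1]
  refine (abs_add_le _ _).trans ?_
  rw [abs_mul, abs_mul, abs_mul, abs_of_nonneg (sq_nonneg (Real.sin (x * b / 2)))]
  calc |x - y| * Real.sin (x * b / 2) ^ 2 + |y| * (|Real.sin (x * b / 2 + y * b / 2)| *
        |Real.sin (x * b / 2 - y * b / 2)|)
      ≤ |x - y| * 1 + |y| * (1 * (|b| * |x - y|)) := by gcongr
    _ = _ := by ring

lemma abs_rayNum_le (b : ℝ) {ω Λ : ℝ} (h0 : 0 ≤ ω) (h : ω ≤ Λ) : |rayNum b ω| ≤ Λ := by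
  rw [rayNum, abs_mul, abs_of_nonneg h0, abs_of_nonneg (sq_nonneg _)]
  calc ω * Real.sin (ω * b / 2) ^ 2 ≤ ω * 1 := by gcongr; exact Real.sin_sq_le_one _
    _ ≤ Λ := by linarith

lemma integral_linear_combination {X : Type*} [MeasurableSpace X] {μ : Measure X}
    {f₁ f₂ f₃ f₄ f₅ : X → ℂ} (h₁ : Integrable f₁ μ) (h₂ : Integrable f₂ μ) (h₃ : Integrable f₃ μ)
    (h₄ : Integrable f₄ μ) (h₅ : Integrable f₅ μ) (A B : ℂ) :
    ∫ x, A * (f₁ x + f₂ x + f₃ x) + B * (f₄ x + f₅ x) ∂μ =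
      A * (∫ x, f₁ x ∂μ + ∫ x, f₂ x ∂μ + ∫ x, f₃ x ∂μ) + B * (∫ x, f₄ x ∂μ + ∫ x, f₅ x ∂μ) := by
  rw [integral_add, integral_const_mul, integral_const_mul, integral_add, integral_add h₁ h₂,
    integral_add h₄ h₅] <;> fun_prop

section Limits

variable {w b : Sph → ℝ} {m E Λ : ℝ}

/-- The measure on directions and rescaled radial coordinates below the cutoff. -/
noncomputable abbrev coneBelow (Λ : ℝ) : Measure (Sph × ℝ) :=
  sphereMeasure.prod (volume.restrict (Set.Ioc 0 Λ))

lemma ae_coneBelow (Λ : ℝ) : ∀ᵐ p ∂(coneBelow Λ), p.2 ∈ Set.Ioc 0 Λ :=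
  Measure.quasiMeasurePreserving_snd.ae (ae_restrict_mem measurableSet_Ioc)

lemma ae_coneBelow_ne (Λ x : ℝ) : ∀ᵐ p ∂(coneBelow Λ), p.2 ≠ x :=
  Measure.quasiMeasurePreserving_snd.ae (ae_restrict_of_ae (Measure.ae_ne _ x))

lemma integrable_coneBelow_of_bound {F : Sph × ℝ → ℂ} (hF : Measurable F) {C : ℝ}
    (h : ∀ p : Sph × ℝ, 0 < p.2 → p.2 ≤ Λ → ‖F p‖ ≤ C) : Integrable F (coneBelow Λ) :=
  Integrable.of_bound hF.aestronglyMeasurable C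
    ((ae_coneBelow Λ).mono fun p hp => h p hp.1 hp.2)

/-- The value `x` is the radial coordinate of the pole, a null set where pointwise convergence may
fail. -/
lemma tendsto_integral_coneBelow {F : ℝ → Sph × ℝ → ℂ} {G : Sph × ℝ → ℂ}
    (hF : ∀ ε, Measurable (F ε)) {C : ℝ}
    (hb : ∀ ε, 0 < ε → ∀ p : Sph × ℝ, 0 < p.2 → p.2 ≤ Λ → ‖F ε p‖ ≤ C) (x : ℝ)
    (hlim : ∀ p : Sph × ℝ, 0 < p.2 → p.2 ≠ x → Tendsto (fun ε => F ε p) (𝓝[>] 0) (𝓝 (G p))) :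
    Tendsto (fun ε => ∫ p, F ε p ∂(coneBelow Λ)) (𝓝[>] 0) (𝓝 (∫ p, G p ∂(coneBelow Λ))) := by
  refine tendsto_integral_filter_of_dominated_convergence (fun _ => C)
    (Eventually.of_forall fun ε => (hF ε).aestronglyMeasurable) ?_ (integrable_const _) ?_
  · filter_upwards [self_mem_nhdsWithin] with ε hε
    exact (ae_coneBelow Λ).mono fun p hp => hb ε hε p hp.1 hp.2
  · filter_upwards [ae_coneBelow Λ, ae_coneBelow_ne Λ x] with p hp hx
    exact hlim p hp.1 hx

lemma exists_sphere_bound (hw : Continuous w) : ∃ W : ℝ, 0 ≤ W ∧ ∀ n, |w n| ≤ W := by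
  obtain ⟨W, hW⟩ := isCompact_univ.exists_bound_of_continuousOn hw.continuousOn
  have n0 : Sph := ⟨EuclideanSpace.single 0 1, by simp⟩
  exact ⟨W, (norm_nonneg _).trans (hW n0 trivial), fun n => hW n trivial⟩

lemma tendsto_rayDen (m E w ω : ℝ) :
    Tendsto (fun ε => rayDen m E ε w ω) (𝓝[>] 0) (𝓝 ((m ^ 2 - 2 * m * ω : ℝ) : ℂ)) := by
  have : Continuous fun ε => rayDen m E ε w ω := by unfold rayDen; fun_prop
  have h := (this.tendsto 0).mono_left (nhdsWithin_le_nhds (s := Set.Ioi 0))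
  simpa [rayDen] using h

lemma measurable_rayDen (hw : Continuous w) (m E ε : ℝ) :
    Measurable fun p : Sph × ℝ => rayDen m E ε (w p.1) p.2 := by
  unfold rayDen; have := hw.measurable; fun_prop

lemma measurable_rayNum (hb : Continuous b) :
    Measurable fun p : Sph × ℝ => rayNum (b p.1) p.2 := by
  unfold rayNum; have := hb.measurable; fun_prop

lemma tendsto_integral_subtracted (hm : 0 < m) (hw : Continuous w) (hb : Continuous b) :
    Tendsto (fun ε => ∫ p, ((w p.1 ^ 2 * (rayNum (b p.1) p.2 - rayNum (b p.1) (m / 2)) : ℝ) : ℂ) *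
      (rayDen m E ε (w p.1) p.2)⁻¹ ∂(coneBelow Λ)) (𝓝[>] 0)
      (𝓝 (∫ p, ((w p.1 ^ 2 * (rayNum (b p.1) p.2 - rayNum (b p.1) (m / 2)) /
        (m ^ 2 - 2 * m * p.2) : ℝ) : ℂ) ∂(coneBelow Λ))) ∧
    ∀ ε, Integrable (fun p => ((w p.1 ^ 2 * (rayNum (b p.1) p.2 - rayNum (b p.1) (m / 2)) : ℝ) : ℂ) *
      (rayDen m E ε (w p.1) p.2)⁻¹) (coneBelow Λ) := by
  obtain ⟨W, hW0, hW⟩ := exists_sphere_bound hw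
  obtain ⟨B, hB0, hB⟩ := exists_sphere_bound hb
  have hmeas : ∀ ε, Measurable fun p : Sph × ℝ =>
      ((w p.1 ^ 2 * (rayNum (b p.1) p.2 - rayNum (b p.1) (m / 2)) : ℝ) : ℂ) *
      (rayDen m E ε (w p.1) p.2)⁻¹ := by
    intro ε
    have h1 := measurable_rayDen hw m E ε
    have h2 := measurable_rayNum hb
    have h3 : Measurable fun p : Sph × ℝ => rayNum (b p.1) (m / 2) := by
      unfold rayNum; have := hb.measurable; fun_prop
    have h4 := hw.measurable
    fun_prop
  have hbd : ∀ ε, ∀ p : Sph × ℝ,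
      ‖((w p.1 ^ 2 * (rayNum (b p.1) p.2 - rayNum (b p.1) (m / 2)) : ℝ) : ℂ) *
      (rayDen m E ε (w p.1) p.2)⁻¹‖ ≤ W ^ 2 * (1 + m / 2 * B) / (2 * m) := by
    intro ε p
    have h1 := abs_rayNum_sub_le (b p.1) p.2 (m / 2)
    have h2 := abs_re_le_norm_rayDen m E ε (w p.1) p.2
    have h3 : |m ^ 2 - 2 * m * p.2| = 2 * m * |p.2 - m / 2| := by
      rw [show m ^ 2 - 2 * m * p.2 = -(2 * m * (p.2 - m / 2)) by ring, abs_neg, abs_mul,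
        abs_of_pos (by positivity)]
    rw [h3] at h2
    rw [abs_of_pos (half_pos hm)] at h1
    rw [norm_mul, norm_inv, Complex.norm_real, Real.norm_eq_abs, abs_mul, abs_pow,
      ← div_eq_mul_inv]
    rcases eq_or_ne p.2 (m / 2) with hx | hx
    · rw [hx]; simp; positivity
    · have hp : 0 < |p.2 - m / 2| := abs_pos.mpr (sub_ne_zero.mpr hx)
      have hz : 0 < ‖rayDen m E ε (w p.1) p.2‖ := lt_of_lt_of_le (by positivity) h2
      rw [div_le_div_iff₀ hz (by positivity)]
      calc |w p.1| ^ 2 * |rayNum (b p.1) p.2 - rayNum (b p.1) (m / 2)| * (2 * m)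
          ≤ W ^ 2 * ((1 + m / 2 * B) * |p.2 - m / 2|) * (2 * m) := by
            have := hW p.1
            have := h1.trans (mul_le_mul_of_nonneg_right (add_le_add_right
              (mul_le_mul_of_nonneg_left (hB p.1) (half_pos hm).le) 1) (abs_nonneg _))
            gcongr
        _ = W ^ 2 * (1 + m / 2 * B) * (2 * m * |p.2 - m / 2|) := by ring
        _ ≤ _ := by gcongr
  refine ⟨tendsto_integral_coneBelow hmeas (fun ε _ p _ _ => hbd ε p) (m / 2) ?_,
    fun ε => integrable_coneBelow_of_bound (hmeas ε) fun p _ _ => hbd ε p⟩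
  intro p _ hx
  have hne : ((m ^ 2 - 2 * m * p.2 : ℝ) : ℂ) ≠ 0 := by
    norm_cast
    intro h
    have : m * (m - 2 * p.2) = 0 := by linarith
    rcases mul_eq_zero.mp this with h' | h'
    · exact hm.ne' h'
    · exact hx (by linarith)
  have := ((tendsto_rayDen m E (w p.1) p.2).inv₀ hne).const_mul
    ((w p.1 ^ 2 * (rayNum (b p.1) p.2 - rayNum (b p.1) (m / 2)) : ℝ) : ℂ)
  convert this using 2
  rw [Complex.ofReal_div, div_eq_mul_inv]

/-- The backward half of the cone: the denominator stays above m², so there is no pole. -/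
lemma tendsto_integral_regular (hm : 0 < m) (hw : Continuous w) (hb : Continuous b) :
    Tendsto (fun ε => ∫ p, ((w p.1 ^ 2 * rayNum (b p.1) p.2 : ℝ) : ℂ) *
      (rayDen m E ε (w p.1) (-p.2))⁻¹ ∂(coneBelow Λ)) (𝓝[>] 0)
      (𝓝 (∫ p, ((w p.1 ^ 2 * rayNum (b p.1) p.2 / (m ^ 2 + 2 * m * p.2) : ℝ) : ℂ)
        ∂(coneBelow Λ))) ∧
    ∀ ε, Integrable (fun p => ((w p.1 ^ 2 * rayNum (b p.1) p.2 : ℝ) : ℂ) *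
      (rayDen m E ε (w p.1) (-p.2))⁻¹) (coneBelow Λ) := by
  obtain ⟨W, hW0, hW⟩ := exists_sphere_bound hw
  have hmeas : ∀ ε, Measurable fun p : Sph × ℝ => ((w p.1 ^ 2 * rayNum (b p.1) p.2 : ℝ) : ℂ) *
      (rayDen m E ε (w p.1) (-p.2))⁻¹ := by
    intro ε
    have h1 : Measurable fun p : Sph × ℝ => rayDen m E ε (w p.1) (-p.2) :=
      (measurable_rayDen hw m E ε).comp (measurable_fst.prodMk measurable_snd.neg)
    have h2 := measurable_rayNum hb
    have h4 := hw.measurable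
    fun_prop
  have hbd : ∀ ε, ∀ p : Sph × ℝ, 0 < p.2 → p.2 ≤ Λ →
      ‖((w p.1 ^ 2 * rayNum (b p.1) p.2 : ℝ) : ℂ) * (rayDen m E ε (w p.1) (-p.2))⁻¹‖ ≤
        W ^ 2 * Λ * (m ^ 2)⁻¹ := by
    intro ε p h0 hΛ
    have h2 := abs_re_le_norm_rayDen m E ε (w p.1) (-p.2)
    have h3 : m ^ 2 ≤ ‖rayDen m E ε (w p.1) (-p.2)‖ := by
      refine le_trans ?_ h2
      rw [abs_of_pos (by nlinarith [mul_pos hm h0])]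
      nlinarith [mul_pos hm h0]
    rw [norm_mul, norm_inv, Complex.norm_real, Real.norm_eq_abs, abs_mul, abs_pow]
    have := hW p.1
    have := abs_rayNum_le (b p.1) h0.le hΛ
    have hΛ0 : 0 ≤ Λ := h0.le.trans hΛ
    gcongr
  refine ⟨tendsto_integral_coneBelow hmeas (fun ε _ p h0 hΛ => hbd ε p h0 hΛ) 0 ?_,
    fun ε => integrable_coneBelow_of_bound (hmeas ε) (hbd ε)⟩
  intro p h0 _
  have hne : ((m ^ 2 - 2 * m * -p.2 : ℝ) : ℂ) ≠ 0 := by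
    norm_cast
    nlinarith [mul_pos hm h0, mul_pos hm hm]
  have := ((tendsto_rayDen m E (w p.1) (-p.2)).inv₀ hne).const_mul
    ((w p.1 ^ 2 * rayNum (b p.1) p.2 : ℝ) : ℂ)
  convert this using 2
  rw [Complex.ofReal_div, div_eq_mul_inv, mul_neg, sub_neg_eq_add]

/-- The mismatch between the tadpole and the regularized loops. It is bounded because the modulus of
the denominator is at least that of its real part, and it tends to zero away from the pole. The sign
`s` distinguishes the two halves of the cone. -/
lemma tendsto_integral_remainder (hm : 0 < m) (hw : Continuous w) (hb : Continuous b) {s : ℝ}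
    (hs : s = 1 ∨ s = -1) :
    Tendsto (fun ε => ∫ p, ((w p.1 ^ 2 * rayNum (b p.1) p.2 : ℝ) : ℂ) *
      (1 - ((m ^ 2 - 2 * m * (s * p.2) : ℝ) : ℂ) * (rayDen m E ε (w p.1) (s * p.2))⁻¹)
        ∂(coneBelow Λ)) (𝓝[>] 0) (𝓝 0) ∧
    ∀ ε, Integrable (fun p => ((w p.1 ^ 2 * rayNum (b p.1) p.2 : ℝ) : ℂ) *
      (1 - ((m ^ 2 - 2 * m * (s * p.2) : ℝ) : ℂ) * (rayDen m E ε (w p.1) (s * p.2))⁻¹))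
        (coneBelow Λ) := by
  obtain ⟨W, hW0, hW⟩ := exists_sphere_bound hw
  have hmeas : ∀ ε, Measurable fun p : Sph × ℝ => ((w p.1 ^ 2 * rayNum (b p.1) p.2 : ℝ) : ℂ) *
      (1 - ((m ^ 2 - 2 * m * (s * p.2) : ℝ) : ℂ) * (rayDen m E ε (w p.1) (s * p.2))⁻¹) := by
    intro ε
    have h1 : Measurable fun p : Sph × ℝ => rayDen m E ε (w p.1) (s * p.2) :=
      (measurable_rayDen hw m E ε).comp (measurable_fst.prodMk (measurable_snd.const_mul s))
    have h2 := measurable_rayNum hb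
    have h4 := hw.measurable
    fun_prop
  have hbd : ∀ ε, ∀ p : Sph × ℝ, 0 < p.2 → p.2 ≤ Λ →
      ‖((w p.1 ^ 2 * rayNum (b p.1) p.2 : ℝ) : ℂ) *
      (1 - ((m ^ 2 - 2 * m * (s * p.2) : ℝ) : ℂ) * (rayDen m E ε (w p.1) (s * p.2))⁻¹)‖ ≤
        W ^ 2 * Λ * (1 + 1) := by
    intro ε p h0 hΛ
    have h2 := abs_re_le_norm_rayDen m E ε (w p.1) (s * p.2)
    have h3 : ‖((m ^ 2 - 2 * m * (s * p.2) : ℝ) : ℂ) * (rayDen m E ε (w p.1) (s * p.2))⁻¹‖ ≤ 1 := by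
      rw [norm_mul, norm_inv, Complex.norm_real, Real.norm_eq_abs, ← div_eq_mul_inv]
      exact div_le_one_of_le₀ h2 (norm_nonneg _)
    rw [norm_mul, Complex.norm_real, Real.norm_eq_abs, abs_mul, abs_pow]
    have h4 := hW p.1
    have h5 := abs_rayNum_le (b p.1) h0.le hΛ
    have h6 := (norm_sub_le (1 : ℂ) (((m ^ 2 - 2 * m * (s * p.2) : ℝ) : ℂ) *
      (rayDen m E ε (w p.1) (s * p.2))⁻¹)).trans (add_le_add norm_one.le h3)
    have hΛ0 : 0 ≤ Λ := h0.le.trans hΛ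
    gcongr
  have hlim := tendsto_integral_coneBelow (G := fun _ => 0) hmeas
    (fun ε _ p h0 hΛ => hbd ε p h0 hΛ) (m / 2) (fun p h0 hx => by
      have hne : ((m ^ 2 - 2 * m * (s * p.2) : ℝ) : ℂ) ≠ 0 := by
        norm_cast
        rcases hs with rfl | rfl
        · intro h
          have : m * (m - 2 * p.2) = 0 := by linarith
          rcases mul_eq_zero.mp this with h' | h'
          · exact hm.ne' h'
          · exact hx (by linarith)
        · nlinarith [mul_pos hm h0, mul_pos hm hm]
      have := ((((tendsto_rayDen m E (w p.1) (s * p.2)).inv₀ hne).const_mul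
        ((m ^ 2 - 2 * m * (s * p.2) : ℝ) : ℂ)).const_sub 1).const_mul
          ((w p.1 ^ 2 * rayNum (b p.1) p.2 : ℝ) : ℂ)
      rwa [mul_inv_cancel₀ hne, sub_self, mul_zero] at this)
  rw [integral_zero] at hlim
  exact ⟨hlim, fun ε => integrable_coneBelow_of_bound (hmeas ε) (hbd ε)⟩

/-- The residue term has no integrable bound uniform in ε. It is integrated exactly along each ray
instead, and the result is continuous in ε on the compact sphere. -/
lemma tendsto_integral_pole (hm : 0 < m) (hE : ∀ n, 0 < E - w n * (m / 2)) (hw : Continuous w)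
    (hb : Continuous b) (hΛ : m / 2 < Λ) :
    Tendsto (fun ε => ∫ p, ((w p.1 ^ 2 * rayNum (b p.1) (m / 2) : ℝ) : ℂ) *
      (rayDen m E ε (w p.1) p.2)⁻¹ ∂(coneBelow Λ)) (𝓝[>] 0)
      (𝓝 (((∫ n, w n ^ 2 * rayNum (b n) (m / 2) ∂sphereMeasure : ℝ) : ℂ) *
        (-(1 / (2 * m)) * (Real.log ((2 * Λ - m) / m) + Complex.I * Real.pi)))) ∧
    ∀ ε, 0 < ε → Integrable (fun p => ((w p.1 ^ 2 * rayNum (b p.1) (m / 2) : ℝ) : ℂ) *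
      (rayDen m E ε (w p.1) p.2)⁻¹) (coneBelow Λ) := by
  have hΛ0 : 0 < Λ := (half_pos hm).trans hΛ
  have hint : ∀ ε, 0 < ε → Integrable (fun p => ((w p.1 ^ 2 * rayNum (b p.1) (m / 2) : ℝ) : ℂ) *
      (rayDen m E ε (w p.1) p.2)⁻¹) (coneBelow Λ) := by
    intro ε hε
    have hc : Continuous fun p : Sph × ℝ => ((w p.1 ^ 2 * rayNum (b p.1) (m / 2) : ℝ) : ℂ) *
        (rayDen m E ε (w p.1) p.2)⁻¹ := by
      refine Continuous.mul (by unfold rayNum; fun_prop) (Continuous.inv₀ ?_ fun p =>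
        rayDen_ne_zero hm (hE p.1) hε)
      unfold rayDen; fun_prop
    have h1 : IntegrableOn (fun p : Sph × ℝ => ((w p.1 ^ 2 * rayNum (b p.1) (m / 2) : ℝ) : ℂ) *
        (rayDen m E ε (w p.1) p.2)⁻¹) (Set.univ ×ˢ Set.Icc 0 Λ) (sphereMeasure.prod volume) :=
      hc.continuousOn.integrableOn_compact (isCompact_univ.prod isCompact_Icc)
    have h2 := h1.mono_set (Set.prod_mono_right (s := Set.univ) Set.Ioc_subset_Icc_self)
    rwa [IntegrableOn, ← Measure.prod_restrict, Measure.restrict_univ] at h2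
  refine ⟨?_, hint⟩
  have h1 : ∀ ε, 0 < ε → ∫ p, ((w p.1 ^ 2 * rayNum (b p.1) (m / 2) : ℝ) : ℂ) *
      (rayDen m E ε (w p.1) p.2)⁻¹ ∂(coneBelow Λ) =
        ∫ n in Set.univ, ((w n ^ 2 * rayNum (b n) (m / 2) : ℝ) : ℂ) * rayLog m E ε (w n) Λ
          ∂sphereMeasure := by
    intro ε hε
    rw [integral_prod _ (hint ε hε), Measure.restrict_univ]
    refine integral_congr_ae (Eventually.of_forall fun n => ?_)
    simp only
    rw [integral_const_mul, ← intervalIntegral.integral_of_le hΛ0.le,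
      integral_inv_rayDen hm (hE n) hε]
  have hcont : Continuous fun ε => ∫ n in Set.univ, ((w n ^ 2 * rayNum (b n) (m / 2) : ℝ) : ℂ) *
      rayLog m E ε (w n) Λ ∂sphereMeasure := by
    refine continuous_parametric_integral_of_continuous ?_ isCompact_univ
    refine Continuous.mul (by unfold rayNum; fun_prop) ?_
    exact continuous_rayLog hm hΛ continuous_fst (hw.comp continuous_snd)
  have h2 := (hcont.tendsto 0).mono_left (nhdsWithin_le_nhds (s := Set.Ioi 0))
  have h3 : ∫ n in Set.univ, ((w n ^ 2 * rayNum (b n) (m / 2) : ℝ) : ℂ) * rayLog m E 0 (w n) Λ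
      ∂sphereMeasure = ((∫ n, w n ^ 2 * rayNum (b n) (m / 2) ∂sphereMeasure : ℝ) : ℂ) *
        (-(1 / (2 * m)) * (Real.log ((2 * Λ - m) / m) + Complex.I * Real.pi)) := by
    simp only [rayLog_zero hm hΛ]
    rw [integral_mul_const, Measure.restrict_univ]
    congr 1
    exact integral_ofReal
  rw [h3] at h2
  refine h2.congr' ?_
  filter_upwards [self_mem_nhdsWithin] with ε hε
  exact (h1 ε hε).symm

/-- The loop integrand along the rays, for the coefficients `A` and `B` of the two tensors. -/
noncomputable def rayIntegrand (m E : ℝ) (w b : Sph → ℝ) (A B : ℂ) (ε : ℝ) (p : Sph × ℝ) : ℂ :=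
  ((w p.1 ^ 2 * rayNum (b p.1) p.2 : ℝ) : ℂ) *
    (A * ((rayDen m E ε (w p.1) p.2)⁻¹ + (rayDen m E ε (w p.1) (-p.2))⁻¹) +
      B * ((1 - ((m ^ 2 - 2 * m * p.2 : ℝ) : ℂ) * (rayDen m E ε (w p.1) p.2)⁻¹) +
        (1 - ((m ^ 2 + 2 * m * p.2 : ℝ) : ℂ) * (rayDen m E ε (w p.1) (-p.2))⁻¹)))

/-- Five pieces: on the forward half the numerator minus its value at the pole and that value
itself, the backward half, and the mismatch on either half. The coefficient `B` of the metric
disappears in the limit. -/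
lemma tendsto_integral_rayIntegrand (hm : 0 < m) (hE : ∀ n, 0 < E - w n * (m / 2))
    (hw : Continuous w) (hb : Continuous b) (hΛ : m / 2 < Λ) (A B : ℂ) :
    Tendsto (fun ε => ∫ p, rayIntegrand m E w b A B ε p ∂(coneBelow Λ)) (𝓝[>] 0)
      (𝓝 (A * (((∫ p, w p.1 ^ 2 * (rayNum (b p.1) p.2 - rayNum (b p.1) (m / 2)) /
          (m ^ 2 - 2 * m * p.2) ∂(coneBelow Λ) : ℝ) : ℂ) +
        ((∫ n, w n ^ 2 * rayNum (b n) (m / 2) ∂sphereMeasure : ℝ) : ℂ) *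
          (-(1 / (2 * m)) * (Real.log ((2 * Λ - m) / m) + Complex.I * Real.pi)) +
        ((∫ p, w p.1 ^ 2 * rayNum (b p.1) p.2 / (m ^ 2 + 2 * m * p.2) ∂(coneBelow Λ) : ℝ) : ℂ)))) := by
  obtain ⟨l1, i1⟩ := tendsto_integral_subtracted (E := E) (Λ := Λ) hm hw hb
  obtain ⟨l2, i2⟩ := tendsto_integral_pole hm hE hw hb hΛ
  obtain ⟨l3, i3⟩ := tendsto_integral_regular (E := E) (Λ := Λ) hm hw hb
  obtain ⟨l4, i4⟩ := tendsto_integral_remainder (E := E) (Λ := Λ) hm hw hb (s := 1) (Or.inl rfl)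
  obtain ⟨l5, i5⟩ := tendsto_integral_remainder (E := E) (Λ := Λ) hm hw hb (s := -1) (Or.inr rfl)
  have h := (((l1.add l2).add l3).const_mul A).add ((l4.add l5).const_mul B)
  rw [add_zero, mul_zero, add_zero] at h
  convert h.congr' ?_ using 1
  · congr 4
    · exact integral_ofReal.symm
    · exact integral_ofReal.symm
  filter_upwards [self_mem_nhdsWithin] with ε hε
  rw [← integral_linear_combination (i1 ε) (i2 ε hε) (i3 ε) (i4 ε) (i5 ε)]
  refine integral_congr_ae (Eventually.of_forall fun p => ?_)
  simp only [rayIntegrand, one_mul, neg_mul, mul_neg, sub_neg_eq_add]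
  push_cast
  ring

lemma integrable_rayIntegrand (hm : 0 < m) (hE : ∀ n, 0 < E - w n * (m / 2))
    (hw : Continuous w) (hb : Continuous b) (s : ℝ) (A B : ℂ) {ε : ℝ}
    (hε : 0 < ε) :
    Integrable (fun p : Sph × ℝ => ((w p.1 ^ 2 * rayNum (b p.1) p.2 : ℝ) : ℂ) *
      (A * (rayDen m E ε (w p.1) (s * p.2))⁻¹ +
        B * (1 - ((m ^ 2 - 2 * m * (s * p.2) : ℝ) : ℂ) * (rayDen m E ε (w p.1) (s * p.2))⁻¹)))
      (coneBelow Λ) := by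
  have hc : Continuous fun p : Sph × ℝ => (rayDen m E ε (w p.1) (s * p.2))⁻¹ := by
    refine Continuous.inv₀ ?_ fun p => rayDen_ne_zero hm (hE p.1) hε
    unfold rayDen; fun_prop
  have hc' : Continuous fun p : Sph × ℝ => ((w p.1 ^ 2 * rayNum (b p.1) p.2 : ℝ) : ℂ) *
      (A * (rayDen m E ε (w p.1) (s * p.2))⁻¹ +
        B * (1 - ((m ^ 2 - 2 * m * (s * p.2) : ℝ) : ℂ) * (rayDen m E ε (w p.1) (s * p.2))⁻¹)) := by
    unfold rayNum; fun_prop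
  have h2 := (hc'.continuousOn.integrableOn_compact (μ := sphereMeasure.prod volume)
    (isCompact_univ.prod (isCompact_Icc (a := 0) (b := Λ)))).mono_set
      (Set.prod_mono_right (s := Set.univ) Set.Ioc_subset_Icc_self)
  rwa [IntegrableOn, ← Measure.prod_restrict, Measure.restrict_univ] at h2

end Limits

end

/-! ### The self-energy with cutoff as an integral over one energy -/

section

/-- `u - sin u`. -/
noncomputable def subSin (u : ℝ) : ℝ := u - Real.sin u

/-- The limit `ε → 0` of the self-energy with cutoff, in units of `(2π)⁻²` times the transverse
tensor. -/
noncomputable def cutoffSelfEnergy (m a Λ : ℝ) : ℂ :=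
  ((2 / a : ℝ) : ℂ) *
    (((∫ ω in (0 : ℝ)..Λ, ((subSin (a * ω) - subSin (a * m / 2)) / (m ^ 2 - 2 * m * ω) +
        subSin (a * ω) / (m ^ 2 + 2 * m * ω)) : ℝ) : ℂ) +
      ((subSin (a * m / 2) : ℝ) : ℂ) *
        (-(1 / (2 * m)) * (Real.log ((2 * Λ - m) / m) + Complex.I * Real.pi)))

section Frame

variable {k κ : Mom} {m a : ℝ}

/-- Half-angle formula and `integral_cos_ray`: the average of ω sin²(ωb/2) is proportional to ω(1 -
sinc aω). The direction of k has disappeared. -/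
lemma integral_sphere_rayNum (hm : 0 < m) (hk : mdot k k = m ^ 2) (h0 : 0 < k 0)
    (hκ : mdot k κ = 0) (ha0 : 0 < a) (ha : mdot κ κ = -a ^ 2) (ω : ℝ) :
    ∫ n : Sph, (m / mdot k (ray n)) ^ 2 * rayNum (m * mdot κ (ray n) / mdot k (ray n)) ω
      ∂sphereMeasure = 2 * Real.pi / a * subSin (a * ω) := by
  have hkp : 0 < mdot k k := by rw [hk]; positivity
  have hq : ∀ n : Sph, mdot k (ray n) ≠ 0 := fun n => (mdot_ray_pos hkp h0 n).ne'
  have h1 := integral_cos_ray hm hk h0 hκ ha (ω * m)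
  have h2 := integral_cos_ray hm hk h0 hκ ha 0
  simp only [zero_mul, zero_div, Real.cos_zero, Real.sinc_zero, mul_one] at h2
  have c1 : Continuous fun n : Sph => 1 / mdot k (ray n) ^ 2 :=
    continuous_const.div ((continuous_mdot_ray k).pow 2) fun n => pow_ne_zero 2 (hq n)
  have c2 : Continuous fun n : Sph =>
      Real.cos (ω * m * mdot κ (ray n) / mdot k (ray n)) / mdot k (ray n) ^ 2 :=
    (Real.continuous_cos.comp (((continuous_mdot_ray κ).const_mul (ω * m)).div
      (continuous_mdot_ray k) hq)).div ((continuous_mdot_ray k).pow 2)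
        fun n => pow_ne_zero 2 (hq n)
  have hint : ∀ {f : Sph → ℝ}, Continuous f → Integrable f sphereMeasure := fun hf =>
    hf.integrable_of_hasCompactSupport (HasCompactSupport.of_compactSpace _)
  have e : ∀ n : Sph, (m / mdot k (ray n)) ^ 2 *
      rayNum (m * mdot κ (ray n) / mdot k (ray n)) ω = ω * m ^ 2 / 2 *
        (1 / mdot k (ray n) ^ 2 -
          Real.cos (ω * m * mdot κ (ray n) / mdot k (ray n)) / mdot k (ray n) ^ 2) := by
    intro n
    have hc := Real.cos_sq' (ω * (m * mdot κ (ray n) / mdot k (ray n)) / 2)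
    have hc2 := Real.cos_two_mul (ω * (m * mdot κ (ray n) / mdot k (ray n)) / 2)
    rw [show 2 * (ω * (m * mdot κ (ray n) / mdot k (ray n)) / 2) =
      ω * m * mdot κ (ray n) / mdot k (ray n) by ring, hc] at hc2
    rw [hc2, rayNum]
    have := hq n
    field_simp
    ring
  simp only [e]
  rw [integral_const_mul, integral_sub (hint c1) (hint c2), h1, h2]
  rcases eq_or_ne ω 0 with rfl | hω
  · simp [subSin]
  · rw [Real.sinc_of_ne_zero (by positivity), subSin, show ω * m * a / m = a * ω by field_simp]
    field_simp
    ring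

end Frame

lemma integrable_ofReal_iff {X : Type*} [MeasurableSpace X] {μ : Measure X} {f : X → ℝ}
    (h : Integrable (fun x => (f x : ℂ)) μ) : Integrable f μ := by
  simpa using h.re

section Frame

variable {k κ : Mom} {m a Λ : ℝ}

lemma continuous_frame (hm : 0 < m) (hk : mdot k k = m ^ 2) (h0 : 0 < k 0) (x : Mom) (y : ℝ) :
    Continuous fun n : Sph => y * mdot x (ray n) / mdot k (ray n) := by
  have hkp : 0 < mdot k k := by rw [hk]; positivity
  exact ((continuous_mdot_ray x).const_mul y).div (continuous_mdot_ray k)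
    fun n => (mdot_ray_pos hkp h0 n).ne'

lemma continuous_frame' (hm : 0 < m) (hk : mdot k k = m ^ 2) (h0 : 0 < k 0) :
    Continuous fun n : Sph => m / mdot k (ray n) := by
  have hkp : 0 < mdot k k := by rw [hk]; positivity
  exact continuous_const.div (continuous_mdot_ray k) fun n => (mdot_ray_pos hkp h0 n).ne'

/-- At the pole a momentum k decays into two lightlike ones. The energy of l is at most (k₀ +
|𝐤|)/2, less than k₀, so the retarded prescription has a definite sign there. -/
lemma energy_pos_of_pole (hm : 0 < m) (hk : mdot k k = m ^ 2) (h0 : 0 < k 0) (n : Sph) :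
    0 < k 0 - m / mdot k (ray n) * (m / 2) := by
  have hkp : 0 < mdot k k := by rw [hk]; positivity
  have hq := mdot_ray_pos hkp h0 n
  have hge := mdot_ray_ge (k := k) n
  have hs := norm_spatial_lt hkp h0
  have hsq := norm_spatial_sq k
  rw [hk] at hsq
  rw [sub_pos, ← mul_div_assoc, div_mul_eq_mul_div, div_div, div_lt_iff₀ (by positivity)]
  have h1 : m * m = (k 0 - ‖spatial k‖) * (k 0 + ‖spatial k‖) := by nlinarith
  rw [h1]
  calc (k 0 - ‖spatial k‖) * (k 0 + ‖spatial k‖)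
      < (k 0 - ‖spatial k‖) * (2 * k 0) := by
        apply mul_lt_mul_of_pos_left <;> linarith
    _ ≤ mdot k (ray n) * (2 * k 0) := by
        apply mul_le_mul_of_nonneg_right hge; linarith
    _ = _ := by ring

/-- By Fubini the sphere is integrated first; the denominators do not depend on the direction at ε =
0. -/
lemma cutoffSelfEnergy_eq (hm : 0 < m) (hk : mdot k k = m ^ 2) (h0 : 0 < k 0)
    (hκ : mdot k κ = 0) (ha0 : 0 < a) (ha : mdot κ κ = -a ^ 2) (hΛ : m / 2 < Λ) {w b : Sph → ℝ}
    (hw : w = fun n : Sph => m / mdot k (ray n))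
    (hb : b = fun n : Sph => m * mdot κ (ray n) / mdot k (ray n)) :
    (((∫ p, w p.1 ^ 2 * (rayNum (b p.1) p.2 - rayNum (b p.1) (m / 2)) /
          (m ^ 2 - 2 * m * p.2) ∂(coneBelow Λ) : ℝ) : ℂ) +
        ((∫ n, w n ^ 2 * rayNum (b n) (m / 2) ∂sphereMeasure : ℝ) : ℂ) *
          (-(1 / (2 * m)) * (Real.log ((2 * Λ - m) / m) + Complex.I * Real.pi)) +
        ((∫ p, w p.1 ^ 2 * rayNum (b p.1) p.2 / (m ^ 2 + 2 * m * p.2) ∂(coneBelow Λ) : ℝ) : ℂ)) =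
      Real.pi * cutoffSelfEnergy m a Λ := by
  have hΛ0 : 0 < Λ := (half_pos hm).trans hΛ
  have hwc : Continuous w := hw ▸ continuous_frame' hm hk h0
  have hbc : Continuous b := hb ▸ continuous_frame hm hk h0 κ m
  have hN : ∀ ω, ∫ n, w n ^ 2 * rayNum (b n) ω ∂sphereMeasure = 2 * Real.pi / a * subSin (a * ω) :=
    fun ω => by rw [hw, hb]; exact integral_sphere_rayNum hm hk h0 hκ ha0 ha ω
  have hint : ∀ ω, Integrable (fun n => w n ^ 2 * rayNum (b n) ω) sphereMeasure := fun ω =>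
    Continuous.integrable_of_hasCompactSupport (by unfold rayNum; fun_prop)
      (HasCompactSupport.of_compactSpace _)
  have i1 : Integrable (fun p : Sph × ℝ => w p.1 ^ 2 * (rayNum (b p.1) p.2 -
      rayNum (b p.1) (m / 2)) / (m ^ 2 - 2 * m * p.2)) (coneBelow Λ) := by
    refine integrable_ofReal_iff (((tendsto_integral_subtracted (E := 0) (Λ := Λ) hm hwc hbc).2
      0).congr (Eventually.of_forall fun p => ?_))
    simp [rayDen, div_eq_mul_inv]
  have i2 : Integrable (fun p : Sph × ℝ => w p.1 ^ 2 * rayNum (b p.1) p.2 /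
      (m ^ 2 + 2 * m * p.2)) (coneBelow Λ) := by
    refine integrable_ofReal_iff (((tendsto_integral_regular (E := 0) (Λ := Λ) hm hwc hbc).2
      0).congr (Eventually.of_forall fun p => ?_))
    simp [rayDen, div_eq_mul_inv]
  have e1 : ∀ ω, ∫ n, w n ^ 2 * (rayNum (b n) ω - rayNum (b n) (m / 2)) / (m ^ 2 - 2 * m * ω)
      ∂sphereMeasure = 2 * Real.pi / a * ((subSin (a * ω) - subSin (a * m / 2)) /
        (m ^ 2 - 2 * m * ω)) := by
    intro ω
    simp only [mul_sub]
    rw [integral_div, integral_sub (hint _) (hint _), hN, hN, mul_div_assoc a m 2]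
    ring
  have e2 : ∀ ω, ∫ n, w n ^ 2 * rayNum (b n) ω / (m ^ 2 + 2 * m * ω)
      ∂sphereMeasure = 2 * Real.pi / a * (subSin (a * ω) / (m ^ 2 + 2 * m * ω)) := by
    intro ω
    rw [integral_div, hN]; ring
  have j1 := i1.integral_prod_right
  have j2 := i2.integral_prod_right
  simp only [e1] at j1
  simp only [e2] at j2
  have hne : (2 * Real.pi / a) ≠ 0 := by positivity
  rw [integrable_const_mul_iff (IsUnit.mk0 _ hne)] at j1 j2
  rw [integral_prod_symm _ i1, integral_prod_symm _ i2, hN]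
  simp only [e1, e2]
  rw [integral_const_mul, integral_const_mul, cutoffSelfEnergy,
    intervalIntegral.integral_of_le hΛ0.le, integral_add j1 j2, mul_div_assoc a m 2]
  push_cast
  ring

end Frame

/-- The self-energy integrand on the cone. -/
noncomputable def coneIntegrand (Θ : Matrix (Fin 4) (Fin 4) ℝ) (ε : ℝ) (k : Mom) (T g : ℝ)
    (l : Mom) : ℂ :=
  ((Real.sin (twist Θ k l / 2) ^ 2 : ℝ) : ℂ) *
    (-4 * (T : ℂ) * retProp ε (k - l) - 6 * ((2 * Real.pi : ℝ) : ℂ) ^ (-2 : ℤ) * (g : ℂ) *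
      (1 + ((2 * Real.pi : ℝ) : ℂ) ^ 2 * ((mdot (k - l) (k - l) : ℝ) : ℂ) * retProp ε (k - l)))

lemma measurable_coneIntegrand (Θ : Matrix (Fin 4) (Fin 4) ℝ) (ε : ℝ) (k : Mom) (T g : ℝ) :
    Measurable (coneIntegrand Θ ε k T g) := by
  have h1 : Measurable fun l : Mom => mdot (k - l) (k - l) := by
    simp only [mdot_four, Pi.sub_apply]; fun_prop
  have h2 : Measurable fun l : Mom => twist Θ k l := by
    simp only [twist, mdot_four]; fun_prop
  have h3 : Measurable fun l : Mom => retProp ε (k - l) := by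
    simp only [retProp, Pi.sub_apply]; fun_prop
  unfold coneIntegrand
  fun_prop

section Assembly

variable {Θ : Matrix (Fin 4) (Fin 4) ℝ} {k : Mom} {m a Λ : ℝ}

lemma coneIntegrand_ray (hm : 0 < m) (hk : mdot k k = m ^ 2) (h0 : 0 < k 0) (ε T g : ℝ) (n : Sph)
    (s ω : ℝ) (hs : s = 1 ∨ s = -1) :
    (((4 * Real.pi)⁻¹ * (m / mdot k (ray n)) ^ 2 * ω : ℝ) : ℂ) *
        coneIntegrand Θ ε k T g (s • (ω * (m / mdot k (ray n))) • ray n) =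
      (((m / mdot k (ray n)) ^ 2 *
          rayNum (m * mdot (kTheta Θ k) (ray n) / mdot k (ray n)) ω : ℝ) : ℂ) *
        -- The coefficient -4T, the prefactor -(2π)⁻² of the propagator and the density 1/(4π)
        -- combine to T(2π)⁻²/π.
        ((T * ((2 * Real.pi : ℝ) : ℂ) ^ (-2 : ℤ) / Real.pi) *
            (rayDen m (k 0) ε (m / mdot k (ray n)) (s * ω))⁻¹ +
          (-6 * g * ((2 * Real.pi : ℝ) : ℂ) ^ (-2 : ℤ) / (4 * Real.pi)) *
            (1 - ((m ^ 2 - 2 * m * (s * ω) : ℝ) : ℂ) *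
              (rayDen m (k 0) ε (m / mdot k (ray n)) (s * ω))⁻¹)) := by
  have hkp : 0 < mdot k k := by rw [hk]; positivity
  have hq := (mdot_ray_pos hkp h0 n).ne'
  set q := mdot k (ray n) with hqd
  set l : Mom := s • (ω * (m / q)) • ray n with hl
  have t1 : twist Θ k l = s * (ω * (m * mdot (kTheta Θ k) (ray n) / q)) := by
    rw [hl, twist, mdot_smul_right, mdot_smul_right]; ring
  have t2 : mdot (k - l) (k - l) = m ^ 2 - 2 * m * (s * ω) := by
    rw [mdot_sub_self, hk, hl, mdot_smul_right, mdot_smul_right, mdot_smul_left, mdot_smul_left,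
      mdot_smul_right, mdot_smul_right, mdot_ray_self, ← hqd]
    field_simp
    ring
  have t3 : (k - l) 0 = k 0 - m / q * (s * ω) := by
    simp [hl, ray]; ring
  have t4 : retProp ε (k - l) = -((2 * Real.pi : ℝ) : ℂ) ^ (-2 : ℤ) *
      (rayDen m (k 0) ε (m / q) (s * ω))⁻¹ := by
    rw [retProp, t2, t3, rayDen, div_eq_mul_inv]
  have t5 : Real.sin (twist Θ k l / 2) ^ 2 =
      Real.sin (ω * (m * mdot (kTheta Θ k) (ray n) / q) / 2) ^ 2 := by
    rw [t1]
    rcases hs with rfl | rfl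
    · rw [one_mul]
    · rw [neg_one_mul, neg_div, Real.sin_neg, neg_sq]
  rw [coneIntegrand, t4, t5, t2, rayNum]
  have hpi : (Real.pi : ℂ) ≠ 0 := Complex.ofReal_ne_zero.mpr Real.pi_ne_zero
  generalize (rayDen m (k 0) ε (m / q) (s * ω))⁻¹ = z
  have hz : ((2 * Real.pi : ℝ) : ℂ) ^ (-2 : ℤ) = ((2 * (Real.pi : ℂ)) ^ 2)⁻¹ := by
    rw [_root_.zpow_neg]; push_cast; rfl
  rw [hz]
  push_cast
  field_simp
  ring

lemma tendsto_selfEnergyReg (hΘ : Θᵀ = -Θ) (hm : 0 < m) (hk : mdot k k = m ^ 2) (h0 : 0 < k 0)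
    (ha0 : 0 < a) (ha : mdot (kTheta Θ k) (kTheta Θ k) = -a ^ 2) (hΛ : m / 2 < Λ) (μ ν : Fin 4) :
    Tendsto (fun ε => selfEnergyReg Θ ε Λ k μ ν) (𝓝[>] 0)
      (𝓝 (((2 * Real.pi : ℝ) : ℂ) ^ (-2 : ℤ) * ((transverse k μ ν : ℝ) : ℂ) *
        cutoffSelfEnergy m a Λ)) := by
  have hkp : 0 < mdot k k := by rw [hk]; positivity
  have hκ : mdot k (kTheta Θ k) = 0 := by rw [mdot_comm]; exact twist_self hΘ k
  -- With this rescaling the radial coordinate is |k·l|/m, the loop energy in the rest frame of k,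
  -- and the cutoff region is the same interval on every ray.
  set w : Sph → ℝ := fun n => m / mdot k (ray n) with hw
  set b : Sph → ℝ := fun n => m * mdot (kTheta Θ k) (ray n) / mdot k (ray n) with hb
  have hwc : Continuous w := continuous_frame' hm hk h0
  have hbc : Continuous b := continuous_frame hm hk h0 (kTheta Θ k) m
  have hw0 : ∀ n, 0 < w n := fun n => div_pos hm (mdot_ray_pos hkp h0 n)
  have hE : ∀ n, 0 < k 0 - w n * (m / 2) := energy_pos_of_pole hm hk h0
  have hsqrt : √(mdot k k) = m := by rw [hk, Real.sqrt_sq hm.le]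
  set S : Set Mom := {l | |mdot k l| ≤ Λ * √(mdot k k)} with hS
  have hSm : MeasurableSet S := by
    have : Measurable fun l : Mom => |mdot k l| := by simp only [mdot_four]; fun_prop
    exact measurableSet_le this measurable_const
  have hneg : ∀ l, -l ∈ S ↔ l ∈ S := fun l => by
    simp only [hS, Set.mem_ofPred_eq, mdot_neg_right, abs_neg]
  have hSΛ : ∀ (n : Sph) (r : ℝ), 0 < r → ((r * w n) • ray (n : Mom3) ∈ S ↔ r ≤ Λ) := by
    intro n r hr
    have hq := mdot_ray_pos hkp h0 n
    have e : mdot k ((r * w n) • ray (n : Mom3)) = r * m := by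
      rw [mdot_smul_right]; simp only [hw]; field_simp
    rw [hS, Set.mem_ofPred_eq, e, hsqrt, abs_of_pos (by positivity)]
    exact mul_le_mul_iff_left₀ hm
  set T := transverse k μ ν
  set g := metric μ ν
  set A : ℂ := T * ((2 * Real.pi : ℝ) : ℂ) ^ (-2 : ℤ) / Real.pi with hA
  set B : ℂ := -6 * g * ((2 * Real.pi : ℝ) : ℂ) ^ (-2 : ℤ) / (4 * Real.pi) with hB
  have hlim := tendsto_integral_rayIntegrand hm hE hwc hbc hΛ A B
  rw [cutoffSelfEnergy_eq hm hk h0 hκ ha0 ha hΛ hw hb, hA, ← mul_assoc, div_mul_cancel₀ _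
    (Complex.ofReal_ne_zero.mpr Real.pi_ne_zero), mul_comm (T : ℂ)] at hlim
  refine hlim.congr' ?_
  filter_upwards [self_mem_nhdsWithin] with ε hε
  have hG := measurable_coneIntegrand Θ ε k T g
  have hray : ∀ (s : ℝ), s = 1 ∨ s = -1 → ∀ p : Sph × ℝ, _ := fun s hs p =>
    coneIntegrand_ray (Θ := Θ) hm hk h0 ε T g p.1 s p.2 hs
  have c1 := integrable_restrict_deltaPlus_zero hwc.measurable hw0 hSm hSΛ hG
  have c2 := integrable_restrict_deltaPlus_zero hwc.measurable hw0 hSm hSΛ (hG.comp measurable_neg)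
  have I1 : Integrable (coneIntegrand Θ ε k T g) ((deltaPlus 0).restrict S) := by
    refine c1.1.2 ((integrable_rayIntegrand hm hE hwc hbc 1 A B hε).congr
      (Eventually.of_forall fun p => ?_))
    have := hray 1 (Or.inl rfl) p
    rw [one_smul] at this
    exact this.symm
  have I2 : Integrable (fun l => coneIntegrand Θ ε k T g (-l)) ((deltaPlus 0).restrict S) := by
    refine c2.1.2 ((integrable_rayIntegrand hm hE hwc hbc (-1) A B hε).congr
      (Eventually.of_forall fun p => ?_))
    have := hray (-1) (Or.inr rfl) p
    rw [neg_one_smul] at this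
    exact this.symm
  have e1 : selfEnergyReg Θ ε Λ k μ ν = ∫ l in S, coneIntegrand Θ ε k T g l ∂deltaOne := by
    refine integral_congr_ae (ae_restrict_of_ae ?_)
    filter_upwards [ae_deltaOne] with l hl
    exact selfEnergy_integrand hΘ ε k l hl μ ν
  rw [e1, integral_restrict_deltaOne hSm hneg I1 I2,
    (integrable_restrict_deltaPlus_zero hwc.measurable hw0 hSm hSΛ
      (F := fun l => coneIntegrand Θ ε k T g l + coneIntegrand Θ ε k T g (-l))
      (hG.add (hG.comp measurable_neg))).2]
  refine integral_congr_ae (Eventually.of_forall fun p => ?_)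
  have h1 := hray 1 (Or.inl rfl) p
  have h2 := hray (-1) (Or.inr rfl) p
  rw [one_smul] at h1
  rw [neg_one_smul] at h2
  simp only
  rw [mul_add]
  refine Eq.trans ?_ (congrArg₂ (· + ·) h1 h2).symm
  simp only [rayIntegrand, one_mul, neg_mul, mul_neg, sub_neg_eq_add, hw, hb, hB]
  ring

end Assembly

end

/-! ### Sine and cosine integrals and the removal of the cutoff -/

section

/-- `(1 - cos v) / v`. -/
noncomputable def cinc (v : ℝ) : ℝ := v / 2 * Real.sinc (v / 2) ^ 2

lemma continuous_cinc : Continuous cinc := by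
  have := Real.continuous_sinc
  unfold cinc; fun_prop

lemma cinc_eq {v : ℝ} (hv : v ≠ 0) : cinc v = (1 - Real.cos v) / v := by
  have h := Real.cos_two_mul (v / 2)
  rw [mul_div_cancel₀ _ (two_ne_zero)] at h
  rw [cinc, Real.sinc_of_ne_zero (by positivity), h, Real.cos_sq']
  field_simp
  ring

lemma cinc_neg (v : ℝ) : cinc (-v) = -cinc v := by
  rw [cinc, cinc, neg_div, Real.sinc_neg]; ring

lemma abs_cinc_le (v : ℝ) : |cinc v| ≤ |v| / 2 := by
  rw [cinc, abs_mul, abs_div, abs_two, abs_pow]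
  have h := Real.abs_sinc_le_one (v / 2)
  calc |v| / 2 * |Real.sinc (v / 2)| ^ 2 ≤ |v| / 2 * 1 ^ 2 := by gcongr
    _ = _ := by ring

/-- The sine integral. -/
noncomputable def sinIntegral (x : ℝ) : ℝ := ∫ v in (0 : ℝ)..x, Real.sinc v

/-- The entire cosine integral `∫₀ˣ (1 - cos v) / v dv`. -/
noncomputable def cosIntegral (x : ℝ) : ℝ := ∫ v in (0 : ℝ)..x, cinc v

lemma hasDerivAt_sinIntegral (x : ℝ) : HasDerivAt sinIntegral (Real.sinc x) x :=
  intervalIntegral.integral_hasDerivAt_right (Real.continuous_sinc.intervalIntegrable _ _)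
    (Real.continuous_sinc.stronglyMeasurableAtFilter _ _) Real.continuous_sinc.continuousAt

lemma hasDerivAt_cosIntegral (x : ℝ) : HasDerivAt cosIntegral (cinc x) x :=
  intervalIntegral.integral_hasDerivAt_right (continuous_cinc.intervalIntegrable _ _)
    (continuous_cinc.stronglyMeasurableAtFilter _ _) continuous_cinc.continuousAt

lemma sinIntegral_neg (x : ℝ) : sinIntegral (-x) = -sinIntegral x := by
  have h := intervalIntegral.integral_comp_neg (a := 0) (b := x) Real.sinc
  simp only [Real.sinc_neg, neg_zero] at h
  rw [sinIntegral, sinIntegral, h, intervalIntegral.integral_symm]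

lemma cosIntegral_neg (x : ℝ) : cosIntegral (-x) = cosIntegral x := by
  have h := intervalIntegral.integral_comp_neg (a := 0) (b := x) cinc
  simp only [cinc_neg, neg_zero, intervalIntegral.integral_neg] at h
  rw [cosIntegral, cosIntegral, intervalIntegral.integral_symm, ← h, neg_neg]

/-- The limit of `∫₀ʸ (1 - cos v) / v dv - ln y`. -/
noncomputable def cosIntegralConst : ℝ :=
  limUnder atTop fun y => cosIntegral y - Real.log y + Real.sin y / y

/-- Adding sin y / y amounts to an integration by parts: the derivative becomes -sin y / y², which
is absolutely integrable. The value of the constant is not needed. -/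
lemma tendsto_cosIntegral_sub_log :
    Tendsto (fun y => cosIntegral y - Real.log y) atTop (𝓝 cosIntegralConst) := by
  have hd : ∀ y ∈ Set.Ioi (1 : ℝ), HasDerivAt
      (fun y => cosIntegral y - Real.log y + Real.sin y / y) (-(Real.sin y / y ^ 2)) y := by
    intro y hy
    have hy0 : y ≠ 0 := (zero_lt_one.trans hy).ne'
    have h := ((hasDerivAt_cosIntegral y).sub (Real.hasDerivAt_log hy0)).add
      ((Real.hasDerivAt_sin y).div (hasDerivAt_id y) hy0)
    have h' : HasDerivAt (fun y => cosIntegral y - Real.log y + Real.sin y / y) _ y := h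
    refine h'.congr_deriv ?_
    rw [cinc_eq hy0]
    simp only [id]
    field_simp
    ring
  have hint : IntegrableOn (fun y : ℝ => -(Real.sin y / y ^ 2)) (Set.Ioi 1) := by
    have h2 := integrableOn_Ioi_rpow_of_lt (by norm_num : (-2 : ℝ) < -1) zero_lt_one
    refine Integrable.mono' h2 ?_ ?_
    · exact (by fun_prop : Measurable fun y : ℝ => -(Real.sin y / y ^ 2)).aestronglyMeasurable
    · filter_upwards [ae_restrict_mem measurableSet_Ioi] with y hy
      have hy0 : 0 < y := zero_lt_one.trans hy
      rw [norm_neg, Real.norm_eq_abs, abs_div, abs_of_pos (pow_pos hy0 2),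
        Real.rpow_neg hy0.le, Real.rpow_two, ← one_div]
      gcongr
      exact Real.abs_sin_le_one y
  have h1 := tendsto_limUnder_of_hasDerivAt_of_integrableOn_Ioi hd hint
  have h2 : Tendsto (fun y : ℝ => Real.sin y / y) atTop (𝓝 0) := by
    refine squeeze_zero_norm' ?_ tendsto_inv_atTop_zero
    filter_upwards [eventually_gt_atTop 0] with y hy
    rw [norm_div, Real.norm_eq_abs, Real.norm_eq_abs, abs_of_pos hy, ← one_div]
    gcongr
    exact Real.abs_sin_le_one y
  have h3 := h1.sub h2
  rw [sub_zero] at h3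
  refine h3.congr fun y => ?_
  ring

lemma tendsto_sinIntegral_sub {a : ℝ} (ha : 0 < a) (τ : ℝ) :
    Tendsto (fun x => sinIntegral (a * x - τ) - sinIntegral (a * x + τ)) atTop (𝓝 0) := by
  have hlin : Tendsto (fun x : ℝ => a * x - |τ|) atTop atTop :=
    tendsto_atTop_add_const_right _ _ (tendsto_id.const_mul_atTop ha)
  have h0 : Tendsto (fun x : ℝ => (a * x - |τ|)⁻¹ * (2 * |τ|)) atTop (𝓝 0) := by
    simpa using (tendsto_inv_atTop_zero.comp hlin).mul_const (2 * |τ|)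
  refine squeeze_zero_norm' ?_ h0
  filter_upwards [hlin.eventually_gt_atTop 0] with x hx
  rw [sinIntegral, sinIntegral, intervalIntegral.integral_interval_sub_left
    (Real.continuous_sinc.intervalIntegrable _ _) (Real.continuous_sinc.intervalIntegrable _ _)]
  have := intervalIntegral.norm_integral_le_of_norm_le_const (a := a * x + τ) (b := a * x - τ)
    (f := Real.sinc) (C := (a * x - |τ|)⁻¹) (fun v hv => by
      have hv' : a * x - |τ| ≤ v := by
        have h1 := hv.1
        have : a * x - |τ| ≤ min (a * x + τ) (a * x - τ) :=
          le_min (by linarith [neg_abs_le τ]) (by linarith [le_abs_self τ])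
        exact this.trans h1.le
      have hv0 : 0 < v := hx.trans_le hv'
      rw [Real.sinc_of_ne_zero hv0.ne', norm_div, Real.norm_eq_abs, Real.norm_eq_abs,
        abs_of_pos hv0, ← one_div]
      exact div_le_div₀ zero_le_one (Real.abs_sin_le_one v) hx hv')
  refine this.trans (le_of_eq ?_)
  rw [show a * x - τ - (a * x + τ) = -(2 * τ) by ring, abs_neg, abs_mul, abs_two]

lemma tendsto_log_affine_sub {a : ℝ} (ha : 0 < a) (τ : ℝ) :
    Tendsto (fun x => Real.log (a * x + τ) - Real.log x) atTop (𝓝 (Real.log a)) := by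
  have h1 : Tendsto (fun x : ℝ => a + τ * x⁻¹) atTop (𝓝 a) := by
    simpa using (tendsto_inv_atTop_zero.const_mul τ).const_add a
  refine ((Real.continuousAt_log ha.ne').tendsto.comp h1).congr' ?_
  have hlin : Tendsto (fun x : ℝ => a * x + τ) atTop atTop :=
    tendsto_atTop_add_const_right _ _ (tendsto_id.const_mul_atTop ha)
  filter_upwards [eventually_gt_atTop 0, hlin.eventually_gt_atTop 0] with x hx hx2
  rw [← Real.log_div hx2.ne' hx.ne']
  simp only [Function.comp_apply]
  congr 1
  field_simp

/-- The remainder of the renormalized self-energy. -/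
noncomputable def selfEnergyRem (τ : ℝ) : ℂ :=
  (((Real.sinc τ - 1) * (Real.log τ + cosIntegralConst) +
      (1 - Real.cos τ * sinIntegral τ / τ) - Real.sinc τ * cosIntegral τ : ℝ) : ℂ) +
    Complex.I * ((Real.pi / 2 * (1 - Real.sinc τ) : ℝ) : ℂ)

/-- A primitive of the self-energy integrand. -/
noncomputable def cutoffPrimitive (τ u : ℝ) : ℝ :=
  (Real.sin τ - τ) * Real.log (u + τ) +
    Real.cos τ * (sinIntegral (u - τ) - sinIntegral (u + τ)) -
    Real.sin τ * (cosIntegral (u - τ) + cosIntegral (u + τ))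

/-- Expanding sin u about ±τ with the addition theorems reduces the two quotients to sinc, (1 - cos
v)/v and 1/(u+τ) at the shifted arguments. -/
lemma integral_subSin {τ X : ℝ} (hτ : 0 < τ) (hX : 0 < X) :
    ∫ u in (0 : ℝ)..X, (-((subSin u - subSin τ) / (u - τ)) + subSin u / (u + τ)) =
      cutoffPrimitive τ X - cutoffPrimitive τ 0 := by
  have hd : ∀ u ∈ Set.uIcc 0 X, HasDerivAt (cutoffPrimitive τ)
      ((Real.sin τ - τ) * (u + τ)⁻¹ + Real.cos τ * (Real.sinc (u - τ) - Real.sinc (u + τ)) -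
        Real.sin τ * (cinc (u - τ) + cinc (u + τ))) u := by
    intro u hu
    rw [Set.uIcc_of_le hX.le] at hu
    have hu' : u + τ ≠ 0 := by linarith [hu.1]
    have h1 : HasDerivAt (fun u => u + τ) 1 u := (hasDerivAt_id u).add_const τ
    have h2 : HasDerivAt (fun u => u - τ) 1 u := (hasDerivAt_id u).sub_const τ
    have k1 := (hasDerivAt_sinIntegral (u - τ)).comp u h2
    have k2 := (hasDerivAt_sinIntegral (u + τ)).comp u h1
    have k3 := (hasDerivAt_cosIntegral (u - τ)).comp u h2
    have k4 := (hasDerivAt_cosIntegral (u + τ)).comp u h1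
    have := (((h1.log hu').const_mul (Real.sin τ - τ)).add
      ((k1.sub k2).const_mul (Real.cos τ))).sub ((k3.add k4).const_mul (Real.sin τ))
    have h' : HasDerivAt (cutoffPrimitive τ) _ u := this
    exact h'.congr_deriv (by ring)
  have hc : ContinuousOn (fun u => (Real.sin τ - τ) * (u + τ)⁻¹ +
      Real.cos τ * (Real.sinc (u - τ) - Real.sinc (u + τ)) -
        Real.sin τ * (cinc (u - τ) + cinc (u + τ))) (Set.uIcc 0 X) := by
    have c1 := Real.continuous_sinc
    have c2 := continuous_cinc
    have c3 : ContinuousOn (fun u : ℝ => (u + τ)⁻¹) (Set.uIcc 0 X) := by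
      refine ContinuousOn.inv₀ (by fun_prop) fun u hu => ?_
      rw [Set.uIcc_of_le hX.le] at hu
      linarith [hu.1]
    fun_prop
  rw [← intervalIntegral.integral_eq_sub_of_hasDerivAt hd hc.intervalIntegrable]
  refine intervalIntegral.integral_congr_ae ?_
  -- At u = τ the quotient on the left is 0 by convention and the formulas may disagree; the point
  -- is negligible.
  filter_upwards [Measure.ae_ne volume τ] with u hu hmem
  rw [Set.uIoc_of_le hX.le] at hmem
  have h1 : u - τ ≠ 0 := sub_ne_zero.mpr hu
  have h2 : u + τ ≠ 0 := by linarith [hmem.1]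
  rw [Real.sinc_of_ne_zero h1, Real.sinc_of_ne_zero h2, cinc_eq h1, cinc_eq h2, Real.sin_sub,
    Real.sin_add, Real.cos_sub, Real.cos_add, subSin, subSin]
  have h3 := Real.sin_sq_add_cos_sq τ
  have e1 : -((u - Real.sin u - (τ - Real.sin τ)) / (u - τ)) =
      -1 + (Real.sin u - Real.sin τ) * (u - τ)⁻¹ := by field_simp; ring
  have e2 : (u - Real.sin u) / (u + τ) = 1 - (τ + Real.sin u) * (u + τ)⁻¹ := by field_simp; ring
  rw [e1, e2]
  simp only [div_eq_mul_inv]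
  linear_combination (-(Real.sin u) * (u - τ)⁻¹ + Real.sin u * (u + τ)⁻¹) * h3

/-- In the variable u = aω the only parameter left is τ = am/2, the position of the pole. -/
lemma cutoffSelfEnergy_closed {m a Λ : ℝ} (hm : 0 < m) (ha : 0 < a) (hΛ : m / 2 < Λ) :
    cutoffSelfEnergy m a Λ = (((2 * (a * m / 2))⁻¹ *
      (cutoffPrimitive (a * m / 2) (a * Λ) - cutoffPrimitive (a * m / 2) 0 -
        subSin (a * m / 2) * (Real.log (a * Λ + -(a * m / 2)) - Real.log (a * m / 2))) : ℝ) : ℂ) -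
      Complex.I * ((Real.pi / 2 * (1 - Real.sinc (a * m / 2)) : ℝ) : ℂ) := by
  set τ := a * m / 2 with hτd
  have hτ : 0 < τ := by positivity
  have hΛ0 : 0 < Λ := (half_pos hm).trans hΛ
  have h1 : ∫ ω in (0 : ℝ)..Λ, ((subSin (a * ω) - subSin τ) / (m ^ 2 - 2 * m * ω) +
        subSin (a * ω) / (m ^ 2 + 2 * m * ω)) =
      (2 * m)⁻¹ * (cutoffPrimitive τ (a * Λ) - cutoffPrimitive τ 0) := by
    rw [← integral_subSin hτ (by positivity : 0 < a * Λ)]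
    have := intervalIntegral.mul_integral_comp_mul_left (a := 0) (b := Λ) (c := a)
      (f := fun u => -((subSin u - subSin τ) / (u - τ)) + subSin u / (u + τ))
    rw [mul_zero] at this
    rw [← this, ← mul_assoc, ← intervalIntegral.integral_const_mul]
    refine intervalIntegral.integral_congr fun ω _ => ?_
    have e1 : m ^ 2 - 2 * m * ω = -(2 * m * a⁻¹ * (a * ω - τ)) := by
      rw [hτd]; field_simp; ring
    have e2 : m ^ 2 + 2 * m * ω = 2 * m * a⁻¹ * (a * ω + τ) := by
      rw [hτd]; field_simp; ring
    rw [e1, e2, div_neg, mul_comm (2 * m * a⁻¹), mul_comm (2 * m * a⁻¹), ← div_div, ← div_div]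
    generalize (subSin (a * ω) - subSin τ) / (a * ω - τ) = x
    field_simp
  have h2 : (2 * Λ - m) / m = (a * Λ + -τ) / τ := by
    rw [hτd]; field_simp; ring
  have h3 : 0 < a * Λ + -τ := by
    have : a * (m / 2) < a * Λ := mul_lt_mul_of_pos_left hΛ ha
    rw [hτd]; linarith
  rw [cutoffSelfEnergy, ← hτd, h1, h2, Real.log_div h3.ne' hτ.ne', Real.sinc_of_ne_zero hτ.ne']
  have e3 : m = 2 * τ / a := by rw [hτd]; field_simp
  have hτc : (τ : ℂ) ≠ 0 := Complex.ofReal_ne_zero.mpr hτ.ne'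
  have hac : (a : ℂ) ≠ 0 := Complex.ofReal_ne_zero.mpr ha.ne'
  have e4 : (subSin τ : ℂ) = τ - Real.sin τ := by rw [subSin]; push_cast; rfl
  rw [e3]
  push_cast
  rw [e4]
  push_cast
  field_simp
  ring

/-- The coefficients of ln Λ are sin τ - τ, then -2 sin τ from the two cosine integrals, and sin τ -
τ from the pole. Their sum is -2τ, and the prefactor 1/(2τ) makes it -1 for every momentum and every
Θ. This is what permits a counterterm independent of both. -/
lemma tendsto_cutoffSelfEnergy {m a : ℝ} (hm : 0 < m) (ha : 0 < a) :
    Tendsto (fun Λ => cutoffSelfEnergy m a Λ + (Real.log Λ : ℂ)) atTop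
      (𝓝 (-(((Real.log a + cosIntegralConst - 1 : ℝ) : ℂ) + selfEnergyRem (a * m / 2)))) := by
  set τ := a * m / 2 with hτd
  have hτ : 0 < τ := by positivity
  have hX1 : Tendsto (fun x : ℝ => a * x - τ) atTop atTop :=
    tendsto_atTop_add_const_right _ _ (tendsto_id.const_mul_atTop ha)
  have hX2 : Tendsto (fun x : ℝ => a * x + τ) atTop atTop :=
    tendsto_atTop_add_const_right _ _ (tendsto_id.const_mul_atTop ha)
  have d1 := tendsto_cosIntegral_sub_log.comp hX1
  have d2 := tendsto_cosIntegral_sub_log.comp hX2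
  have p := tendsto_log_affine_sub ha τ
  have q := tendsto_log_affine_sub ha (-τ)
  have s := tendsto_sinIntegral_sub ha τ
  have hreal := (((((p.const_mul (Real.sin τ - τ)).add (s.const_mul (Real.cos τ))).sub
    (((d1.add d2).add (p.add q)).const_mul (Real.sin τ))).sub (q.const_mul (subSin τ))).add_const
      (subSin τ * Real.log τ - cutoffPrimitive τ 0)).const_mul ((2 * τ)⁻¹)
  have hc := (Complex.continuous_ofReal.tendsto _).comp hreal
  have hc2 := hc.sub_const (Complex.I * ((Real.pi / 2 * (1 - Real.sinc τ) : ℝ) : ℂ))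
  convert hc2.congr' ?_ using 2
  · rw [selfEnergyRem, cutoffPrimitive, zero_add, zero_sub, sinIntegral_neg, cosIntegral_neg, subSin,
      Real.sinc_of_ne_zero hτ.ne']
    have hτc : (τ : ℂ) ≠ 0 := Complex.ofReal_ne_zero.mpr hτ.ne'
    push_cast
    field_simp
    ring
  · filter_upwards [eventually_gt_atTop (m / 2)] with Λ hΛ
    rw [cutoffSelfEnergy_closed hm ha hΛ, ← hτd]
    simp only [Function.comp_apply]
    have e : (((Real.log Λ : ℝ)) : ℂ) = (((2 * τ)⁻¹ * (2 * τ * Real.log Λ) : ℝ) : ℂ) := by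
      congr 1; field_simp
    have key : ∀ (x y z : ℝ) (w : ℂ), x = y + z → (x : ℂ) - w = (y : ℂ) - w + (z : ℂ) := by
      rintro x y z w rfl; push_cast; ring
    rw [e]
    refine key _ _ _ _ ?_
    rw [← mul_add]
    simp only [subSin, cutoffPrimitive, ← sub_eq_add_neg]
    ring

end

/-! ### Bounds on the remainder -/

section

lemma abs_sinc_sub_one_le {τ : ℝ} (hτ : 0 ≤ τ) : |Real.sinc τ - 1| ≤ 2 * τ ^ 2 := by
  rcases hτ.eq_or_lt with rfl | h0
  · simp
  rcases le_or_gt τ 1 with h1 | h1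
  · have h2 := Real.sin_gt_sub_cube h0
    have h3 := Real.sin_lt h0
    rw [Real.sinc_of_ne_zero h0.ne', abs_le]
    constructor
    · rw [neg_le_sub_iff_le_add, ← sub_le_iff_le_add, le_div_iff₀ h0]
      nlinarith [pow_pos h0 3, h2]
    · rw [sub_le_iff_le_add, div_le_iff₀ h0]
      nlinarith [pow_pos h0 3]
  · have h2 := abs_le.mp (Real.abs_sinc_le_one τ)
    rw [abs_le]
    constructor <;> nlinarith

lemma abs_one_sub_cos_le (τ : ℝ) : |1 - Real.cos τ| ≤ τ ^ 2 / 2 := by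
  rw [abs_of_nonneg (by linarith [Real.cos_le_one τ])]
  linarith [Real.one_sub_sq_div_two_le_cos (x := τ)]

lemma abs_sinIntegral_sub_le {τ : ℝ} (hτ : 0 ≤ τ) : |sinIntegral τ - τ| ≤ 2 * τ ^ 2 * τ := by
  have h1 : sinIntegral τ - τ = ∫ v in (0 : ℝ)..τ, (Real.sinc v - 1) := by
    rw [intervalIntegral.integral_sub (Real.continuous_sinc.intervalIntegrable _ _)
      (by simp), sinIntegral]
    simp
  rw [h1]
  have := intervalIntegral.norm_integral_le_of_norm_le_const (a := 0) (b := τ)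
    (f := fun v => Real.sinc v - 1) (C := 2 * τ ^ 2) (fun v hv => by
      rw [Set.uIoc_of_le hτ] at hv
      refine (abs_sinc_sub_one_le hv.1.le).trans ?_
      have := hv.1.le
      have := hv.2
      gcongr)
  simpa [abs_of_nonneg hτ] using this

lemma abs_cosIntegral_le {τ : ℝ} (hτ : 0 ≤ τ) : |cosIntegral τ| ≤ τ / 2 * τ := by
  have := intervalIntegral.norm_integral_le_of_norm_le_const (a := 0) (b := τ)
    (f := cinc) (C := τ / 2) (fun v hv => by
      rw [Set.uIoc_of_le hτ] at hv
      refine (abs_cinc_le v).trans ?_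
      rw [abs_of_pos hv.1]
      linarith [hv.2])
  simpa [abs_of_nonneg hτ, cosIntegral] using this

/-- The constant in the bound on the remainder. -/
noncomputable def remConst : ℝ := 2 * |cosIntegralConst| + 5 + Real.pi

lemma remConst_pos : 0 < remConst := by
  have := Real.pi_pos
  unfold remConst; positivity

/-- The combination is arranged so that each summand vanishes quadratically at τ = 0, up to one
factor ln τ. The quotient by τ is harmless, since the sine integral differs from τ by O(τ³). -/
lemma norm_selfEnergyRem_le {τ : ℝ} (hτ : 0 < τ) :
    ‖selfEnergyRem τ‖ ≤ remConst * τ ^ 2 * (1 + |Real.log τ|) := by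
  have h1 := abs_sinc_sub_one_le hτ.le
  have h2 := abs_one_sub_cos_le τ
  have h3 := abs_sinIntegral_sub_le hτ.le
  have h4 := abs_cosIntegral_le hτ.le
  have h5 := Real.abs_sinc_le_one τ
  have h6 := Real.abs_cos_le_one τ
  have e1 : 1 - Real.cos τ * sinIntegral τ / τ =
      (1 - Real.cos τ) - Real.cos τ * ((sinIntegral τ - τ) / τ) := by field_simp; ring
  have b1 : |1 - Real.cos τ * sinIntegral τ / τ| ≤ τ ^ 2 / 2 + 1 * (2 * τ ^ 2) := by
    rw [e1]
    refine (abs_sub _ _).trans (add_le_add h2 ?_)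
    rw [abs_mul, abs_div, abs_of_pos hτ]
    have : |sinIntegral τ - τ| / τ ≤ 2 * τ ^ 2 := (div_le_iff₀ hτ).2 h3
    gcongr
  have b2 : |(Real.sinc τ - 1) * (Real.log τ + cosIntegralConst)| ≤
      2 * τ ^ 2 * (|Real.log τ| + |cosIntegralConst|) := by
    rw [abs_mul]
    have := abs_add_le (Real.log τ) cosIntegralConst
    gcongr
  have b3 : |Real.sinc τ * cosIntegral τ| ≤ 1 * (τ / 2 * τ) := by
    rw [abs_mul]; gcongr
  have b4 : |Real.pi / 2 * (1 - Real.sinc τ)| ≤ Real.pi / 2 * (2 * τ ^ 2) := by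
    rw [abs_mul, abs_of_pos (by positivity : 0 < Real.pi / 2), abs_sub_comm]
    gcongr
  have hL := abs_nonneg (Real.log τ)
  have hγ := abs_nonneg cosIntegralConst
  have hpi := Real.pi_pos
  have key : ‖selfEnergyRem τ‖ ≤ (2 * τ ^ 2 * (|Real.log τ| + |cosIntegralConst|) +
      (τ ^ 2 / 2 + 1 * (2 * τ ^ 2)) + 1 * (τ / 2 * τ)) + Real.pi / 2 * (2 * τ ^ 2) := by
    rw [selfEnergyRem]
    refine (norm_add_le _ _).trans (add_le_add ?_ ?_)
    · rw [Complex.norm_real, Real.norm_eq_abs]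
      exact (abs_sub _ _).trans (add_le_add ((abs_add_le _ _).trans (add_le_add b2 b1)) b3)
    · rw [norm_mul, Complex.norm_I, one_mul, Complex.norm_real, Real.norm_eq_abs]
      exact b4
  refine key.trans ?_
  rw [remConst]
  have := mul_nonneg (sq_nonneg τ) hL
  have := mul_nonneg (sq_nonneg τ) hγ
  have := mul_nonneg (mul_nonneg (sq_nonneg τ) hL) hγ
  have := mul_nonneg (mul_nonneg (sq_nonneg τ) hL) hpi.le
  have := sq_nonneg τ
  nlinarith

lemma abs_log_le_add_inv {x : ℝ} (hx : 0 < x) : |Real.log x| ≤ x + x⁻¹ := by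
  have h1 := Real.log_le_sub_one_of_pos hx
  have h2 := Real.log_le_sub_one_of_pos (inv_pos.mpr hx)
  rw [Real.log_inv] at h2
  have := inv_pos.mpr hx
  rw [abs_le]; constructor <;> linarith

/-- A cruder bound without logarithm. It still vanishes at τ = 0, and it grows only polynomially, so
it can be dominated by Schwartz decay. -/
lemma norm_selfEnergyRem_le' {τ : ℝ} (hτ : 0 < τ) :
    ‖selfEnergyRem τ‖ ≤ remConst * (τ ^ 2 + τ ^ 3 + τ) := by
  refine (norm_selfEnergyRem_le hτ).trans ?_
  have := abs_log_le_add_inv hτ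
  have hr := remConst_pos
  calc remConst * τ ^ 2 * (1 + |Real.log τ|) ≤ remConst * τ ^ 2 * (1 + (τ + τ⁻¹)) := by gcongr
    _ = _ := by field_simp; ring

/-! ## The orbit of the noncommutativity tensor -/

lemma mdot_eq_dotProduct (k l : Mom) : mdot k l = k ⬝ᵥ (metric *ᵥ l) := by
  simp only [mdot, metric, dotProduct, Matrix.mulVec_diagonal]
  exact Finset.sum_congr rfl fun _ _ => by ring

lemma mulVec_dotProduct (A : Matrix (Fin 4) (Fin 4) ℝ) (x z : Mom) :
    (A *ᵥ x) ⬝ᵥ z = x ⬝ᵥ (Aᵀ *ᵥ z) := by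
  rw [Matrix.dotProduct_mulVec, Matrix.vecMul_transpose]

lemma metric_mul_metric : metric * metric = 1 := by
  rw [metric, Matrix.diagonal_mul_diagonal, ← Matrix.diagonal_one]
  congr 1; ext i; simp only [eta]; split_ifs <;> norm_num

/-- Let y be the components of k in the frame given by the columns of L. The block form of Θ₀ gives
-(kΘ)² = λ⁴(y₀² + y₁² - y₂² + y₃²), which is λ⁴(k² + 2y₁² + 2y₃²). So kΘ is spacelike for timelike
k. The normalization of one of the vectors is what makes the zero set of (kΘ)² on the cone
controllable. -/
lemma exists_spacelike {lam : ℝ} {Θ : Matrix (Fin 4) (Fin 4) ℝ} (hΘ : Θ ∈ thetaOrbit lam) :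
    ∃ n₁ n₂ : Mom, mdot n₁ n₁ = -1 ∧ ∀ k : Mom, -mdot (kTheta Θ k) (kTheta Θ k) =
      lam ^ 4 * (mdot k k + 2 * mdot n₁ k ^ 2 + 2 * mdot n₂ k ^ 2) := by
  obtain ⟨L, hL, rfl⟩ := hΘ
  -- A left inverse of a square matrix is a right inverse, so the transposed Lorentz condition holds
  -- as well.
  have hL2 : L * metric * Lᵀ = metric := by
    have h1 : (metric * Lᵀ * metric) * L = 1 := by
      rw [Matrix.mul_assoc, Matrix.mul_assoc, ← Matrix.mul_assoc Lᵀ, hL, metric_mul_metric]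
    have h2 := mul_eq_one_comm.mp h1
    calc L * metric * Lᵀ = L * (metric * Lᵀ * metric) * metric := by
          rw [← Matrix.mul_assoc, ← Matrix.mul_assoc, Matrix.mul_assoc _ metric metric,
            metric_mul_metric, Matrix.mul_one]
      _ = metric := by rw [h2, Matrix.one_mul]
  have hcol : ∀ (i : Fin 4) (k : Mom), mdot (fun μ => L μ i) k = (Lᵀ *ᵥ (metric *ᵥ k)) i := by
    intro i k; rw [mdot_eq_dotProduct]; rfl
  refine ⟨fun μ => L μ 1, fun μ => L μ 3, ?_, fun k => ?_⟩
  · have := congrFun (congrFun hL 1) 1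
    rw [Matrix.mul_assoc, Matrix.mul_apply] at this
    simp only [metric, Matrix.diagonal_mul, Matrix.transpose_apply,
      Matrix.diagonal_apply_eq] at this
    rw [show eta 1 = -1 from by simp [eta]] at this
    rw [mdot, ← this]
    exact Finset.sum_congr rfl fun _ _ => by ring
  · set y : Mom := Lᵀ *ᵥ (metric *ᵥ k) with hy
    have hk : kTheta (L * theta0 lam * Lᵀ) k = L *ᵥ ((theta0 lam)ᵀ *ᵥ y) := by
      have : kTheta (L * theta0 lam * Lᵀ) k = (L * theta0 lam * Lᵀ)ᵀ *ᵥ (metric *ᵥ k) := by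
        ext ν
        simp only [kTheta, low, Matrix.mulVec, dotProduct, Matrix.transpose_apply, metric,
          Matrix.diagonal_apply, ite_mul, zero_mul, Finset.sum_ite_eq, Finset.mem_univ, if_true]
        exact Finset.sum_congr rfl fun _ _ => by ring
      rw [this, hy]
      simp only [Matrix.mulVec_mulVec, Matrix.transpose_mul, Matrix.transpose_transpose,
        Matrix.mul_assoc]
    have hx : mdot (kTheta (L * theta0 lam * Lᵀ) k) (kTheta (L * theta0 lam * Lᵀ) k) =
        mdot ((theta0 lam)ᵀ *ᵥ y) ((theta0 lam)ᵀ *ᵥ y) := by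
      have h : ∀ x : Mom, Lᵀ *ᵥ (metric *ᵥ (L *ᵥ x)) = metric *ᵥ x := fun x => by
        rw [Matrix.mulVec_mulVec, Matrix.mulVec_mulVec, hL]
      rw [hk, mdot_eq_dotProduct, mulVec_dotProduct L, h, mdot_eq_dotProduct]
    have hkk : mdot k k = mdot y y := by
      have : mdot y y = (metric *ᵥ k) ⬝ᵥ ((L * metric * Lᵀ) *ᵥ (metric *ᵥ k)) := by
        rw [mdot_eq_dotProduct, hy, mulVec_dotProduct Lᵀ, Matrix.transpose_transpose]
        simp only [Matrix.mulVec_mulVec, Matrix.mul_assoc]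
      rw [this, hL2, Matrix.mulVec_mulVec, metric_mul_metric, Matrix.one_mulVec,
        mdot_eq_dotProduct, dotProduct_comm]
    rw [hx, hcol 1 k, hcol 3 k, hkk, ← hy, mdot_four, mdot_four]
    simp [theta0, Matrix.mulVec, dotProduct, Fin.sum_univ_four]
    ring

lemma kTheta_spacelike {lam : ℝ} (hlam : 0 < lam) {Θ : Matrix (Fin 4) (Fin 4) ℝ}
    (hΘ : Θ ∈ thetaOrbit lam) {k : Mom} (hk : 0 < mdot k k) :
    mdot (kTheta Θ k) (kTheta Θ k) < 0 := by
  obtain ⟨n₁, n₂, -, h⟩ := exists_spacelike hΘ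
  have : 0 < lam ^ 4 * (mdot k k + 2 * mdot n₁ k ^ 2 + 2 * mdot n₂ k ^ 2) := by positivity
  linarith [h k]

lemma kTheta_nonpos {lam : ℝ} {Θ : Matrix (Fin 4) (Fin 4) ℝ}
    (hΘ : Θ ∈ thetaOrbit lam) {k : Mom} (hk : 0 ≤ mdot k k) :
    mdot (kTheta Θ k) (kTheta Θ k) ≤ 0 := by
  obtain ⟨n₁, n₂, -, h⟩ := exists_spacelike hΘ
  have : 0 ≤ lam ^ 4 * (mdot k k + 2 * mdot n₁ k ^ 2 + 2 * mdot n₂ k ^ 2) := by positivity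
  linarith [h k]

end

/-! ### The renormalized self-energy -/

section

lemma retProp_neg (ε : ℝ) (p : Mom) : retProp ε (-p) = (starRingEnd ℂ) (retProp ε p) := by
  simp only [retProp, mdot_neg_neg, Pi.neg_apply, map_div₀, map_neg, map_add, map_mul, map_zpow₀,
    Complex.conj_ofReal, Complex.conj_I]
  push_cast
  ring

lemma transverse_neg (k : Mom) (μ ν : Fin 4) : transverse (-k) μ ν = transverse k μ ν := by
  simp only [transverse, mdot_neg_neg, low, Pi.neg_apply]; ring

section

variable {Θ : Matrix (Fin 4) (Fin 4) ℝ}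

/-- Reversal of k and l conjugates the retarded propagator and leaves the rest unchanged. The
backward cone is thereby reduced to the forward cone. -/
lemma selfEnergyReg_neg (hΘ : Θᵀ = -Θ) (ε Λ : ℝ) (k : Mom) (μ ν : Fin 4) :
    selfEnergyReg Θ ε Λ (-k) μ ν = (starRingEnd ℂ) (selfEnergyReg Θ ε Λ k μ ν) := by
  simp only [selfEnergyReg, mdot_neg_left, mdot_neg_right, neg_neg, abs_neg]
  refine (integral_deltaOne_neg _ (fun l => by
    simp only [Set.mem_ofPred_eq, mdot_neg_right, abs_neg])).symm.trans
      ((integral_congr_ae (ae_restrict_of_ae ?_)).trans integral_conj)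
  filter_upwards [ae_deltaOne] with l hl
  rw [selfEnergy_integrand hΘ ε (-k) (-l) (by rwa [mdot_neg_neg]),
    selfEnergy_integrand hΘ ε k l hl, twist_neg_left, twist_neg_right, neg_neg,
    transverse_neg, show -k - -l = -(k - l) by abel, mdot_neg_neg, retProp_neg]
  simp only [map_mul, map_sub, map_add, map_neg, map_one, map_pow, map_zpow₀, Complex.conj_ofReal,
    map_ofNat]

/-- `√(-(kΘ)²)`. -/
noncomputable def ncLength (Θ : Matrix (Fin 4) (Fin 4) ℝ) (k : Mom) : ℝ :=
  √(-mdot (kTheta Θ k) (kTheta Θ k))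

/-- The remainder of the renormalized self-energy at a timelike momentum. -/
noncomputable def momentumRem (Θ : Matrix (Fin 4) (Fin 4) ℝ) (k : Mom) : ℂ :=
  open Classical in
  if 0 < k 0 then selfEnergyRem (ncLength Θ k * √(mdot k k) / 2)
  else (starRingEnd ℂ) (selfEnergyRem (ncLength Θ k * √(mdot k k) / 2))

lemma ncLength_pos {lam : ℝ} (hlam : 0 < lam) (hΘ : Θ ∈ thetaOrbit lam) {k : Mom}
    (hk : 0 < mdot k k) : 0 < ncLength Θ k :=
  Real.sqrt_pos.mpr (neg_pos.mpr (kTheta_spacelike hlam hΘ hk))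

lemma ncLength_sq {lam : ℝ} (hΘ : Θ ∈ thetaOrbit lam) {k : Mom} (hk : 0 ≤ mdot k k) :
    ncLength Θ k ^ 2 = -mdot (kTheta Θ k) (kTheta Θ k) :=
  Real.sq_sqrt (by linarith [kTheta_nonpos hΘ hk])

lemma time_ne_zero {k : Mom} (hk : 0 < mdot k k) : k 0 ≠ 0 := fun h => by
  rw [mdot_four, h] at hk
  nlinarith [sq_nonneg (k 1), sq_nonneg (k 2), sq_nonneg (k 3)]

lemma norm_momentumRem (k : Mom) :
    ‖momentumRem Θ k‖ = ‖selfEnergyRem (ncLength Θ k * √(mdot k k) / 2)‖ := by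
  rw [momentumRem]
  split_ifs
  · rfl
  · exact RCLike.norm_conj _

lemma exists_limit_selfEnergyReg {lam : ℝ} (hlam : 0 < lam) (hΘ : Θ ∈ thetaOrbit lam) {k : Mom}
    (hk : 0 < mdot k k) : ∃ V : ℝ → ℂ,
      (∀ᶠ Λ in atTop, ∀ μ ν : Fin 4, Tendsto (fun ε => selfEnergyReg Θ ε Λ k μ ν) (𝓝[>] 0)
        (𝓝 (((2 * Real.pi : ℝ) : ℂ) ^ (-2 : ℤ) * ((transverse k μ ν : ℝ) : ℂ) * V Λ))) ∧
      Tendsto (fun Λ => V Λ + (Real.log Λ : ℂ)) atTop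
        (𝓝 (-(((Real.log (ncLength Θ k) + cosIntegralConst - 1 : ℝ) : ℂ) + momentumRem Θ k))) := by
  have hT := thetaOrbit_transpose hΘ
  have hm : 0 < √(mdot k k) := Real.sqrt_pos.mpr hk
  have ha := ncLength_pos hlam hΘ hk
  have hmk : mdot k k = √(mdot k k) ^ 2 := (Real.sq_sqrt hk.le).symm
  have hak : mdot (kTheta Θ k) (kTheta Θ k) = -ncLength Θ k ^ 2 := by
    rw [ncLength_sq hΘ hk.le]; ring
  have hlim := tendsto_cutoffSelfEnergy hm ha
  rcases lt_or_gt_of_ne (time_ne_zero hk) with h0 | h0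
  · refine ⟨fun Λ => (starRingEnd ℂ) (cutoffSelfEnergy √(mdot k k) (ncLength Θ k) Λ), ?_, ?_⟩
    · filter_upwards [eventually_gt_atTop (√(mdot k k) / 2)] with Λ hΛ μ ν
      have h := tendsto_selfEnergyReg (k := -k) hT hm (by rw [mdot_neg_neg, ← hmk])
        (by simpa using h0) ha (by rw [kTheta_neg, mdot_neg_neg, hak]) hΛ μ ν
      have h2 := (Complex.continuous_conj.tendsto _).comp h
      rw [transverse_neg] at h2
      convert h2 using 2
      · simp only [Function.comp_apply, selfEnergyReg_neg hT, Complex.conj_conj]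
      · simp only [map_mul, map_zpow₀, Complex.conj_ofReal]
    · have h2 := (Complex.continuous_conj.tendsto _).comp hlim
      convert h2 using 2
      · simp
      · rw [momentumRem, if_neg (not_lt.mpr h0.le)]
        simp only [map_neg, map_add, Complex.conj_ofReal]
  · refine ⟨cutoffSelfEnergy √(mdot k k) (ncLength Θ k), ?_, ?_⟩
    · filter_upwards [eventually_gt_atTop (√(mdot k k) / 2)] with Λ hΛ μ ν
      exact tendsto_selfEnergyReg hT hm hmk h0 ha hak hΛ μ ν
    · rw [momentumRem, if_pos h0]
      exact hlim

lemma continuous_kTheta : Continuous (kTheta Θ) := by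
  refine continuous_pi fun ν => ?_
  simp only [kTheta, low]; fun_prop

lemma continuous_mdot {X : Type*} [TopologicalSpace X] {f g : X → Mom} (hf : Continuous f)
    (hg : Continuous g) : Continuous fun x => mdot (f x) (g x) := by
  simp only [mdot]; fun_prop

lemma continuous_ncLength : Continuous (ncLength Θ) :=
  (continuous_mdot continuous_kTheta continuous_kTheta).neg.sqrt

lemma continuous_transverse (μ ν : Fin 4) : Continuous fun k => transverse k μ ν := by
  have := continuous_mdot continuous_id (continuous_id (X := Mom))
  simp only [id] at this
  simp only [transverse, low]; fun_prop

lemma ncLength_pos_of_ne {lam : ℝ} (hΘ : Θ ∈ thetaOrbit lam) {k : Mom} (hk : 0 ≤ mdot k k)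
    (h : mdot (kTheta Θ k) (kTheta Θ k) ≠ 0) : 0 < ncLength Θ k :=
  Real.sqrt_pos.mpr (neg_pos.mpr (lt_of_le_of_ne (kTheta_nonpos hΘ hk) h))

/-- The argument of the remainder contains √(k²), so the remainder disappears at the light cone,
also where kΘ becomes lightlike. -/
lemma tendsto_momentumRem {lam : ℝ} (hlam : 0 < lam) (hΘ : Θ ∈ thetaOrbit lam) {k : Mom}
    (hk : mdot k k = 0) :
    Tendsto (momentumRem Θ) (𝓝[{k' : Mom | 0 < mdot k' k'}] k) (𝓝 0) := by
  have hc : Continuous fun k' : Mom => ncLength Θ k' * √(mdot k' k') / 2 :=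
    (continuous_ncLength.mul (continuous_mdot continuous_id continuous_id).sqrt).div_const 2
  have h1 : Tendsto (fun k' : Mom => remConst * ((ncLength Θ k' * √(mdot k' k') / 2) ^ 2 +
      (ncLength Θ k' * √(mdot k' k') / 2) ^ 3 + ncLength Θ k' * √(mdot k' k') / 2))
      (𝓝[{k' : Mom | 0 < mdot k' k'}] k) (𝓝 0) := by
    have : Continuous fun k' : Mom => remConst * ((ncLength Θ k' * √(mdot k' k') / 2) ^ 2 +
      (ncLength Θ k' * √(mdot k' k') / 2) ^ 3 + ncLength Θ k' * √(mdot k' k') / 2) := by fun_prop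
    have h := (this.tendsto k).mono_left
      (nhdsWithin_le_nhds (s := {k' : Mom | 0 < mdot k' k'}))
    simpa [hk] using h
  refine squeeze_zero_norm' ?_ h1
  filter_upwards [self_mem_nhdsWithin] with k' hk'
  rw [norm_momentumRem]
  have := ncLength_pos hlam hΘ hk'
  have hm : 0 < √(mdot k' k') := Real.sqrt_pos.mpr hk'
  exact norm_selfEnergyRem_le' (by positivity)

/-- The scale-independent part of the renormalized self-energy. -/
noncomputable def renormValue (Θ : Matrix (Fin 4) (Fin 4) ℝ) (e : ℝ) (c : ℝ) (k : Mom)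
    (μ ν : Fin 4) (R : ℂ) : ℂ :=
  -((2 * Real.pi : ℝ) : ℂ) ^ (-2 : ℤ) * (e : ℂ) ^ 2 * ((transverse k μ ν : ℝ) : ℂ) *
    (((Real.log (ncLength Θ k) + c : ℝ) : ℂ) + R)

lemma exists_renormalized {lam : ℝ} (hlam : 0 < lam) (hΘ : Θ ∈ thetaOrbit lam) (e : ℝ) :
    ∃ P, IsRenormalizedSelfEnergy Θ e (fun Λ => (2 * Real.pi) ^ (-2 : ℤ) * Real.log Λ) P := by
  classical
  -- On and outside the light cone the remainder is replaced by 0, its limit at the cone; this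
  -- yields the required continuity from the interior.
  refine ⟨fun k μ ν => renormValue Θ e (cosIntegralConst - 1) k μ ν
    (if 0 < mdot k k then momentumRem Θ k else 0), fun k hk μ ν => ?_, fun k hk hκ μ ν => ?_⟩
  · obtain ⟨V, h1, h2⟩ := exists_limit_selfEnergyReg hlam hΘ hk
    refine ⟨_, h1.mono fun Λ h => (h μ ν).const_mul _, ?_⟩
    have h3 := h2.const_mul ((e : ℂ) ^ 2 * ((2 * Real.pi : ℝ) : ℂ) ^ (-2 : ℤ) *
      ((transverse k μ ν : ℝ) : ℂ))
    convert h3 using 2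
    · push_cast; ring
    · beta_reduce
      rw [if_pos hk, renormValue]; push_cast; ring
  · simp only [renormValue]
    rw [if_neg (by rw [hk]; exact lt_irrefl 0)]
    have hpos := ncLength_pos_of_ne hΘ hk.ge hκ
    have c1 : Tendsto (fun k' => ((transverse k' μ ν : ℝ) : ℂ))
        (𝓝[{k' : Mom | 0 < mdot k' k'}] k) (𝓝 ((transverse k μ ν : ℝ) : ℂ)) :=
      ((Complex.continuous_ofReal.comp (continuous_transverse μ ν)).tendsto k).mono_left
        nhdsWithin_le_nhds
    have c2 : Tendsto (fun k' => ((Real.log (ncLength Θ k') + (cosIntegralConst - 1) : ℝ) : ℂ))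
        (𝓝[{k' : Mom | 0 < mdot k' k'}] k)
        (𝓝 ((Real.log (ncLength Θ k) + (cosIntegralConst - 1) : ℝ) : ℂ)) := by
      refine Tendsto.mono_left ?_ nhdsWithin_le_nhds
      have : ContinuousAt (fun k' => Real.log (ncLength Θ k') + (cosIntegralConst - 1)) k :=
        (continuous_ncLength.continuousAt.log hpos.ne').add continuousAt_const
      exact (Complex.continuous_ofReal.continuousAt.comp this).tendsto
    have c3 : Tendsto (fun k' => if 0 < mdot k' k' then momentumRem Θ k' else 0)
        (𝓝[{k' : Mom | 0 < mdot k' k'}] k) (𝓝 0) := by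
      refine (tendsto_momentumRem hlam hΘ hk).congr' ?_
      filter_upwards [self_mem_nhdsWithin] with k' hk'
      exact (if_pos hk').symm
    exact (c1.const_mul _).mul (c2.add c3)

/-- Convergence at one momentum with a nonzero tensor component forces (2π)²Z(Λ) - ln Λ to converge.
The limit involves only Z, so the scale built from it serves all Θ, e and k. -/
lemma renormalized_eq (Z : ℝ → ℝ) : ∃ M : ℝ, 0 < M ∧ ∀ lam : ℝ, 0 < lam →
    ∀ Θ ∈ thetaOrbit lam, ∀ (e : ℝ) (P : Mom → Fin 4 → Fin 4 → ℂ),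
      IsRenormalizedSelfEnergy Θ e Z P → ∀ k : Mom, 0 < mdot k k → ∀ μ ν : Fin 4,
        P k μ ν = renormValue Θ e (Real.log M) k μ ν (momentumRem Θ k) := by
  classical
  -- If there is no limit, a renormalized self-energy exists only for e = 0, and the default 1 is as
  -- good as any scale.
  refine ⟨if h : ∃ z : ℝ, Tendsto (fun Λ => (2 * Real.pi) ^ 2 * Z Λ - Real.log Λ) atTop (𝓝 z) then
    Real.exp (cosIntegralConst - 1 - h.choose) else 1, ?_, ?_⟩
  · split_ifs <;> positivity
  intro lam hlam Θ hΘ e P hP k hk μ ν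
  have hpi : ((2 * Real.pi : ℝ) : ℂ) ≠ 0 := Complex.ofReal_ne_zero.mpr (by positivity)
  have hpi2 : ((2 * Real.pi : ℝ) : ℂ) ^ (-2 : ℤ) * ((2 * Real.pi : ℝ) : ℂ) ^ 2 = 1 := by
    rw [← zpow_natCast, ← zpow_add₀ hpi]; norm_num
  have main : ∀ k : Mom, 0 < mdot k k → ∀ μ ν : Fin 4,
      Tendsto (fun Λ => (e : ℂ) ^ 2 * ((2 * Real.pi : ℝ) : ℂ) ^ (-2 : ℤ) *
        ((transverse k μ ν : ℝ) : ℂ) * (((2 * Real.pi) ^ 2 * Z Λ - Real.log Λ : ℝ) : ℂ)) atTop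
        (𝓝 (P k μ ν - renormValue Θ e (cosIntegralConst - 1) k μ ν (momentumRem Θ k))) := by
    intro k hk μ ν
    obtain ⟨U, hU1, hU2⟩ := hP.1 k hk μ ν
    obtain ⟨V, h1, h2⟩ := exists_limit_selfEnergyReg hlam hΘ hk
    have h3 := hU2.sub (h2.const_mul ((e : ℂ) ^ 2 * ((2 * Real.pi : ℝ) : ℂ) ^ (-2 : ℤ) *
      ((transverse k μ ν : ℝ) : ℂ)))
    convert h3.congr' ?_ using 2
    · rw [renormValue]; push_cast; ring
    · filter_upwards [hU1, h1] with Λ a1 a2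
      rw [tendsto_nhds_unique a1 ((a2 μ ν).const_mul _)]
      push_cast
      push_cast at hpi2
      linear_combination (-(e : ℂ) ^ 2 * Z Λ * (transverse k μ ν : ℂ)) * hpi2
  -- For e = 0 nothing can be inferred about Z, but both sides vanish.
  rcases eq_or_ne e 0 with rfl | he
  · have h := main k hk μ ν
    simp only [renormValue, Complex.ofReal_zero, ne_eq, OfNat.ofNat_ne_zero, not_false_eq_true,
      zero_pow, zero_mul, mul_zero, sub_zero] at h ⊢
    exact (tendsto_nhds_unique h tendsto_const_nhds)
  -- At rest the component 11 of the transverse tensor is -1, so the convergence can be divided by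
  -- it.
  set k₀ : Mom := ![1, 0, 0, 0] with hk₀
  have hk₀1 : mdot k₀ k₀ = 1 := by simp [mdot_four, hk₀]
  have hT₀ : transverse k₀ 1 1 = -1 := by
    rw [transverse, hk₀1]; simp [metric, low, eta, hk₀]
  have hex : ∃ z : ℝ, Tendsto (fun Λ => (2 * Real.pi) ^ 2 * Z Λ - Real.log Λ) atTop (𝓝 z) := by
    have h := main k₀ (by rw [hk₀1]; exact one_pos) 1 1
    rw [hT₀] at h
    have hc : (e : ℂ) ^ 2 * ((2 * Real.pi : ℝ) : ℂ) ^ (-2 : ℤ) * ((-1 : ℝ) : ℂ) ≠ 0 :=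
      mul_ne_zero (mul_ne_zero (pow_ne_zero 2 (Complex.ofReal_ne_zero.mpr he))
        (zpow_ne_zero _ hpi)) (by norm_num)
    have h2 := h.const_mul ((e : ℂ) ^ 2 * ((2 * Real.pi : ℝ) : ℂ) ^ (-2 : ℤ) * ((-1 : ℝ) : ℂ))⁻¹
    have h3 := (Complex.continuous_re.tendsto _).comp h2
    refine ⟨_, h3.congr fun Λ => ?_⟩
    simp only [Function.comp_apply]
    rw [inv_mul_cancel_left₀ hc, Complex.ofReal_re]
  rw [dif_pos hex]
  have hz := hex.choose_spec
  set z := hex.choose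
  have h4 := ((Complex.continuous_ofReal.tendsto _).comp hz).const_mul
    ((e : ℂ) ^ 2 * ((2 * Real.pi : ℝ) : ℂ) ^ (-2 : ℤ) * ((transverse k μ ν : ℝ) : ℂ))
  have h5 := tendsto_nhds_unique (main k hk μ ν) h4
  rw [sub_eq_iff_eq_add] at h5
  rw [h5, renormValue, renormValue, Real.log_exp]
  push_cast
  ring

end

end

/-! ### Integrable singularities on the light cone -/

section

lemma schwartz_family_bound (f : Fin 4 → Fin 4 → 𝓢(Mom, ℂ)) (N : ℕ) :
    ∃ C : ℝ, 0 ≤ C ∧ ∀ μ ν k, ‖f μ ν k‖ ≤ C * ((1 + ‖k‖) ^ N)⁻¹ := by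
  have h : ∀ g : 𝓢(Mom, ℂ), ∃ C : ℝ, 0 ≤ C ∧ ∀ k, ‖g k‖ ≤ C * ((1 + ‖k‖) ^ N)⁻¹ := by
    intro g
    refine ⟨2 ^ N * (Finset.Iic (N, 0)).sup (fun m => SchwartzMap.seminorm ℝ m.1 m.2) g,
      by positivity, fun k => ?_⟩
    have := SchwartzMap.one_add_le_sup_seminorm_apply (𝕜 := ℝ) (m := (N, 0)) le_rfl le_rfl g k
    rw [norm_iteratedFDeriv_zero, mul_comm] at this
    rw [← div_eq_mul_inv]
    exact (le_div_iff₀ (by positivity)).2 this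
  choose C hC0 hC using fun p : Fin 4 × Fin 4 => h (f p.1 p.2)
  refine ⟨∑ p, C p, Finset.sum_nonneg fun p _ => hC0 p, fun μ ν k => (hC (μ, ν) k).trans ?_⟩
  gcongr
  exact Finset.single_le_sum (f := C) (fun p _ => hC0 p) (Finset.mem_univ (μ, ν))

lemma lintegral_one_add_pow_lt_top :
    ∫⁻ r in Set.Ioi (0 : ℝ), ENNReal.ofReal (((1 + r) ^ 2)⁻¹) < ⊤ := by
  have h : IntegrableOn (fun r : ℝ => (r + 1) ^ (-2 : ℝ)) (Set.Ioi 0) :=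
    integrableOn_add_rpow_Ioi_of_lt (by norm_num) (by norm_num)
  refine lt_of_le_of_lt (lintegral_mono_ae ?_) h.lintegral_lt_top
  filter_upwards [ae_restrict_mem measurableSet_Ioi] with r hr
  have : (0 : ℝ) < r := hr
  rw [Real.rpow_neg (by positivity), Real.rpow_two, add_comm r 1]

/-- The exponent -1/2 is one choice that is integrable in one dimension and dominates a logarithm.
-/
lemma lintegral_abs_affine_lt_top (c : ℝ) {d : ℝ} (hd : 0 < d) :
    ∫⁻ z in Set.Ioo (-1 : ℝ) 1, ENNReal.ofReal |c - d * z| ^ (-(1 / 2) : ℝ) < ⊤ := by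
  have h1 : IntervalIntegrable (fun z : ℝ => (c - d * z) ^ (-(1 / 2) : ℝ)) volume (-1) 1 := by
    have := (((intervalIntegral.intervalIntegrable_rpow' (a := c + d) (b := c - d)
      (r := -(1 / 2)) (by norm_num)).comp_sub_left c).comp_mul_left (c := d))
    convert this using 1 <;> field_simp <;> ring
  have h2 : IntervalIntegrable (fun z : ℝ => (d * z - c) ^ (-(1 / 2) : ℝ)) volume (-1) 1 := by
    have := (((intervalIntegral.intervalIntegrable_rpow' (a := -d - c) (b := d - c)
      (r := -(1 / 2)) (by norm_num)).comp_sub_right c).comp_mul_left (c := d))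
    convert this using 1 <;> field_simp <;> ring
  have h3 := (intervalIntegrable_iff_integrableOn_Ioo_of_le (by norm_num)).1 (h1.add h2)
  refine lt_of_le_of_lt (lintegral_mono_ae ?_) h3.lintegral_lt_top
  filter_upwards [ae_restrict_of_ae (Measure.ae_ne volume (c / d))] with z hz
  have hne : c - d * z ≠ 0 := fun h => hz (by field_simp; linarith)
  rw [ENNReal.ofReal_rpow_of_pos (abs_pos.mpr hne)]
  refine ENNReal.ofReal_le_ofReal ?_
  -- A real power of a negative base carries the factor cos(-π/2) = 0. Of the two powers in the sum,
  -- only the one with positive base contributes.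
  have hcos : Real.cos (-(1 / 2) * Real.pi) = 0 := by
    rw [show -(1 / 2) * Real.pi = -(Real.pi / 2) by ring, Real.cos_neg, Real.cos_pi_div_two]
  rcases lt_or_gt_of_ne hne with h | h
  · rw [abs_of_neg h, Real.rpow_def_of_neg h, hcos, mul_zero, zero_add, neg_sub]
  · rw [abs_of_pos h, Real.rpow_def_of_neg (x := d * z - c) (by linarith), hcos, mul_zero, add_zero]

lemma lintegral_sphere_affine_lt_top (c : ℝ) {u : Mom3} (hu : u ≠ 0) :
    ∫⁻ n : Sph, ENNReal.ofReal |c - inner ℝ u (n : Mom3)| ^ (-(1 / 2) : ℝ) ∂sphereMeasure < ⊤ := by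
  rw [lintegral_sphere_inner (φ := fun z => ENNReal.ofReal |c - z| ^ (-(1 / 2) : ℝ)) (by fun_prop)]
  exact ENNReal.mul_lt_top ENNReal.ofReal_lt_top (lintegral_abs_affine_lt_top c (norm_pos_iff.mpr hu))

/-- A weight on spatial momenta with an integrable singularity on a cone. -/
noncomputable def coneWeight (n : Mom) (x : Mom3) : ENNReal :=
  ENNReal.ofReal (‖x‖⁻¹ * ((1 + ‖x‖) ^ 3)⁻¹) *
    (1 + ENNReal.ofReal |mdot n (onShell 0 x)| ^ (-(1 / 2) : ℝ))

lemma measurable_mdot_onShell (n : Mom) (s : ℝ) : Measurable fun x => mdot n (onShell s x) :=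
  (continuous_mdot continuous_const (continuous_onShell s)).measurable

lemma measurable_coneWeight (n : Mom) : Measurable (coneWeight n) := by
  have := measurable_mdot_onShell n 0
  unfold coneWeight; fun_prop

/-- By homogeneity the singular factor splits into r^(-1/2) and a function of the direction, so
radial and angular integrals separate. A spacelike vector has a nonzero spatial part, and the
angular integral is finite by the uniform distribution of projections. -/
lemma lintegral_coneWeight_lt_top {n : Mom} (hn : mdot n n = -1) :
    ∫⁻ x, coneWeight n x < ⊤ := by
  have hsp : spatial n ≠ 0 := fun h => by
    have := norm_spatial_sq n
    rw [h, hn, norm_zero] at this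
    nlinarith [sq_nonneg (n 0)]
  rw [lintegral_sphere_polar (measurable_coneWeight n)]
  calc ∫⁻ v : Sph, ∫⁻ r in Set.Ioi (0 : ℝ), ENNReal.ofReal (r ^ 2) * coneWeight n (r • (v : Mom3))
        ∂volume ∂sphereMeasure
      ≤ ∫⁻ v : Sph, ∫⁻ r in Set.Ioi (0 : ℝ), ENNReal.ofReal (((1 + r) ^ 2)⁻¹) *
          (1 + ENNReal.ofReal |n 0 - inner ℝ (spatial n) (v : Mom3)| ^ (-(1 / 2) : ℝ))
        ∂volume ∂sphereMeasure := by
        refine lintegral_mono fun v => setLIntegral_mono_ae' measurableSet_Ioi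
          (Eventually.of_forall fun r hr => ?_)
        have hr0 : 0 < r := hr
        have hnorm : ‖r • (v : Mom3)‖ = r := by simp [norm_smul, abs_of_pos hr0]
        rw [coneWeight, onShell_zero_smul hr0.le, mdot_smul_right, mdot_ray, hnorm, abs_mul,
          abs_of_pos hr0, ENNReal.ofReal_mul hr0.le,
          ENNReal.mul_rpow_of_ne_top ENNReal.ofReal_ne_top ENNReal.ofReal_ne_top,
          ← mul_assoc (ENNReal.ofReal (r ^ 2)),
          ← ENNReal.ofReal_mul (by positivity), ENNReal.ofReal_rpow_of_pos hr0, mul_add, mul_add,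
          mul_one, mul_one, ← mul_assoc (ENNReal.ofReal (r ^ 2 * (r⁻¹ * ((1 + r) ^ 3)⁻¹))),
          ← ENNReal.ofReal_mul (by positivity)]
        have e1 : r ^ 2 * (r⁻¹ * ((1 + r) ^ 3)⁻¹) ≤ ((1 + r) ^ 2)⁻¹ := by
          rw [show r ^ 2 * (r⁻¹ * ((1 + r) ^ 3)⁻¹) = r / (1 + r) ^ 3 by field_simp,
            ← one_div, div_le_div_iff₀ (by positivity) (by positivity)]
          nlinarith [pow_pos hr0 2]
        have e2 : r ^ 2 * (r⁻¹ * ((1 + r) ^ 3)⁻¹) * r ^ (-(1 / 2) : ℝ) ≤ ((1 + r) ^ 2)⁻¹ := by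
          have h1 : r * r ^ (-(1 / 2) : ℝ) = √r := by
            rw [Real.sqrt_eq_rpow, ← Real.rpow_one_add' hr0.le (by norm_num)]; norm_num
          have h2 : √r ≤ 1 + r := by
            nlinarith [Real.sq_sqrt hr0.le, sq_nonneg (√r - 1), Real.sqrt_nonneg r]
          rw [show r ^ 2 * (r⁻¹ * ((1 + r) ^ 3)⁻¹) * r ^ (-(1 / 2) : ℝ) =
            (r * r ^ (-(1 / 2) : ℝ)) / (1 + r) ^ 3 by field_simp, h1, ← one_div,
            div_le_div_iff₀ (by positivity) (by positivity)]
          nlinarith [pow_pos hr0 2]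
        gcongr
    _ = (∫⁻ r in Set.Ioi (0 : ℝ), ENNReal.ofReal (((1 + r) ^ 2)⁻¹)) * ∫⁻ v : Sph,
          (1 + ENNReal.ofReal |n 0 - inner ℝ (spatial n) (v : Mom3)| ^ (-(1 / 2) : ℝ))
            ∂sphereMeasure := by
        rw [← lintegral_const_mul _ (by fun_prop)]
        refine lintegral_congr fun v => ?_
        rw [lintegral_mul_const _ (by fun_prop)]
    _ < ⊤ := by
        refine ENNReal.mul_lt_top lintegral_one_add_pow_lt_top ?_
        rw [lintegral_add_left measurable_const]
        refine ENNReal.add_lt_top.2 ⟨?_, lintegral_sphere_affine_lt_top _ hsp⟩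
        rw [lintegral_const, one_mul]
        exact measure_lt_top _ _

/-- The weight takes the value ∞ where n·k = 0 and x ≠ 0. Since its integral is finite, this set is
null. -/
lemma ae_mdot_onShell_ne_zero {n : Mom} (hn : mdot n n = -1) :
    ∀ᵐ x : Mom3, x ≠ 0 ∧ mdot n (onShell 0 x) ≠ 0 := by
  filter_upwards [ae_lt_top (measurable_coneWeight n) (lintegral_coneWeight_lt_top hn).ne,
    Measure.ae_ne volume (0 : Mom3)] with x hx hx0
  refine ⟨hx0, fun h => ?_⟩
  rw [coneWeight, h, abs_zero, ENNReal.ofReal_zero, ENNReal.zero_rpow_of_neg (by norm_num),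
    add_top, ENNReal.mul_top] at hx
  · exact lt_irrefl _ hx
  · have : 0 < ‖x‖ := norm_pos_iff.mpr hx0
    exact (ENNReal.ofReal_pos.mpr (by positivity)).ne'

/-- The real-valued version of the weight. -/
noncomputable def coneWeightReal (n : Mom) (x : Mom3) : ℝ :=
  ‖x‖⁻¹ * ((1 + ‖x‖) ^ 3)⁻¹ * (1 + |mdot n (onShell 0 x)| ^ (-(1 / 2) : ℝ))

lemma coneWeightReal_nonneg (n : Mom) (x : Mom3) : 0 ≤ coneWeightReal n x := by
  unfold coneWeightReal; positivity

lemma integrable_coneWeightReal {n : Mom} (hn : mdot n n = -1) :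
    Integrable (coneWeightReal n) := by
  have hm : Measurable (coneWeightReal n) := by
    have := measurable_mdot_onShell n 0
    unfold coneWeightReal; fun_prop
  refine ⟨hm.aestronglyMeasurable, ?_⟩
  rw [hasFiniteIntegral_iff_ofReal (Eventually.of_forall (coneWeightReal_nonneg n))]
  refine lt_of_le_of_lt (lintegral_mono_ae ?_) (lintegral_coneWeight_lt_top hn)
  filter_upwards [ae_mdot_onShell_ne_zero hn] with x hx
  rw [coneWeightReal, coneWeight, ENNReal.ofReal_mul (by positivity), ENNReal.ofReal_add zero_le_one
    (by positivity), ENNReal.ofReal_one, ENNReal.ofReal_rpow_of_pos (abs_pos.mpr hx.2)]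

lemma mdot_onShell {s : ℝ} (hs : 0 ≤ s) (x : Mom3) : mdot (onShell s x) (onShell s x) = s := by
  have h : √(s + ‖x‖ ^ 2) * √(s + ‖x‖ ^ 2) = s + ‖x‖ ^ 2 := Real.mul_self_sqrt (by positivity)
  have := norm_sq_mom3 x
  simp [mdot_four, onShell, h]
  linarith

lemma norm_onShell_le {s : ℝ} (hs1 : s ≤ 1) (x : Mom3) :
    ‖onShell s x‖ ≤ 1 + ‖x‖ := by
  rw [pi_norm_le_iff_of_nonneg (by positivity)]
  have hc : ∀ i, |x i| ≤ 1 + ‖x‖ := fun i => by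
    have := PiLp.norm_apply_le x i
    rw [Real.norm_eq_abs] at this
    linarith
  intro i
  fin_cases i
  · simp only [onShell, Real.norm_eq_abs]
    change |√(s + ‖x‖ ^ 2)| ≤ _
    rw [abs_of_nonneg (Real.sqrt_nonneg _), Real.sqrt_le_left (by positivity)]
    nlinarith [norm_nonneg x]
  · exact hc 0
  · exact hc 1
  · exact hc 2

lemma le_norm_onShell {s : ℝ} (hs : 0 ≤ s) (x : Mom3) : ‖x‖ ≤ ‖onShell s x‖ := by
  refine le_trans ?_ (norm_le_pi_norm (onShell s x) 0)
  change ‖x‖ ≤ |√(s + ‖x‖ ^ 2)|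
  rw [abs_of_nonneg (Real.sqrt_nonneg _)]
  exact Real.le_sqrt_of_sq_le (by linarith)

lemma integral_deltaPlus (s : ℝ) {F : Mom → ℂ} (hF : Measurable F) :
    ∫ k, F k ∂(deltaPlus s) =
      ∫ x : Mom3, (((2 * Real.pi)⁻¹ / (2 * √(s + ‖x‖ ^ 2)) : ℝ) : ℂ) * F (onShell s x) := by
  rw [deltaPlus, integral_map (continuous_onShell s).measurable.aemeasurable
    hF.aestronglyMeasurable, integral_withDensity_eq_integral_toReal_smul (by fun_prop)
      (Eventually.of_forall fun _ => ENNReal.ofReal_lt_top)]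
  refine integral_congr_ae (Eventually.of_forall fun x => ?_)
  simp only
  rw [ENNReal.toReal_ofReal (by positivity), Complex.real_smul]

lemma ae_deltaPlus {s : ℝ} {p : Mom → Prop} (hp : MeasurableSet {k | p k})
    (h : ∀ᵐ x : Mom3, p (onShell s x)) : ∀ᵐ k ∂(deltaPlus s), p k := by
  rw [deltaPlus, ae_map_iff (continuous_onShell s).measurable.aemeasurable hp]
  exact (withDensity_absolutelyContinuous _ _).ae_le h

end

/-! ### Pairing of the self-energy with the test functions -/

section

/-- The contraction `f^{μν}(-k) h^λ_ν(k) k_μ k_λ`. -/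
noncomputable def smearedForm (f h : Fin 4 → Fin 4 → Mom → ℂ) (k : Mom) : ℂ :=
  ∑ μ, ∑ ν, ∑ l, f μ ν (-k) * (eta ν : ℂ) * h l ν k * ((low k μ * low k l : ℝ) : ℂ)

lemma sum_antisymm_mul_low {F : Fin 4 → Fin 4 → ℂ} (hF : ∀ μ ν, F μ ν = -F ν μ) (k : Mom) :
    ∑ μ, ∑ ν, F μ ν * ((low k μ : ℂ) * (low k ν : ℂ)) = 0 := by
  have h : ∑ μ, ∑ ν, F μ ν * ((low k μ : ℂ) * (low k ν : ℂ)) =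
      -∑ μ, ∑ ν, F μ ν * ((low k μ : ℂ) * (low k ν : ℂ)) := by
    conv_lhs => rw [Finset.sum_comm]
    rw [← Finset.sum_neg_distrib]
    refine Finset.sum_congr rfl fun μ _ => ?_
    rw [← Finset.sum_neg_distrib]
    refine Finset.sum_congr rfl fun ν _ => ?_
    rw [hF ν μ]; ring
  exact self_eq_neg.mp h

lemma sum_kernel0 (k : Mom) (μ ν l r : Fin 4) (P : Fin 4 → Fin 4 → ℂ) :
    ∑ σ, ∑ τ, kernel0 k μ ν σ * kernel0 (-k) l r τ * P σ τ =
      -4 * ((low k μ : ℂ) * (low (-k) l : ℂ)) * P ν r := by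
  simp only [kernel0, mul_ite, mul_one, mul_zero, ite_mul, zero_mul, Finset.sum_ite_eq',
    Finset.mem_univ, if_true]
  linear_combination (4 * (low k μ : ℂ) * (low (-k) l : ℂ) * P ν r) * Complex.I_sq

/-- The part k_ν k_r of the transverse tensor meets f^{μν}k_μk_ν = 0. The other part leaves an
overall factor k², which is the mass squared under the integral. -/
lemma pairing_integrand_eq {f h : Fin 4 → Fin 4 → Mom → ℂ} {k : Mom}
    (hf : ∀ μ ν, f μ ν (-k) = -f ν μ (-k)) {P : Fin 4 → Fin 4 → ℂ} {c : ℂ}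
    (hP : ∀ ν r, P ν r = c * ((transverse k ν r : ℝ) : ℂ)) :
    ∑ μ, ∑ ν, ∑ l, ∑ r, f μ ν (-k) * h l r k *
      ∑ σ, ∑ τ, kernel0 k μ ν σ * kernel0 (-k) l r τ * P σ τ =
        4 * c * ((mdot k k : ℝ) : ℂ) * smearedForm f h k := by
  simp only [sum_kernel0, hP]
  have hlow : ∀ l, (low (-k) l : ℂ) = -(low k l : ℂ) := fun l => by
    simp only [low, Pi.neg_apply]; push_cast; ring
  have hterm : ∀ μ ν, ∑ l, ∑ r, f μ ν (-k) * h l r k *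
      (-4 * ((low k μ : ℂ) * (low (-k) l : ℂ)) * (c * ((transverse k ν r : ℝ) : ℂ))) =
      4 * c * ((mdot k k : ℝ) : ℂ) * (∑ l, f μ ν (-k) * (eta ν : ℂ) * h l ν k *
        ((low k μ * low k l : ℝ) : ℂ)) - f μ ν (-k) * ((low k μ : ℂ) * (low k ν : ℂ)) *
          (4 * c * ∑ l, ∑ r, h l r k * ((low k l : ℂ) * (low k r : ℂ))) := by
    intro μ ν
    rw [Finset.mul_sum, Finset.mul_sum, Finset.mul_sum, ← Finset.sum_sub_distrib]
    refine Finset.sum_congr rfl fun l _ => ?_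
    have e : ∑ r, f μ ν (-k) * (eta ν : ℂ) * h l r k * (if ν = r then 1 else 0) =
        f μ ν (-k) * (eta ν : ℂ) * h l ν k := by simp
    rw [← e, Finset.sum_mul, Finset.mul_sum, Finset.mul_sum, Finset.mul_sum,
      ← Finset.sum_sub_distrib]
    refine Finset.sum_congr rfl fun r _ => ?_
    rw [hlow]
    simp only [transverse, metric, Matrix.diagonal_apply]
    split_ifs <;> push_cast <;> ring
  simp only [hterm, Finset.sum_sub_distrib, ← Finset.sum_mul]
  rw [sum_antisymm_mul_low hf, zero_mul, sub_zero, smearedForm]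
  simp only [Finset.mul_sum]

section Renormalized

variable {lam : ℝ} {Θ : Matrix (Fin 4) (Fin 4) ℝ}

/-- The points k + t e₀ with t > 0 are timelike, since their square is 2tk₀ + t². Limits from the
interior of the cone are therefore unique. -/
lemma neBot_timelike {k : Mom} (hk : mdot k k = 0) (h0 : 0 < k 0) :
    (𝓝[{k' : Mom | 0 < mdot k' k'}] k).NeBot := by
  rw [← mem_closure_iff_nhdsWithin_neBot]
  have hc : Continuous fun t : ℝ => k + t • (Pi.single 0 1 : Mom) := by fun_prop
  have ht : Tendsto (fun t : ℝ => k + t • (Pi.single 0 1 : Mom)) (𝓝[>] 0) (𝓝 k) := by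
    have := (hc.tendsto 0).mono_left (nhdsWithin_le_nhds (s := Set.Ioi 0))
    simpa using this
  refine mem_closure_of_tendsto ht ?_
  filter_upwards [self_mem_nhdsWithin] with t ht
  have ht' : (0 : ℝ) < t := ht
  have e1 : mdot k (Pi.single 0 1) = k 0 := by simp [mdot_four]
  have e2 : mdot (Pi.single 0 1) (Pi.single 0 1) = (1 : ℝ) := by simp [mdot_four]
  change 0 < mdot _ _
  rw [mdot_add_left, mdot_add_right, mdot_add_right, mdot_smul_left, mdot_smul_left,
    mdot_smul_right, mdot_smul_right, hk, mdot_comm _ k, e1, e2]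
  nlinarith [mul_pos ht' h0, mul_pos ht' ht']

lemma renormalized_lightlike (hlam : 0 < lam) (hΘ : Θ ∈ thetaOrbit lam) {e M : ℝ} {Z : ℝ → ℝ}
    {P : Mom → Fin 4 → Fin 4 → ℂ} (hP : IsRenormalizedSelfEnergy Θ e Z P)
    (hf : ∀ k : Mom, 0 < mdot k k → ∀ μ ν : Fin 4,
      P k μ ν = renormValue Θ e (Real.log M) k μ ν (momentumRem Θ k))
    {k : Mom} (hk : mdot k k = 0) (h0 : 0 < k 0) (hκ : 0 < ncLength Θ k) (μ ν : Fin 4) :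
    P k μ ν = renormValue Θ e (Real.log M) k μ ν 0 := by
  have hne : mdot (kTheta Θ k) (kTheta Θ k) ≠ 0 := fun h => by
    rw [ncLength, h, neg_zero, Real.sqrt_zero] at hκ; exact lt_irrefl _ hκ
  have := neBot_timelike hk h0
  refine tendsto_nhds_unique (hP.2 k hk hne μ ν) ?_
  have c1 : Tendsto (fun k' => ((transverse k' μ ν : ℝ) : ℂ))
      (𝓝[{k' : Mom | 0 < mdot k' k'}] k) (𝓝 ((transverse k μ ν : ℝ) : ℂ)) :=
    ((Complex.continuous_ofReal.comp (continuous_transverse μ ν)).tendsto k).mono_left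
      nhdsWithin_le_nhds
  have c2 : Tendsto (fun k' => ((Real.log (ncLength Θ k') + Real.log M : ℝ) : ℂ))
      (𝓝[{k' : Mom | 0 < mdot k' k'}] k)
      (𝓝 ((Real.log (ncLength Θ k) + Real.log M : ℝ) : ℂ)) := by
    refine Tendsto.mono_left ?_ nhdsWithin_le_nhds
    have : ContinuousAt (fun k' => Real.log (ncLength Θ k') + Real.log M) k :=
      (continuous_ncLength.continuousAt.log hκ.ne').add continuousAt_const
    exact (Complex.continuous_ofReal.continuousAt.comp this).tendsto
  refine ((c1.const_mul _).mul (c2.add (tendsto_momentumRem hlam hΘ hk))).congr' ?_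
  filter_upwards [self_mem_nhdsWithin] with k' hk'
  exact (hf k' hk' μ ν).symm

lemma measurable_selfEnergyRem : Measurable selfEnergyRem := by
  have c1 : Continuous sinIntegral :=
    continuous_iff_continuousAt.2 fun x => (hasDerivAt_sinIntegral x).continuousAt
  have c2 : Continuous cosIntegral :=
    continuous_iff_continuousAt.2 fun x => (hasDerivAt_cosIntegral x).continuousAt
  have m1 := c1.measurable
  have m2 := c2.measurable
  have m3 := Real.continuous_sinc.measurable
  unfold selfEnergyRem
  fun_prop

lemma measurable_momentumRem : Measurable (momentumRem Θ) := by
  classical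
  have h1 : Measurable fun k => selfEnergyRem (ncLength Θ k * √(mdot k k) / 2) :=
    measurable_selfEnergyRem.comp
      ((continuous_ncLength.measurable.mul measurable_mdot_self.sqrt).div_const 2)
  have h2 : Measurable fun k =>
      (starRingEnd ℂ) (selfEnergyRem (ncLength Θ k * √(mdot k k) / 2)) :=
    Complex.continuous_conj.measurable.comp h1
  have h3 : MeasurableSet {k : Mom | 0 < k 0} :=
    measurableSet_lt measurable_const (measurable_pi_apply 0)
  exact Measurable.ite h3 h1 h2

lemma measurable_smearedForm (f h : Fin 4 → Fin 4 → 𝓢(Mom, ℂ)) :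
    Measurable (smearedForm (fun μ ν => f μ ν) (fun μ ν => h μ ν)) := by
  have h1 : ∀ μ ν, Measurable fun k : Mom => f μ ν (-k) := fun μ ν =>
    (f μ ν).continuous.measurable.comp measurable_neg
  have h2 : ∀ μ ν, Measurable fun k : Mom => h μ ν k := fun μ ν => (h μ ν).continuous.measurable
  unfold smearedForm low
  refine Finset.measurable_sum _ fun μ _ => Finset.measurable_sum _ fun ν _ =>
    Finset.measurable_sum _ fun l _ => ?_
  have := h1 μ ν
  have := h2 l ν
  fun_prop

/-- The pairing divided by the mass squared. -/
noncomputable def reducedPairing (Θ : Matrix (Fin 4) (Fin 4) ℝ) (f h : Fin 4 → Fin 4 → Mom → ℂ)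
    (M : ℝ) (k : Mom) (R : ℂ) : ℂ :=
  smearedForm f h k * (((Real.log (ncLength Θ k) + Real.log M : ℝ) : ℂ) + R)

lemma pairing_integrand_renormValue {f h : Fin 4 → Fin 4 → Mom → ℂ} {k : Mom}
    (hf : ∀ μ ν, f μ ν (-k) = -f ν μ (-k)) {P : Fin 4 → Fin 4 → ℂ} {e M : ℝ} {R : ℂ}
    (hP : ∀ ν r, P ν r = renormValue Θ e (Real.log M) k ν r R) :
    ((2 * Real.pi : ℝ) : ℂ) ^ 2 * ∑ μ, ∑ ν, ∑ l, ∑ r, f μ ν (-k) * h l r k *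
      ∑ σ, ∑ τ, kernel0 k μ ν σ * kernel0 (-k) l r τ * P σ τ =
        -4 * (e : ℂ) ^ 2 * (((mdot k k : ℝ) : ℂ) * reducedPairing Θ f h M k R) := by
  have hpi : ((2 * Real.pi : ℝ) : ℂ) ≠ 0 := Complex.ofReal_ne_zero.mpr (by positivity)
  have hpi2 : ((2 * Real.pi : ℝ) : ℂ) ^ (-2 : ℤ) * ((2 * Real.pi : ℝ) : ℂ) ^ 2 = 1 := by
    rw [← zpow_natCast, ← zpow_add₀ hpi]; norm_num
  rw [pairing_integrand_eq hf (c := -((2 * Real.pi : ℝ) : ℂ) ^ (-2 : ℤ) * (e : ℂ) ^ 2 *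
    (((Real.log (ncLength Θ k) + Real.log M : ℝ) : ℂ) + R)) (fun ν r => by
      rw [hP, renormValue]; ring), reducedPairing]
  linear_combination (-4 * (e : ℂ) ^ 2 * ((mdot k k : ℝ) : ℂ) * smearedForm f h k *
    (((Real.log (ncLength Θ k) + Real.log M : ℝ) : ℂ) + R)) * hpi2

end Renormalized

end

/-! ### A bound on the pairing uniform in the mass -/

section

lemma abs_low (k : Mom) (μ : Fin 4) : |low k μ| ≤ ‖k‖ := by
  have h : |eta μ| = 1 := by unfold eta; split_ifs <;> simp
  rw [low, abs_mul, h, one_mul, ← Real.norm_eq_abs]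
  exact norm_le_pi_norm k μ

lemma abs_mdot_le (k l : Mom) : |mdot k l| ≤ 4 * (‖k‖ * ‖l‖) := by
  calc |mdot k l| ≤ ∑ μ, |eta μ * k μ * l μ| := Finset.abs_sum_le_sum_abs _ _
    _ ≤ ∑ _μ : Fin 4, ‖k‖ * ‖l‖ := by
        refine Finset.sum_le_sum fun μ _ => ?_
        rw [abs_mul]
        exact mul_le_mul (abs_low k μ) (norm_le_pi_norm l μ) (abs_nonneg _) (norm_nonneg _)
    _ = 4 * (‖k‖ * ‖l‖) := by simp

lemma norm_smearedForm_le (f h : Fin 4 → Fin 4 → 𝓢(Mom, ℂ)) :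
    ∃ C : ℝ, 0 ≤ C ∧ ∀ k, ‖smearedForm (fun μ ν => f μ ν) (fun μ ν => h μ ν) k‖ ≤
      C * ((1 + ‖k‖) ^ 6)⁻¹ := by
  obtain ⟨A, hA0, hA⟩ := schwartz_family_bound f 8
  obtain ⟨B, hB0, hB⟩ := schwartz_family_bound h 0
  refine ⟨64 * (A * B), by positivity, fun k => ?_⟩
  have hterm : ∀ μ ν l, ‖f μ ν (-k) * (eta ν : ℂ) * h l ν k * ((low k μ * low k l : ℝ) : ℂ)‖ ≤
      A * B * ((1 + ‖k‖) ^ 6)⁻¹ := by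
    intro μ ν l
    have h1 := hA μ ν (-k)
    have h2 := hB l ν k
    rw [norm_neg] at h1
    rw [pow_zero, inv_one, mul_one] at h2
    have h3 : ‖(eta ν : ℂ)‖ = 1 := by
      rw [Complex.norm_real, Real.norm_eq_abs]; unfold eta; split_ifs <;> simp
    have h4 : ‖((low k μ * low k l : ℝ) : ℂ)‖ ≤ (1 + ‖k‖) ^ 2 := by
      rw [Complex.norm_real, Real.norm_eq_abs, abs_mul]
      nlinarith [abs_low k μ, abs_low k l, abs_nonneg (low k μ), abs_nonneg (low k l), norm_nonneg k]
    rw [norm_mul, norm_mul, norm_mul, h3, mul_one]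
    calc ‖f μ ν (-k)‖ * ‖h l ν k‖ * ‖((low k μ * low k l : ℝ) : ℂ)‖
        ≤ (A * ((1 + ‖k‖) ^ 8)⁻¹) * B * (1 + ‖k‖) ^ 2 := by gcongr
      _ = A * B * ((1 + ‖k‖) ^ 6)⁻¹ := by
          have : (1 + ‖k‖) ≠ 0 := by positivity
          field_simp
  calc ‖smearedForm (fun μ ν => f μ ν) (fun μ ν => h μ ν) k‖
      ≤ ∑ _μ : Fin 4, ∑ _ν : Fin 4, ∑ _l : Fin 4, A * B * ((1 + ‖k‖) ^ 6)⁻¹ := by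
        refine norm_sum_le_of_le _ fun μ _ => norm_sum_le_of_le _ fun ν _ =>
          norm_sum_le_of_le _ fun l _ => hterm μ ν l
    _ = 64 * (A * B) * ((1 + ‖k‖) ^ 6)⁻¹ := by
        simp only [Finset.sum_const, Finset.card_univ, Fintype.card_fin, nsmul_eq_mul]
        push_cast; ring

/-- The inequality ln x ≤ x - 1, applied to a and to a^(-1/2), trades the logarithm for an
integrable power. -/
lemma abs_log_le_rpow {a : ℝ} (ha : 0 < a) :
    |Real.log a| ≤ a + 2 * a ^ (-(1 / 2) : ℝ) := by
  have hp : 0 < a ^ (-(1 / 2) : ℝ) := Real.rpow_pos_of_pos ha _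
  rw [abs_le]
  constructor
  · have h1 := Real.log_le_sub_one_of_pos hp
    rw [Real.log_rpow ha] at h1
    linarith
  · linarith [Real.log_le_sub_one_of_pos ha]

section Bounds

variable {lam : ℝ} {Θ : Matrix (Fin 4) (Fin 4) ℝ}

/-- The lower bound must not depend on s. Raising the mass changes n·k by n₀d with d² ≤ s, while s
itself occurs under the root and absorbs this change: (n·k₀)² ≤ (1 + 2n₀²)(s + 2(n·k_s)²), where k_s
is the momentum on the shell of mass squared s. -/
lemma ncLength_onShell_bounds (hlam : 0 < lam) (hΘ : Θ ∈ thetaOrbit lam) :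
    ∃ n : Mom, mdot n n = -1 ∧ ∃ c A : ℝ, 0 < c ∧ 0 ≤ A ∧ ∀ s x, 0 ≤ s → s ≤ 1 →
      c * |mdot n (onShell 0 x)| ≤ ncLength Θ (onShell s x) ∧
      ncLength Θ (onShell s x) ≤ A * (1 + ‖x‖) := by
  obtain ⟨n, n', hn, hsq⟩ := exists_spacelike hΘ
  have hd : 0 < 1 + 2 * n 0 ^ 2 := by positivity
  refine ⟨n, hn, lam ^ 2 / √(1 + 2 * n 0 ^ 2), lam ^ 2 * √(1 + 32 * ‖n‖ ^ 2 + 32 * ‖n'‖ ^ 2),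
    by positivity, by positivity, fun s x hs hs1 => ?_⟩
  have hs' := mdot_onShell hs x
  have hlen : ncLength Θ (onShell s x) = √(lam ^ 4 *
      (s + 2 * mdot n (onShell s x) ^ 2 + 2 * mdot n' (onShell s x) ^ 2)) := by
    rw [ncLength, hsq, hs']
  rw [hlen]
  constructor
  · apply Real.le_sqrt_of_sq_le
    have hdiff : mdot n (onShell s x) - mdot n (onShell 0 x) =
        n 0 * (√(s + ‖x‖ ^ 2) - ‖x‖) := by
      have : √(0 + ‖x‖ ^ 2) = ‖x‖ := by rw [zero_add, Real.sqrt_sq (norm_nonneg x)]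
      simp only [mdot_four, onShell, this]
      simp
      ring
    have hr : (√(s + ‖x‖ ^ 2) - ‖x‖) ^ 2 ≤ s := by
      have h1 := Real.sq_sqrt (show 0 ≤ s + ‖x‖ ^ 2 by positivity)
      have h2 : ‖x‖ ≤ √(s + ‖x‖ ^ 2) := Real.le_sqrt_of_sq_le (by linarith)
      nlinarith [norm_nonneg x]
    have h1 : mdot n (onShell 0 x) ^ 2 ≤ (1 + 2 * n 0 ^ 2) * (s + 2 * mdot n (onShell s x) ^ 2) := by
      set u := mdot n (onShell s x)
      set d := √(s + ‖x‖ ^ 2) - ‖x‖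
      have hu : mdot n (onShell 0 x) = u - n 0 * d := by linarith
      rw [hu]
      nlinarith [sq_nonneg (u + n 0 * d), mul_le_mul_of_nonneg_left hr (sq_nonneg (n 0)),
        mul_nonneg (sq_nonneg (n 0)) (sq_nonneg u)]
    rw [mul_pow, sq_abs, div_pow, Real.sq_sqrt hd.le, div_mul_eq_mul_div, div_le_iff₀ hd]
    nlinarith [mul_le_mul_of_nonneg_left h1 (show 0 ≤ lam ^ 4 by positivity),
      mul_nonneg (mul_nonneg (show 0 ≤ lam ^ 4 by positivity) hd.le)
        (sq_nonneg (mdot n' (onShell s x)))]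
  · rw [Real.sqrt_le_left (by positivity), mul_pow, mul_pow, Real.sq_sqrt (by positivity)]
    have hk := norm_onShell_le hs1 x
    have hb : ∀ m : Mom, mdot m (onShell s x) ^ 2 ≤ 16 * ‖m‖ ^ 2 * (1 + ‖x‖) ^ 2 := by
      intro m
      have h1 := abs_mdot_le m (onShell s x)
      have h2 : |mdot m (onShell s x)| ≤ 4 * (‖m‖ * (1 + ‖x‖)) := h1.trans (by gcongr)
      rw [← sq_abs]
      calc |mdot m (onShell s x)| ^ 2 ≤ (4 * (‖m‖ * (1 + ‖x‖))) ^ 2 := by gcongr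
        _ = _ := by ring
    have hx : s ≤ (1 + ‖x‖) ^ 2 := by nlinarith [norm_nonneg x]
    calc lam ^ 4 * (s + 2 * mdot n (onShell s x) ^ 2 + 2 * mdot n' (onShell s x) ^ 2)
        ≤ lam ^ 4 * ((1 + ‖x‖) ^ 2 + 2 * (16 * ‖n‖ ^ 2 * (1 + ‖x‖) ^ 2) +
          2 * (16 * ‖n'‖ ^ 2 * (1 + ‖x‖) ^ 2)) := by gcongr <;> exact hb _
      _ = _ := by ring

/-- The contribution of mass squared `s` in terms of spatial momenta. -/
noncomputable def pairingDensity (Θ : Matrix (Fin 4) (Fin 4) ℝ) (f h : Fin 4 → Fin 4 → Mom → ℂ)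
    (M s : ℝ) (R : Mom → ℂ) (x : Mom3) : ℂ :=
  (((2 * Real.pi)⁻¹ / (2 * √(s + ‖x‖ ^ 2)) : ℝ) : ℂ) *
    reducedPairing Θ f h M (onShell s x) (R (onShell s x))

/-- The test functions supply (1+|x|)⁻⁶, and the logarithm and the remainder cost at most (1+|x|)³
apart from the singularity. What is left is exactly the integrable cone weight. -/
lemma norm_pairingDensity_le (hlam : 0 < lam) (hΘ : Θ ∈ thetaOrbit lam)
    (f h : Fin 4 → Fin 4 → 𝓢(Mom, ℂ)) (M : ℝ) :
    ∃ n : Mom, mdot n n = -1 ∧ (∀ x : Mom3, mdot n (onShell 0 x) ≠ 0 →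
        0 < ncLength Θ (onShell 0 x)) ∧
      ∃ C : ℝ, ∀ s x, 0 < s → s ≤ 1 → x ≠ 0 → mdot n (onShell 0 x) ≠ 0 →
        ‖pairingDensity Θ (fun μ ν => f μ ν) (fun μ ν => h μ ν) M s (momentumRem Θ) x‖ ≤
          C * coneWeightReal n x := by
  obtain ⟨n, hn, c, A, hc, hA, hb⟩ := ncLength_onShell_bounds hlam hΘ
  obtain ⟨B, hB0, hB⟩ := norm_smearedForm_le f h
  refine ⟨n, hn, fun x hx => lt_of_lt_of_le (mul_pos hc (abs_pos.mpr hx))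
    (hb 0 x le_rfl zero_le_one).1, B * ((A + |Real.log M| + remConst * (A ^ 2 + A ^ 3 + A)) +
      2 * c ^ (-(1 / 2) : ℝ)), ?_⟩
  intro s x hs hs1 hx0 hx
  obtain ⟨hlo, hhi⟩ := hb s x hs.le hs1
  set k := onShell s x with hk
  set y := ‖x‖ with hy
  have hy0 : 0 < y := norm_pos_iff.mpr hx0
  set a := ncLength Θ k with ha
  set w := |mdot n (onShell 0 x)| with hw
  have hw0 : 0 < w := abs_pos.mpr hx
  have ha0 : 0 < a := lt_of_lt_of_le (mul_pos hc hw0) hlo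
  have hρ : ‖(((2 * Real.pi)⁻¹ / (2 * √(s + y ^ 2)) : ℝ) : ℂ)‖ ≤ y⁻¹ := by
    rw [Complex.norm_real, Real.norm_of_nonneg (by positivity)]
    have h1 : y ≤ √(s + y ^ 2) := Real.le_sqrt_of_sq_le (by linarith)
    have hpi := Real.pi_gt_three
    rw [← one_div, ← one_div, div_div, div_le_div_iff₀ (by positivity) hy0]
    nlinarith [mul_pos hy0 hy0]
  have hS : ‖smearedForm (fun μ ν => f μ ν) (fun μ ν => h μ ν) k‖ ≤ B * ((1 + y) ^ 6)⁻¹ := by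
    refine (hB k).trans ?_
    have := le_norm_onShell hs.le x
    gcongr
  have hlog : |Real.log a| ≤ A * (1 + y) + 2 * (c ^ (-(1 / 2) : ℝ) * w ^ (-(1 / 2) : ℝ)) := by
    refine (abs_log_le_rpow ha0).trans ?_
    have : a ^ (-(1 / 2) : ℝ) ≤ c ^ (-(1 / 2) : ℝ) * w ^ (-(1 / 2) : ℝ) := by
      rw [← Real.mul_rpow hc.le hw0.le]
      exact Real.rpow_le_rpow_of_nonpos (mul_pos hc hw0) hlo (by norm_num)
    linarith
  have hR : ‖momentumRem Θ k‖ ≤ remConst * (A ^ 2 + A ^ 3 + A) * (1 + y) ^ 3 := by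
    rw [norm_momentumRem, mdot_onShell hs.le]
    have hsq : √s ≤ 1 := Real.sqrt_le_one.mpr hs1
    have hsq0 : 0 < √s := Real.sqrt_pos.mpr hs
    have ht : a * √s / 2 ≤ A * (1 + y) := by nlinarith
    have ht0 : 0 < a * √s / 2 := by positivity
    refine (norm_selfEnergyRem_le' ht0).trans ?_
    rw [mul_assoc]
    refine mul_le_mul_of_nonneg_left ?_ remConst_pos.le
    have h1 : 1 ≤ 1 + y := by linarith
    calc (a * √s / 2) ^ 2 + (a * √s / 2) ^ 3 + a * √s / 2
        ≤ (A * (1 + y)) ^ 2 + (A * (1 + y)) ^ 3 + A * (1 + y) := by gcongr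
      _ ≤ A ^ 2 * (1 + y) ^ 3 + A ^ 3 * (1 + y) ^ 3 + A * (1 + y) ^ 3 := by
          rw [mul_pow, mul_pow]
          have e1 : (1 + y) ^ 2 ≤ (1 + y) ^ 3 := pow_le_pow_right₀ h1 (by norm_num)
          have e2 : (1 + y) ≤ (1 + y) ^ 3 := le_self_pow₀ h1 (by norm_num)
          gcongr
      _ = _ := by ring
  have hw' : 0 ≤ w ^ (-(1 / 2) : ℝ) := by positivity
  have hc' : 0 ≤ c ^ (-(1 / 2) : ℝ) := by positivity
  have hL : ‖((Real.log a + Real.log M : ℝ) : ℂ) + momentumRem Θ k‖ ≤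
      ((A + |Real.log M| + remConst * (A ^ 2 + A ^ 3 + A)) + 2 * c ^ (-(1 / 2) : ℝ)) *
        (1 + y) ^ 3 * (1 + w ^ (-(1 / 2) : ℝ)) := by
    have h1 : ‖((Real.log a + Real.log M : ℝ) : ℂ)‖ ≤ |Real.log a| + |Real.log M| := by
      rw [Complex.norm_real]; exact abs_add_le _ _
    have e0 : (1 : ℝ) ≤ (1 + y) ^ 3 := one_le_pow₀ (by linarith)
    have e1 : (1 + y) ≤ (1 + y) ^ 3 := le_self_pow₀ (by linarith) (by norm_num)
    have hrem := remConst_pos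
    set W := w ^ (-(1 / 2) : ℝ)
    set c' := c ^ (-(1 / 2) : ℝ)
    set Q := remConst * (A ^ 2 + A ^ 3 + A)
    have hQ : 0 ≤ Q := by positivity
    set Y := (1 + y) ^ 3
    have f1 : A * (1 + y) ≤ A * Y := by gcongr
    have f2 : |Real.log M| ≤ |Real.log M| * Y := le_mul_of_one_le_right (abs_nonneg _) e0
    have f3 : c' * W ≤ c' * W * Y := le_mul_of_one_le_right (by positivity) e0
    have f4 : 0 ≤ (A + |Real.log M| + Q) * Y * W := by positivity
    have f5 : 0 ≤ c' * Y := by positivity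
    refine (norm_add_le _ _).trans ?_
    nlinarith
  rw [pairingDensity, reducedPairing, norm_mul, norm_mul, coneWeightReal, ← hy, ← hw]
  calc _ ≤ y⁻¹ * (B * ((1 + y) ^ 6)⁻¹ *
        (((A + |Real.log M| + remConst * (A ^ 2 + A ^ 3 + A)) + 2 * c ^ (-(1 / 2) : ℝ)) *
        (1 + y) ^ 3 * (1 + w ^ (-(1 / 2) : ℝ)))) := by gcongr
    _ = _ := by
        have : (1 + y) ≠ 0 := by positivity
        field_simp

end Bounds

end

/-! ### The derivative with respect to the mass squared -/

section

section Derivative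

variable {lam : ℝ} {Θ : Matrix (Fin 4) (Fin 4) ℝ}

lemma measurable_reducedPairing (f h : Fin 4 → Fin 4 → 𝓢(Mom, ℂ)) (M : ℝ) {R : Mom → ℂ}
    (hR : Measurable R) : Measurable fun k =>
      reducedPairing Θ (fun μ ν => f μ ν) (fun μ ν => h μ ν) M k (R k) := by
  have h1 := measurable_smearedForm f h
  have h2 : Measurable fun k => Real.log (ncLength Θ k) + Real.log M :=
    (Real.measurable_log.comp continuous_ncLength.measurable).add_const _
  exact h1.mul ((Complex.measurable_ofReal.comp h2).add hR)

lemma tendsto_onShell (x : Mom3) : Tendsto (fun s => onShell s x) (𝓝[>] 0)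
    (𝓝[{k' : Mom | 0 < mdot k' k'}] (onShell 0 x)) := by
  refine tendsto_nhdsWithin_iff.2 ⟨?_, ?_⟩
  · have hc : Continuous fun s => onShell s x :=
      continuous_onShell_uncurry.comp (continuous_id.prodMk continuous_const)
    exact (hc.tendsto 0).mono_left nhdsWithin_le_nhds
  · filter_upwards [self_mem_nhdsWithin] with s hs
    have hs' : (0 : ℝ) < s := hs
    change 0 < mdot _ _
    rwa [mdot_onShell hs'.le]

lemma continuous_smearedForm (f h : Fin 4 → Fin 4 → 𝓢(Mom, ℂ)) :
    Continuous (smearedForm (fun μ ν => f μ ν) (fun μ ν => h μ ν)) := by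
  have h1 : ∀ μ ν, Continuous fun k : Mom => f μ ν (-k) := fun μ ν =>
    (f μ ν).continuous.comp continuous_neg
  have h2 : ∀ μ ν, Continuous fun k : Mom => h μ ν k := fun μ ν => (h μ ν).continuous
  unfold smearedForm low
  refine continuous_finsetSum _ fun μ _ => continuous_finsetSum _ fun ν _ =>
    continuous_finsetSum _ fun l _ => ?_
  have := h1 μ ν
  have := h2 l ν
  fun_prop

lemma tendsto_pairingDensity (hlam : 0 < lam) (hΘ : Θ ∈ thetaOrbit lam)
    (f h : Fin 4 → Fin 4 → 𝓢(Mom, ℂ)) (M : ℝ) {x : Mom3} (hx : x ≠ 0)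
    (hκ : 0 < ncLength Θ (onShell 0 x)) :
    Tendsto (fun s => pairingDensity Θ (fun μ ν => f μ ν) (fun μ ν => h μ ν) M s (momentumRem Θ) x)
      (𝓝[>] 0)
      (𝓝 (pairingDensity Θ (fun μ ν => f μ ν) (fun μ ν => h μ ν) M 0 (fun _ => 0) x)) := by
  have ht := tendsto_onShell x
  have ht' := ht.mono_right nhdsWithin_le_nhds
  have c1 : Tendsto (fun s => (((2 * Real.pi)⁻¹ / (2 * √(s + ‖x‖ ^ 2)) : ℝ) : ℂ)) (𝓝[>] 0)
      (𝓝 (((2 * Real.pi)⁻¹ / (2 * √(0 + ‖x‖ ^ 2)) : ℝ) : ℂ)) := by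
    have hx' : 0 < ‖x‖ := norm_pos_iff.mpr hx
    have : ContinuousAt (fun s : ℝ => (2 * Real.pi)⁻¹ / (2 * √(s + ‖x‖ ^ 2))) 0 := by
      refine continuousAt_const.div (by fun_prop) ?_
      positivity
    exact (Complex.continuous_ofReal.continuousAt.comp this).tendsto.mono_left nhdsWithin_le_nhds
  have c2 := ((continuous_smearedForm f h).tendsto (onShell 0 x)).comp ht'
  have c3 : Tendsto (fun s => ((Real.log (ncLength Θ (onShell s x)) + Real.log M : ℝ) : ℂ))
      (𝓝[>] 0) (𝓝 ((Real.log (ncLength Θ (onShell 0 x)) + Real.log M : ℝ) : ℂ)) := by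
    have h1 := ((continuous_ncLength (Θ := Θ)).tendsto (onShell 0 x)).comp ht'
    have h2 := (h1.log hκ.ne').add_const (Real.log M)
    exact (Complex.continuous_ofReal.tendsto _).comp h2
  have c4 := (tendsto_momentumRem hlam hΘ (mdot_onShell le_rfl x)).comp ht
  exact c1.mul (c2.mul (c3.add c4))

lemma tendsto_integral_reducedPairing (hlam : 0 < lam) (hΘ : Θ ∈ thetaOrbit lam)
    (f h : Fin 4 → Fin 4 → 𝓢(Mom, ℂ)) (M : ℝ) :
    Tendsto (fun s => ∫ k, reducedPairing Θ (fun μ ν => f μ ν) (fun μ ν => h μ ν) M k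
      (momentumRem Θ k) ∂(deltaPlus s)) (𝓝[>] 0)
      (𝓝 (∫ k, reducedPairing Θ (fun μ ν => f μ ν) (fun μ ν => h μ ν) M k 0 ∂(deltaPlus 0))) := by
  obtain ⟨n, hn, hpos, C, hC⟩ := norm_pairingDensity_le hlam hΘ f h M
  simp only [integral_deltaPlus _ (measurable_reducedPairing f h M measurable_momentumRem)]
  rw [integral_deltaPlus _ (measurable_reducedPairing f h M measurable_const)]
  refine tendsto_integral_filter_of_dominated_convergence (fun x => C * coneWeightReal n x)
    ?_ ?_ ((integrable_coneWeightReal hn).const_mul C) ?_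
  · refine Eventually.of_forall fun s => Measurable.aestronglyMeasurable ?_
    have := (measurable_reducedPairing (Θ := Θ) f h M (measurable_momentumRem (Θ := Θ))).comp
      (continuous_onShell s).measurable
    exact Measurable.mul (by fun_prop) this
  · filter_upwards [Ioc_mem_nhdsGT (zero_lt_one' ℝ)] with s hs
    filter_upwards [ae_mdot_onShell_ne_zero hn] with x hx
    exact hC s x hs.1 hs.2 hx.1 hx.2
  · filter_upwards [ae_mdot_onShell_ne_zero hn] with x hx
    exact tendsto_pairingDensity hlam hΘ f h M hx.1 (hpos x hx.2)

lemma measurableSet_ncLength_pos : MeasurableSet {k : Mom | 0 < ncLength Θ k} :=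
  measurableSet_lt measurable_const continuous_ncLength.measurable

lemma ae_deltaPlus_ncLength_pos (hlam : 0 < lam) (hΘ : Θ ∈ thetaOrbit lam) :
    ∀ᵐ k ∂(deltaPlus 0), mdot k k = 0 ∧ 0 < k 0 ∧ 0 < ncLength Θ k := by
  obtain ⟨n, hn, c, A, hc, hA, hb⟩ := ncLength_onShell_bounds hlam hΘ
  have hm : MeasurableSet {k : Mom | mdot k k = 0 ∧ 0 < k 0 ∧ 0 < ncLength Θ k} :=
    (measurableSet_eq_fun measurable_mdot_self measurable_const).inter
      ((measurableSet_lt measurable_const (measurable_pi_apply 0)).inter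
        measurableSet_ncLength_pos)
  refine ae_deltaPlus hm ?_
  filter_upwards [ae_mdot_onShell_ne_zero hn] with x hx
  refine ⟨mdot_onShell le_rfl x, ?_, lt_of_lt_of_le (mul_pos hc (abs_pos.mpr hx.2))
    (hb 0 x le_rfl zero_le_one).1⟩
  have : 0 < ‖x‖ := norm_pos_iff.mpr hx.1
  change 0 < √(0 + ‖x‖ ^ 2)
  positivity

/-- The pairing is s times an integral for s > 0 and vanishes at s = 0. Its slope at 0 is therefore
that integral, whose limit follows by dominated convergence. -/
lemma hasDerivWithinAt_selfEnergyPairing (hlam : 0 < lam) (hΘ : Θ ∈ thetaOrbit lam) {e M : ℝ}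
    {Z : ℝ → ℝ} {P : Mom → Fin 4 → Fin 4 → ℂ} (hP : IsRenormalizedSelfEnergy Θ e Z P)
    (hform : ∀ k : Mom, 0 < mdot k k → ∀ μ ν : Fin 4,
      P k μ ν = renormValue Θ e (Real.log M) k μ ν (momentumRem Θ k))
    (f h : Fin 4 → Fin 4 → 𝓢(Mom, ℂ)) (hf : ∀ μ ν, f μ ν = -f ν μ) :
    HasDerivWithinAt (selfEnergyPairing (fun μ ν => f μ ν) (fun μ ν => h μ ν) P)
      (-4 * (e : ℂ) ^ 2 * ∫ k, reducedPairing Θ (fun μ ν => f μ ν) (fun μ ν => h μ ν) M k 0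
        ∂(deltaPlus 0)) (Set.Ici 0) 0 := by
  have hf' : ∀ k μ ν, f μ ν (-k) = -f ν μ (-k) := fun k μ ν => by
    conv_lhs => rw [hf μ ν]
    rfl
  -- On the massless shell the values of P are those of the continuous extension, and k² = 0. The
  -- points with (kΘ)² = 0, where P is not determined, are null.
  have h0 : selfEnergyPairing (fun μ ν => f μ ν) (fun μ ν => h μ ν) P 0 = 0 := by
    refine integral_eq_zero_of_ae ?_
    filter_upwards [ae_deltaPlus_ncLength_pos hlam hΘ] with k hk
    rw [pairing_integrand_renormValue (hf' k) (P := P k) (R := 0)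
      (fun ν r => renormalized_lightlike hlam hΘ hP hform hk.1 hk.2.1 hk.2.2 ν r), hk.1]
    simp
  have hs : ∀ s : ℝ, 0 < s → selfEnergyPairing (fun μ ν => f μ ν) (fun μ ν => h μ ν) P s =
      (s : ℂ) * (-4 * (e : ℂ) ^ 2 * ∫ k, reducedPairing Θ (fun μ ν => f μ ν) (fun μ ν => h μ ν) M k
        (momentumRem Θ k) ∂(deltaPlus s)) := by
    intro s hs
    rw [← mul_assoc, ← integral_const_mul]
    refine integral_congr_ae ?_
    have hae : ∀ᵐ k ∂(deltaPlus s), mdot k k = s :=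
      ae_deltaPlus (measurableSet_eq_fun measurable_mdot_self measurable_const)
        (Eventually.of_forall fun x => mdot_onShell hs.le x)
    filter_upwards [hae] with k hk
    have hk0 : 0 < mdot k k := hk ▸ hs
    rw [pairing_integrand_renormValue (hf' k) (P := P k) (hform k hk0), hk]
    ring
  rw [hasDerivWithinAt_iff_tendsto_slope]
  have hset : Set.Ici (0 : ℝ) \ {0} = Set.Ioi 0 := Set.Ici_sdiff_left
  rw [hset]
  refine ((tendsto_integral_reducedPairing hlam hΘ f h M).const_mul _).congr' ?_
  filter_upwards [self_mem_nhdsWithin] with s hs0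
  have hs0' : (0 : ℝ) < s := hs0
  have hne : (s : ℂ) ≠ 0 := Complex.ofReal_ne_zero.mpr hs0'.ne'
  rw [slope, h0, vsub_eq_sub, sub_zero, sub_zero, hs s hs0', Complex.real_smul, Complex.ofReal_inv,
    inv_mul_cancel_left₀ hne]

lemma integral_reducedPairing_eq (hlam : 0 < lam) (hΘ : Θ ∈ thetaOrbit lam) {M : ℝ} (hM : 0 < M)
    (f h : Fin 4 → Fin 4 → Mom → ℂ) :
    ∫ k, reducedPairing Θ f h M k 0 ∂(deltaPlus 0) = ∫ k : Mom,
      (∑ μ, ∑ ν, ∑ l, f μ ν (-k) * (eta ν : ℂ) * h l ν k *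
        ((low k μ * low k l * Real.log (M * √(-mdot (kTheta Θ k) (kTheta Θ k))) : ℝ) : ℂ))
      ∂(deltaPlus 0) := by
  refine integral_congr_ae ?_
  filter_upwards [ae_deltaPlus_ncLength_pos hlam hΘ] with k hk
  have hl : Real.log (M * √(-mdot (kTheta Θ k) (kTheta Θ k))) =
      Real.log (ncLength Θ k) + Real.log M := by
    rw [← ncLength, Real.log_mul hM.ne' hk.2.2.ne', add_comm]
  rw [hl, reducedPairing, smearedForm, add_zero]
  simp only [Finset.sum_mul]
  refine Finset.sum_congr rfl fun μ _ => Finset.sum_congr rfl fun ν _ =>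
    Finset.sum_congr rfl fun l _ => ?_
  push_cast; ring

lemma norm_momentumRem_le {k : Mom} (hκ : 0 < ncLength Θ k) (hk : 0 < mdot k k) {t : ℝ}
    (ht : t = -(mdot k k * mdot (kTheta Θ k) (kTheta Θ k))) :
    ‖momentumRem Θ k‖ ≤ remConst * t * (1 + |Real.log t|) := by
  set τ := ncLength Θ k * √(mdot k k) / 2 with hτ
  have hτ0 : 0 < τ := by positivity
  have hlen : ncLength Θ k ^ 2 = -mdot (kTheta Θ k) (kTheta Θ k) := by
    rw [ncLength, Real.sq_sqrt]
    by_contra h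
    rw [ncLength, Real.sqrt_eq_zero_of_nonpos (not_le.mp h).le] at hκ
    exact lt_irrefl _ hκ
  -- Hence ln τ and ½ ln t differ by ln 2 < 1, and the factor 1/4 in τ² = t/4 pays for the larger
  -- logarithmic bracket.
  have htτ : t = 4 * τ ^ 2 := by
    rw [hτ, div_pow, mul_pow, hlen, Real.sq_sqrt hk.le, ht]; ring
  have hlog : Real.log τ = (Real.log t - 2 * Real.log 2) / 2 := by
    rw [htτ, Real.log_mul (by norm_num) (by positivity), Real.log_pow,
      show (4 : ℝ) = 2 ^ 2 by norm_num, Real.log_pow]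
    push_cast; ring
  have hl2 := Real.log_two_lt_d9
  have hl2' := Real.log_two_gt_d9
  have habs : |Real.log τ| ≤ 1 + |Real.log t| := by
    rw [hlog, abs_le]
    constructor <;> nlinarith [neg_abs_le (Real.log t), le_abs_self (Real.log t),
      abs_nonneg (Real.log t)]
  rw [norm_momentumRem]
  refine (norm_selfEnergyRem_le hτ0).trans ?_
  have h2 : τ ^ 2 * (1 + |Real.log τ|) ≤ t * (1 + |Real.log t|) := by
    have ht0 : τ ^ 2 = t / 4 := by rw [htτ]; ring
    have ht' : 0 ≤ t / 4 := ht0 ▸ sq_nonneg τ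
    rw [ht0]
    nlinarith [mul_nonneg ht' (abs_nonneg (Real.log t)), mul_le_mul_of_nonneg_left habs ht']
  rw [mul_assoc, mul_assoc]
  exact mul_le_mul_of_nonneg_left h2 remConst_pos.le

end Derivative

theorem exists_fieldStrengthNormalization :
    ∃ C : ℝ, ∀ Z : ℝ → ℝ, ∃ M : ℝ, 0 < M ∧
      ∀ lam : ℝ, 0 < lam → ∀ Θ ∈ thetaOrbit lam, ∀ e : ℝ,
      ∀ P : Mom → Fin 4 → Fin 4 → ℂ, IsRenormalizedSelfEnergy Θ e Z P →
        (∀ k : Mom, 0 < mdot k k →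
          mdot (kTheta Θ k) (kTheta Θ k) < 0 ∧
          ∃ R : ℂ,
            (∀ t : ℝ, t = -(mdot k k * mdot (kTheta Θ k) (kTheta Θ k)) →
              t ≤ 1 → ‖R‖ ≤ C * t * (1 + |Real.log t|)) ∧
            ∀ μ ν : Fin 4, P k μ ν =
              -((2 * Real.pi : ℝ) : ℂ) ^ (-2 : ℤ) * (e : ℂ) ^ 2 *
                ((transverse k μ ν : ℝ) : ℂ) *
                ((Real.log (M * Real.sqrt
                  (-mdot (kTheta Θ k) (kTheta Θ k))) : ℝ) + R)) ∧
        (∀ f h : Fin 4 → Fin 4 → 𝓢(Mom, ℂ),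
          (∀ μ ν, f μ ν = -f ν μ) → (∀ μ ν, h μ ν = -h ν μ) →
          HasDerivWithinAt
            (selfEnergyPairing (fun μ ν => f μ ν) (fun μ ν => h μ ν) P)
            (-4 * (e : ℂ) ^ 2 * ∫ k : Mom,
              (∑ μ, ∑ ν, ∑ l, f μ ν (-k) * (eta ν : ℂ) * h l ν k *
                ((low k μ * low k l * Real.log (M * Real.sqrt
                  (-mdot (kTheta Θ k) (kTheta Θ k))) : ℝ) : ℂ))
              ∂(deltaPlus 0))
            (Set.Ici 0) 0) := by
  refine ⟨remConst, fun Z => ?_⟩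
  obtain ⟨M, hM, hform⟩ := renormalized_eq Z
  refine ⟨M, hM, fun lam hlam Θ hΘ e P hP => ⟨fun k hk => ⟨kTheta_spacelike hlam hΘ hk,
    momentumRem Θ k, ?_, fun μ ν => ?_⟩, fun f h hf _ => ?_⟩⟩
  · intro t ht _
    exact norm_momentumRem_le (ncLength_pos hlam hΘ hk) hk ht
  · rw [hform lam hlam Θ hΘ e P hP k hk μ ν, renormValue, ← ncLength,
      Real.log_mul hM.ne' (ncLength_pos hlam hΘ hk).ne', add_comm (Real.log M)]
  · rw [← integral_reducedPairing_eq hlam hΘ hM (fun μ ν => f μ ν) (fun μ ν => h μ ν)]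
    exact hasDerivWithinAt_selfEnergyPairing hlam hΘ hP (hform lam hlam Θ hΘ e P hP) f h hf

end

/-! ### Bounds on the residual integrand by the bivector k∧l -/

section

/-- The contraction `G^{μν} k_μ l_ν`. -/
noncomputable def tensorForm (G : Fin 4 → Fin 4 → ℂ) (k l : Mom) : ℂ :=
  ∑ μ, ∑ ν, G μ ν * ((low k μ : ℂ) * (low l ν : ℂ))

lemma tensorForm_add_right (G : Fin 4 → Fin 4 → ℂ) (k l m : Mom) :
    tensorForm G k (l + m) = tensorForm G k l + tensorForm G k m := by
  simp only [tensorForm, ← Finset.sum_add_distrib]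
  refine Finset.sum_congr rfl fun μ _ => Finset.sum_congr rfl fun ν _ => ?_
  simp only [low, Pi.add_apply]; push_cast; ring

lemma tensorForm_neg_right (G : Fin 4 → Fin 4 → ℂ) (k l : Mom) :
    tensorForm G k (-l) = -tensorForm G k l := by
  simp only [tensorForm, ← Finset.sum_neg_distrib]
  refine Finset.sum_congr rfl fun μ _ => Finset.sum_congr rfl fun ν _ => ?_
  simp only [low, Pi.neg_apply]; push_cast; ring

lemma norm_tensorForm_le {G : Fin 4 → Fin 4 → ℂ} {B : ℝ} (hG : ∀ μ ν, ‖G μ ν‖ ≤ B) (k l : Mom) :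
    ‖tensorForm G k l‖ ≤ 16 * (B * (‖k‖ * ‖l‖)) := by
  calc ‖tensorForm G k l‖ ≤ ∑ _μ : Fin 4, ∑ _ν : Fin 4, B * (‖k‖ * ‖l‖) := by
        refine norm_sum_le_of_le _ fun μ _ => norm_sum_le_of_le _ fun ν _ => ?_
        rw [norm_mul, norm_mul, Complex.norm_real, Complex.norm_real]
        have h1 := abs_low k μ
        have h2 := abs_low l ν
        have h3 : 0 ≤ B := (norm_nonneg _).trans (hG μ ν)
        gcongr
        · exact hG μ ν
        · exact h1
        · exact h2
    _ = 16 * (B * (‖k‖ * ‖l‖)) := by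
        simp only [Finset.sum_const, Finset.card_univ, Fintype.card_fin, nsmul_eq_mul]
        push_cast; ring

/-- Bound on the components of the bivector spanned by two momenta. -/
def WedgeLE (k l : Mom) (S : ℝ) : Prop :=
  ∀ μ ν, |low k μ * low l ν - low k ν * low l μ| ≤ S

/-- An antisymmetric tensor sees only the bivector, so the form is small when the momenta are nearly
parallel. -/
lemma norm_tensorForm_le_wedge {G : Fin 4 → Fin 4 → ℂ} {B : ℝ} (hG : ∀ μ ν, ‖G μ ν‖ ≤ B)
    (ha : ∀ μ ν, G μ ν = -G ν μ) {k l : Mom} {S : ℝ} (hS : WedgeLE k l S) :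
    ‖tensorForm G k l‖ ≤ 8 * (B * S) := by
  have h2 : tensorForm G k l =
      ∑ μ, ∑ ν, G μ ν * (((1 / 2 : ℝ) * (low k μ * low l ν - low k ν * low l μ) : ℝ) : ℂ) := by
    refine sum_antisymm_congr G _ _ ha fun μ ν _ => ?_
    push_cast; ring
  rw [h2]
  calc _ ≤ ∑ _μ : Fin 4, ∑ _ν : Fin 4, B * (1 / 2 * S) := by
        refine norm_sum_le_of_le _ fun μ _ => norm_sum_le_of_le _ fun ν _ => ?_
        rw [norm_mul, Complex.norm_real, Real.norm_eq_abs, abs_mul, abs_of_pos one_half_pos]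
        have h3 : 0 ≤ B := (norm_nonneg _).trans (hG μ ν)
        gcongr
        · exact hG μ ν
        · exact hS μ ν
    _ = 8 * (B * S) := by
        simp only [Finset.sum_const, Finset.card_univ, Fintype.card_fin, nsmul_eq_mul]
        push_cast; ring

lemma WedgeLE.swap {k l : Mom} {S : ℝ} (h : WedgeLE k l S) : WedgeLE l k S := fun μ ν => by
  have := h ν μ
  rwa [mul_comm (low l μ), mul_comm (low l ν)]

lemma WedgeLE.add_left {k l : Mom} {S : ℝ} (h : WedgeLE k l S) : WedgeLE (l + k) l S :=
  fun μ ν => by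
    have := h μ ν
    have e : low (l + k) μ * low l ν - low (l + k) ν * low l μ =
        low k μ * low l ν - low k ν * low l μ := by
      simp only [low, Pi.add_apply]; ring
    rwa [e]

lemma mdot_nonneg_of_lightlike {a b : Mom} (ha : mdot a a = 0) (hb : mdot b b = 0) (ha0 : 0 < a 0)
    (hb0 : 0 < b 0) : 0 ≤ mdot a b := by
  rw [mdot_four] at *
  have h : 0 ≤ (a 0 * b 1 - b 0 * a 1) ^ 2 + (a 0 * b 2 - b 0 * a 2) ^ 2 +
    (a 0 * b 3 - b 0 * a 3) ^ 2 := by positivity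
  have e : (a 0 * b 1 - b 0 * a 1) ^ 2 + (a 0 * b 2 - b 0 * a 2) ^ 2 +
    (a 0 * b 3 - b 0 * a 3) ^ 2 =
      2 * (a 0 * b 0) * (a 0 * b 0 - a 1 * b 1 - a 2 * b 2 - a 3 * b 3) := by
    linear_combination -(a 0) ^ 2 * hb - (b 0) ^ 2 * ha
  rw [e] at h
  exact nonneg_of_mul_nonneg_right h (by positivity)

lemma abs_apply_le_time {a : Mom} (ha : mdot a a = 0) (ha0 : 0 < a 0) (i : Fin 4) :
    |a i| ≤ a 0 := by
  rw [mdot_four] at ha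
  apply abs_le_of_sq_le_sq _ ha0.le
  fin_cases i
  · exact le_rfl
  · change a 1 ^ 2 ≤ _; nlinarith [sq_nonneg (a 2), sq_nonneg (a 3)]
  · change a 2 ^ 2 ≤ _; nlinarith [sq_nonneg (a 1), sq_nonneg (a 3)]
  · change a 3 ^ 2 ≤ _; nlinarith [sq_nonneg (a 1), sq_nonneg (a 2)]

lemma norm_eq_time {a : Mom} (ha : mdot a a = 0) (ha0 : 0 < a 0) : ‖a‖ = a 0 := by
  refine le_antisymm ((pi_norm_le_iff_of_nonneg ha0.le).2 fun i => abs_apply_le_time ha ha0 i) ?_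
  exact (le_abs_self _).trans (norm_le_pi_norm a 0)

/-- For v_i = a₀b_i - b₀a_i one has Σ v_i² = 2a₀b₀ a·b on the light cone. Moreover a₀(a∧b)_{μν} =
±(a_μv_ν - a_νv_μ), with the components of a bounded by a₀. -/
lemma wedgeLE_of_lightlike {a b : Mom} (ha : mdot a a = 0) (hb : mdot b b = 0) (ha0 : 0 < a 0)
    (hb0 : 0 < b 0) : WedgeLE a b (2 * √(2 * (a 0 * b 0) * mdot a b)) := by
  set S := √(2 * (a 0 * b 0) * mdot a b) with hS
  have hab := mdot_nonneg_of_lightlike ha hb ha0 hb0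
  have hv : ∀ i, |a 0 * b i - b 0 * a i| ≤ S := by
    intro i
    apply Real.abs_le_sqrt
    have e : (a 0 * b 1 - b 0 * a 1) ^ 2 + (a 0 * b 2 - b 0 * a 2) ^ 2 +
      (a 0 * b 3 - b 0 * a 3) ^ 2 = 2 * (a 0 * b 0) * mdot a b := by
      rw [mdot_four] at *
      linear_combination -(a 0) ^ 2 * hb - (b 0) ^ 2 * ha
    rw [← e]
    have h1 := sq_nonneg (a 0 * b 1 - b 0 * a 1)
    have h2 := sq_nonneg (a 0 * b 2 - b 0 * a 2)
    have h3 := sq_nonneg (a 0 * b 3 - b 0 * a 3)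
    fin_cases i
    · change (a 0 * b 0 - b 0 * a 0) ^ 2 ≤ _
      rw [show a 0 * b 0 - b 0 * a 0 = 0 by ring, zero_pow two_ne_zero]
      linarith
    · change (a 0 * b 1 - b 0 * a 1) ^ 2 ≤ _; linarith
    · change (a 0 * b 2 - b 0 * a 2) ^ 2 ≤ _; linarith
    · change (a 0 * b 3 - b 0 * a 3) ^ 2 ≤ _; linarith
  intro μ ν
  have he : ∀ i, |eta i| = 1 := fun i => by unfold eta; split_ifs <;> simp
  have e : a 0 * (low a μ * low b ν - low a ν * low b μ) = eta μ * eta ν *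
      (a μ * (a 0 * b ν - b 0 * a ν) - a ν * (a 0 * b μ - b 0 * a μ)) := by
    simp only [low]; ring
  have h1 : a 0 * |low a μ * low b ν - low a ν * low b μ| ≤ a 0 * (2 * S) := by
    rw [← abs_of_pos ha0, ← abs_mul, abs_of_pos ha0, e, abs_mul, abs_mul, he, he, one_mul, one_mul]
    refine (abs_sub _ _).trans ?_
    rw [abs_mul, abs_mul]
    have m1 := mul_le_mul (abs_apply_le_time ha ha0 μ) (hv ν) (abs_nonneg _) ha0.le
    have m2 := mul_le_mul (abs_apply_le_time ha ha0 ν) (hv μ) (abs_nonneg _) ha0.le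
    linarith
  exact le_of_mul_le_mul_left h1 ha0

section Residual

variable {Θ : Matrix (Fin 4) (Fin 4) ℝ}

lemma twist_eq_tensorForm (k l : Mom) :
    ((twist Θ k l : ℝ) : ℂ) = tensorForm (fun μ ν => (Θ μ ν : ℂ)) k l := by
  simp only [twist, mdot, kTheta, tensorForm]
  push_cast
  rw [Finset.sum_comm]
  refine Finset.sum_congr rfl fun ν _ => ?_
  rw [Finset.mul_sum, Finset.sum_mul]
  refine Finset.sum_congr rfl fun μ _ => ?_
  simp only [low]; push_cast; ring

lemma residualIntegrand_eq (f h : Fin 4 → Fin 4 → Mom → ℂ) (k l : Mom) :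
    residualIntegrand Θ f h k l = 8 * ((2 * Real.pi : ℝ) : ℂ) ^ 2 *
      ((Real.sin (twist Θ k l / 2) * Real.sinc (twist Θ k l / 2) : ℝ) : ℂ) *
      (tensorForm (fun μ ν => f μ ν (-k)) k (kTheta Θ k) * tensorForm (fun μ ν => h μ ν k) k l -
        tensorForm (fun μ ν => f μ ν (-k)) k l *
          tensorForm (fun μ ν => h μ ν k) k (kTheta Θ k)) := by
  rw [residualIntegrand, sin_sq_div_eq]
  congr 1
  simp only [tensorForm, Finset.sum_mul, Finset.mul_sum, ← Finset.sum_sub_distrib]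
  have : ∀ F G : Fin 4 → Fin 4 → Fin 4 → Fin 4 → ℂ, (∀ a b c d, F a b c d = G c d a b) →
      ∑ a, ∑ b, ∑ c, ∑ d, F a b c d = ∑ c, ∑ d, ∑ a, ∑ b, G c d a b := fun F G hFG => by
    rw [sum_swap_pairs]
    refine Finset.sum_congr rfl fun _ _ => Finset.sum_congr rfl fun _ _ =>
      Finset.sum_congr rfl fun _ _ => Finset.sum_congr rfl fun _ _ => hFG _ _ _ _
  refine this _ _ fun a b c d => ?_
  push_cast; ring

/-- Each factor contains l only through an antisymmetric form with k. Different routings of the loop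
momentum are therefore equivalent. -/
lemma residualIntegrand_add_right (hΘ : Θᵀ = -Θ) {f h : Fin 4 → Fin 4 → Mom → ℂ} {k : Mom}
    (hf : ∀ μ ν, f μ ν (-k) = -f ν μ (-k)) (hh : ∀ μ ν, h μ ν k = -h ν μ k) (l : Mom) :
    residualIntegrand Θ f h k (l + k) = residualIntegrand Θ f h k l := by
  rw [residualIntegrand_eq, residualIntegrand_eq, twist_add_right, twist_self hΘ, add_zero,
    tensorForm_add_right, tensorForm_add_right]
  have h1 : tensorForm (fun μ ν => f μ ν (-k)) k k = 0 := sum_antisymm_mul_low hf k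
  have h2 : tensorForm (fun μ ν => h μ ν k) k k = 0 := sum_antisymm_mul_low hh k
  rw [h1, h2, add_zero, add_zero]

lemma residualIntegrand_neg_right (f h : Fin 4 → Fin 4 → Mom → ℂ) (k l : Mom) :
    residualIntegrand Θ f h k (-l) = residualIntegrand Θ f h k l := by
  rw [residualIntegrand_eq, residualIntegrand_eq, twist_neg_right, tensorForm_neg_right,
    tensorForm_neg_right, neg_div, Real.sin_neg, Real.sinc_neg]
  push_cast; ring

lemma norm_kTheta_le {T : ℝ} (hT : ∀ μ ν, |Θ μ ν| ≤ T) (k : Mom) :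
    ‖kTheta Θ k‖ ≤ 4 * (T * ‖k‖) := by
  have hT0 : 0 ≤ T := (abs_nonneg _).trans (hT 0 0)
  refine (pi_norm_le_iff_of_nonneg (by positivity)).2 fun ν => ?_
  calc ‖kTheta Θ k ν‖ ≤ ∑ _μ : Fin 4, T * ‖k‖ := by
        refine norm_sum_le_of_le _ fun μ _ => ?_
        rw [norm_mul, mul_comm T]
        exact mul_le_mul (abs_low k μ) (hT μ ν) (abs_nonneg _) (norm_nonneg _)
    _ = 4 * (T * ‖k‖) := by simp

/-- Each term has two factors linear in the bivector, one from the sine and one from a test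
function, hence the square of S. The constant is 8 · 4 · 1024. -/
lemma norm_residualIntegrand_le (hΘ : Θᵀ = -Θ) {T : ℝ} (hT : ∀ μ ν, |Θ μ ν| ≤ T)
    {f h : Fin 4 → Fin 4 → Mom → ℂ} {k l : Mom} {A B S : ℝ}
    (hf : ∀ μ ν, f μ ν (-k) = -f ν μ (-k)) (hh : ∀ μ ν, h μ ν k = -h ν μ k)
    (hA : ∀ μ ν, ‖f μ ν (-k)‖ ≤ A) (hB : ∀ μ ν, ‖h μ ν k‖ ≤ B) (hS : WedgeLE k l S) :
    ‖residualIntegrand Θ f h k l‖ ≤ 32768 * (2 * Real.pi) ^ 2 * T ^ 2 * (A * B * ‖k‖ ^ 2 * S ^ 2) := by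
  have hT0 : 0 ≤ T := (abs_nonneg _).trans (hT 0 0)
  have hA0 : 0 ≤ A := (norm_nonneg _).trans (hA 0 0)
  have hB0 : 0 ≤ B := (norm_nonneg _).trans (hB 0 0)
  have hS0 : 0 ≤ S := (abs_nonneg _).trans (hS 0 0)
  have hΘ' : ∀ μ ν, Θ μ ν = -Θ ν μ := fun μ ν => by
    have := congrFun (congrFun hΘ ν) μ
    simpa using this
  have hx : |twist Θ k l| ≤ 8 * (T * S) := by
    rw [← Real.norm_eq_abs, ← Complex.norm_real, twist_eq_tensorForm]
    exact norm_tensorForm_le_wedge (fun μ ν => by rw [Complex.norm_real]; exact hT μ ν)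
      (fun μ ν => by rw [hΘ']; push_cast; rfl) hS
  have hsin : ‖((Real.sin (twist Θ k l / 2) * Real.sinc (twist Θ k l / 2) : ℝ) : ℂ)‖ ≤
      4 * (T * S) := by
    rw [Complex.norm_real, Real.norm_eq_abs, abs_mul]
    have h1 : |Real.sin (twist Θ k l / 2)| ≤ |twist Θ k l / 2| := Real.abs_sin_le_abs
    have h2 := Real.abs_sinc_le_one (twist Θ k l / 2)
    rw [abs_div, abs_two] at h1
    calc _ ≤ (|twist Θ k l| / 2) * 1 := by gcongr
      _ ≤ _ := by linarith
  have hκ := norm_kTheta_le hT k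
  have t1 : ‖tensorForm (fun μ ν => f μ ν (-k)) k (kTheta Θ k)‖ ≤ 64 * (A * T * ‖k‖ ^ 2) := by
    refine (norm_tensorForm_le hA k _).trans ?_
    calc _ ≤ 16 * (A * (‖k‖ * (4 * (T * ‖k‖)))) := by gcongr
      _ = _ := by ring
  have t2 : ‖tensorForm (fun μ ν => h μ ν k) k (kTheta Θ k)‖ ≤ 64 * (B * T * ‖k‖ ^ 2) := by
    refine (norm_tensorForm_le hB k _).trans ?_
    calc _ ≤ 16 * (B * (‖k‖ * (4 * (T * ‖k‖)))) := by gcongr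
      _ = _ := by ring
  have t3 := norm_tensorForm_le_wedge hA hf hS
  have t4 := norm_tensorForm_le_wedge hB hh hS
  have hsub : ‖tensorForm (fun μ ν => f μ ν (-k)) k (kTheta Θ k) *
      tensorForm (fun μ ν => h μ ν k) k l - tensorForm (fun μ ν => f μ ν (-k)) k l *
        tensorForm (fun μ ν => h μ ν k) k (kTheta Θ k)‖ ≤ 1024 * (A * B * T * ‖k‖ ^ 2 * S) := by
    refine (norm_sub_le _ _).trans ?_
    rw [norm_mul, norm_mul]
    calc _ ≤ 64 * (A * T * ‖k‖ ^ 2) * (8 * (B * S)) + 8 * (A * S) * (64 * (B * T * ‖k‖ ^ 2)) := by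
          gcongr
      _ = _ := by ring
  rw [residualIntegrand_eq, norm_mul, norm_mul]
  have hc : ‖8 * ((2 * Real.pi : ℝ) : ℂ) ^ 2‖ = 8 * (2 * Real.pi) ^ 2 := by
    rw [norm_mul, norm_pow, Complex.norm_real, Real.norm_of_nonneg (by positivity)]
    norm_num
  rw [hc]
  calc _ ≤ 8 * (2 * Real.pi) ^ 2 * (4 * (T * S)) * (1024 * (A * B * T * ‖k‖ ^ 2 * S)) := by gcongr
    _ = _ := by ring

lemma measurable_residualIntegrand {f h : Fin 4 → Fin 4 → Mom → ℂ}
    (hf : ∀ μ ν, Measurable (f μ ν)) (hh : ∀ μ ν, Measurable (h μ ν)) :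
    Measurable fun z : Mom × Mom => residualIntegrand Θ f h z.1 z.2 := by
  have ht : Measurable fun z : Mom × Mom => twist Θ z.1 z.2 :=
    (continuous_mdot (continuous_kTheta.comp continuous_fst) continuous_snd).measurable
  have hk : ∀ μ, Measurable fun z : Mom × Mom => low (kTheta Θ z.1) μ := fun μ => by
    have : Continuous fun z : Mom × Mom => kTheta Θ z.1 := continuous_kTheta.comp continuous_fst
    exact (((continuous_apply μ).comp this).const_mul _).measurable
  have h1 : ∀ μ, Measurable fun z : Mom × Mom => low z.1 μ := fun μ => by
    unfold low; fun_prop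
  have h2 : ∀ μ, Measurable fun z : Mom × Mom => low z.2 μ := fun μ => by
    unfold low; fun_prop
  unfold residualIntegrand
  refine Measurable.mul (by fun_prop) ?_
  refine Finset.measurable_sum _ fun μ _ => Finset.measurable_sum _ fun ν _ =>
    Finset.measurable_sum _ fun l _ => Finset.measurable_sum _ fun r _ => ?_
  have e1 : Measurable fun z : Mom × Mom => f μ ν (-z.1) := (hf μ ν).comp (by fun_prop)
  have e2 : Measurable fun z : Mom × Mom => h l r z.1 := (hh l r).comp measurable_fst
  have := hk ν
  have := hk r
  have := h1 μ
  have := h1 l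
  have := h2 r
  have := h2 ν
  fun_prop

end Residual

end

/-! ### Propagators with compensating numerators -/

section

/-- A weight in the energy that is integrable on the light cone. -/
noncomputable def energyWeight (k : Mom) : ℝ := ((1 + |k 0|) ^ 3)⁻¹

lemma energyWeight_nonneg (k : Mom) : 0 ≤ energyWeight k := by unfold energyWeight; positivity

lemma measurable_energyWeight : Measurable energyWeight := by unfold energyWeight; fun_prop

lemma integrable_energyWeight : Integrable energyWeight (deltaPlus 0) := by
  refine ⟨measurable_energyWeight.aestronglyMeasurable, ?_⟩
  rw [hasFiniteIntegral_iff_ofReal (Eventually.of_forall energyWeight_nonneg),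
    lintegral_deltaPlus_zero measurable_energyWeight.ennreal_ofReal]
  calc ∫⁻ n : Sph, ∫⁻ r in Set.Ioi (0 : ℝ), ENNReal.ofReal ((4 * Real.pi)⁻¹ * r) *
        ENNReal.ofReal (energyWeight (r • ray n)) ∂volume ∂sphereMeasure
      ≤ ∫⁻ _n : Sph, ∫⁻ r in Set.Ioi (0 : ℝ), ENNReal.ofReal (((1 + r) ^ 2)⁻¹)
          ∂volume ∂sphereMeasure := by
        refine lintegral_mono fun n => setLIntegral_mono_ae' measurableSet_Ioi
          (Eventually.of_forall fun r hr => ?_)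
        have hr0 : 0 < r := hr
        have hE : energyWeight (r • ray n) = ((1 + r) ^ 3)⁻¹ := by
          simp [energyWeight, ray, abs_of_pos hr0]
        rw [hE, ← ENNReal.ofReal_mul (by positivity)]
        refine ENNReal.ofReal_le_ofReal ?_
        have hpi : (4 * Real.pi)⁻¹ ≤ 1 := inv_le_one_of_one_le₀ (by linarith [Real.pi_gt_three])
        calc (4 * Real.pi)⁻¹ * r * ((1 + r) ^ 3)⁻¹ ≤ 1 * (1 + r) * ((1 + r) ^ 3)⁻¹ := by
              gcongr; linarith
          _ = ((1 + r) ^ 2)⁻¹ := by field_simp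
    _ < ⊤ := by
        rw [lintegral_const]
        exact ENNReal.mul_lt_top lintegral_one_add_pow_lt_top (measure_lt_top _ _)

lemma norm_retProp_le (ε : ℝ) {p : Mom} (hp : mdot p p ≠ 0) :
    ‖retProp ε p‖ ≤ (2 * Real.pi) ^ (-2 : ℤ) / |mdot p p| := by
  rw [retProp, norm_div, norm_neg, norm_zpow, Complex.norm_real,
    Real.norm_of_nonneg Real.two_pi_pos.le]
  refine div_le_div_of_nonneg_left (by positivity) (abs_pos.mpr hp) ?_
  refine le_trans (le_of_eq ?_) (Complex.abs_re_le_norm _)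
  simp

lemma tendsto_retProp {p : Mom} (hp : mdot p p ≠ 0) :
    Tendsto (fun ε => retProp ε p) (𝓝[>] 0) (𝓝 (retProp 0 p)) := by
  have hd : ContinuousAt (fun ε : ℝ => retProp ε p) 0 := by
    unfold retProp
    refine ContinuousAt.div (by fun_prop) (by fun_prop) ?_
    simpa using hp
  exact hd.tendsto.mono_left nhdsWithin_le_nhds

lemma measurable_retProp (ε : ℝ) : Measurable (retProp ε) := by
  have := measurable_mdot_self
  unfold retProp
  fun_prop

/-- A numerator bounded by |p²| compensates the propagator for every ε, including ε = 0: where p² =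
0 the numerator vanishes. -/
lemma norm_retProp_mul_le (ε : ℝ) {p : Mom} {c : ℂ} {g : ℝ} (hg : 0 ≤ g)
    (hc : ‖c‖ ≤ |mdot p p| * g) : ‖retProp ε p * c‖ ≤ (2 * Real.pi) ^ (-2 : ℤ) * g := by
  rcases eq_or_ne (mdot p p) 0 with h | h
  · rw [h, abs_zero, zero_mul, norm_le_zero_iff] at hc
    rw [hc, mul_zero, norm_zero]
    positivity
  · rw [norm_mul]
    have h' := abs_pos.mpr h
    calc ‖retProp ε p‖ * ‖c‖ ≤ (2 * Real.pi) ^ (-2 : ℤ) / |mdot p p| * (|mdot p p| * g) := by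
          gcongr; exact norm_retProp_le ε h
      _ = _ := by field_simp

section Regularized

variable {α : Type*} [MeasurableSpace α] {μ : Measure α} {p : α → Mom} {c : α → ℂ} {g : α → ℝ}

lemma integrable_retProp_mul (hp : Measurable p) (hc : Measurable c) (hg : Integrable g μ)
    (hg0 : ∀ z, 0 ≤ g z) (hb : ∀ᵐ z ∂μ, ‖c z‖ ≤ |mdot (p z) (p z)| * g z) (ε : ℝ) :
    Integrable (fun z => retProp ε (p z) * c z) μ := by
  refine (hg.const_mul ((2 * Real.pi) ^ (-2 : ℤ))).mono'
    (((measurable_retProp ε).comp hp).mul hc).aestronglyMeasurable ?_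
  filter_upwards [hb] with z hz
  exact norm_retProp_mul_le ε (hg0 z) hz

lemma tendsto_integral_retProp_mul (hp : Measurable p) (hc : Measurable c) (hg : Integrable g μ)
    (hg0 : ∀ z, 0 ≤ g z) (hb : ∀ᵐ z ∂μ, ‖c z‖ ≤ |mdot (p z) (p z)| * g z) :
    Tendsto (fun ε => ∫ z, retProp ε (p z) * c z ∂μ) (𝓝[>] 0)
      (𝓝 (∫ z, retProp 0 (p z) * c z ∂μ)) := by
  refine tendsto_integral_filter_of_dominated_convergence
    (fun z => (2 * Real.pi) ^ (-2 : ℤ) * g z)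
    (Eventually.of_forall fun ε => (((measurable_retProp ε).comp hp).mul hc).aestronglyMeasurable)
    (Eventually.of_forall fun ε => ?_) (hg.const_mul _) ?_
  · filter_upwards [hb] with z hz
    exact norm_retProp_mul_le ε (hg0 z) hz
  · filter_upwards [hb] with z hz
    rcases eq_or_ne (mdot (p z) (p z)) 0 with h | h
    · rw [h, abs_zero, zero_mul, norm_le_zero_iff] at hz
      simp [hz]
    · exact (tendsto_retProp h).mul_const _

end Regularized

section Cancellation

variable {Θ : Matrix (Fin 4) (Fin 4) ℝ}

lemma exists_norm_residualIntegrand_le (hΘ : Θᵀ = -Θ) (f h : Fin 4 → Fin 4 → 𝓢(Mom, ℂ))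
    (hf : ∀ μ ν, f μ ν = -f ν μ) (hh : ∀ μ ν, h μ ν = -h ν μ) :
    ∃ K : ℝ, 0 ≤ K ∧ ∀ k l S, WedgeLE k l S →
      ‖residualIntegrand Θ (fun μ ν => f μ ν) (fun μ ν => h μ ν) k l‖ ≤
        K * (((1 + ‖k‖) ^ 8)⁻¹ * S ^ 2) := by
  -- Two of the ten powers are spent on the factor ‖k‖².
  obtain ⟨A, hA0, hA⟩ := schwartz_family_bound f 10
  obtain ⟨B, hB0, hB⟩ := schwartz_family_bound h 0
  set T := ∑ q : Fin 4 × Fin 4, |Θ q.1 q.2| with hTdef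
  have hT : ∀ μ ν, |Θ μ ν| ≤ T := fun μ ν =>
    Finset.single_le_sum (f := fun q : Fin 4 × Fin 4 => |Θ q.1 q.2|)
      (fun q _ => abs_nonneg _) (Finset.mem_univ (μ, ν))
  refine ⟨32768 * (2 * Real.pi) ^ 2 * T ^ 2 * (A * B), by positivity, fun k l S hS => ?_⟩
  have hf' : ∀ μ ν, f μ ν (-k) = -f ν μ (-k) := fun μ ν => by
    conv_lhs => rw [hf μ ν]
    rfl
  have hh' : ∀ μ ν, h μ ν k = -h ν μ k := fun μ ν => by
    conv_lhs => rw [hh μ ν]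
    rfl
  refine (norm_residualIntegrand_le hΘ hT (A := A * ((1 + ‖k‖) ^ 10)⁻¹) (B := B) hf' hh'
    (fun μ ν => by simpa using hA μ ν (-k)) (fun μ ν => by simpa using hB μ ν k) hS).trans ?_
  have hk : ‖k‖ ^ 2 ≤ (1 + ‖k‖) ^ 2 := by gcongr; linarith
  calc _ ≤ 32768 * (2 * Real.pi) ^ 2 * T ^ 2 *
        (A * ((1 + ‖k‖) ^ 10)⁻¹ * B * (1 + ‖k‖) ^ 2 * S ^ 2) := by gcongr
    _ = _ := by
        have : (1 + ‖k‖) ≠ 0 := by positivity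
        field_simp

lemma sq_wedge_bound {a b : Mom} (ha : mdot a a = 0) (hb : mdot b b = 0) (ha0 : 0 < a 0)
    (hb0 : 0 < b 0) : (2 * √(2 * (a 0 * b 0) * mdot a b)) ^ 2 = 8 * (a 0 * b 0) * mdot a b := by
  have := mdot_nonneg_of_lightlike ha hb ha0 hb0
  rw [mul_pow, Real.sq_sqrt (by positivity)]; ring

/-- With the external momentum on shell the test functions decay in k only. The growth in the loop
energy is bounded with the help of the cutoff. -/
lemma exists_norm_residual_external_le (hΘ : Θᵀ = -Θ) (f h : Fin 4 → Fin 4 → 𝓢(Mom, ℂ))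
    (hf : ∀ μ ν, f μ ν = -f ν μ) (hh : ∀ μ ν, h μ ν = -h ν μ) (Λ : ℝ) :
    ∃ K : ℝ, 0 ≤ K ∧ ∀ k l : Mom, mdot k k = 0 → mdot l l = 0 → 0 < k 0 → 0 < l 0 → l 0 ≤ Λ →
      ‖residualIntegrand Θ (fun μ ν => f μ ν) (fun μ ν => h μ ν) k l‖ ≤
        mdot k l * (K * (energyWeight k * energyWeight l)) := by
  obtain ⟨K, hK0, hK⟩ := exists_norm_residualIntegrand_le hΘ f h hf hh
  refine ⟨8 * K * (1 + |Λ|) ^ 4, by positivity, fun k l hk hl hk0 hl0 hlΛ => ?_⟩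
  have hkl := mdot_nonneg_of_lightlike hk hl hk0 hl0
  refine (hK k l _ (wedgeLE_of_lightlike hk hl hk0 hl0)).trans ?_
  rw [sq_wedge_bound hk hl hk0 hl0, norm_eq_time hk hk0, energyWeight, energyWeight,
    abs_of_pos hk0, abs_of_pos hl0]
  have e1 : k 0 * ((1 + k 0) ^ 8)⁻¹ ≤ ((1 + k 0) ^ 3)⁻¹ := by
    have h1 : (1 : ℝ) ≤ 1 + k 0 := by linarith
    rw [← div_eq_mul_inv, ← one_div, div_le_div_iff₀ (by positivity) (by positivity), one_mul]
    calc k 0 * (1 + k 0) ^ 3 ≤ (1 + k 0) * (1 + k 0) ^ 3 := by gcongr; linarith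
      _ = (1 + k 0) ^ 4 := by ring
      _ ≤ (1 + k 0) ^ 8 := pow_le_pow_right₀ h1 (by norm_num)
  have e2 : l 0 ≤ (1 + |Λ|) ^ 4 * ((1 + l 0) ^ 3)⁻¹ := by
    rw [← div_eq_mul_inv, le_div_iff₀ (by positivity)]
    have h1 : l 0 ≤ |Λ| := hlΛ.trans (le_abs_self Λ)
    calc l 0 * (1 + l 0) ^ 3 ≤ (1 + |Λ|) * (1 + |Λ|) ^ 3 := by gcongr; linarith
      _ = _ := by ring
  calc K * (((1 + k 0) ^ 8)⁻¹ * (8 * (k 0 * l 0) * mdot k l))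
      = 8 * K * mdot k l * (k 0 * ((1 + k 0) ^ 8)⁻¹) * l 0 := by ring
    _ ≤ 8 * K * mdot k l * ((1 + k 0) ^ 3)⁻¹ * ((1 + |Λ|) ^ 4 * ((1 + l 0) ^ 3)⁻¹) := by gcongr
    _ = _ := by ring

/-- Here the test functions depend on a + b. Its norm is at least a₀ + b₀ and thus controls both
energies, so no cutoff is needed. -/
lemma exists_norm_residual_internal_le (hΘ : Θᵀ = -Θ) (f h : Fin 4 → Fin 4 → 𝓢(Mom, ℂ))
    (hf : ∀ μ ν, f μ ν = -f ν μ) (hh : ∀ μ ν, h μ ν = -h ν μ) :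
    ∃ K : ℝ, 0 ≤ K ∧ ∀ a b : Mom, mdot a a = 0 → mdot b b = 0 → 0 < a 0 → 0 < b 0 →
      ‖residualIntegrand Θ (fun μ ν => f μ ν) (fun μ ν => h μ ν) (a + b) a‖ ≤
        mdot a b * (K * (energyWeight a * energyWeight b)) := by
  obtain ⟨K, hK0, hK⟩ := exists_norm_residualIntegrand_le hΘ f h hf hh
  refine ⟨8 * K, by positivity, fun a b ha hb ha0 hb0 => ?_⟩
  have hab := mdot_nonneg_of_lightlike ha hb ha0 hb0
  refine (hK (a + b) a _ (wedgeLE_of_lightlike ha hb ha0 hb0).swap.add_left).trans ?_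
  rw [sq_wedge_bound ha hb ha0 hb0, energyWeight, energyWeight, abs_of_pos ha0, abs_of_pos hb0]
  have hn : a 0 + b 0 ≤ ‖a + b‖ := (le_abs_self _).trans (norm_le_pi_norm (a + b) 0)
  have e1 : ((1 + ‖a + b‖) ^ 8)⁻¹ * (a 0 * b 0) ≤ ((1 + a 0) ^ 3)⁻¹ * ((1 + b 0) ^ 3)⁻¹ := by
    rw [← mul_inv, inv_mul_eq_div, ← one_div, div_le_div_iff₀ (by positivity) (by positivity)]
    have h1 : 1 + a 0 ≤ 1 + ‖a + b‖ := by linarith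
    have h2 : 1 + b 0 ≤ 1 + ‖a + b‖ := by linarith
    have h3 : a 0 ≤ 1 + ‖a + b‖ := by linarith
    have h4 : b 0 ≤ 1 + ‖a + b‖ := by linarith
    calc a 0 * b 0 * ((1 + a 0) ^ 3 * (1 + b 0) ^ 3)
        ≤ (1 + ‖a + b‖) * (1 + ‖a + b‖) * ((1 + ‖a + b‖) ^ 3 * (1 + ‖a + b‖) ^ 3) := by gcongr
      _ = 1 * (1 + ‖a + b‖) ^ 8 := by ring
  calc K * (((1 + ‖a + b‖) ^ 8)⁻¹ * (8 * (a 0 * b 0) * mdot a b))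
      = 8 * K * mdot a b * (((1 + ‖a + b‖) ^ 8)⁻¹ * (a 0 * b 0)) := by ring
    _ ≤ 8 * K * mdot a b * (((1 + a 0) ^ 3)⁻¹ * ((1 + b 0) ^ 3)⁻¹) := by gcongr
    _ = _ := by ring

end Cancellation

end

/-! ### Pairwise cancellation of the six contributions -/

section

/-- The momentum of the retarded propagator when the first order field is at position `j`. -/
def legProp (j : Fin 3) (z : Mom × Mom) : Mom := ![z.1 + z.2, z.2 - z.1, -(z.1 + z.2)] j

lemma legMom_self (j : Fin 3) (a b : Mom) : legMom j a b j = legProp j (a, b) := by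
  fin_cases j <;> rfl

lemma measurable_legProp (j : Fin 3) : Measurable (legProp j) := by
  fin_cases j
  · change Measurable fun z : Mom × Mom => z.1 + z.2; fun_prop
  · change Measurable fun z : Mom × Mom => z.2 - z.1; fun_prop
  · change Measurable fun z : Mom × Mom => -(z.1 + z.2); fun_prop

lemma abs_mdot_legProp (j : Fin 3) {z : Mom × Mom} (ha : mdot z.1 z.1 = 0) (hb : mdot z.2 z.2 = 0)
    (hab : 0 ≤ mdot z.1 z.2) : |mdot (legProp j z) (legProp j z)| = 2 * mdot z.1 z.2 := by
  have h1 : mdot (z.1 + z.2) (z.1 + z.2) = 2 * mdot z.1 z.2 := by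
    rw [mdot_add_left, mdot_add_right, mdot_add_right, ha, hb, mdot_comm z.2]; ring
  have h2 : mdot (z.2 - z.1) (z.2 - z.1) = -(2 * mdot z.1 z.2) := by
    rw [mdot_sub_self, ha, hb, mdot_comm z.2]; ring
  fin_cases j
  · change |mdot (z.1 + z.2) (z.1 + z.2)| = _
    rw [h1, abs_of_nonneg (by positivity)]
  · change |mdot (z.2 - z.1) (z.2 - z.1)| = _
    rw [h2, abs_neg, abs_of_nonneg (by positivity)]
  · change |mdot (-(z.1 + z.2)) (-(z.1 + z.2))| = _
    rw [mdot_neg_neg, h1, abs_of_nonneg (by positivity)]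

lemma retProp_zero_eq (p : Mom) :
    retProp 0 p = -((2 * Real.pi : ℝ) : ℂ) ^ (-2 : ℤ) / (mdot p p : ℝ) := by
  simp [retProp]

/-- For lightlike a and b one has (b-a)² = -(a+b)², so the unregularized propagators of the three
positions agree up to sign. -/
lemma retProp_zero_legProp {z : Mom × Mom} (ha : mdot z.1 z.1 = 0) (hb : mdot z.2 z.2 = 0) :
    retProp 0 (legProp 1 z) = -retProp 0 (legProp 0 z) ∧
      retProp 0 (legProp 2 z) = retProp 0 (legProp 0 z) := by
  have h2 : mdot (z.2 - z.1) (z.2 - z.1) = -mdot (z.1 + z.2) (z.1 + z.2) := by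
    rw [mdot_sub_self, mdot_add_left, mdot_add_right, mdot_add_right, ha, hb, mdot_comm z.2]; ring
  constructor
  · change retProp 0 (z.2 - z.1) = -retProp 0 (z.1 + z.2)
    rw [retProp_zero_eq, retProp_zero_eq, h2, Complex.ofReal_neg, div_neg]
  · change retProp 0 (-(z.1 + z.2)) = retProp 0 (z.1 + z.2)
    rw [retProp_zero_eq, retProp_zero_eq, mdot_neg_neg]

section Vertex

variable {Θ : Matrix (Fin 4) (Fin 4) ℝ}

/-- Vertex factor with external momentum `b` on shell and the loop energy `a₀` cut off. -/
noncomputable def externalVertex (Θ : Matrix (Fin 4) (Fin 4) ℝ) (f h : Fin 4 → Fin 4 → Mom → ℂ)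
    (Λ : ℝ) (a b : Mom) : ℂ :=
  open Classical in if a 0 ≤ Λ then residualIntegrand Θ f h b a else 0

/-- Vertex factors of the contributions with the first order kernel in the first observable. -/
noncomputable def vertex21 (Θ : Matrix (Fin 4) (Fin 4) ℝ) (f h : Fin 4 → Fin 4 → Mom → ℂ)
    (Λ : ℝ) (j : Fin 3) (z : Mom × Mom) : ℂ :=
  ![externalVertex Θ f h Λ z.1 z.2, externalVertex Θ f h Λ z.1 z.2,
    residualIntegrand Θ f h (z.1 + z.2) z.1] j

/-- Vertex factors of the contributions with the first order kernel in the second observable. -/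
noncomputable def vertex12 (Θ : Matrix (Fin 4) (Fin 4) ℝ) (f h : Fin 4 → Fin 4 → Mom → ℂ)
    (Λ : ℝ) (j : Fin 3) (z : Mom × Mom) : ℂ :=
  ![-residualIntegrand Θ f h (z.1 + z.2) z.1, -externalVertex Θ f h Λ z.2 z.1,
    -externalVertex Θ f h Λ z.2 z.1] j

lemma integrand21_eq (hΘ : Θᵀ = -Θ) {f h : Fin 4 → Fin 4 → Mom → ℂ}
    (hf : ∀ k μ ν, f μ ν k = -f ν μ k) (hh : ∀ k μ ν, h μ ν k = -h ν μ k) (ε Λ : ℝ) (j : Fin 3) :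
    integrand21 Θ f h ε Λ j = fun z => retProp ε (legProp j z) * vertex21 Θ f h Λ j z := by
  classical
  funext z
  obtain ⟨a, b⟩ := z
  rw [integrand21, legMom_self]
  fin_cases j
  · have e : amp21 Θ f h 0 (a + b) (-a) (-b) = residualIntegrand Θ f h b a := by
      -- The loop momentum at this position is a + b, with total momentum b; the shift by b does not
      -- change N.
      have := amp21_eq hΘ f h 0 b (a + b) (hf _) (hh _)
      rwa [show b - (a + b) = -a by abel, residualIntegrand_add_right hΘ (hf _) (hh _)] at this
    simp only [vertex21, externalVertex, legMom]
    simp [e]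
  · have e : amp21 Θ f h 1 a (b - a) (-b) = residualIntegrand Θ f h b a :=
      amp21_eq hΘ f h 1 b a (hf _) (hh _)
    simp only [vertex21, externalVertex, legMom]
    simp [e]
  · have e : amp21 Θ f h 2 a b (-(a + b)) = residualIntegrand Θ f h (a + b) a := by
      have := amp21_eq hΘ f h 2 (a + b) a (hf _) (hh _)
      rwa [show a + b - a = b by abel] at this
    simp only [vertex21, legMom]
    simp [-neg_add_rev, e]

lemma integrand12_eq (hΘ : Θᵀ = -Θ) {f h : Fin 4 → Fin 4 → Mom → ℂ}
    (hf : ∀ k μ ν, f μ ν k = -f ν μ k) (hh : ∀ k μ ν, h μ ν k = -h ν μ k) (ε Λ : ℝ) (j : Fin 3) :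
    integrand12 Θ f h ε Λ j = fun z => retProp ε (legProp j z) * vertex12 Θ f h Λ j z := by
  classical
  funext z
  obtain ⟨a, b⟩ := z
  rw [integrand12, legMom_self]
  fin_cases j
  · have e : amp12 Θ f h 0 (a + b) (-a) (-b) = -residualIntegrand Θ f h (a + b) a := by
      have := amp12_eq hΘ f h 0 (a + b) a (hf _) (hh _)
      rwa [show a - (a + b) = -b by abel] at this
    simp only [vertex12, legMom]
    simp [e]
  · have e : amp12 Θ f h 1 a (b - a) (-b) = -residualIntegrand Θ f h a b := by
      have := amp12_eq hΘ f h 1 a (a - b) (hf _) (hh _)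
      rwa [show -(a - b) = b - a by abel, show a - b - a = -b by abel,
        show a - b = -b + a by abel, residualIntegrand_add_right hΘ (hf _) (hh _),
        residualIntegrand_neg_right] at this
    simp only [vertex12, externalVertex, legMom]
    simp [e]
    split_ifs <;> simp
  · have e : amp12 Θ f h 2 a b (-(a + b)) = -residualIntegrand Θ f h a b := by
      have := amp12_eq hΘ f h 2 a (-b) (hf _) (hh _)
      rwa [neg_neg, show -b - a = -(a + b) by abel, residualIntegrand_neg_right] at this
    simp only [vertex12, externalVertex, legMom]
    simp [-neg_add_rev, e]
    split_ifs <;> simp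

lemma measurable_externalVertex {f h : Fin 4 → Fin 4 → Mom → ℂ}
    (hf : ∀ μ ν, Measurable (f μ ν)) (hh : ∀ μ ν, Measurable (h μ ν)) (Λ : ℝ) :
    Measurable fun z : Mom × Mom => externalVertex Θ f h Λ z.1 z.2 := by
  classical
  have h1 : MeasurableSet {z : Mom × Mom | z.1 0 ≤ Λ} :=
    measurableSet_le ((measurable_pi_apply 0).comp measurable_fst) measurable_const
  unfold externalVertex
  refine Measurable.ite h1 ?_ measurable_const
  have := (measurable_residualIntegrand (Θ := Θ) hf hh).comp
    (measurable_snd.prodMk measurable_fst : Measurable fun z : Mom × Mom => (z.2, z.1))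
  simpa only [Function.comp_def, Pi.add_apply] using this

lemma measurable_internalVertex {f h : Fin 4 → Fin 4 → Mom → ℂ}
    (hf : ∀ μ ν, Measurable (f μ ν)) (hh : ∀ μ ν, Measurable (h μ ν)) :
    Measurable fun z : Mom × Mom => residualIntegrand Θ f h (z.1 + z.2) z.1 := by
  have := (measurable_residualIntegrand (Θ := Θ) hf hh).comp
    ((measurable_fst.add measurable_snd).prodMk measurable_fst :
      Measurable fun z : Mom × Mom => (z.1 + z.2, z.1))
  simpa only [Function.comp_def, Pi.add_apply] using this

lemma measurable_vertex21 {f h : Fin 4 → Fin 4 → Mom → ℂ}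
    (hf : ∀ μ ν, Measurable (f μ ν)) (hh : ∀ μ ν, Measurable (h μ ν)) (Λ : ℝ) (j : Fin 3) :
    Measurable (vertex21 Θ f h Λ j) := by
  fin_cases j
  · exact measurable_externalVertex hf hh Λ
  · exact measurable_externalVertex hf hh Λ
  · exact measurable_internalVertex hf hh

lemma measurable_vertex12 {f h : Fin 4 → Fin 4 → Mom → ℂ}
    (hf : ∀ μ ν, Measurable (f μ ν)) (hh : ∀ μ ν, Measurable (h μ ν)) (Λ : ℝ) (j : Fin 3) :
    Measurable (vertex12 Θ f h Λ j) := by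
  fin_cases j
  · exact (measurable_internalVertex hf hh).neg
  · exact ((measurable_externalVertex hf hh Λ).comp measurable_swap).neg
  · exact ((measurable_externalVertex hf hh Λ).comp measurable_swap).neg

lemma ae_lightlike_pair : ∀ᵐ z ∂((deltaPlus 0).prod (deltaPlus 0)),
    (mdot z.1 z.1 = 0 ∧ 0 < z.1 0) ∧ (mdot z.2 z.2 = 0 ∧ 0 < z.2 0) := by
  have h : ∀ᵐ k ∂(deltaPlus 0), mdot k k = 0 ∧ 0 < k 0 := by
    refine ae_deltaPlus ((measurableSet_eq_fun measurable_mdot_self measurable_const).inter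
      (measurableSet_lt measurable_const (measurable_pi_apply 0))) ?_
    filter_upwards [Measure.ae_ne volume (0 : Mom3)] with x hx
    refine ⟨mdot_onShell le_rfl x, ?_⟩
    have : 0 < ‖x‖ := norm_pos_iff.mpr hx
    change 0 < √(0 + ‖x‖ ^ 2)
    positivity
  have : SFinite (deltaPlus 0) := by unfold deltaPlus; infer_instance
  exact (Measure.quasiMeasurePreserving_fst.ae h).and (Measure.quasiMeasurePreserving_snd.ae h)

lemma exists_vertex_bound (hΘ : Θᵀ = -Θ) (f h : Fin 4 → Fin 4 → 𝓢(Mom, ℂ))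
    (hf : ∀ μ ν, f μ ν = -f ν μ) (hh : ∀ μ ν, h μ ν = -h ν μ) (Λ : ℝ) :
    ∃ g : Mom × Mom → ℝ, Integrable g ((deltaPlus 0).prod (deltaPlus 0)) ∧ (∀ z, 0 ≤ g z) ∧
      ∀ j, ∀ᵐ z ∂((deltaPlus 0).prod (deltaPlus 0)),
        ‖vertex21 Θ (fun μ ν => f μ ν) (fun μ ν => h μ ν) Λ j z‖ ≤
          |mdot (legProp j z) (legProp j z)| * g z ∧
        ‖vertex12 Θ (fun μ ν => f μ ν) (fun μ ν => h μ ν) Λ j z‖ ≤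
          |mdot (legProp j z) (legProp j z)| * g z := by
  classical
  obtain ⟨K, hK0, hK⟩ := exists_norm_residual_external_le hΘ f h hf hh Λ
  obtain ⟨K', hK0', hK'⟩ := exists_norm_residual_internal_le hΘ f h hf hh
  refine ⟨fun z => (K + K') * (energyWeight z.1 * energyWeight z.2), ?_, fun z => ?_, fun j => ?_⟩
  · have : SFinite (deltaPlus 0) := by unfold deltaPlus; infer_instance
    exact (integrable_energyWeight.mul_prod integrable_energyWeight).const_mul _
  · have h1 := energyWeight_nonneg z.1
    have h2 := energyWeight_nonneg z.2
    positivity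
  filter_upwards [ae_lightlike_pair] with z hz
  obtain ⟨⟨ha, ha0⟩, hb, hb0⟩ := hz
  have hab := mdot_nonneg_of_lightlike ha hb ha0 hb0
  have h1 := energyWeight_nonneg z.1
  have h2 := energyWeight_nonneg z.2
  rw [abs_mdot_legProp j ha hb hab]
  set W := energyWeight z.1 * energyWeight z.2 with hW
  have hW0 : 0 ≤ W := mul_nonneg h1 h2
  have i1 : mdot z.1 z.2 * (K * W) ≤ 2 * mdot z.1 z.2 * ((K + K') * W) := by
    have : 0 ≤ mdot z.1 z.2 * W := mul_nonneg hab hW0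
    nlinarith [mul_nonneg this hK0, mul_nonneg this hK0']
  have i2 : mdot z.1 z.2 * (K' * W) ≤ 2 * mdot z.1 z.2 * ((K + K') * W) := by
    have : 0 ≤ mdot z.1 z.2 * W := mul_nonneg hab hW0
    nlinarith [mul_nonneg this hK0, mul_nonneg this hK0']
  have hz0 : (0 : ℝ) ≤ 2 * mdot z.1 z.2 * ((K + K') * W) := by positivity
  have b1 : ‖externalVertex Θ (fun μ ν => f μ ν) (fun μ ν => h μ ν) Λ z.1 z.2‖ ≤
      2 * mdot z.1 z.2 * ((K + K') * W) := by
    rw [externalVertex]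
    split_ifs with hΛ
    · refine (hK z.2 z.1 hb ha hb0 ha0 hΛ).trans ?_
      rwa [mdot_comm, mul_comm (energyWeight z.2)]
    · rwa [norm_zero]
  have b2 : ‖externalVertex Θ (fun μ ν => f μ ν) (fun μ ν => h μ ν) Λ z.2 z.1‖ ≤
      2 * mdot z.1 z.2 * ((K + K') * W) := by
    rw [externalVertex]
    split_ifs with hΛ
    · exact (hK z.1 z.2 ha hb ha0 hb0 hΛ).trans i1
    · rwa [norm_zero]
  have b3 : ‖residualIntegrand Θ (fun μ ν => f μ ν) (fun μ ν => h μ ν) (z.1 + z.2) z.1‖ ≤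
      2 * mdot z.1 z.2 * ((K + K') * W) := (hK' z.1 z.2 ha hb ha0 hb0).trans i2
  fin_cases j
  · exact ⟨b1, (norm_neg _).trans_le b3⟩
  · exact ⟨b1, (norm_neg _).trans_le b2⟩
  · exact ⟨b3, (norm_neg _).trans_le b2⟩

/-- Dominated convergence reduces the sum to ε = 0. There the two terms with external propagator
cancel for each observable separately, and the internal term of one observable cancels that of the
other. -/
theorem firstOrderKernel_cancellation (hΘ : Θᵀ = -Θ) (f h : Fin 4 → Fin 4 → 𝓢(Mom, ℂ))
    (hf : ∀ μ ν, f μ ν = -f ν μ) (hh : ∀ μ ν, h μ ν = -h ν μ) (Λ : ℝ) :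
    (∀ ε : ℝ, ∀ j : Fin 3,
      Integrable (integrand21 Θ (fun μ ν => f μ ν) (fun μ ν => h μ ν) ε Λ j)
        ((deltaPlus 0).prod (deltaPlus 0)) ∧
      Integrable (integrand12 Θ (fun μ ν => f μ ν) (fun μ ν => h μ ν) ε Λ j)
        ((deltaPlus 0).prod (deltaPlus 0))) ∧
    Tendsto (fun ε : ℝ => firstOrderKernelSum Θ (fun μ ν => f μ ν) (fun μ ν => h μ ν) ε Λ)
      (𝓝[>] 0) (𝓝 0) := by
  have hf' : ∀ k μ ν, f μ ν k = -f ν μ k := fun k μ ν => by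
    conv_lhs => rw [hf μ ν]
    rfl
  have hh' : ∀ k μ ν, h μ ν k = -h ν μ k := fun k μ ν => by
    conv_lhs => rw [hh μ ν]
    rfl
  have mf : ∀ μ ν, Measurable (f μ ν) := fun μ ν => (f μ ν).continuous.measurable
  have mh : ∀ μ ν, Measurable (h μ ν) := fun μ ν => (h μ ν).continuous.measurable
  obtain ⟨g, hg, hg0, hb⟩ := exists_vertex_bound hΘ f h hf hh Λ
  have e21 := fun ε j => integrand21_eq (Θ := Θ) hΘ (f := fun μ ν => f μ ν)
    (h := fun μ ν => h μ ν) hf' hh' ε Λ j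
  have e12 := fun ε j => integrand12_eq (Θ := Θ) hΘ (f := fun μ ν => f μ ν)
    (h := fun μ ν => h μ ν) hf' hh' ε Λ j
  have m21 := fun j => measurable_vertex21 (Θ := Θ) mf mh Λ j
  have m12 := fun j => measurable_vertex12 (Θ := Θ) mf mh Λ j
  have b21 := fun j => (hb j).mono fun z hz => hz.1
  have b12 := fun j => (hb j).mono fun z hz => hz.2
  refine ⟨fun ε j => ⟨?_, ?_⟩, ?_⟩
  · rw [e21]; exact integrable_retProp_mul (measurable_legProp j) (m21 j) hg hg0 (b21 j) ε
  · rw [e12]; exact integrable_retProp_mul (measurable_legProp j) (m12 j) hg hg0 (b12 j) ε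
  simp only [firstOrderKernelSum, e21, e12]
  set m := (deltaPlus 0).prod (deltaPlus 0)
  have t21 := fun j => tendsto_integral_retProp_mul (measurable_legProp j) (m21 j) hg hg0 (b21 j)
  have t12 := fun j => tendsto_integral_retProp_mul (measurable_legProp j) (m12 j) hg hg0 (b12 j)
  have hsum := (tendsto_finsetSum Finset.univ fun j _ => t21 j).add
    (tendsto_finsetSum Finset.univ fun j _ => t12 j)
  convert hsum using 2
  rw [Fin.sum_univ_three, Fin.sum_univ_three]
  have hneg : ∀ u v : Mom × Mom → ℂ, (∀ᵐ z ∂m, u z = -v z) → ∫ z, u z ∂m = -∫ z, v z ∂m :=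
    fun u v huv => by rw [← integral_neg]; exact integral_congr_ae huv
  have n1 := hneg
    (fun z => retProp 0 (legProp 1 z) * vertex21 Θ (fun μ ν => f μ ν) (fun μ ν => h μ ν) Λ 1 z)
    (fun z => retProp 0 (legProp 0 z) * vertex21 Θ (fun μ ν => f μ ν) (fun μ ν => h μ ν) Λ 0 z) (by
      filter_upwards [ae_lightlike_pair] with z hz
      rw [(retProp_zero_legProp hz.1.1 hz.2.1).1]
      exact neg_mul _ _)
  have n2 := hneg
    (fun z => retProp 0 (legProp 0 z) * vertex12 Θ (fun μ ν => f μ ν) (fun μ ν => h μ ν) Λ 0 z)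
    (fun z => retProp 0 (legProp 2 z) * vertex21 Θ (fun μ ν => f μ ν) (fun μ ν => h μ ν) Λ 2 z) (by
      filter_upwards [ae_lightlike_pair] with z hz
      rw [(retProp_zero_legProp hz.1.1 hz.2.1).2]
      exact mul_neg _ _)
  have n3 := hneg
    (fun z => retProp 0 (legProp 1 z) * vertex12 Θ (fun μ ν => f μ ν) (fun μ ν => h μ ν) Λ 1 z)
    (fun z => retProp 0 (legProp 2 z) * vertex12 Θ (fun μ ν => f μ ν) (fun μ ν => h μ ν) Λ 2 z) (by
      filter_upwards [ae_lightlike_pair] with z hz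
      rw [(retProp_zero_legProp hz.1.1 hz.2.1).1, (retProp_zero_legProp hz.1.1 hz.2.1).2]
      exact neg_mul _ _)
  rw [n1, n2, n3]
  ring

end Vertex

end

end NCSQED

/-! ### Assembly of the theorem -/

theorem mainTheorem3 :
    -- the photino loop cancels the second term of the loop tensor
    (∀ k l : NCSQED.Mom, NCSQED.mdot l l = 0 → ∀ μ ν : Fin 4,
      NCSQED.piIno k l μ ν = -((NCSQED.piTot2 k l μ ν : ℝ) : ℂ)) ∧
    (∀ lam : ℝ, 0 < lam → ∀ Θ ∈ NCSQED.thetaOrbit lam, ∀ k l : NCSQED.Mom, ∀ μ ν : Fin 4,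
      (∀ ε : ℝ, NCSQED.photinoLoop Θ ε k l μ ν =
        2 * NCSQED.retProp ε (k - l) * ((Real.sin (NCSQED.twist Θ k l / 2) ^ 2 : ℝ) : ℂ) *
          NCSQED.piIno k l μ ν) ∧
      (NCSQED.mdot l l = 0 → NCSQED.mdot (k - l) (k - l) ≠ 0 →
        NCSQED.tadpole Θ k l μ ν + NCSQED.photonLoop Θ 0 k l μ ν + NCSQED.ghostLoop Θ 0 k l μ ν =
          2 * NCSQED.retProp 0 (k - l) * ((Real.sin (NCSQED.twist Θ k l / 2) ^ 2 : ℝ) : ℂ) *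
            ((NCSQED.piTot1 k μ ν + NCSQED.piTot2 k l μ ν : ℝ) : ℂ))) ∧
    -- the contributions with one kernel of first order cancel
    (∀ lam : ℝ, 0 < lam → ∀ Θ ∈ NCSQED.thetaOrbit lam,
      ∀ f h : Fin 4 → Fin 4 → 𝓢(NCSQED.Mom, ℂ),
      (∀ μ ν, f μ ν = -f ν μ) → (∀ μ ν, h μ ν = -h ν μ) →
      (∀ (j : Fin 3) (k l : NCSQED.Mom),
        NCSQED.amp21 Θ (fun μ ν => f μ ν) (fun μ ν => h μ ν) j l (k - l) (-k) =
          NCSQED.residualIntegrand Θ (fun μ ν => f μ ν) (fun μ ν => h μ ν) k l ∧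
        NCSQED.amp12 Θ (fun μ ν => f μ ν) (fun μ ν => h μ ν) j k (-l) (l - k) =
          -NCSQED.residualIntegrand Θ (fun μ ν => f μ ν) (fun μ ν => h μ ν) k l) ∧
      (∀ k l : NCSQED.Mom, NCSQED.mdot k k = 0 → NCSQED.mdot l l = 0 →
        NCSQED.mdot (k - l) (k - l) = 0 → NCSQED.twist Θ k l = 0 ∧
        NCSQED.residualIntegrand Θ (fun μ ν => f μ ν) (fun μ ν => h μ ν) k l = 0) ∧
      (∀ Λ : ℝ, 0 < Λ →
        (∀ ε : ℝ, 0 < ε → ∀ j : Fin 3,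
          MeasureTheory.Integrable
            (NCSQED.integrand21 Θ (fun μ ν => f μ ν) (fun μ ν => h μ ν) ε Λ j)
            ((NCSQED.deltaPlus 0).prod (NCSQED.deltaPlus 0)) ∧
          MeasureTheory.Integrable
            (NCSQED.integrand12 Θ (fun μ ν => f μ ν) (fun μ ν => h μ ν) ε Λ j)
            ((NCSQED.deltaPlus 0).prod (NCSQED.deltaPlus 0))) ∧
        Tendsto (fun ε : ℝ => NCSQED.firstOrderKernelSum Θ
            (fun μ ν => f μ ν) (fun μ ν => h μ ν) ε Λ) (𝓝[>] 0) (𝓝 0))) ∧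
    -- the self-energy is finite after a local field strength renormalization
    (∃ Z : ℝ → ℝ, ∀ lam : ℝ, 0 < lam → ∀ Θ ∈ NCSQED.thetaOrbit lam, ∀ e : ℝ,
      ∃ P : NCSQED.Mom → Fin 4 → Fin 4 → ℂ, NCSQED.IsRenormalizedSelfEnergy Θ e Z P) ∧
    -- and it is a momentum-dependent field strength normalization
    (∃ C : ℝ, ∀ Z : ℝ → ℝ, ∃ M : ℝ, 0 < M ∧
      ∀ lam : ℝ, 0 < lam → ∀ Θ ∈ NCSQED.thetaOrbit lam, ∀ e : ℝ,
      ∀ P : NCSQED.Mom → Fin 4 → Fin 4 → ℂ, NCSQED.IsRenormalizedSelfEnergy Θ e Z P →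
        (∀ k : NCSQED.Mom, 0 < NCSQED.mdot k k →
          NCSQED.mdot (NCSQED.kTheta Θ k) (NCSQED.kTheta Θ k) < 0 ∧
          ∃ R : ℂ,
            (∀ t : ℝ, t = -(NCSQED.mdot k k * NCSQED.mdot (NCSQED.kTheta Θ k) (NCSQED.kTheta Θ k)) →
              t ≤ 1 → ‖R‖ ≤ C * t * (1 + |Real.log t|)) ∧
            ∀ μ ν : Fin 4, P k μ ν =
              -((2 * Real.pi : ℝ) : ℂ) ^ (-2 : ℤ) * (e : ℂ) ^ 2 *
                ((NCSQED.transverse k μ ν : ℝ) : ℂ) *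
                ((Real.log (M * Real.sqrt
                  (-NCSQED.mdot (NCSQED.kTheta Θ k) (NCSQED.kTheta Θ k))) : ℝ) + R)) ∧
        (∀ f h : Fin 4 → Fin 4 → 𝓢(NCSQED.Mom, ℂ),
          (∀ μ ν, f μ ν = -f ν μ) → (∀ μ ν, h μ ν = -h ν μ) →
          HasDerivWithinAt
            (NCSQED.selfEnergyPairing (fun μ ν => f μ ν) (fun μ ν => h μ ν) P)
            (-4 * (e : ℂ) ^ 2 * ∫ k : NCSQED.Mom,
              (∑ μ, ∑ ν, ∑ l, f μ ν (-k) * (NCSQED.eta ν : ℂ) * h l ν k *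
                ((NCSQED.low k μ * NCSQED.low k l * Real.log (M * Real.sqrt
                  (-NCSQED.mdot (NCSQED.kTheta Θ k) (NCSQED.kTheta Θ k))) : ℝ) : ℂ))
              ∂(NCSQED.deltaPlus 0))
            (Set.Ici 0) 0)) := by
  refine ⟨fun k l hl μ ν => NCSQED.piIno_eq k l hl μ ν, fun lam _ Θ hΘ k l μ ν => ⟨fun ε =>
    NCSQED.photinoLoop_eq (NCSQED.thetaOrbit_transpose hΘ) ε k l μ ν, fun hl hkl =>
    NCSQED.tadpole_add_photonLoop_add_ghostLoop (NCSQED.thetaOrbit_transpose hΘ) k l hl hkl μ ν⟩,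
    -- The counterterm, left to unification, is Z(Λ) = (2π)⁻² ln Λ.
    fun lam _ Θ hΘ f h hf hh => ?_, ⟨_, fun lam hlam Θ hΘ e =>
      NCSQED.exists_renormalized hlam hΘ e⟩, NCSQED.exists_fieldStrengthNormalization⟩
  have hΘ' := NCSQED.thetaOrbit_transpose hΘ
  have hf' : ∀ k μ ν, f μ ν k = -f ν μ k := fun k μ ν => by
    conv_lhs => rw [hf μ ν]
    rfl
  have hh' : ∀ k μ ν, h μ ν k = -h ν μ k := fun k μ ν => by
    conv_lhs => rw [hh μ ν]
    rfl
  refine ⟨fun j k l => ⟨NCSQED.amp21_eq hΘ' _ _ j k l (hf' _) (hh' _),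
    NCSQED.amp12_eq hΘ' _ _ j k l (hf' _) (hh' _)⟩, fun k l hk hl hkl => ?_, fun Λ _ => ?_⟩
  · have hx : NCSQED.twist Θ k l = 0 := by
      refine NCSQED.twist_eq_zero_of_lightlike hΘ' hk hl ?_
      rw [NCSQED.mdot_sub_self] at hkl
      linarith
    exact ⟨hx, NCSQED.residualIntegrand_eq_zero _ _ hx⟩
  · obtain ⟨h1, h2⟩ := NCSQED.firstOrderKernel_cancellation hΘ' f h hf hh Λ
    exact ⟨fun ε _ j => h1 ε j, h2⟩
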